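/- Let $K$ be a number field with ring of integers $\mathcal O_K$, degree $N=[K:\mathbb Q]$, $r_2$ complex places, absolute discriminant $D_K$, group of roots of unity $\mu(K)$, Dedekind zeta function $\zeta_K$ and Möbius function $\mu_K$ on ideals. For an infinite place $v$ let $|\cdot|_v$ be the usual absolute value of $K_v$ if $v$ is real and its square if $v$ is complex. Let $w=(w_1,\dots,w_m)$ and $u=(u_1,\dots,u_m)$ be tuples of positive integers, where $m\ge 2$ (or $K=\mathbb Q$, $m=1$ and $w=(2)$), and put $|w|=\sum_i w_i$. Let $\lambda\in K^\times$ act on $x\in K^m$ by $\lambda_*x=(\lambda^{w_1}x_1,\dots,\lambda^{w_m}x_m)$, let $\mathbb P(w)(K)=K^\times\backslash(K^m-\{0\})$, and let $\operatorname{Aut}x=\{\lambda\in K^\times:\lambda_*x=x\}$; similarly for $u$. For a fractional ideal $\mathfrak b$ write $\mathfrak b^w=\mathfrak b^{w_1}\times\cdots\times\mathfrak b^{w_m}$. Let $\phi:\mathbb P(w)_K\to\mathbb P(u)_K$ be a non-constant morphism given by polynomials $f_1,\dots,f_m\in K[x_1,\dots,x_m]$ such that $f_i$ is homogeneous of degree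 $eu_i$ when $x_j$ has degree $w_j$, with $e\ge1$, and such that the radical of $(f_1,\dots,f_m)$ contains $(x_1,\dots,x_m)$. Assume that $e=1$ or $w=(1,\dots,1)$. *Heights.* For $x\in K^m-\{0\}$ the scaling ideal $\mathfrak I_w(x)$ is the fractional ideal with inverse $\{a\in K: a_*x\in\mathcal O_K^m\}$, and the height is $S_w(x)=N(\mathfrak I_w(x))^{-1}\prod_{v\mid\infty}\max_i|x_i|_v^{1/w_i}$; it depends only on the class of $x$ in $\mathbb P(w)(K)$. The discrepancy ideal of $x\in\mathbb P(w)(K)$ is $\mathfrak I_u(\phi(x))\,\mathfrak I_w(x)^{-e}$, and $\mathcal D_\phi$ is the set of all discrepancy ideals. Put $$N_\phi(T)=\sum_{x\in\mathbb P(w)(K),\ S_u(\phi(x))\le T}\frac1{\#\operatorname{Aut}x}.$$ *Local data.* Let $R_K$ be a set of integral ideals representing the ideal classes of $K$. For a prime $\mathfrak p$ and $x\in K_{\mathfrak p}^m-\{0\}$ put $\epsilon_{w,\mathfrak p}(x)=\min_i\lfloor\operatorname{ord}_{\mathfrak p}(x_i)/w_i\rfloor$. For $\mathfrak a\in R_K$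 and $\mathfrak d\in\mathcal D_\phi$ let $$R_{\mathfrak p}^{\mathfrak a}=\{x\in K_{\mathfrak p}^m-\{0\}:\epsilon_{w,\mathfrak p}(x)=\operatorname{ord}_{\mathfrak p}\mathfrak a\},\qquad R_{\mathfrak p}^{\mathfrak a,\mathfrak d}=\{x\in R_{\mathfrak p}^{\mathfrak a}:\epsilon_{u,\mathfrak p}(\phi(x))-e\,\epsilon_{w,\mathfrak p}(x)=\operatorname{ord}_{\mathfrak p}\mathfrak d\}.$$ For each $\mathfrak a\in R_K$ choose local moduli $\mathfrak m_{\mathfrak p}^{\mathfrak a}=\prod_i\mathfrak p^{s_i}\mathfrak a_{\mathfrak p}^{w_i}$, where the integers $s_i=s_i(\mathfrak p,\mathfrak a)\ge0$ are such that $\mathcal S=\mathcal S_{\mathfrak a}=\{\mathfrak p:\mathfrak m_{\mathfrak p}^{\mathfrak a}\ne(\mathfrak a_{\mathfrak p})^w\}$ is finite, and sets $V_{\mathfrak p}^{\mathfrak a,\mathfrak d}\subseteq(\mathfrak a_{\mathfrak p})^w$ that are unions of cosets of $\mathfrak m_{\mathfrak p}^{\mathfrak a}$, stable under the weight $w$ action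 of $\mathcal O_{K,\mathfrak p}^\times$, and satisfy $V_{\mathfrak p}^{\mathfrak a,\mathfrak d}\cap R_{\mathfrak p}^{\mathfrak a}=R_{\mathfrak p}^{\mathfrak a,\mathfrak d}$, for all $\mathfrak p$ and all $\mathfrak d\in\mathcal D_\phi$. Let $\mathfrak m^{\mathfrak a}$ (resp. $V^{\mathfrak a,\mathfrak d}$) be the set of $x\in K^m$ lying in $\mathfrak m_{\mathfrak p}^{\mathfrak a}$ (resp. $V_{\mathfrak p}^{\mathfrak a,\mathfrak d}$) for all $\mathfrak p$. For a nonzero ideal $\mathfrak c_1\subseteq\mathcal O_K$ put $\mathfrak m^{\mathfrak a}_{\mathfrak c_1}=\mathfrak m^{\mathfrak a}\cap(\mathfrak a\mathfrak c_1)^w$, and let $\mathfrak S^{\mathfrak a,\mathfrak d}_{\mathfrak c_1}$ be the set of cosets of $\mathfrak m^{\mathfrak a}_{\mathfrak c_1}$ contained in $V^{\mathfrak a,\mathfrak d}\cap(\mathfrak a\mathfrak c_1)^w$. Define $$C_\phi^K=\sum_{\mathfrak a\in R_K}\ \sum_{\mathfrak d\in\mathcal D_\phi}\ \sum_{\substack{\mathfrak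 c_1\subseteq\mathcal O_K\\ \text{product of }\mathfrak p\in\mathcal S_{\mathfrak a}}}\bigl(N(\mathfrak d)^{1/e}N(\mathfrak a)\bigr)^{|w|}\,\frac{\mu_K(\mathfrak c_1)\,\#\mathfrak S^{\mathfrak a,\mathfrak d}_{\mathfrak c_1}}{(\mathcal O_K^m:\mathfrak m^{\mathfrak a}_{\mathfrak c_1})}\ \prod_{\mathfrak p\in\mathcal S_{\mathfrak a}}\bigl(1-N(\mathfrak p)^{-|w|}\bigr)^{-1}.$$ *The archimedean region.* Choose a $\mathbb Z$-basis of the lattice $\Gamma=\{(\log|\varepsilon|_v)_{v\mid\infty}:\varepsilon\in\mathcal O_K^\times\}$ and let $F$ be its half-open fundamental parallelepiped. Let $\mathfrak B_\phi(1)$ be the set of $z\in\prod_{v\mid\infty}(K_v^m-\{0\})$ such that $\prod_{v\mid\infty}\max_i|f_i(z_v)|_v^{1/u_i}\le1$ and $\bigl(y_v-\tfrac{N_v}{N}\sum_{v'}y_{v'}\bigr)_v\in F$, where $y_v=\log\max_i|z_{v,i}|_v^{1/w_i}$ and $N_v=[K_v:\mathbb R]$. Let $\operatorname{vol}_{Nm}$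 be Lebesgue measure on $\prod_{v\mid\infty}K_v^m\cong\mathbb R^{Nm}$. **Theorem.** The set $\mathcal D_\phi$, the sets $\{x\in\mathbb P(w)(K):S_u(\phi(x))\le T\}$ and the volume $\operatorname{vol}_{Nm}(\mathfrak B_\phi(1))$ are finite, and local data as above exist. For every choice of $R_K$, of the local data and of the basis of $\Gamma$, as $T\to\infty$, $$N_\phi(T)=\left(\frac1{\zeta_K(|w|)}\Bigl(\frac{2^{r_2}}{\sqrt{D_K}}\Bigr)^m\frac{C_\phi^K\operatorname{vol}_{Nm}(\mathfrak B_\phi(1))}{\#\mu(K)}\right)T^{|w|/e}+O\!\left(T^{\frac{|w|}e-\frac{\min_iw_i}{eN}}\right),$$ except that the error term is $O\bigl(T^{1/e}\log(T^{1/e})\bigr)$ if $K=\mathbb Q$ and $w\in\{(1,1),(2)\}$. -/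

import Mathlib

open NumberField IsDedekindDomain MeasureTheory Filter Asymptotics
open scoped nonZeroDivisors

noncomputable section

namespace WeightedProj

/-! ### Weighted projective spaces -/

/-- The set `F ^ m - {0}`. -/
abbrev Punctured (m : ℕ) (F : Type*) [Field F] : Type _ := {x : Fin m → F // x ≠ 0}

/-- The total weight `|w| = w₁ + ⋯ + w_m`. -/
def totalWeight {m : ℕ} (w : Fin m → ℕ+) : ℕ := ∑ i, (w i : ℕ)

section Points

variable {m : ℕ} {F : Type*} [Field F]

theorem act_ne_zero (w : Fin m → ℕ+) (c : Fˣ) (x : Punctured m F) :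
    (fun i => (c : F) ^ (w i : ℕ) * x.1 i) ≠ 0 := by
  intro h
  refine x.2 (funext fun i => ?_)
  have := congrFun h i
  simpa using this

/-- The weight `w` action `c_* x = (c ^ w₁ x₁, …, c ^ w_m x_m)` of `Fˣ` on `F ^ m - {0}`. -/
def act (w : Fin m → ℕ+) (c : Fˣ) (x : Punctured m F) : Punctured m F :=
  ⟨fun i => (c : F) ^ (w i : ℕ) * x.1 i, act_ne_zero w c x⟩

theorem act_one (w : Fin m → ℕ+) (x : Punctured m F) : act w 1 x = x := by
  ext i; simp [act]

theorem act_act (w : Fin m → ℕ+) (a b : Fˣ) (x : Punctured m F) :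
    act w a (act w b x) = act w (a * b) x := by
  ext i; simp [act, mul_pow, mul_assoc]

/-- Two nonzero vectors are equivalent when they lie in the same orbit of the weighted action. -/
def orbitSetoid (w : Fin m → ℕ+) (F : Type*) [Field F] : Setoid (Punctured m F) where
  r x y := ∃ c : Fˣ, act w c x = y
  iseqv :=
    { refl := fun x => ⟨1, act_one w x⟩
      symm := by
        rintro x y ⟨c, rfl⟩
        exact ⟨c⁻¹, by rw [act_act, inv_mul_cancel, act_one]⟩
      trans := by
        rintro x y z ⟨c, rfl⟩ ⟨d, rfl⟩
        exact ⟨d * c, (act_act w d c x).symm⟩ }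

/-- The set of `F`-points `P(w)(F) = Fˣ \ (F ^ m - {0})` of the weighted projective space. -/
def Points (w : Fin m → ℕ+) (F : Type*) [Field F] : Type _ := Quotient (orbitSetoid w F)

/-- The automorphism group `Aut x = {c ∈ Fˣ | c_* x = x}`. -/
def autGroup (w : Fin m → ℕ+) (x : Punctured m F) : Subgroup Fˣ where
  carrier := {c | act w c x = x}
  one_mem' := act_one w x
  mul_mem' {a b} ha hb := by
    change act w (a * b) x = x
    rw [← act_act, show act w b x = x from hb, show act w a x = x from ha]
  inv_mem' {a} ha := by
    change act w a⁻¹ x = x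
    have h : act w a x = x := ha
    conv_lhs => rw [← h]
    rw [act_act, inv_mul_cancel, act_one]

theorem autGroup_act (w : Fin m → ℕ+) (c : Fˣ) (x : Punctured m F) :
    autGroup w (act w c x) = autGroup w x := by
  ext a
  change act w a (act w c x) = act w c x ↔ act w a x = x
  rw [act_act, mul_comm, ← act_act]
  constructor
  · intro h
    have := congrArg (act w c⁻¹) h
    simpa only [act_act, inv_mul_cancel_left, inv_mul_cancel, act_one] using this
  · intro h
    rw [h]

/-- The order `#Aut x` for a point `x` of `P(w)(F)`. -/
def Points.autCard {w : Fin m → ℕ+} (x : Points w F) : ℕ :=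
  Quotient.lift (s := orbitSetoid w F) (fun y => Nat.card (autGroup w y))
    (by rintro y z ⟨c, rfl⟩; exact (congrArg (fun G : Subgroup Fˣ => Nat.card G)
      (autGroup_act w c y)).symm) x

end Points

/-! ### Morphisms of weighted projective spaces -/

/-- A morphism `P(w)_F → P(u)_F`, given by a tuple `(f₁, …, f_m)` of polynomials such that `f_i` is
homogeneous of degree `e * u_i` when `x_j` has degree `w_j`, and such that the radical of the ideal
`(f₁, …, f_m)` contains `(x₁, …, x_m)`. The morphism is constant exactly when `e = 0`. -/
structure Morphism {m : ℕ} (F : Type*) [Field F] (w u : Fin m → ℕ+) where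
  /-- the integer `e` -/
  e : ℕ
  /-- the defining polynomials -/
  f : Fin m → MvPolynomial (Fin m) F
  homogeneous : ∀ i, (f i).IsWeightedHomogeneous (fun j => (w j : ℕ)) (e * (u i : ℕ))
  radical : ∀ i, MvPolynomial.X i ∈ (Ideal.span (Set.range f)).radical

namespace Morphism

variable {m : ℕ} {F : Type*} [Field F] {w u : Fin m → ℕ+} (φ : Morphism F w u)

theorem aeval_ne_zero {L : Type*} [Field L] [Algebra F L] (x : Punctured m L) :
    (fun i => MvPolynomial.aeval x.1 (φ.f i)) ≠ 0 := by
  intro h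
  refine x.2 (funext fun i => ?_)
  obtain ⟨n, hn⟩ := φ.radical i
  have hle : Ideal.span (Set.range φ.f) ≤
      RingHom.ker (MvPolynomial.aeval (R := F) x.1 : MvPolynomial (Fin m) F →ₐ[F] L) := by
    rw [Ideal.span_le]
    rintro _ ⟨j, rfl⟩
    exact congrFun h j
  have h0 : MvPolynomial.aeval x.1 (MvPolynomial.X i ^ n : MvPolynomial (Fin m) F) = 0 := hle hn
  rw [map_pow, MvPolynomial.aeval_X] at h0
  exact eq_zero_of_pow_eq_zero h0

/-- The map `L ^ m - {0} → L ^ m - {0}` given by the polynomials of `φ`, for an extension field `L`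
of the base field. -/
def eval {L : Type*} [Field L] [Algebra F L] (x : Punctured m L) : Punctured m L :=
  ⟨fun i => MvPolynomial.aeval x.1 (φ.f i), φ.aeval_ne_zero x⟩

theorem eval_act (c : Fˣ) (x : Punctured m F) :
    φ.eval (act w c x) = act u (c ^ φ.e) (φ.eval x) := by
  ext i
  simp only [eval, act, MvPolynomial.aeval_def, MvPolynomial.eval₂_eq', Finset.mul_sum]
  refine Finset.sum_congr rfl fun d hd => ?_
  have hw := φ.homogeneous i (MvPolynomial.mem_support_iff.mp hd)
  have hprod : ∏ j, (((c : F) ^ (w j : ℕ) * x.1 j) ^ d j) =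
      (c : F) ^ (φ.e * (u i : ℕ)) * ∏ j, x.1 j ^ d j := by
    simp only [mul_pow, Finset.prod_mul_distrib]
    congr 1
    rw [← hw, Finsupp.weight_apply, Finsupp.sum_fintype _ _ (by simp), ← Finset.prod_pow_eq_pow_sum]
    refine Finset.prod_congr rfl fun j _ => ?_
    rw [← pow_mul, smul_eq_mul, mul_comm]
  rw [hprod, Units.val_pow_eq_pow_val, ← pow_mul]
  ring

/-- The map `P(w)(F) → P(u)(F)` induced by `φ`. -/
def map (x : Points w F) : Points u F :=
  Quotient.map' (s₁ := orbitSetoid w F) (s₂ := orbitSetoid u F) φ.eval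
    (by rintro y z ⟨c, rfl⟩; exact ⟨c ^ φ.e, (φ.eval_act c y).symm⟩) x

end Morphism

/-! ### Scaling ideals and heights -/

section Height

variable {m : ℕ} {K : Type*} [Field K] [NumberField K]

/-- The `𝓞 K`-submodule `{a ∈ K | a_* x ∈ (𝓞 K) ^ m}` of `K`. -/
def scalingSubmodule (w : Fin m → ℕ+) (x : Punctured m K) : Submodule (𝓞 K) K where
  carrier := {a | ∀ i, IsIntegral ℤ (a ^ (w i : ℕ) * x.1 i)}
  zero_mem' i := by simpa using isIntegral_zero
  add_mem' {a b} ha hb i := by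
    rw [add_pow, Finset.sum_mul]
    refine IsIntegral.sum _ fun j hj => ?_
    have hj' : j ≤ (w i : ℕ) := Nat.lt_succ_iff.mp (Finset.mem_range.mp hj)
    have key : IsIntegral ℤ (a ^ j * b ^ ((w i : ℕ) - j) * x.1 i) := by
      refine IsIntegral.of_pow (w i).pos ?_
      have h : (a ^ j * b ^ ((w i : ℕ) - j) * x.1 i) ^ (w i : ℕ) =
          (a ^ (w i : ℕ) * x.1 i) ^ j * (b ^ (w i : ℕ) * x.1 i) ^ ((w i : ℕ) - j) := by
        obtain ⟨k, hk⟩ := Nat.exists_eq_add_of_le hj'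
        rw [hk, Nat.add_sub_cancel_left]
        ring
      rw [h]
      exact ((ha i).pow _).mul ((hb i).pow _)
    have h2 : a ^ j * b ^ ((w i : ℕ) - j) * ((w i : ℕ).choose j : K) * x.1 i =
        ((w i : ℕ).choose j : K) * (a ^ j * b ^ ((w i : ℕ) - j) * x.1 i) := by ring
    rw [h2]
    exact (isIntegral_natCast _).mul key
  smul_mem' c a ha i := by
    have h : (c • a) ^ (w i : ℕ) * x.1 i = (c : K) ^ (w i : ℕ) * (a ^ (w i : ℕ) * x.1 i) := by
      rw [Algebra.smul_def, mul_pow, mul_assoc]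
    rw [h]
    exact (c.2.pow _).mul (ha i)

theorem scalingSubmodule_isFractional (w : Fin m → ℕ+) (x : Punctured m K) :
    IsFractional (𝓞 K)⁰ (scalingSubmodule w x) := by
  obtain ⟨i, hi⟩ := Function.ne_iff.mp x.2
  obtain ⟨n, d, hd, hnd⟩ := IsFractionRing.div_surjective (A := 𝓞 K) (x.1 i)
  have hd0 : (algebraMap (𝓞 K) K d) ≠ 0 := by
    simpa using nonZeroDivisors.ne_zero hd
  have hn0 : n ≠ 0 := by
    rintro rfl
    apply hi
    rw [← hnd]; simp
  refine ⟨n, mem_nonZeroDivisors_of_ne_zero hn0, fun a ha => ?_⟩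
  have hint : IsIntegral ℤ (n • a) := by
    refine IsIntegral.of_pow (w i).pos ?_
    obtain ⟨k, hk⟩ := Nat.exists_eq_succ_of_ne_zero (w i).ne_zero
    have h : (n • a) ^ (w i : ℕ) =
        (algebraMap (𝓞 K) K n) ^ k * algebraMap (𝓞 K) K d * (a ^ (w i : ℕ) * x.1 i) := by
      rw [Algebra.smul_def, ← hnd, hk, Nat.succ_eq_add_one, mul_pow, pow_succ (algebraMap (𝓞 K) K n)]
      field_simp
    rw [h]
    exact ((n.2.pow _).mul d.2).mul (ha i)
  exact ⟨⟨n • a, hint⟩, rfl⟩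

/-- The fractional ideal `{a ∈ K | a_* x ∈ (𝓞 K) ^ m}`. -/
def scalingInverse (w : Fin m → ℕ+) (x : Punctured m K) : FractionalIdeal (𝓞 K)⁰ K :=
  ⟨scalingSubmodule w x, scalingSubmodule_isFractional w x⟩

/-- The scaling ideal `𝔍_w(x)`, the inverse of the ideal `{a ∈ K | a_* x ∈ (𝓞 K) ^ m}`. -/
def scalingIdeal (w : Fin m → ℕ+) (x : Punctured m K) : FractionalIdeal (𝓞 K)⁰ K :=
  (scalingInverse w x)⁻¹

theorem scalingIdeal_act (w : Fin m → ℕ+) (c : Kˣ) (x : Punctured m K) :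
    scalingIdeal w (act w c x) =
      FractionalIdeal.spanSingleton (𝓞 K)⁰ (c : K) * scalingIdeal w x := by
  have h : scalingInverse w (act w c x) =
      FractionalIdeal.spanSingleton (𝓞 K)⁰ ((c : K)⁻¹) * scalingInverse w x := by
    ext a
    rw [FractionalIdeal.mem_singleton_mul]
    change (∀ i, IsIntegral ℤ (a ^ (w i : ℕ) * ((c : K) ^ (w i : ℕ) * x.1 i))) ↔
      ∃ y, (∀ i, IsIntegral ℤ (y ^ (w i : ℕ) * x.1 i)) ∧ a = (c : K)⁻¹ * y
    constructor
    · intro ha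
      refine ⟨c * a, fun i => ?_, by simp⟩
      rw [mul_pow, mul_comm ((c : K) ^ _), mul_assoc]
      exact ha i
    · rintro ⟨y, hy, rfl⟩ i
      rw [← mul_assoc, ← mul_pow, mul_comm, mul_comm (c : K)⁻¹, mul_assoc,
        inv_mul_cancel₀ c.ne_zero, mul_one, mul_comm]
      exact hy i
  rw [scalingIdeal, scalingIdeal, h, mul_inv, FractionalIdeal.spanSingleton_inv, inv_inv]

/-- The archimedean part `S_{w,∞}(x) = ∏ᵥ maxᵢ |x_i|_v ^ (1 / w_i)` of the height, the product being
over the infinite places, with `|·|_v` the square of the usual absolute value if `v` is complex. -/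
def archHeight (w : Fin m → ℕ+) (x : Punctured m K) : ℝ :=
  ∏ v : InfinitePlace K, ⨆ i, ((v (x.1 i)) ^ v.mult) ^ (1 / ((w i : ℕ) : ℝ))

/-- The height `S_w(x) = S_{w,∞}(x) / N(𝔍_w(x))`. -/
def vectorHeight (w : Fin m → ℕ+) (x : Punctured m K) : ℝ :=
  (1 / (FractionalIdeal.absNorm (scalingIdeal w x) : ℝ)) * archHeight w x

theorem archHeight_act (w : Fin m → ℕ+) (c : Kˣ) (x : Punctured m K) :
    archHeight w (act w c x) = |(Algebra.norm ℚ (c : K) : ℝ)| * archHeight w x := by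
  have hn : |(Algebra.norm ℚ (c : K) : ℝ)| = ∏ v : InfinitePlace K, v (c : K) ^ v.mult := by
    rw [InfinitePlace.prod_eq_abs_norm]; simp
  rw [hn, archHeight, archHeight, ← Finset.prod_mul_distrib]
  refine Finset.prod_congr rfl fun v _ => ?_
  rw [Real.mul_iSup_of_nonneg (by positivity)]
  refine iSup_congr fun i => ?_
  have h1 : v ((act w c x).1 i) ^ v.mult =
      (v (c : K) ^ v.mult) ^ (w i : ℕ) * v (x.1 i) ^ v.mult := by
    simp only [act, map_mul, map_pow]
    ring
  rw [h1, Real.mul_rpow (by positivity) (by positivity), one_div,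
    Real.pow_rpow_inv_natCast (by positivity) (w i).ne_zero]

theorem vectorHeight_act (w : Fin m → ℕ+) (c : Kˣ) (x : Punctured m K) :
    vectorHeight w (act w c x) = vectorHeight w x := by
  have hc : |(Algebra.norm ℚ (c : K) : ℝ)| ≠ 0 := by
    simp [Algebra.norm_eq_zero_iff]
  rw [vectorHeight, vectorHeight, scalingIdeal_act, archHeight_act, map_mul,
    FractionalIdeal.absNorm_span_singleton]
  push_cast
  rw [one_div, mul_inv, one_div]
  field_simp

/-- The height `S_w` on `P(w)(K)`. -/
def Points.height {w : Fin m → ℕ+} (x : Points w K) : ℝ :=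
  Quotient.lift (s := orbitSetoid w K) (vectorHeight w)
    (by rintro y z ⟨c, rfl⟩; exact (vectorHeight_act w c y).symm) x

/-- The ideal lattice `I ^ w = I ^ w₁ × ⋯ × I ^ w_m` in `K ^ m`. -/
def idealLattice (w : Fin m → ℕ+) (I : FractionalIdeal (𝓞 K)⁰ K) : AddSubgroup (Fin m → K) :=
  AddSubgroup.pi Set.univ fun i => ((I ^ (w i : ℕ) : FractionalIdeal (𝓞 K)⁰ K) :
    Submodule (𝓞 K) K).toAddSubgroup

/-- The lattice `(𝓞 K) ^ m` in `K ^ m`. -/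
def integralLattice (m : ℕ) (K : Type*) [Field K] [NumberField K] : AddSubgroup (Fin m → K) :=
  AddSubgroup.pi Set.univ fun _ => (algebraMap (𝓞 K) K).range.toAddSubgroup

end Height

/-! ### Local objects at the finite primes -/

section Local

variable {m : ℕ} {K : Type*} [Field K] [NumberField K]

/-- The normalized valuation `ord_𝔭` of a nonzero element of the completion `K_𝔭`. -/
def localOrd (p : HeightOneSpectrum (𝓞 K)) (x : p.adicCompletion K) : ℤ :=
  -WithZero.log (Valued.v x : WithZero (Multiplicative ℤ))

/-- The integer `ε_{w,𝔭}(x) = minᵢ ⌊ord_𝔭(x_i) / w_i⌋`, so that `𝔍_{w,𝔭}(x) = 𝔭 ^ ε_{w,𝔭}(x)`. The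
minimum is over the nonzero coordinates, and division in `ℤ` rounds down. -/
def localExponent (w : Fin m → ℕ+) (p : HeightOneSpectrum (𝓞 K))
    (x : Punctured m (p.adicCompletion K)) : ℤ :=
  ⨅ i : {i // x.1 i ≠ 0}, localOrd p (x.1 i) / ((w i : ℕ) : ℤ)

/-- The open subgroup `𝔭 ^ n₁ × ⋯ × 𝔭 ^ n_m` of `K_𝔭 ^ m`, for integers `n_i`. -/
def localBox (p : HeightOneSpectrum (𝓞 K)) (n : Fin m → ℤ) :
    AddSubgroup (Fin m → p.adicCompletion K) where
  carrier := {x | ∀ i, Valued.v (x i) ≤ WithZero.exp (-n i)}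
  zero_mem' i := by simp
  add_mem' {x y} hx hy i := Valuation.map_add_le _ (hx i) (hy i)
  neg_mem' {x} hx i := by
    rw [Pi.neg_apply, Valuation.map_neg]
    exact hx i

/-- The embedding `K ^ m → K_𝔭 ^ m`. -/
def toLocal (m : ℕ) (p : HeightOneSpectrum (𝓞 K)) : (Fin m → K) →+ (Fin m → p.adicCompletion K) :=
  ((algebraMap K (p.adicCompletion K)).toAddMonoidHom).compLeft (Fin m)

/-- The local ideal lattice `(𝔞_𝔭) ^ w`. -/
def localIdealLattice (w : Fin m → ℕ+) (𝔞 : FractionalIdeal (𝓞 K)⁰ K)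
    (p : HeightOneSpectrum (𝓞 K)) : AddSubgroup (Fin m → p.adicCompletion K) :=
  localBox p fun i => ((w i : ℕ) : ℤ) * FractionalIdeal.count K p 𝔞

/-- The local modulus `𝔭 ^ s₁ 𝔞_𝔭 ^ w₁ × ⋯ × 𝔭 ^ s_m 𝔞_𝔭 ^ w_m` with exponents `s_i ≥ 0`. -/
def localModulus (w : Fin m → ℕ+) (𝔞 : FractionalIdeal (𝓞 K)⁰ K) (p : HeightOneSpectrum (𝓞 K))
    (s : Fin m → ℕ) : AddSubgroup (Fin m → p.adicCompletion K) :=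
  localBox p fun i => (s i : ℤ) + ((w i : ℕ) : ℤ) * FractionalIdeal.count K p 𝔞

/-- The set `R_𝔭^𝔞` of nonzero vectors in `K_𝔭 ^ m` with local scaling ideal `𝔞_𝔭`. -/
def localPrimitive (w : Fin m → ℕ+) (𝔞 : FractionalIdeal (𝓞 K)⁰ K) (p : HeightOneSpectrum (𝓞 K)) :
    Set (Fin m → p.adicCompletion K) :=
  {x | ∃ hx : x ≠ 0, localExponent w p ⟨x, hx⟩ = FractionalIdeal.count K p 𝔞}

end Local

namespace Morphism

variable {m : ℕ} {K : Type*} [Field K] [NumberField K] {w u : Fin m → ℕ+} (φ : Morphism K w u)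

theorem discrepancy_aux (c : Kˣ) (x : Punctured m K) :
    scalingIdeal u (φ.eval (act w c x)) * (scalingIdeal w (act w c x) ^ φ.e)⁻¹ =
      scalingIdeal u (φ.eval x) * (scalingIdeal w x ^ φ.e)⁻¹ := by
  have hs : FractionalIdeal.spanSingleton (𝓞 K)⁰ ((c : K) ^ φ.e) ≠ 0 := by
    rw [Ne, FractionalIdeal.spanSingleton_eq_zero_iff]
    exact pow_ne_zero _ c.ne_zero
  rw [φ.eval_act, scalingIdeal_act, scalingIdeal_act, mul_pow, FractionalIdeal.spanSingleton_pow,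
    Units.val_pow_eq_pow_val, mul_inv, mul_mul_mul_comm, mul_inv_cancel₀ hs, one_mul]

/-- The discrepancy ideal `δ_φ(x) = 𝔍_u(φ(x)) 𝔍_w(x) ^ (-e)` of a point `x` of `P(w)(K)`. -/
def discrepancy (x : Points w K) : FractionalIdeal (𝓞 K)⁰ K :=
  Quotient.lift (s := orbitSetoid w K)
    (fun y => scalingIdeal u (φ.eval y) * (scalingIdeal w y ^ φ.e)⁻¹)
    (by rintro y z ⟨c, rfl⟩; exact (φ.discrepancy_aux c y).symm) x

/-- The set `𝒟_φ` of discrepancy ideals of `φ`. -/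
def discrepancyIdeals : Set (FractionalIdeal (𝓞 K)⁰ K) := Set.range φ.discrepancy

/-- The points of `P(w)(K)` whose image under `φ` has height at most `T`. -/
def pointsOfHeightLE (T : ℝ) : Set (Points w K) := {x | (φ.map x).height ≤ T}

/-- The counting function `N_φ(T)`: the number of `x` in `P(w)(K)` with `S_u(φ(x)) ≤ T`, each
weighted by `1 / #Aut x`. -/
def count (T : ℝ) : ℝ := ∑ᶠ x ∈ φ.pointsOfHeightLE T, 1 / (x.autCard : ℝ)

/-- The local discrepancy `δ_{φ,𝔭}(x) = ε_{u,𝔭}(φ(x)) - e ε_{w,𝔭}(x)`. -/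
def localDiscrepancy (p : HeightOneSpectrum (𝓞 K)) (x : Punctured m (p.adicCompletion K)) : ℤ :=
  localExponent u p (φ.eval x) - φ.e * localExponent w p x

/-- The set `R_𝔭^{𝔞,𝔡}` of nonzero vectors in `K_𝔭 ^ m` with local scaling ideal `𝔞_𝔭` and local
discrepancy `ord_𝔭(𝔡)`. -/
def localDiscrepancySet (𝔞 𝔡 : FractionalIdeal (𝓞 K)⁰ K) (p : HeightOneSpectrum (𝓞 K)) :
    Set (Fin m → p.adicCompletion K) :=
  {x | ∃ hx : x ≠ 0, localExponent w p ⟨x, hx⟩ = FractionalIdeal.count K p 𝔞 ∧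
    φ.localDiscrepancy p ⟨x, hx⟩ = FractionalIdeal.count K p 𝔡}

/-- A choice, for a fixed ideal `𝔞`, of local moduli `𝔪_𝔭` (almost all of them equal to `(𝔞_𝔭) ^ w`)
and of sets of residue classes modulo `𝔪_𝔭` in `(𝔞_𝔭) ^ w`, stable under the weighted action of the
local units, by which the condition of having local discrepancy `ord_𝔭(𝔡)` is described on the
vectors with local scaling ideal `𝔞_𝔭`, for every discrepancy ideal `𝔡`. The set of residue classes
for `𝔡` and `𝔭` is recorded by its inverse image `V_𝔭^{𝔞,𝔡}` in `(𝔞_𝔭) ^ w`. -/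
structure CongruenceData (𝔞 : FractionalIdeal (𝓞 K)⁰ K) where
  /-- the exponents `s_i` of the local modulus at `𝔭` -/
  s : HeightOneSpectrum (𝓞 K) → Fin m → ℕ
  finite_bad : {p | localModulus w 𝔞 p (s p) ≠ localIdealLattice w 𝔞 p}.Finite
  /-- the sets `V_𝔭^{𝔞,𝔡}` -/
  V : FractionalIdeal (𝓞 K)⁰ K → ∀ p : HeightOneSpectrum (𝓞 K), Set (Fin m → p.adicCompletion K)
  subset : ∀ 𝔡 ∈ φ.discrepancyIdeals, ∀ p, V 𝔡 p ⊆ localIdealLattice w 𝔞 p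
  periodic : ∀ 𝔡 ∈ φ.discrepancyIdeals, ∀ p, ∀ x ∈ V 𝔡 p, ∀ y ∈ localModulus w 𝔞 p (s p),
    x + y ∈ V 𝔡 p
  stable : ∀ 𝔡 ∈ φ.discrepancyIdeals, ∀ p, ∀ x ∈ V 𝔡 p, ∀ c : p.adicCompletion K,
    Valued.v c = (1 : WithZero (Multiplicative ℤ)) → (fun i => c ^ (w i : ℕ) * x i) ∈ V 𝔡 p
  inter_primitive : ∀ 𝔡 ∈ φ.discrepancyIdeals, ∀ p,
    V 𝔡 p ∩ localPrimitive w 𝔞 p = φ.localDiscrepancySet 𝔞 𝔡 p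

namespace CongruenceData

variable {φ} {𝔞 : FractionalIdeal (𝓞 K)⁰ K} (M : φ.CongruenceData 𝔞)

/-- The finite set `𝒮` of primes where the local modulus is different from `(𝔞_𝔭) ^ w`. -/
def badPrimes : Set (HeightOneSpectrum (𝓞 K)) :=
  {p | localModulus w 𝔞 p (M.s p) ≠ localIdealLattice w 𝔞 p}

/-- The global modulus `𝔪^𝔞`, the set of `x ∈ K ^ m` that lie in every local modulus. -/
def globalModulus : AddSubgroup (Fin m → K) :=
  ⨅ p : HeightOneSpectrum (𝓞 K), (localModulus w 𝔞 p (M.s p)).comap (toLocal m p)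

/-- The global set `V^{𝔞,𝔡}`, the set of `x ∈ K ^ m` that lie in every `V_𝔭^{𝔞,𝔡}`. -/
def globalSet (𝔡 : FractionalIdeal (𝓞 K)⁰ K) : Set (Fin m → K) :=
  {x | ∀ p, toLocal m p x ∈ M.V 𝔡 p}

/-- The lattice `𝔪^𝔞_{𝔠₁} = 𝔪^𝔞 ∩ (𝔞 𝔠₁) ^ w`. -/
def modulusAt (𝔠₁ : Ideal (𝓞 K)) : AddSubgroup (Fin m → K) :=
  M.globalModulus ⊓ idealLattice w (𝔞 * (𝔠₁ : FractionalIdeal (𝓞 K)⁰ K))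

/-- The number `#𝔖^{𝔞,𝔡}_{𝔠₁}` of cosets of `𝔪^𝔞_{𝔠₁}` in `V^{𝔞,𝔡} ∩ (𝔞 𝔠₁) ^ w`. -/
def cosetCount (𝔡 : FractionalIdeal (𝓞 K)⁰ K) (𝔠₁ : Ideal (𝓞 K)) : ℕ :=
  ((QuotientAddGroup.mk : (Fin m → K) → (Fin m → K) ⧸ M.modulusAt 𝔠₁) ''
    (M.globalSet 𝔡 ∩ idealLattice w (𝔞 * (𝔠₁ : FractionalIdeal (𝓞 K)⁰ K)))).ncard

/-- The index of `𝔪^𝔞_{𝔠₁}` in `(𝓞 K) ^ m`. -/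
def modulusIndex (𝔠₁ : Ideal (𝓞 K)) : ℕ := (M.modulusAt 𝔠₁).relIndex (integralLattice m K)

/-- The part of the constant `C_φ^K` that belongs to the ideal `𝔞`: the sum, over `𝔡 ∈ 𝒟_φ` and over
the products `𝔠₁` of primes in `𝒮`, of
`(N(𝔡) ^ (1 / e) N(𝔞)) ^ |w| μ_K(𝔠₁) #𝔖^{𝔞,𝔡}_{𝔠₁} / ((𝓞 K) ^ m : 𝔪^𝔞_{𝔠₁})`,
multiplied by `∏_{𝔭 ∈ 𝒮} (1 - N(𝔭) ^ (-|w|))⁻¹`. -/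
def localConstant : ℝ :=
  ∑ᶠ 𝔡 ∈ φ.discrepancyIdeals,
    ∑ᶠ 𝔠₁ ∈ {I : Ideal (𝓞 K) | I ≠ ⊥ ∧
        ∀ p : HeightOneSpectrum (𝓞 K), I ≤ p.asIdeal → p ∈ M.badPrimes},
      (((FractionalIdeal.absNorm 𝔡 : ℝ) ^ (1 / (φ.e : ℝ)) *
          (FractionalIdeal.absNorm 𝔞 : ℝ)) ^ totalWeight w *
        ((UniqueFactorizationMonoid.moebius 𝔠₁ : ℝ) * (M.cosetCount 𝔡 𝔠₁ : ℝ) /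
          (M.modulusIndex 𝔠₁ : ℝ)) *
        ∏ᶠ p ∈ M.badPrimes, (1 - ((Ideal.absNorm p.asIdeal : ℝ) ^ totalWeight w)⁻¹)⁻¹)

end CongruenceData

end Morphism

/-! ### Archimedean objects -/

section Archimedean

variable {m : ℕ} {K : Type*} [Field K] [NumberField K]

/-- The logarithmic map `ℓ(ε) = (log |ε|_v)_v` on the units of `𝓞 K`. -/
def logUnits (K : Type*) [Field K] [NumberField K] :
    Additive (𝓞 K)ˣ →+ (InfinitePlace K → ℝ) where
  toFun ε v := Real.log (v ((ε.toMul : (𝓞 K)ˣ) : K) ^ v.mult)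
  map_zero' := by ext v; simp
  map_add' a b := by
    ext v
    have h : ∀ c : (𝓞 K)ˣ, v (c : K) ^ v.mult ≠ 0 := fun c =>
      pow_ne_zero _ (by simp)
    simp only [toMul_add, Pi.add_apply, Units.val_mul, map_mul, mul_pow]
    exact Real.log_mul (h _) (h _)

/-- The lattice `Γ` of logarithms of units. -/
def unitLogLattice (K : Type*) [Field K] [NumberField K] : AddSubgroup (InfinitePlace K → ℝ) :=
  (logUnits K).range

/-- The half-open fundamental parallelepiped `F` of a `ℤ`-basis of `Γ`. -/
def fundDomain {r : ℕ} (b : Module.Basis (Fin r) ℤ (unitLogLattice K)) :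
    Set (InfinitePlace K → ℝ) :=
  {y | ∃ t : Fin r → ℝ, (∀ j, 0 ≤ t j ∧ t j < 1) ∧
    y = ∑ j, t j • ((b j : unitLogLattice K) : InfinitePlace K → ℝ)}

/-- The quantity `maxᵢ |z_{v,i}|_v ^ (1 / w_i)` at the infinite place `v`, for an element `z` of
`∏ᵥ K_v ^ m`. The ring `∏ᵥ K_v` is Mathlib's mixed space, the product of copies of `ℝ` over the real
places and copies of `ℂ` over the complex places. -/
def placeMax (w : Fin m → ℕ+) (v : InfinitePlace K) (z : Fin m → mixedEmbedding.mixedSpace K) : ℝ :=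
  ⨆ i, (mixedEmbedding.normAtPlace v (z i) ^ v.mult) ^ (1 / ((w i : ℕ) : ℝ))

/-- The subset `∏ᵥ (K_v ^ m - {0})` of `∏ᵥ K_v ^ m`. -/
def archPunctured (m : ℕ) (K : Type*) [Field K] [NumberField K] :
    Set (Fin m → mixedEmbedding.mixedSpace K) :=
  {z | ∀ v : InfinitePlace K, ∃ i, mixedEmbedding.normAtPlace v (z i) ≠ 0}

/-- The map `η(z) = (log maxᵢ |z_{v,i}|_v ^ (1 / w_i))_v`. -/
def eta (w : Fin m → ℕ+) (z : Fin m → mixedEmbedding.mixedSpace K) : InfinitePlace K → ℝ :=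
  fun v => Real.log (placeMax w v z)

/-- The projection `pr` to the hyperplane of vectors with coordinate sum zero. -/
def hyperplaneProj (y : InfinitePlace K → ℝ) : InfinitePlace K → ℝ :=
  fun v => y v - (∑ v', y v') / (Module.finrank ℚ K : ℝ) * (v.mult : ℝ)

/-- The set `Δ = (pr ∘ η)⁻¹ F`. -/
def archDelta (w : Fin m → ℕ+) {r : ℕ} (b : Module.Basis (Fin r) ℤ (unitLogLattice K)) :
    Set (Fin m → mixedEmbedding.mixedSpace K) :=
  {z | z ∈ archPunctured m K ∧ hyperplaneProj (eta w z) ∈ fundDomain b}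

variable {w u : Fin m → ℕ+}

/-- The map `∏ᵥ K_v ^ m → ∏ᵥ K_v ^ m` given by the polynomials of `φ`. -/
def Morphism.archEval (φ : Morphism K w u) (z : Fin m → mixedEmbedding.mixedSpace K) :
    Fin m → mixedEmbedding.mixedSpace K :=
  fun i => MvPolynomial.eval₂ (mixedEmbedding K) z (φ.f i)

/-- The set `𝔇_φ(T)` of `z` with `∏ᵥ maxᵢ |φ(z)_i|_v ^ (1 / u_i) ≤ T`. -/
def Morphism.archD (φ : Morphism K w u) (T : ℝ) : Set (Fin m → mixedEmbedding.mixedSpace K) :=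
  {z | z ∈ archPunctured m K ∧ ∏ v : InfinitePlace K, placeMax u v (φ.archEval z) ≤ T}

/-- The set `𝔅_φ(T) = 𝔇_φ(T) ∩ Δ`. -/
def Morphism.archB (φ : Morphism K w u) {r : ℕ} (b : Module.Basis (Fin r) ℤ (unitLogLattice K))
    (T : ℝ) : Set (Fin m → mixedEmbedding.mixedSpace K) :=
  φ.archD T ∩ archDelta w b

open Classical in
/-- The volume of `𝔅_φ(1)` for the Lebesgue measure on `∏ᵥ K_v ^ m`, where `ℂ` carries the usual
Lebesgue measure of the plane. -/
def Morphism.archVolume (φ : Morphism K w u) {r : ℕ}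
    (b : Module.Basis (Fin r) ℤ (unitLogLattice K)) : ENNReal :=
  volume (φ.archB b 1)

end Archimedean

/-! ### The shape of the main term and of the error term -/

section Terms

variable {m : ℕ} {K : Type*} [Field K] [NumberField K] {w u : Fin m → ℕ+}

/-- The constant `C_φ^K`, the sum over the ideal classes of `K` of the contributions of their chosen
representatives. -/
def Morphism.constantC (φ : Morphism K w u) (rep : ClassGroup (𝓞 K) → (Ideal (𝓞 K))⁰)
    (M : ∀ c, φ.CongruenceData ((rep c : Ideal (𝓞 K)) : FractionalIdeal (𝓞 K)⁰ K)) : ℝ :=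
  ∑ c : ClassGroup (𝓞 K), (M c).localConstant

/-- The coefficient of `T ^ (|w| / e)`. -/
def Morphism.leadingCoeff (φ : Morphism K w u) (rep : ClassGroup (𝓞 K) → (Ideal (𝓞 K))⁰)
    (M : ∀ c, φ.CongruenceData ((rep c : Ideal (𝓞 K)) : FractionalIdeal (𝓞 K)⁰ K)) {r : ℕ}
    (b : Module.Basis (Fin r) ℤ (unitLogLattice K)) : ℝ :=
  1 / (dedekindZeta K (totalWeight w : ℂ)).re *
    (2 ^ InfinitePlace.nrComplexPlaces K / Real.sqrt |(discr K : ℝ)|) ^ m *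
    (φ.constantC rep M * (φ.archVolume b).toReal / (Units.torsionOrder K : ℝ))

/-- The exceptional cases `K = ℚ` and `w ∈ {(1, 1), (2)}`. -/
def IsExceptional (K : Type*) [Field K] [NumberField K] (w : Fin m → ℕ+) : Prop :=
  Module.finrank ℚ K = 1 ∧ ((m = 2 ∧ ∀ i, w i = 1) ∨ (m = 1 ∧ ∀ i, w i = 2))

open Classical in
/-- The error term: `T ^ (|w| / e - min w_i / (e N))` with `N = [K : ℚ]`, except that it is
`T ^ (1 / e) log (T ^ (1 / e))` in the exceptional cases. -/
def Morphism.errorTerm (φ : Morphism K w u) (T : ℝ) : ℝ :=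
  if IsExceptional K w then
    T ^ (1 / (φ.e : ℝ)) * Real.log (T ^ (1 / (φ.e : ℝ)))
  else
    T ^ ((totalWeight w : ℝ) / φ.e -
      (⨅ i, ((w i : ℕ) : ℝ)) / ((φ.e : ℝ) * (Module.finrank ℚ K : ℝ)))

end Terms

end WeightedProj

end

open WeightedProj

set_option linter.unusedSectionVars false

noncomputable section

/-! Counting orbits becomes counting lattice points. Every `Kˣ`-orbit contains vectors whose scaling
ideal is one of the chosen representatives `𝔞`; the remaining freedom is the unit group, and asking
the logarithmic coordinates to lie in the parallelepiped `F` leaves only roots of unity. By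
orbit-stabilizer the weights `1 / #Aut x` conspire so that `#μ(K) N_φ(T)` is the plain number of
such vectors (`Morphism.count_mul_torsionOrder`). For scaling ideal `𝔞` and discrepancy `𝔡` the
height bound concerns the infinite places only: `x` lies in `𝔅_φ(T N(𝔡) N(𝔞)^e)`.

Only finitely many `𝔡` occur. Expressing powers of the coordinates through the `f_i` bounds the
discrepancy at every prime, and makes it vanish at almost all primes when `e = 1` or `w = (1,…,1)`.
At the other primes it is locally constant on vectors of given exponent, hence a congruence
condition. The requirement that the scaling ideal be exactly `𝔞` is removed by Möbius inversion over
ideals `𝔠` (`ncard_primitiveVectors`).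

For each `𝔠` there remains a union of lattice cosets and a region that grows by weighted dilation by
`t` (`Morphism.exists_regionSet_estimate`). Minkowski's theorem puts boxes of weighted size
`N(𝔠)^(1/N)` into the lattice, so the number of points is volume over covolume, up to the volume of
a neighbourhood of the boundary. The boundary needs no parametrization: the region is cut out by the
logarithmic height and the unit coordinates, which are Lipschitz under relative perturbations and
increase at unit speed along explicit flows. Disjoint translates along such a flow show that thin
layers have small volume (`exists_volume_layer_le`). Relative perturbations grow towards the origin,
and a sum over dyadic shells absorbs this. With `a = min w_i` the error is `O(t^(N|w| - a)
N(𝔠)^(-(|w| - a/N)))`.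

Finally one sums over `𝔠`; none with `N(𝔠) > A t^N` contributes. The densities are multiplicative
away from the bad primes, which produces `1/ζ_K(|w|)` and the Euler factors of `C_φ^K`
(`tsum_moebius_mul_eq`). The errors sum to the stated order because `|w| - a/N > 1`; in the
exceptional cases `a = 1` makes this exponent equal to `1`, and a harmonic sum gives the logarithm.
-/

namespace WeightedProj

/-! ### Weighted maximum norms -/

section WeightedNorm

variable {m : ℕ} {L : Type*} [NormedField L]

/-- The weighted maximum norm `maxᵢ ‖z_i‖ ^ (1 / w_i)`. -/
def wnorm (w : Fin m → ℕ+) (z : Fin m → L) : ℝ := ⨆ i, ‖z i‖ ^ (1 / ((w i : ℕ) : ℝ))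

theorem wnorm_nonneg (w : Fin m → ℕ+) (z : Fin m → L) : 0 ≤ wnorm w z :=
  Real.iSup_nonneg fun _ => by positivity

theorem rpow_one_div_le_iff {x R : ℝ} (hx : 0 ≤ x) (hR : 0 ≤ R) (n : ℕ+) :
    x ^ (1 / ((n : ℕ) : ℝ)) ≤ R ↔ x ≤ R ^ (n : ℕ) := by
  have hn : (n : ℕ) ≠ 0 := n.ne_zero
  rw [one_div]
  constructor
  · intro h
    have := pow_le_pow_left₀ (by positivity) h (n : ℕ)
    rwa [Real.rpow_inv_natCast_pow hx hn] at this
  · intro h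
    have := Real.rpow_le_rpow hx h (z := (((n : ℕ) : ℝ))⁻¹) (by positivity)
    rwa [Real.pow_rpow_inv_natCast hR hn] at this

theorem norm_rpow_le_wnorm (w : Fin m → ℕ+) (z : Fin m → L) (i : Fin m) :
    ‖z i‖ ^ (1 / ((w i : ℕ) : ℝ)) ≤ wnorm w z :=
  le_ciSup (f := fun i => ‖z i‖ ^ (1 / ((w i : ℕ) : ℝ))) (Set.finite_range _).bddAbove i

theorem norm_le_wnorm_pow (w : Fin m → ℕ+) (z : Fin m → L) (i : Fin m) :
    ‖z i‖ ≤ wnorm w z ^ (w i : ℕ) :=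
  (rpow_one_div_le_iff (norm_nonneg _) (wnorm_nonneg w z) (w i)).mp (norm_rpow_le_wnorm w z i)

theorem wnorm_le_iff (w : Fin m → ℕ+) (z : Fin m → L) {R : ℝ} (hR : 0 ≤ R) :
    wnorm w z ≤ R ↔ ∀ i, ‖z i‖ ≤ R ^ (w i : ℕ) := by
  constructor
  · intro h i
    exact (norm_le_wnorm_pow w z i).trans (pow_le_pow_left₀ (wnorm_nonneg w z) h _)
  · intro h
    exact Real.iSup_le (fun i => (rpow_one_div_le_iff (norm_nonneg _) hR (w i)).mpr (h i)) hR

theorem exists_norm_eq_wnorm_pow [NeZero m] (w : Fin m → ℕ+) (z : Fin m → L) :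
    ∃ i, ‖z i‖ = wnorm w z ^ (w i : ℕ) := by
  obtain ⟨i, hi⟩ := exists_eq_ciSup_of_finite (f := fun i => ‖z i‖ ^ (1 / ((w i : ℕ) : ℝ)))
  refine ⟨i, ?_⟩
  rw [wnorm, ← hi, one_div, Real.rpow_inv_natCast_pow (norm_nonneg _) (w i).ne_zero]

theorem wnorm_eq_zero_iff (w : Fin m → ℕ+) (z : Fin m → L) : wnorm w z = 0 ↔ z = 0 := by
  constructor
  · intro h
    ext i
    have := norm_le_wnorm_pow w z i
    rw [h, zero_pow (w i).ne_zero] at this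
    simpa using this
  · rintro rfl
    refine le_antisymm ((wnorm_le_iff w _ le_rfl).mpr fun i => ?_) (wnorm_nonneg _ _)
    simp

theorem wnorm_pos_iff (w : Fin m → ℕ+) (z : Fin m → L) : 0 < wnorm w z ↔ z ≠ 0 := by
  rw [(wnorm_nonneg w z).lt_iff_ne', Ne, wnorm_eq_zero_iff]

theorem wnorm_act (w : Fin m → ℕ+) (c : L) (z : Fin m → L) :
    wnorm w (fun i => c ^ (w i : ℕ) * z i) = ‖c‖ * wnorm w z := by
  rw [wnorm, wnorm, Real.mul_iSup_of_nonneg (norm_nonneg c)]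
  refine iSup_congr fun i => ?_
  rw [norm_mul, norm_pow, Real.mul_rpow (by positivity) (by positivity), one_div,
    Real.pow_rpow_inv_natCast (by positivity) (w i).ne_zero]

end WeightedNorm

/-! ### Size and variation of weighted homogeneous polynomials -/

section PolynomialBounds

variable {m : ℕ} {F : Type*} [Field F] {L : Type*} [NormedField L] (σ : F →+* L)

theorem norm_prod_pow_le (w : Fin m → ℕ+) {d : ℕ} {s : Fin m →₀ ℕ}
    (hs : Finsupp.weight (fun j => (w j : ℕ)) s = d) (z : Fin m → L) :
    ‖∏ j, z j ^ s j‖ ≤ wnorm w z ^ d := by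
  rw [norm_prod, ← hs, Finsupp.weight_apply, Finsupp.sum_fintype _ _ (by simp),
    ← Finset.prod_pow_eq_pow_sum]
  refine Finset.prod_le_prod (fun _ _ => norm_nonneg _) fun j _ => ?_
  rw [norm_pow, smul_eq_mul, mul_comm, pow_mul]
  exact pow_le_pow_left₀ (norm_nonneg _) (norm_le_wnorm_pow w z j) _

/-- The sum of the absolute values of the coefficients. -/
def coeffSum (P : MvPolynomial (Fin m) F) : ℝ := ∑ s ∈ P.support, ‖σ (P.coeff s)‖

theorem coeffSum_nonneg (P : MvPolynomial (Fin m) F) : 0 ≤ coeffSum σ P :=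
  Finset.sum_nonneg fun _ _ => norm_nonneg _

theorem norm_eval₂_le (w : Fin m → ℕ+) {d : ℕ} {P : MvPolynomial (Fin m) F}
    (hP : P.IsWeightedHomogeneous (fun j => (w j : ℕ)) d) (z : Fin m → L) :
    ‖MvPolynomial.eval₂ σ z P‖ ≤ coeffSum σ P * wnorm w z ^ d := by
  rw [MvPolynomial.eval₂_eq', coeffSum, Finset.sum_mul]
  refine (norm_sum_le _ _).trans (Finset.sum_le_sum fun s hs => ?_)
  rw [norm_mul]
  gcongr
  exact norm_prod_pow_le w (hP (MvPolynomial.mem_support_iff.mp hs)) z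

theorem norm_eval₂_le_of_ultrametric [IsUltrametricDist L] (w : Fin m → ℕ+) {d : ℕ}
    {P : MvPolynomial (Fin m) F} (hP : P.IsWeightedHomogeneous (fun j => (w j : ℕ)) d)
    (h1 : ∀ s, ‖σ (P.coeff s)‖ ≤ 1) (z : Fin m → L) :
    ‖MvPolynomial.eval₂ σ z P‖ ≤ wnorm w z ^ d := by
  rw [MvPolynomial.eval₂_eq']
  refine IsUltrametricDist.norm_sum_le_of_forall_le_of_nonneg
    (pow_nonneg (wnorm_nonneg w z) d) fun s hs => ?_
  rw [norm_mul]
  have h2 := norm_prod_pow_le w (hP (MvPolynomial.mem_support_iff.mp hs)) z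
  calc _ ≤ 1 * ‖∏ j, z j ^ s j‖ := by gcongr; exact h1 s
    _ ≤ _ := by rw [one_mul]; exact h2

/-- Polynomials are Lipschitz on bounded sets. -/
theorem exists_lipschitz_eval₂ (P : MvPolynomial (Fin m) F) (R : ℝ) :
    ∃ C : ℝ, 0 ≤ C ∧ ∀ z z' : Fin m → L, ∀ δ : ℝ, (∀ i, ‖z i‖ ≤ R) → (∀ i, ‖z' i‖ ≤ R) →
      (∀ i, ‖z i - z' i‖ ≤ δ) → 0 ≤ δ →
      ‖MvPolynomial.eval₂ σ z P‖ ≤ C ∧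
      ‖MvPolynomial.eval₂ σ z P - MvPolynomial.eval₂ σ z' P‖ ≤ C * δ := by
  -- The bound for the value is carried along with the Lipschitz bound because the product rule in
  -- the `mul_X` case uses both.
  induction P using MvPolynomial.induction_on with
  | C a =>
    refine ⟨‖σ a‖, norm_nonneg _, fun z z' δ _ _ _ h0 => ⟨?_, ?_⟩⟩
    · simp
    · simpa using mul_nonneg (norm_nonneg (σ a)) h0
  | add p q hp hq =>
    obtain ⟨C, hC, h1⟩ := hp
    obtain ⟨D, hD, h2⟩ := hq
    refine ⟨C + D, by positivity, fun z z' δ hz hz' hd h0 => ⟨?_, ?_⟩⟩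
    · rw [MvPolynomial.eval₂_add]
      exact (norm_add_le _ _).trans (add_le_add (h1 z z' δ hz hz' hd h0).1
        (h2 z z' δ hz hz' hd h0).1)
    · rw [MvPolynomial.eval₂_add, MvPolynomial.eval₂_add, add_sub_add_comm, add_mul]
      exact (norm_add_le _ _).trans (add_le_add (h1 z z' δ hz hz' hd h0).2
        (h2 z z' δ hz hz' hd h0).2)
  | mul_X p j hp =>
    obtain ⟨C, hC, h1⟩ := hp
    refine ⟨C * (|R| + 1), by positivity, fun z z' δ hz hz' hd h0 => ⟨?_, ?_⟩⟩
    · rw [MvPolynomial.eval₂_mul, MvPolynomial.eval₂_X, norm_mul]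
      have := h1 z z' δ hz hz' hd h0
      have h3 := (hz j).trans (le_abs_self R)
      gcongr
      · exact this.1
      · linarith
    · rw [MvPolynomial.eval₂_mul, MvPolynomial.eval₂_X, MvPolynomial.eval₂_mul,
        MvPolynomial.eval₂_X]
      have h2 := h1 z z' δ hz hz' hd h0
      have h3 := (hz' j).trans (le_abs_self R)
      have e : MvPolynomial.eval₂ σ z p * z j - MvPolynomial.eval₂ σ z' p * z' j =
        MvPolynomial.eval₂ σ z p * (z j - z' j) +
          (MvPolynomial.eval₂ σ z p - MvPolynomial.eval₂ σ z' p) * z' j := by ring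
      rw [e]
      refine (norm_add_le _ _).trans ?_
      rw [norm_mul, norm_mul]
      have h4 : ‖MvPolynomial.eval₂ σ z p‖ * ‖z j - z' j‖ ≤ C * δ :=
        mul_le_mul h2.1 (hd j) (norm_nonneg _) hC
      have h5 : ‖MvPolynomial.eval₂ σ z p - MvPolynomial.eval₂ σ z' p‖ * ‖z' j‖ ≤ C * δ * |R| :=
        mul_le_mul h2.2 h3 (norm_nonneg _) (by positivity)
      calc _ ≤ C * δ + C * δ * |R| := add_le_add h4 h5
        _ = _ := by ring

end PolynomialBounds

/-! ### Growth of a morphism: a quantitative Nullstellensatz -/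

namespace Morphism

variable {m : ℕ} {F : Type*} [Field F] {w u : Fin m → ℕ+} (φ : Morphism F w u)

/-- Some power of each coordinate is a combination of the defining polynomials with weighted
homogeneous coefficients. -/
theorem exists_homogeneous_relation (j : Fin m) : ∃ n : ℕ, ∃ g : Fin m → MvPolynomial (Fin m) F,
    MvPolynomial.X j ^ n = ∑ i, g i * φ.f i ∧
    ∀ i, g i = 0 ∨ ∃ k, k + φ.e * (u i : ℕ) = (w j : ℕ) * n ∧
      (g i).IsWeightedHomogeneous (fun j => (w j : ℕ)) k := by
  classical
  obtain ⟨n, hn⟩ := φ.radical j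
  rw [Ideal.mem_span_range_iff_exists_fun] at hn
  obtain ⟨g, hg⟩ := hn
  let W : Fin m → ℕ := fun j => (w j : ℕ)
  let _ := MvPolynomial.weightedGradedAlgebra F W
  let 𝒜 := MvPolynomial.weightedHomogeneousSubmodule F W
  let N : ℕ := (w j : ℕ) * n
  -- The relation given by the radical condition is projected to its component of weighted degree
  -- `N`: since `f_i` is homogeneous, only the component of `g i` of degree `N - e u_i` survives.
  -- The case distinction guards against truncated subtraction.
  refine ⟨n, fun i => if φ.e * (u i : ℕ) ≤ N then
    (DirectSum.decompose 𝒜 (g i) (N - φ.e * (u i : ℕ)) : MvPolynomial (Fin m) F) else 0, ?_, ?_⟩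
  · have hX : (MvPolynomial.X j ^ n : MvPolynomial (Fin m) F) ∈ 𝒜 N := by
      have := (MvPolynomial.isWeightedHomogeneous_X F W j).pow n
      rw [smul_eq_mul, mul_comm] at this
      exact this
    have h1 := DirectSum.decompose_of_mem_same 𝒜 hX
    rw [← h1, ← hg, DirectSum.decompose_sum, DirectSum.sum_apply, AddSubmonoidClass.coe_finsetSum]
    refine Finset.sum_congr rfl fun i _ => ?_
    rw [DirectSum.coe_decompose_mul_of_right_mem 𝒜 N (φ.homogeneous i)]
    split_ifs <;> simp_all
  · intro i
    by_cases h : φ.e * (u i : ℕ) ≤ N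
    · right
      refine ⟨N - φ.e * (u i : ℕ), Nat.sub_add_cancel h, ?_⟩
      simp only [h, if_true]
      exact (DirectSum.decompose 𝒜 (g i) (N - φ.e * (u i : ℕ))).2
    · left
      simp [h]

variable {L : Type*} [NormedField L] (σ : F →+* L)

/-- The map `L ^ m → L ^ m` given by the polynomials of `φ` and an embedding of the base field. -/
def evalHom (z : Fin m → L) : Fin m → L := fun i => MvPolynomial.eval₂ σ z (φ.f i)

theorem evalHom_ne_zero {z : Fin m → L} (hz : z ≠ 0) : φ.evalHom σ z ≠ 0 := by
  let _ := σ.toAlgebra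
  exact φ.aeval_ne_zero ⟨z, hz⟩

theorem evalHom_act (c : L) (z : Fin m → L) :
    φ.evalHom σ (fun i => c ^ (w i : ℕ) * z i) =
      fun i => (c ^ φ.e) ^ (u i : ℕ) * φ.evalHom σ z i := by
  ext i
  simp only [evalHom, MvPolynomial.eval₂_eq', Finset.mul_sum]
  refine Finset.sum_congr rfl fun d hd => ?_
  have hw := φ.homogeneous i (MvPolynomial.mem_support_iff.mp hd)
  have hprod : ∏ j, ((c ^ (w j : ℕ) * z j) ^ d j) =
      c ^ (φ.e * (u i : ℕ)) * ∏ j, z j ^ d j := by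
    simp only [mul_pow, Finset.prod_mul_distrib]
    congr 1
    rw [← hw, Finsupp.weight_apply, Finsupp.sum_fintype _ _ (by simp), ← Finset.prod_pow_eq_pow_sum]
    refine Finset.prod_congr rfl fun j _ => ?_
    rw [← pow_mul, smul_eq_mul, mul_comm]
  rw [hprod, ← pow_mul]
  ring

theorem wnorm_evalHom_le_of_bound {A : ℝ} (hA : 1 ≤ A)
    (hf : ∀ i (z : Fin m → L), ‖MvPolynomial.eval₂ σ z (φ.f i)‖ ≤ A * wnorm w z ^ (φ.e * (u i : ℕ)))
    (z : Fin m → L) : wnorm u (φ.evalHom σ z) ≤ A * wnorm w z ^ φ.e := by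
  have h0 := wnorm_nonneg w z
  rw [wnorm_le_iff _ _ (by positivity)]
  intro i
  refine (hf i z).trans ?_
  rw [mul_pow, ← pow_mul]
  gcongr
  exact le_self_pow₀ hA (u i).ne_zero

/-- Choose the coordinate `j` at which the weighted norm `r` is attained and the summand of `z_j^n =
∑ g_i f_i` that dominates the sum up to the factor `D`. Homogeneity of the coefficient lets a power
of `r` cancel on both sides. The constant `D` is `m` for a general norm and `1` for an ultrametric
one, which is why it is a parameter. -/
theorem le_wnorm_evalHom_of_bound [NeZero m] {B D : ℝ} (hB : 0 ≤ B) (hD : 0 ≤ D)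
    (hBD : 1 ≤ D * B) {n : Fin m → ℕ} {g : Fin m → Fin m → MvPolynomial (Fin m) F}
    (hsum : ∀ j, MvPolynomial.X j ^ n j = ∑ i, g j i * φ.f i)
    (hg : ∀ j i, g j i = 0 ∨ ∃ k, k + φ.e * (u i : ℕ) = (w j : ℕ) * n j ∧
      ∀ z : Fin m → L, ‖MvPolynomial.eval₂ σ z (g j i)‖ ≤ B * wnorm w z ^ k)
    (hmax : ∀ a : Fin m → L, ∃ i, ‖∑ i, a i‖ ≤ D * ‖a i‖) (z : Fin m → L) (hz : z ≠ 0) :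
    wnorm w z ^ φ.e ≤ D * B * wnorm u (φ.evalHom σ z) := by
  have hr := (wnorm_pos_iff w z).mpr hz
  have hh := wnorm_nonneg u (φ.evalHom σ z)
  set r := wnorm w z
  set h := wnorm u (φ.evalHom σ z)
  obtain ⟨j, hj⟩ := exists_norm_eq_wnorm_pow w z
  have h1 : z j ^ n j = ∑ i, MvPolynomial.eval₂ σ z (g j i) * φ.evalHom σ z i := by
    have := congrArg (MvPolynomial.eval₂ σ z) (hsum j)
    simpa [MvPolynomial.eval₂_sum, MvPolynomial.eval₂_mul, MvPolynomial.eval₂_pow, evalHom]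
      using this
  obtain ⟨i, hi⟩ := hmax fun i => MvPolynomial.eval₂ σ z (g j i) * φ.evalHom σ z i
  rw [← h1, norm_pow, hj, norm_mul, ← pow_mul] at hi
  have hfi := norm_le_wnorm_pow u (φ.evalHom σ z) i
  rcases hg j i with h0 | ⟨k, hk, hb⟩
  · rw [h0, MvPolynomial.eval₂_zero, norm_zero, zero_mul, mul_zero] at hi
    exact absurd hi (not_le.mpr (by positivity))
  · have h2 : r ^ (k + φ.e * (u i : ℕ)) ≤ D * (B * r ^ k * h ^ (u i : ℕ)) := by
      rw [hk]
      refine hi.trans ?_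
      gcongr
      exact hb z
    have h2' : r ^ k * r ^ (φ.e * (u i : ℕ)) ≤ r ^ k * (D * B * h ^ (u i : ℕ)) := by
      rw [← pow_add]
      exact h2.trans_eq (by ring)
    have h3 := le_of_mul_le_mul_left h2' (by positivity)
    rw [pow_mul] at h3
    refine le_of_pow_le_pow_left₀ (u i).ne_zero (by positivity) (h3.trans ?_)
    rw [mul_pow]
    gcongr
    exact le_self_pow₀ hBD (u i).ne_zero

/-- The growth of `φ` with respect to the weighted norms. -/
theorem exists_wnorm_evalHom_bounds [NeZero m] : ∃ A : ℝ, 1 ≤ A ∧ ∀ z : Fin m → L, z ≠ 0 →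
    wnorm u (φ.evalHom σ z) ≤ A * wnorm w z ^ φ.e ∧
    wnorm w z ^ φ.e ≤ A * wnorm u (φ.evalHom σ z) := by
  choose n g hsum hg using φ.exists_homogeneous_relation
  let B : ℝ := 1 + ∑ j, ∑ i, coeffSum σ (g j i)
  have hB : 1 ≤ B := le_add_of_nonneg_right
    (Finset.sum_nonneg fun j _ => Finset.sum_nonneg fun i _ => coeffSum_nonneg σ _)
  have hgB : ∀ j i, coeffSum σ (g j i) ≤ B := by
    intro j i
    have h1 := Finset.single_le_sum (f := fun i => coeffSum σ (g j i))
      (fun i _ => coeffSum_nonneg σ _) (Finset.mem_univ i)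
    have h2 := Finset.single_le_sum (f := fun j => ∑ i, coeffSum σ (g j i))
      (fun j _ => Finset.sum_nonneg fun i _ => coeffSum_nonneg σ _) (Finset.mem_univ j)
    exact (h1.trans h2).trans (le_add_of_nonneg_left zero_le_one)
  let A₁ : ℝ := 1 + ∑ i, coeffSum σ (φ.f i)
  have hA₁ : 1 ≤ A₁ := le_add_of_nonneg_right
    (Finset.sum_nonneg fun i _ => coeffSum_nonneg σ _)
  have hm1 : (1 : ℝ) ≤ m := by exact_mod_cast NeZero.one_le (n := m)
  have hDB : 1 ≤ m * B := by nlinarith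
  refine ⟨max A₁ (m * B), le_max_of_le_left hA₁, fun z hz => ⟨?_, ?_⟩⟩
  · refine (φ.wnorm_evalHom_le_of_bound σ hA₁ (fun i z => ?_) z).trans ?_
    · refine (norm_eval₂_le σ w (φ.homogeneous i) z).trans ?_
      have := wnorm_nonneg w z
      gcongr
      exact (Finset.single_le_sum (f := fun i => coeffSum σ (φ.f i))
        (fun i _ => coeffSum_nonneg σ _) (Finset.mem_univ i)).trans
        (le_add_of_nonneg_left zero_le_one)
    · have := wnorm_nonneg w z
      gcongr
      exact le_max_left _ _
  · refine (φ.le_wnorm_evalHom_of_bound σ (B := B) (D := m) (by linarith) (by linarith) hDB hsum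
      (fun j i => ?_) (fun a => ?_) z hz).trans ?_
    · refine (hg j i).imp id fun ⟨k, hk, hk'⟩ => ⟨k, hk, fun z => ?_⟩
      refine (norm_eval₂_le σ w hk' z).trans ?_
      have := wnorm_nonneg w z
      gcongr
      exact hgB j i
    · obtain ⟨i, _, hi⟩ := Finset.exists_max_image Finset.univ (fun i => ‖a i‖)
        ⟨0, Finset.mem_univ _⟩
      refine ⟨i, (norm_sum_le _ _).trans ?_⟩
      simpa using Finset.sum_le_card_nsmul Finset.univ (fun i => ‖a i‖) _ hi
    · have := wnorm_nonneg u (φ.evalHom σ z)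
      gcongr
      exact le_max_right _ _

/-- In the ultrametric case with integral coefficients, `φ` multiplies weighted norms exactly. -/
theorem wnorm_evalHom_of_integral [NeZero m] [IsUltrametricDist L]
    {n : Fin m → ℕ} {g : Fin m → Fin m → MvPolynomial (Fin m) F}
    (hsum : ∀ j, MvPolynomial.X j ^ n j = ∑ i, g j i * φ.f i)
    (hg : ∀ j i, g j i = 0 ∨ ∃ k, k + φ.e * (u i : ℕ) = (w j : ℕ) * n j ∧
      (g j i).IsWeightedHomogeneous (fun j => (w j : ℕ)) k)
    (hf1 : ∀ i s, ‖σ ((φ.f i).coeff s)‖ ≤ 1) (hg1 : ∀ j i s, ‖σ ((g j i).coeff s)‖ ≤ 1)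
    (z : Fin m → L) (hz : z ≠ 0) : wnorm u (φ.evalHom σ z) = wnorm w z ^ φ.e := by
  apply le_antisymm
  · simpa using φ.wnorm_evalHom_le_of_bound σ (A := 1) le_rfl
      (fun i z => by
        simpa using norm_eval₂_le_of_ultrametric σ w (φ.homogeneous i) (hf1 i) z) z
  · simpa using φ.le_wnorm_evalHom_of_bound σ (B := 1) (D := 1) zero_le_one zero_le_one (by simp)
      hsum (fun j i => (hg j i).imp id fun ⟨k, hk, hk'⟩ => ⟨k, hk, fun z => by
        simpa using norm_eval₂_le_of_ultrametric σ w hk' (hg1 j i) z⟩)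
      (fun a => by
        obtain ⟨i, hi⟩ := IsUltrametricDist.exists_norm_finsetSum_le Finset.univ a
        exact ⟨i, by simpa using hi.2⟩) z hz

/-- The weighted norm of `φ(z)` varies by a factor close to `1` under small relative changes. -/
theorem exists_wnorm_evalHom_le_mul [NeZero m] (σ : F →+* ℂ) : ∃ C : ℝ, 0 ≤ C ∧
    ∀ (z z' : Fin m → ℂ) (r δ : ℝ), 0 < r → r ≤ wnorm w z → 0 ≤ δ → δ ≤ 1 →
      (∀ i, ‖z i - z' i‖ ≤ δ * r ^ (w i : ℕ)) →
      wnorm u (φ.evalHom σ z') ≤ (1 + C * δ) * wnorm u (φ.evalHom σ z) := by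
  obtain ⟨A, hA, hb⟩ := φ.exists_wnorm_evalHom_bounds σ
  choose C hC hlip using fun i => exists_lipschitz_eval₂ σ (φ.f i) 2
  let U : ℕ := ∑ i, (u i : ℕ)
  have hC0 : 0 ≤ ∑ i, C i := Finset.sum_nonneg fun i _ => hC i
  refine ⟨(∑ i, C i) * A ^ U, by positivity, fun z z' r δ hr hrz hδ hδ1 hzz => ?_⟩
  set γ := wnorm w z with hγ
  have hγ0 : 0 < γ := hr.trans_le hrz
  have hγc : (γ : ℂ) ≠ 0 := by exact_mod_cast hγ0.ne'
  have hnγ : ‖(γ : ℂ)‖ = γ := by simp [hγ0.le]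
  -- By homogeneity both vectors may be divided, in the weighted sense, by the norm of `z`. Then `y`
  -- lies on the unit sphere and `y'` in the ball of radius `2`, where the Lipschitz bound is
  -- uniform.
  let y : Fin m → ℂ := fun i => ((γ : ℂ)⁻¹) ^ (w i : ℕ) * z i
  let y' : Fin m → ℂ := fun i => ((γ : ℂ)⁻¹) ^ (w i : ℕ) * z' i
  have hy : wnorm w y = 1 := by
    rw [wnorm_act, norm_inv, hnγ, ← hγ, inv_mul_cancel₀ hγ0.ne']
  have hy0 : y ≠ 0 := by
    rw [← wnorm_pos_iff w, hy]
    exact one_pos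
  have h1 : ∀ i, ‖y i‖ ≤ 1 := fun i => by simpa [hy] using norm_le_wnorm_pow w y i
  have h2 : ∀ i, ‖y i - y' i‖ ≤ δ := by
    intro i
    have : y i - y' i = ((γ : ℂ)⁻¹) ^ (w i : ℕ) * (z i - z' i) := by simp only [y, y']; ring
    rw [this, norm_mul, norm_pow, norm_inv, hnγ, inv_pow, inv_mul_le_iff₀ (by positivity)]
    refine (hzz i).trans ?_
    rw [mul_comm]
    gcongr
  have h3 : ∀ i, ‖y' i‖ ≤ 2 := by
    intro i
    have : y' i = y i - (y i - y' i) := by ring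
    rw [this]
    refine (norm_sub_le _ _).trans ?_
    linarith [h1 i, h2 i]
  have hlo := (hb y hy0).2
  rw [hy, one_pow] at hlo
  set h := wnorm u (φ.evalHom σ y) with hh
  have hh0 : 0 ≤ h := wnorm_nonneg _ _
  have key : wnorm u (φ.evalHom σ y') ≤ (1 + (∑ i, C i) * A ^ U * δ) * h := by
    rw [wnorm_le_iff _ _ (by positivity)]
    intro i
    have h4 := (hlip i y y' δ (fun i => (h1 i).trans one_le_two) h3 h2 hδ).2
    have h5 : ‖φ.evalHom σ y' i‖ ≤ h ^ (u i : ℕ) + C i * δ := by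
      have e : φ.evalHom σ y' i = φ.evalHom σ y i - (φ.evalHom σ y i - φ.evalHom σ y' i) := by ring
      rw [e]
      exact (norm_sub_le _ _).trans (add_le_add (norm_le_wnorm_pow u _ i) h4)
    -- The lower bound `1 ≤ A h` on the unit sphere turns the additive error `C i * δ` into a
    -- relative one.
    have h6 : (1 : ℝ) ≤ A ^ U * h ^ (u i : ℕ) := by
      calc (1 : ℝ) ≤ (A * h) ^ (u i : ℕ) := one_le_pow₀ hlo
        _ = A ^ (u i : ℕ) * h ^ (u i : ℕ) := mul_pow _ _ _
        _ ≤ A ^ U * h ^ (u i : ℕ) := by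
          gcongr ?_ * _
          exact pow_le_pow_right₀ hA (Finset.single_le_sum (f := fun i => (u i : ℕ))
            (fun _ _ => Nat.zero_le _) (Finset.mem_univ i))
    have h7 : C i ≤ ∑ i, C i := Finset.single_le_sum (fun i _ => hC i) (Finset.mem_univ i)
    calc ‖φ.evalHom σ y' i‖ ≤ h ^ (u i : ℕ) + C i * δ := h5
      _ ≤ h ^ (u i : ℕ) + (∑ i, C i) * δ * (A ^ U * h ^ (u i : ℕ)) := by
        have h8 : C i * δ ≤ (∑ i, C i) * δ * 1 := by rw [mul_one]; gcongr
        have h9 : (∑ i, C i) * δ * 1 ≤ (∑ i, C i) * δ * (A ^ U * h ^ (u i : ℕ)) := by gcongr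
        linarith
      _ = (1 + (∑ i, C i) * A ^ U * δ) * h ^ (u i : ℕ) := by ring
      _ ≤ (1 + (∑ i, C i) * A ^ U * δ) ^ (u i : ℕ) * h ^ (u i : ℕ) := by
        gcongr
        exact le_self_pow₀ (le_add_of_nonneg_right (by positivity)) (u i).ne_zero
      _ = _ := (mul_pow _ _ _).symm
  have hz : z = fun i => (γ : ℂ) ^ (w i : ℕ) * y i := by
    ext i
    rw [← mul_assoc, ← mul_pow, mul_inv_cancel₀ hγc, one_pow, one_mul]
  have hz' : z' = fun i => (γ : ℂ) ^ (w i : ℕ) * y' i := by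
    ext i
    rw [← mul_assoc, ← mul_pow, mul_inv_cancel₀ hγc, one_pow, one_mul]
  have e1 : wnorm u (φ.evalHom σ z) = ‖(γ : ℂ) ^ φ.e‖ * h := by
    rw [hz, evalHom_act, wnorm_act]
  have e2 : wnorm u (φ.evalHom σ z') = ‖(γ : ℂ) ^ φ.e‖ * wnorm u (φ.evalHom σ y') := by
    rw [hz', evalHom_act, wnorm_act]
  rw [e1, e2]
  calc _ ≤ ‖(γ : ℂ) ^ φ.e‖ * ((1 + (∑ i, C i) * A ^ U * δ) * h) := by gcongr
    _ = _ := by ring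

end Morphism

/-! ### The archimedean space, its volume and its weighted flows -/

section ArchSpace

open NumberField.InfinitePlace

variable {m : ℕ} {K : Type*} [Field K]

/-- The projection of the mixed space to the completion at the infinite place `v`, inside `ℂ`. -/
def placeHom (v : InfinitePlace K) : mixedEmbedding.mixedSpace K →+* ℂ :=
  open Classical in
  if hv : v.IsReal then
    (Complex.ofRealHom.comp (Pi.evalRingHom (fun _ => ℝ) ⟨v, hv⟩)).comp (RingHom.fst _ _)
  else (Pi.evalRingHom (fun _ => ℂ) ⟨v, not_isReal_iff_isComplex.mp hv⟩).comp (RingHom.snd _ _)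

theorem norm_placeHom (v : InfinitePlace K) (x : mixedEmbedding.mixedSpace K) :
    ‖placeHom v x‖ = mixedEmbedding.normAtPlace v x := by
  by_cases hv : v.IsReal
  · rw [mixedEmbedding.normAtPlace_apply_of_isReal hv]
    simp [placeHom, hv]
  · rw [mixedEmbedding.normAtPlace_apply_of_isComplex (not_isReal_iff_isComplex.mp hv)]
    simp [placeHom, hv]

theorem placeHom_mixedEmbedding (v : InfinitePlace K) (x : K) :
    placeHom v (mixedEmbedding K x) = v.embedding x := by
  by_cases hv : v.IsReal
  · simp [placeHom, hv]
  · simp [placeHom, hv]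

theorem continuous_placeHom (v : InfinitePlace K) : Continuous (placeHom v) := by
  by_cases hv : v.IsReal
  · have : (placeHom v : mixedEmbedding.mixedSpace K → ℂ) = fun x => ((x.1 ⟨v, hv⟩ : ℝ) : ℂ) := by
      ext x; simp [placeHom, hv]
    rw [this]; fun_prop
  · have : (placeHom v : mixedEmbedding.mixedSpace K → ℂ) =
        fun x => x.2 ⟨v, not_isReal_iff_isComplex.mp hv⟩ := by
      ext x; simp [placeHom, hv]
    rw [this]; fun_prop

/-- The component at the place `v` of a vector over the mixed space. -/
def coordAt (v : InfinitePlace K) (z : Fin m → mixedEmbedding.mixedSpace K) : Fin m → ℂ :=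
  fun i => placeHom v (z i)

theorem continuous_coordAt (v : InfinitePlace K) :
    Continuous (coordAt v : (Fin m → mixedEmbedding.mixedSpace K) → Fin m → ℂ) :=
  continuous_pi fun i => (continuous_placeHom v).comp (continuous_apply i)

theorem placeMax_eq [NeZero m] (w : Fin m → ℕ+) (v : InfinitePlace K)
    (z : Fin m → mixedEmbedding.mixedSpace K) :
    placeMax w v z = wnorm w (coordAt v z) ^ v.mult := by
  have h : ∀ i, (mixedEmbedding.normAtPlace v (z i) ^ v.mult) ^ (1 / ((w i : ℕ) : ℝ)) =
      (‖coordAt v z i‖ ^ (1 / ((w i : ℕ) : ℝ))) ^ v.mult := by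
    intro i
    rw [coordAt, norm_placeHom, ← Real.rpow_natCast, ← Real.rpow_natCast,
      ← Real.rpow_mul (mixedEmbedding.normAtPlace_nonneg _ _),
      ← Real.rpow_mul (mixedEmbedding.normAtPlace_nonneg _ _), mul_comm]
  simp only [placeMax, h, wnorm]
  rw [Real.iSup_pow (fun i => by positivity)]

theorem measurable_wnorm (w : Fin m → ℕ+) : Measurable (wnorm w : (Fin m → ℂ) → ℝ) :=
  Measurable.iSup fun i => ((measurable_pi_apply i).norm).pow_const _

theorem measurable_evalHom {w u : Fin m → ℕ+} (φ : Morphism K w u) (σ : K →+* ℂ) :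
    Measurable (φ.evalHom σ : (Fin m → ℂ) → Fin m → ℂ) := by
  refine measurable_pi_lambda _ fun i => ?_
  simp only [Morphism.evalHom, MvPolynomial.eval₂_eq']
  fun_prop

theorem coordAt_archEval [NumberField K] {w u : Fin m → ℕ+} (φ : Morphism K w u)
    (v : InfinitePlace K) (z : Fin m → mixedEmbedding.mixedSpace K) :
    coordAt v (φ.archEval z) = φ.evalHom v.embedding (coordAt v z) := by
  ext i
  simp only [coordAt, Morphism.archEval, Morphism.evalHom]
  rw [MvPolynomial.eval₂_comp_left (placeHom v)]
  congr 1
  ext x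
  exact placeHom_mixedEmbedding v x

variable [NumberField K]

section Volume

open scoped Classical

theorem borelSpace_archSpace : @BorelSpace (Fin m → mixedEmbedding.mixedSpace K)
    (PseudoMetricSpace.toUniformSpace.toTopologicalSpace) MeasureSpace.toMeasurableSpace :=
  inferInstanceAs (BorelSpace (Fin m → mixedEmbedding.mixedSpace K))

theorem isAddHaarMeasure_archSpace : @Measure.IsAddHaarMeasure
    (Fin m → mixedEmbedding.mixedSpace K) _ (PseudoMetricSpace.toUniformSpace.toTopologicalSpace)
    MeasureSpace.toMeasurableSpace volume :=
  @Measure.pi.isAddHaarMeasure (Fin m) (fun _ => mixedEmbedding.mixedSpace K) _ _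
    (fun _ => volume) _ _ _ _ (fun _ => ContinuousAdd.measurableAdd)

theorem volume_preimage_add (x : Fin m → mixedEmbedding.mixedSpace K)
    (A : Set (Fin m → mixedEmbedding.mixedSpace K)) :
    volume ((fun z => x + z) ⁻¹' A) = volume A := by
  have := borelSpace_archSpace (m := m) (K := K)
  have := isAddHaarMeasure_archSpace (m := m) (K := K)
  exact measure_preimage_add _ _ _

/-- Multiplication by `a` is diagonal over the places, and multiplication by a complex number `x`
has real determinant `|x|²`, in accordance with the normalization of the norm at complex places. -/
theorem det_mulLeft_mixedSpace (a : mixedEmbedding.mixedSpace K) :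
    |LinearMap.det (LinearMap.mulLeft ℝ a)| = mixedEmbedding.norm a := by
  have h : LinearMap.mulLeft ℝ a = LinearMap.prodMap
      (LinearMap.pi fun w => (LinearMap.mulLeft ℝ (a.1 w)).comp (LinearMap.proj w))
      (LinearMap.pi fun w => (LinearMap.mulLeft ℝ (a.2 w)).comp (LinearMap.proj w)) := by
    ext <;> simp
  have hr : ∀ x : ℝ, LinearMap.det (LinearMap.mulLeft ℝ x) = x := fun x => by simp
  have hc : ∀ x : ℂ, LinearMap.det (LinearMap.mulLeft ℝ x) = ‖x‖ ^ 2 := fun x => by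
    have := Algebra.norm_apply ℝ x
    rw [Algebra.norm_complex_apply, Complex.normSq_eq_norm_sq] at this
    exact this.symm
  rw [h, LinearMap.det_prodMap, LinearMap.det_pi, LinearMap.det_pi, mixedEmbedding.norm_apply,
    InfinitePlace.prod_eq_prod_mul_prod]
  simp only [hr, hc, abs_mul, Finset.abs_prod]
  congr 1
  · refine Finset.prod_congr rfl fun w _ => ?_
    rw [mixedEmbedding.normAtPlace_apply_of_isReal w.2, mult_isReal, pow_one]
    rfl
  · refine Finset.prod_congr rfl fun w _ => ?_
    rw [mixedEmbedding.normAtPlace_apply_of_isComplex w.2, mult_isComplex]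
    simp

theorem volume_preimage_mul (a : Fin m → mixedEmbedding.mixedSpace K)
    (ha : ∀ i, mixedEmbedding.norm (a i) ≠ 0) (A : Set (Fin m → mixedEmbedding.mixedSpace K)) :
    volume ((fun z : Fin m → mixedEmbedding.mixedSpace K => fun i => a i * z i) ⁻¹' A) =
      ENNReal.ofReal (∏ i, mixedEmbedding.norm (a i))⁻¹ * volume A := by
  let f : (Fin m → mixedEmbedding.mixedSpace K) →ₗ[ℝ] (Fin m → mixedEmbedding.mixedSpace K) :=
    LinearMap.pi fun i => (LinearMap.mulLeft ℝ (a i)).comp (LinearMap.proj i)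
  have hdet : |LinearMap.det f| = ∏ i, mixedEmbedding.norm (a i) := by
    rw [LinearMap.det_pi, Finset.abs_prod]
    exact Finset.prod_congr rfl fun i _ => det_mulLeft_mixedSpace (a i)
  have h0 : LinearMap.det f ≠ 0 := by
    rw [← abs_ne_zero, hdet]
    exact Finset.prod_ne_zero_iff.mpr fun i _ => ha i
  have := borelSpace_archSpace (m := m) (K := K)
  have := isAddHaarMeasure_archSpace (m := m) (K := K)
  have := Measure.addHaar_preimage_linearMap (volume : Measure (Fin m → mixedEmbedding.mixedSpace K))
    h0 A
  rw [abs_inv, hdet] at this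
  exact this

end Volume

/-- The weighted scaling of a vector over the mixed space, by a positive number at every place. -/
def flow (w : Fin m → ℕ+) (c : InfinitePlace K → ℝ) (z : Fin m → mixedEmbedding.mixedSpace K) :
    Fin m → mixedEmbedding.mixedSpace K :=
  fun i => mixedEmbedding.mixedSpaceOfRealSpace (fun v => c v ^ (w i : ℕ)) * z i

theorem placeHom_mixedSpaceOfRealSpace (v : InfinitePlace K) (c : InfinitePlace K → ℝ) :
    placeHom v (mixedEmbedding.mixedSpaceOfRealSpace c) = (c v : ℂ) := by
  by_cases hv : v.IsReal
  · simp [placeHom, hv, mixedEmbedding.mixedSpaceOfRealSpace_apply]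
  · simp [placeHom, hv, mixedEmbedding.mixedSpaceOfRealSpace_apply]

theorem coordAt_flow (w : Fin m → ℕ+) (c : InfinitePlace K → ℝ) (v : InfinitePlace K)
    (z : Fin m → mixedEmbedding.mixedSpace K) :
    coordAt v (flow w c z) = fun i => (c v : ℂ) ^ (w i : ℕ) * coordAt v z i := by
  ext i
  simp [coordAt, flow, placeHom_mixedSpaceOfRealSpace]

theorem wnorm_coordAt_flow (w : Fin m → ℕ+) (c : InfinitePlace K → ℝ) (v : InfinitePlace K)
    (hc : 0 ≤ c v) (z : Fin m → mixedEmbedding.mixedSpace K) :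
    wnorm w (coordAt v (flow w c z)) = c v * wnorm w (coordAt v z) := by
  rw [coordAt_flow, wnorm_act]
  simp [hc]

theorem mem_archPunctured_iff (w : Fin m → ℕ+) (z : Fin m → mixedEmbedding.mixedSpace K) :
    z ∈ archPunctured m K ↔ ∀ v, 0 < wnorm w (coordAt v z) := by
  refine forall_congr' fun v => ?_
  rw [wnorm_pos_iff, Function.ne_iff]
  refine exists_congr fun i => ?_
  rw [← norm_placeHom, norm_ne_zero_iff]
  rfl

theorem measurableSet_archPunctured : MeasurableSet (archPunctured m K) := by
  have : archPunctured m K = ⋂ v, {z | 0 < wnorm (fun _ => 1) (coordAt v z)} := by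
    ext z
    simp [mem_archPunctured_iff (fun _ => 1)]
  rw [this]
  exact MeasurableSet.iInter fun v => measurableSet_lt measurable_const
    ((measurable_wnorm _).comp (continuous_coordAt v).measurable)

theorem measurable_wnorm_coordAt (w : Fin m → ℕ+) (v : InfinitePlace K) :
    Measurable fun z : Fin m → mixedEmbedding.mixedSpace K => wnorm w (coordAt v z) :=
  (measurable_wnorm _).comp (continuous_coordAt v).measurable

theorem norm_flow_factor (w : Fin m → ℕ+) (c : InfinitePlace K → ℝ) (hc : ∀ v, 0 ≤ c v) :
    ∏ i, mixedEmbedding.norm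
      (mixedEmbedding.mixedSpaceOfRealSpace fun v => c v ^ (w i : ℕ)) =
      (∏ v, c v ^ v.mult) ^ totalWeight w := by
  rw [totalWeight, ← Finset.prod_pow_eq_pow_sum]
  refine Finset.prod_congr rfl fun i _ => ?_
  rw [mixedEmbedding.norm_apply, ← Finset.prod_pow]
  refine Finset.prod_congr rfl fun v _ => ?_
  rw [← norm_placeHom, placeHom_mixedSpaceOfRealSpace, Complex.norm_real, Real.norm_eq_abs,
    abs_of_nonneg (pow_nonneg (hc v) _), pow_right_comm]

open scoped Classical in
theorem volume_preimage_flow (w : Fin m → ℕ+) (c : InfinitePlace K → ℝ) (hc : ∀ v, 0 < c v)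
    (A : Set (Fin m → mixedEmbedding.mixedSpace K)) :
    volume (flow w c ⁻¹' A) =
      ENNReal.ofReal ((∏ v, c v ^ v.mult) ^ totalWeight w)⁻¹ * volume A := by
  have h := volume_preimage_mul
    (fun i => mixedEmbedding.mixedSpaceOfRealSpace fun v => c v ^ (w i : ℕ)) (fun i => ?_) A
  · rw [norm_flow_factor w c fun v => (hc v).le] at h
    exact h
  · rw [mixedEmbedding.norm_apply]
    refine Finset.prod_ne_zero_iff.mpr fun v _ => pow_ne_zero _ ?_
    rw [← norm_placeHom, placeHom_mixedSpaceOfRealSpace, norm_ne_zero_iff]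
    exact_mod_cast (pow_pos (hc v) _).ne'

theorem measurable_flow (w : Fin m → ℕ+) (c : InfinitePlace K → ℝ) :
    Measurable (flow w c : (Fin m → mixedEmbedding.mixedSpace K) → _) := by
  refine Continuous.measurable (continuous_pi fun i => ?_)
  exact continuous_const.mul (continuous_apply i)

/-- The set of vectors of weighted norm at most `R` at all infinite places. -/
def wbox (w : Fin m → ℕ+) (R : ℝ) : Set (Fin m → mixedEmbedding.mixedSpace K) :=
  {z | ∀ v, wnorm w (coordAt v z) ≤ R}

theorem measurableSet_wbox (w : Fin m → ℕ+) (R : ℝ) : MeasurableSet (wbox (K := K) w R) := by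
  have : wbox (K := K) w R = ⋂ v, {z | wnorm w (coordAt v z) ≤ R} := by
    ext z
    simp [wbox]
  rw [this]
  exact MeasurableSet.iInter fun v => measurableSet_le (measurable_wnorm_coordAt w v)
    measurable_const

theorem isBounded_wbox (w : Fin m → ℕ+) (R : ℝ) : Bornology.IsBounded (wbox (K := K) w R) := by
  classical
  rcases lt_or_ge R 0 with hR | hR
  · convert Bornology.isBounded_empty
    rw [Set.eq_empty_iff_forall_notMem]
    intro z hz
    obtain ⟨v⟩ := (inferInstance : Nonempty (InfinitePlace K))
    exact absurd (hz v) (not_le.mpr (hR.trans_le (wnorm_nonneg _ _)))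
  refine (Metric.isBounded_closedBall (x := 0) (r := ∑ i, R ^ (w i : ℕ))).subset fun z hz => ?_
  have h0 : 0 ≤ ∑ i, R ^ (w i : ℕ) := Finset.sum_nonneg fun i _ => pow_nonneg hR _
  rw [mem_closedBall_zero_iff, pi_norm_le_iff_of_nonneg h0]
  intro i
  rw [mixedEmbedding.norm_eq_sup'_normAtPlace]
  refine Finset.sup'_le _ _ fun v _ => ?_
  rw [← norm_placeHom]
  exact ((wnorm_le_iff w _ hR).mp (hz v) i).trans
    (Finset.single_le_sum (f := fun i => R ^ (w i : ℕ)) (fun i _ => pow_nonneg hR _)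
      (Finset.mem_univ i))

open scoped Classical in
theorem volume_wbox_lt_top (w : Fin m → ℕ+) (R : ℝ) : volume (wbox (K := K) w R) < ⊤ := by
  have := borelSpace_archSpace (m := m) (K := K)
  have := isAddHaarMeasure_archSpace (m := m) (K := K)
  exact (isBounded_wbox w R).measure_lt_top

theorem prod_const_pow_mult (c : ℝ) :
    ∏ v : InfinitePlace K, c ^ v.mult = c ^ Module.finrank ℚ K := by
  rw [Finset.prod_pow_eq_pow_sum, InfinitePlace.sum_mult_eq]

open scoped Classical in
theorem volume_wbox (w : Fin m → ℕ+) {R : ℝ} (hR : 0 < R) :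
    volume (wbox (K := K) w R) =
      ENNReal.ofReal (R ^ (Module.finrank ℚ K * totalWeight w)) * volume (wbox (K := K) w 1) := by
  have h : wbox (K := K) w R = flow w (fun _ => R⁻¹) ⁻¹' wbox (K := K) w 1 := by
    ext z
    refine forall_congr' fun v => ?_
    rw [wnorm_coordAt_flow _ _ _ (by positivity), inv_mul_le_iff₀ hR, mul_one]
  rw [h, volume_preimage_flow _ _ (fun _ => by positivity), prod_const_pow_mult, inv_pow, inv_pow,
    inv_inv, pow_mul]

open scoped Classical in
/-- The layers of a function that increases at unit speed along a flow have small volume. -/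
theorem exists_volume_layer_le (w : Fin m → ℕ+)
    (ψ : (Fin m → mixedEmbedding.mixedSpace K) → ℝ) (hψ : Measurable ψ) (β : InfinitePlace K → ℝ)
    (hβ : 0 ≤ ∑ v, (v.mult : ℝ) * β v)
    (hflow : ∀ z ∈ archPunctured m K, ∀ s : ℝ, ψ (flow w (fun v => Real.exp (s * β v)) z) = ψ z + s) :
    ∃ C : ℝ, 0 ≤ C ∧ ∀ R δ θ : ℝ, 0 < R → 0 < δ →
      volume {z | z ∈ archPunctured m K ∧ z ∈ wbox (K := K) w R ∧ |ψ z - θ| ≤ δ} ≤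
        ENNReal.ofReal (C * R ^ (Module.finrank ℚ K * totalWeight w) * δ) := by
  set M := Module.finrank ℚ K * totalWeight w with hM
  let B : ℝ := ∑ v, |β v|
  have hB : ∀ v, |β v| ≤ B := fun v =>
    Finset.single_le_sum (f := fun v => |β v|) (fun v _ => abs_nonneg _) (Finset.mem_univ v)
  let V : ℝ := (volume (wbox (m := m) (K := K) w 1)).toReal
  have hV : volume (wbox (m := m) (K := K) w 1) = ENNReal.ofReal V :=
    (ENNReal.ofReal_toReal (volume_wbox_lt_top w 1).ne).symm
  have hV0 : 0 ≤ V := ENNReal.toReal_nonneg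
  have hB0 : 0 ≤ B := Finset.sum_nonneg fun v _ => abs_nonneg _
  refine ⟨Real.exp (3 * B) ^ M * V, by positivity, fun R δ θ hR hδ => ?_⟩
  -- For `δ > 1` the volume of the whole box is already small enough; the flow argument serves `δ ≤
  -- 1`.
  rcases lt_or_ge 1 δ with hδ1 | hδ1
  · refine (measure_mono fun z hz => hz.2.1).trans ?_
    rw [volume_wbox w hR, hV, ← ENNReal.ofReal_mul (by positivity), ← hM]
    refine ENNReal.ofReal_le_ofReal ?_
    have h1 : 1 ≤ Real.exp (3 * B) ^ M := one_le_pow₀ (Real.one_le_exp (by positivity))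
    calc R ^ M * V = 1 * V * R ^ M * 1 := by ring
      _ ≤ _ := by gcongr
  set W := {z | z ∈ archPunctured m K ∧ z ∈ wbox (K := K) w R ∧ |ψ z - θ| ≤ δ} with hW
  have hWm : MeasurableSet W :=
    measurableSet_archPunctured.inter ((measurableSet_wbox w R).inter
      (measurableSet_le ((hψ.sub measurable_const).abs) measurable_const))
  -- About `1/δ` translates of the layer along the flow, at times `3δk`. They are pairwise disjoint
  -- because `ψ` moves by at least `3δ` from one to the next and the layer has width `2δ`. All times
  -- are at most `3`, so they stay in the box enlarged by `exp (3B)`.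
  let n : ℕ := ⌈δ⁻¹⌉₊
  let f : ℕ → (Fin m → mixedEmbedding.mixedSpace K) → (Fin m → mixedEmbedding.mixedSpace K) :=
    fun k => flow w fun v => Real.exp (-(3 * δ * k) * β v)
  have hfm : ∀ k, MeasurableSet (f k ⁻¹' W) := fun k => (measurable_flow w _) hWm
  have hfp : ∀ k z, f k z ∈ archPunctured m K → z ∈ archPunctured m K := by
    intro k z h
    rw [mem_archPunctured_iff w] at h ⊢
    intro v
    have := h v
    rw [wnorm_coordAt_flow _ _ _ (Real.exp_pos _).le] at this
    exact pos_of_mul_pos_right this (Real.exp_pos _).le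
  have hdisj : Pairwise (Function.onFun Disjoint fun k => f k ⁻¹' W) := by
    intro k l hkl
    rw [Function.onFun, Set.disjoint_left]
    rintro z ⟨hk1, -, hk3⟩ ⟨-, -, hl3⟩
    have hz := hfp k z hk1
    rw [hflow z hz] at hk3 hl3
    rw [abs_le] at hk3 hl3
    rcases lt_or_gt_of_ne hkl with h | h
    · have : (k : ℝ) + 1 ≤ l := by exact_mod_cast h
      nlinarith
    · have : (l : ℝ) + 1 ≤ k := by exact_mod_cast h
      nlinarith
  -- The map `f k` runs the flow backwards, and by `hβ` this does not expand volume; so preimages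
  -- are at least as large.
  have hvol : ∀ k, volume W ≤ volume (f k ⁻¹' W) := by
    intro k
    rw [volume_preimage_flow _ _ fun v => Real.exp_pos _]
    refine le_mul_of_one_le_left' ?_
    rw [ENNReal.one_le_ofReal]
    refine (one_le_inv₀ (by positivity)).mpr (pow_le_one₀ (by positivity) ?_)
    simp only [← Real.exp_nat_mul, ← Real.exp_sum]
    rw [Real.exp_le_one_iff]
    have : ∑ v : InfinitePlace K, (v.mult : ℝ) * (-(3 * δ * k) * β v) =
        -(3 * δ * k * ∑ v, (v.mult : ℝ) * β v) := by
      rw [Finset.mul_sum, ← Finset.sum_neg_distrib]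
      exact Finset.sum_congr rfl fun v _ => by ring
    rw [this, neg_nonpos]
    positivity
  have hsub : (⋃ k ∈ Finset.range n, f k ⁻¹' W) ⊆ wbox (K := K) w (Real.exp (3 * B) * R) := by
    intro z hz v
    simp only [Set.mem_iUnion, Finset.mem_range] at hz
    obtain ⟨k, hk, -, hz2, -⟩ := hz
    have h1 := hz2 v
    rw [wnorm_coordAt_flow _ _ _ (Real.exp_pos _).le, neg_mul, Real.exp_neg,
      inv_mul_le_iff₀ (Real.exp_pos _)] at h1
    refine h1.trans ?_
    refine mul_le_mul_of_nonneg_right (Real.exp_le_exp.mpr ?_) hR.le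
    have hk' : (k : ℝ) < δ⁻¹ := Nat.lt_ceil.mp hk
    have hk2 : δ * k ≤ 1 := by
      have := mul_lt_mul_of_pos_left hk' hδ
      rw [mul_inv_cancel₀ hδ.ne'] at this
      exact this.le
    calc 3 * δ * k * β v ≤ 3 * δ * k * B := by
          gcongr
          exact (le_abs_self _).trans (hB v)
      _ ≤ 3 * B := by
          nlinarith
  have hsum : (n : ENNReal) * volume W ≤ volume (wbox (m := m) (K := K) w (Real.exp (3 * B) * R)) := by
    calc (n : ENNReal) * volume W = ∑ k ∈ Finset.range n, volume W := by simp
      _ ≤ ∑ k ∈ Finset.range n, volume (f k ⁻¹' W) := Finset.sum_le_sum fun k _ => hvol k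
      _ = volume (⋃ k ∈ Finset.range n, f k ⁻¹' W) :=
        (measure_biUnion_finset (fun k _ l _ h => hdisj h) fun k _ => hfm k).symm
      _ ≤ _ := measure_mono hsub
  rw [volume_wbox w (by positivity), hV, ← ENNReal.ofReal_mul (by positivity), ← hM] at hsum
  have hn : ENNReal.ofReal δ⁻¹ ≤ n := by
    rw [← ENNReal.ofReal_natCast]
    exact ENNReal.ofReal_le_ofReal (Nat.le_ceil _)
  have h2 : ENNReal.ofReal δ⁻¹ * volume W ≤ _ := (mul_le_mul_left hn _).trans hsum
  have h3 : volume W = ENNReal.ofReal δ * (ENNReal.ofReal δ⁻¹ * volume W) := by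
    rw [← mul_assoc, ← ENNReal.ofReal_mul hδ.le, mul_inv_cancel₀ hδ.ne', ENNReal.ofReal_one, one_mul]
  rw [h3]
  refine (mul_le_mul_right h2 _).trans ?_
  rw [← ENNReal.ofReal_mul hδ.le]
  refine ENNReal.ofReal_le_ofReal (le_of_eq ?_)
  rw [mul_pow]
  ring

end ArchSpace

/-! ### Counting the cells of a tiling -/

section Tiling

/-- Counting the points of a tiling in a set, up to the measure of a neighbourhood of its boundary. -/
theorem tiling_count {E : Type*} [MeasurableSpace E] (μ : Measure E) {ι : Type*} [Countable ι]
    (q : ι → E) (cell : ι → Set E) (hcell : ∀ i, MeasurableSet (cell i)) {V : ENNReal}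
    (hV : ∀ i, μ (cell i) = V) (hV0 : V ≠ 0) (htile : ∀ z, ∃! i, z ∈ cell i)
    (hq : ∀ i, q i ∈ cell i) {B U : Set E} (hB : MeasurableSet B) (hU : MeasurableSet U)
    (hBtop : μ B ≠ ⊤) (hUtop : μ U ≠ ⊤)
    (hBU : ∀ i, cell i ⊆ B ∨ Disjoint (cell i) B ∨ cell i ⊆ U) :
    {i | q i ∈ B}.Finite ∧ |({i | q i ∈ B}.ncard : ℝ) * V.toReal - (μ B).toReal| ≤ (μ U).toReal := by
  classical
  have hdecomp : ∀ A : Set E, MeasurableSet A → μ A = ∑' i, μ (A ∩ cell i) := by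
    intro A hA
    rw [← measure_iUnion]
    · congr 1
      ext z
      simp only [Set.mem_iUnion, Set.mem_inter_iff, exists_and_left]
      exact ⟨fun h => ⟨h, (htile z).exists⟩, fun h => h.1⟩
    · intro i j hij
      rw [Function.onFun, Set.disjoint_left]
      rintro z ⟨-, hi⟩ ⟨-, hj⟩
      exact hij ((htile z).unique hi hj)
    · exact fun i => hA.inter (hcell i)
  -- In every cell, `c i` and the measure of the part in `B` agree if the cell is inside or outside
  -- `B`, and otherwise differ by at most the measure of the part in `U`. Summing gives both
  -- inequalities, and finiteness since each counted cell contributes the same nonzero `V`.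
  let c : ι → ENNReal := fun i => if q i ∈ B then V else 0
  have h1 : ∀ i, c i ≤ μ (B ∩ cell i) + μ (U ∩ cell i) := by
    intro i
    simp only [c]
    split_ifs with h
    · rcases hBU i with h2 | h2 | h2
      · rw [Set.inter_eq_self_of_subset_right h2, hV]
        exact le_self_add
      · exact absurd h (Set.disjoint_left.mp h2 (hq i))
      · rw [Set.inter_eq_self_of_subset_right h2, hV]
        exact le_add_self
    · exact zero_le
  have h2 : ∀ i, μ (B ∩ cell i) ≤ c i + μ (U ∩ cell i) := by
    intro i
    rcases hBU i with h2 | h2 | h2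
    · have : q i ∈ B := h2 (hq i)
      rw [Set.inter_eq_self_of_subset_right h2, hV]
      simp [c, this]
    · rw [Set.inter_comm, Set.disjoint_iff_inter_eq_empty.mp h2, measure_empty]
      exact zero_le
    · rw [Set.inter_eq_self_of_subset_right h2]
      exact (measure_mono Set.inter_subset_right).trans le_add_self
  have hs1 : ∑' i, c i ≤ μ B + μ U := by
    rw [hdecomp B hB, hdecomp U hU, ← ENNReal.tsum_add]
    exact ENNReal.tsum_le_tsum h1
  have hs2 : μ B ≤ ∑' i, c i + μ U := by
    rw [hdecomp B hB, hdecomp U hU, ← ENNReal.tsum_add]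
    exact ENNReal.tsum_le_tsum h2
  have hctop : ∑' i, c i ≠ ⊤ := ne_top_of_le_ne_top (ENNReal.add_ne_top.mpr ⟨hBtop, hUtop⟩) hs1
  have hfin : {i | q i ∈ B}.Finite := by
    have := ENNReal.finite_const_le_of_tsum_ne_top hctop hV0
    refine this.subset fun i hi => ?_
    have hi' : q i ∈ B := hi
    simp [c, hi']
  refine ⟨hfin, ?_⟩
  have hsum : ∑' i, c i = ({i | q i ∈ B}.ncard : ENNReal) * V := by
    rw [tsum_eq_sum (s := hfin.toFinset) fun i hi => ?_]
    · rw [Finset.sum_congr rfl (g := fun _ => V) fun i hi => ?_, Finset.sum_const, nsmul_eq_mul,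
        Set.ncard_eq_toFinset_card _ hfin]
      have : q i ∈ B := hfin.mem_toFinset.mp hi
      simp [c, this]
    · have : q i ∉ B := fun h => hi (hfin.mem_toFinset.mpr h)
      simp [c, this]
  rw [hsum] at hs1 hs2 hctop
  have e1 := ENNReal.toReal_mono (ENNReal.add_ne_top.mpr ⟨hBtop, hUtop⟩) hs1
  have e2 := ENNReal.toReal_mono (ENNReal.add_ne_top.mpr ⟨hctop, hUtop⟩) hs2
  rw [ENNReal.toReal_add hBtop hUtop, ENNReal.toReal_mul, ENNReal.toReal_natCast] at e1
  rw [ENNReal.toReal_add hctop hUtop, ENNReal.toReal_mul, ENNReal.toReal_natCast] at e2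
  rw [abs_le]
  constructor <;> linarith

end Tiling

/-! ### Lattice points in a subset of the archimedean space -/

section LatticeCount

open NumberField.InfinitePlace

variable {m : ℕ} {K : Type*} [Field K] [NumberField K]

/-- The embedding of `K ^ m` in the product of its completions at the infinite places. -/
def embVec (x : Fin m → K) : Fin m → mixedEmbedding.mixedSpace K := fun i => mixedEmbedding K (x i)

theorem coordAt_embVec (v : InfinitePlace K) (x : Fin m → K) :
    coordAt v (embVec x) = fun i => v.embedding (x i) := by
  ext i
  exact placeHom_mixedEmbedding v (x i)

/-- The covolume of the ring of integers in the mixed space. -/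
def covol (K : Type*) [Field K] [NumberField K] : ℝ :=
  (2 : ℝ)⁻¹ ^ nrComplexPlaces K * Real.sqrt |(discr K : ℝ)|

theorem covol_pos : 0 < covol K := by
  have : (discr K : ℝ) ≠ 0 := by exact_mod_cast discr_ne_zero K
  unfold covol
  positivity

open scoped Classical in
theorem volume_fundamentalDomain_eq_covol :
    volume (ZSpan.fundamentalDomain (mixedEmbedding.latticeBasis K)) = ENNReal.ofReal (covol K) := by
  have h : (volume (ZSpan.fundamentalDomain (mixedEmbedding.latticeBasis K))).toReal = covol K := by
    rw [mixedEmbedding.volume_fundamentalDomain_latticeBasis, covol, ENNReal.toReal_mul,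
      ENNReal.toReal_pow, ENNReal.toReal_inv, ENNReal.toReal_ofNat, ENNReal.coe_toReal,
      Real.coe_sqrt, coe_nnnorm, Int.norm_eq_abs]
  rw [← h, ENNReal.ofReal_toReal]
  exact (ZSpan.fundamentalDomain_isBounded _).measure_lt_top.ne

open scoped Classical in
theorem existsUnique_sub_mem_fundamentalDomain (z : mixedEmbedding.mixedSpace K) :
    ∃! l : 𝓞 K, z - mixedEmbedding K l ∈
      ZSpan.fundamentalDomain (mixedEmbedding.latticeBasis K) := by
  obtain ⟨y, hy, hu⟩ :=
    ZSpan.exist_unique_vadd_mem_fundamentalDomain (mixedEmbedding.latticeBasis K) z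
  have hmem : ∀ x : mixedEmbedding.mixedSpace K,
      x ∈ Submodule.span ℤ (Set.range (mixedEmbedding.latticeBasis K)) ↔
        ∃ l : 𝓞 K, mixedEmbedding K l = x := by
    intro x
    rw [mixedEmbedding.mem_span_latticeBasis]
    simp
  obtain ⟨l, hl⟩ := (hmem y).mp y.2
  refine ⟨-l, ?_, fun l' hl' => ?_⟩
  · have e : z - mixedEmbedding K ((-l : 𝓞 K) : K) = y +ᵥ z := by
      change _ = (y : mixedEmbedding.mixedSpace K) + z
      rw [← hl]
      simp [add_comm]
    change z - mixedEmbedding K ((-l : 𝓞 K) : K) ∈ _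
    rw [e]
    exact hy
  · have h := hu ⟨mixedEmbedding K ((-l' : 𝓞 K) : K), (hmem _).mpr ⟨-l', rfl⟩⟩ (by
      change mixedEmbedding K ((-l' : 𝓞 K) : K) + z ∈ _
      have e : mixedEmbedding K ((-l' : 𝓞 K) : K) + z = z - mixedEmbedding K (l' : K) := by
        simp [sub_eq_neg_add]
      rw [e]
      exact hl')
    have h2 : mixedEmbedding K ((-l' : 𝓞 K) : K) = mixedEmbedding K (l : K) := by
      rw [hl]
      exact congrArg Subtype.val h
    have h3 := mixedEmbedding_injective K h2
    have h4 : -l' = l := RingOfIntegers.coe_injective h3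
    rw [← h4, neg_neg]

open scoped Classical in
/-- The number of points of a translate of the lattice `∏ a_i 𝓞 K` in a set `B`. -/
theorem exists_lattice_count : ∃ D : ℝ, 0 < D ∧ ∀ (a y : Fin m → K), (∀ i, a i ≠ 0) →
    ∀ B U : Set (Fin m → mixedEmbedding.mixedSpace K), MeasurableSet B → MeasurableSet U →
    volume B ≠ ⊤ → volume U ≠ ⊤ →
    (∀ z ∈ B, ∀ z' ∉ B, ∀ z'',
      (∀ v i, ‖coordAt v z i - coordAt v z' i‖ ≤ D * v (a i)) →
      (∀ v i, ‖coordAt v z i - coordAt v z'' i‖ ≤ D * v (a i)) → z'' ∈ U) →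
    {l : Fin m → 𝓞 K | embVec (fun i => y i + a i * (l i : K)) ∈ B}.Finite ∧
    |({l : Fin m → 𝓞 K | embVec (fun i => y i + a i * (l i : K)) ∈ B}.ncard : ℝ) *
      (covol K ^ m * ∏ i, |(Algebra.norm ℚ (a i) : ℝ)|) - (volume B).toReal| ≤ (volume U).toReal := by
  let P := ZSpan.fundamentalDomain (mixedEmbedding.latticeBasis K)
  obtain ⟨D, hD⟩ := (ZSpan.fundamentalDomain_isBounded (mixedEmbedding.latticeBasis K)).exists_norm_le
  have hDv : ∀ (v : InfinitePlace K), ∀ p ∈ P, ‖placeHom v p‖ ≤ |D| := by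
    intro v p hp
    rw [norm_placeHom]
    refine le_trans ?_ ((hD p hp).trans (le_abs_self D))
    rw [mixedEmbedding.norm_eq_sup'_normAtPlace]
    exact Finset.le_sup' (fun w => mixedEmbedding.normAtPlace w p) (Finset.mem_univ v)
  -- At each place the fundamental domain has diameter at most `2|D|`; the summand `1` only ensures
  -- positivity.
  refine ⟨2 * |D| + 1, by positivity, fun a y ha B U hB hU hBtop hUtop hBU => ?_⟩
  have hna : ∀ i, mixedEmbedding K (a i) * mixedEmbedding K (a i)⁻¹ = 1 := fun i => by
    rw [← map_mul, mul_inv_cancel₀ (ha i), map_one]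
  -- The cell of a lattice point is the box `∏ a_i P` translated so that this point is its corner.
  let cell : (Fin m → 𝓞 K) → Set (Fin m → mixedEmbedding.mixedSpace K) := fun l =>
    {z | ∀ i, mixedEmbedding K (a i)⁻¹ * (z i - mixedEmbedding K (y i)) - mixedEmbedding K (l i) ∈ P}
  have hcelleq : ∀ l, cell l = (fun z => (embVec fun i => - (y i + a i * (l i : K))) + z) ⁻¹'
      ((fun z : Fin m → mixedEmbedding.mixedSpace K => fun i => mixedEmbedding K (a i)⁻¹ * z i) ⁻¹'
        Set.pi Set.univ fun _ => P) := by
    intro l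
    ext z
    simp only [cell, Set.mem_ofPred_eq, Set.mem_preimage, Set.mem_pi, Set.mem_univ, true_imp_iff]
    refine forall_congr' fun i => ?_
    have : mixedEmbedding K (a i)⁻¹ * (z i - mixedEmbedding K (y i)) - mixedEmbedding K (l i) =
        mixedEmbedding K (a i)⁻¹ * ((embVec fun i => - (y i + a i * (l i : K))) + z) i := by
      simp only [Pi.add_apply, embVec, map_neg, map_add, map_mul]
      linear_combination (mixedEmbedding K (l i : K)) * hna i
    rw [this]
  have hPm : MeasurableSet (Set.pi Set.univ fun _ : Fin m => P) :=
    MeasurableSet.univ_pi fun _ => ZSpan.fundamentalDomain_measurableSet _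
  have hcm : ∀ l, MeasurableSet (cell l) := by
    intro l
    rw [hcelleq]
    refine (Continuous.measurable ?_) ((Continuous.measurable ?_) hPm)
    · exact continuous_const.add continuous_id
    · exact continuous_pi fun i => continuous_const.mul (continuous_apply i)
  have hnorm : ∀ i, mixedEmbedding.norm (mixedEmbedding K (a i)⁻¹) =
      |(Algebra.norm ℚ (a i) : ℝ)|⁻¹ := fun i => by
    refine eq_inv_of_mul_eq_one_right ?_
    rw [← Rat.cast_abs, ← mixedEmbedding.norm_eq_norm, ← map_mul, hna, map_one]
  have hN : ∀ i, |(Algebra.norm ℚ (a i) : ℝ)| ≠ 0 := fun i => by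
    simp [Algebra.norm_eq_zero_iff, ha i]
  have hvol : ∀ l, volume (cell l) =
      ENNReal.ofReal (covol K ^ m * ∏ i, |(Algebra.norm ℚ (a i) : ℝ)|) := by
    intro l
    rw [hcelleq, volume_preimage_add, volume_preimage_mul, volume_pi_pi,
      volume_fundamentalDomain_eq_covol]
    · simp only [hnorm]
      rw [Finset.prod_const, Finset.card_univ, Fintype.card_fin, Finset.prod_inv_distrib, inv_inv,
        ← ENNReal.ofReal_pow covol_pos.le, ← ENNReal.ofReal_mul (by positivity), mul_comm]
    · intro i
      rw [hnorm]
      exact inv_ne_zero (hN i)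
  have hpos : 0 < covol K ^ m * ∏ i, |(Algebra.norm ℚ (a i) : ℝ)| :=
    mul_pos (pow_pos covol_pos _) (Finset.prod_pos fun i _ => (abs_nonneg _).lt_of_ne' (hN i))
  have hclose : ∀ l, ∀ z ∈ cell l, ∀ z' ∈ cell l, ∀ v i,
      ‖coordAt v z i - coordAt v z' i‖ ≤ (2 * |D| + 1) * v (a i) := by
    intro l z hz z' hz' v i
    have e : z i - z' i = mixedEmbedding K (a i) *
        ((mixedEmbedding K (a i)⁻¹ * (z i - mixedEmbedding K (y i)) - mixedEmbedding K (l i)) -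
        (mixedEmbedding K (a i)⁻¹ * (z' i - mixedEmbedding K (y i)) - mixedEmbedding K (l i))) := by
      linear_combination (-(z i - z' i)) * hna i
    have e2 : coordAt v z i - coordAt v z' i = placeHom v (z i - z' i) := (map_sub _ _ _).symm
    rw [e2, e, map_mul, norm_mul, map_sub, placeHom_mixedEmbedding, norm_embedding_eq, mul_comm]
    gcongr
    refine (norm_sub_le _ _).trans ?_
    linarith [hDv v _ (hz i), hDv v _ (hz' i)]
  have htile : ∀ z, ∃! l, z ∈ cell l := by
    intro z
    choose l hl hu using fun i => existsUnique_sub_mem_fundamentalDomain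
      (mixedEmbedding K (a i)⁻¹ * (z i - mixedEmbedding K (y i)))
    exact ⟨l, hl, fun l' hl' => funext fun i => hu i _ (hl' i)⟩
  have hq : ∀ l, embVec (fun i => y i + a i * (l i : K)) ∈ cell l := by
    intro l i
    have : mixedEmbedding K (a i)⁻¹ * (embVec (fun i => y i + a i * (l i : K)) i -
        mixedEmbedding K (y i)) - mixedEmbedding K (l i) = 0 := by
      simp only [embVec, map_add, map_mul]
      linear_combination mixedEmbedding K (l i : K) * hna i
    rw [this, ZSpan.mem_fundamentalDomain]
    simp
  have : Countable (𝓞 K) := (RingOfIntegers.basis K).equivFun.injective.countable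
  have := tiling_count volume (fun l : Fin m → 𝓞 K => embVec (fun i => y i + a i * (l i : K))) cell
    hcm hvol (by simpa using hpos) htile hq hB hU hBtop hUtop (fun l => ?_)
  · rwa [ENNReal.toReal_ofReal hpos.le] at this
  -- A cell that meets both `B` and its complement lies in `U`: any two of its points are as close
  -- as `hBU` requires.
  · by_cases h1 : cell l ⊆ B
    · exact Or.inl h1
    by_cases h2 : Disjoint (cell l) B
    · exact Or.inr (Or.inl h2)
    rw [Set.not_disjoint_iff] at h2
    obtain ⟨z, hz, hzB⟩ := h2
    obtain ⟨z', hz', hzB'⟩ := Set.not_subset.mp h1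
    exact Or.inr (Or.inr fun z'' hz'' => hBU z hzB z' hzB' z'' (hclose l z hz z' hz')
      (hclose l z hz z'' hz''))

end LatticeCount

/-! ### Coordinates with respect to a basis of the unit lattice -/

section UnitCoordinates

open NumberField.InfinitePlace NumberField.Units NumberField.Units.dirichletUnitTheorem

variable {m : ℕ} {K : Type*} [Field K] [NumberField K]

theorem logUnits_apply (ε : (𝓞 K)ˣ) (v : InfinitePlace K) :
    logUnits K (Additive.ofMul ε) v = v.mult * Real.log (v (ε : K)) := by
  simp [logUnits, Real.log_pow]

theorem sum_eq_zero_of_mem_unitLogLattice {y : InfinitePlace K → ℝ} (hy : y ∈ unitLogLattice K) :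
    ∑ v, y v = 0 := by
  obtain ⟨ε, rfl⟩ := hy
  obtain ⟨ε, rfl⟩ := Additive.ofMul.surjective ε
  simp only [logUnits_apply]
  exact sum_mult_mul_log ε

/-- The restriction to the places different from a fixed one. -/
def dropPlace (K : Type*) [Field K] [NumberField K] :
    (InfinitePlace K → ℝ) →ₗ[ℝ] logSpace K :=
  LinearMap.pi fun v => LinearMap.proj v.1

/-- A vector of coordinate sum zero is determined by its coordinates at all places but one. This
passes between the lattice `Γ` in the hyperplane and the log space of Dirichlet's theorem. -/
theorem dropPlace_injOn {y : InfinitePlace K → ℝ} (hy : ∑ v, y v = 0) (h : dropPlace K y = 0) :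
    y = 0 := by
  classical
  have h1 : ∀ v, v ≠ w₀ → y v = 0 := fun v hv => congrFun h ⟨v, hv⟩
  have h2 : y w₀ = 0 := by
    rw [← Finset.add_sum_erase _ _ (Finset.mem_univ (w₀ : InfinitePlace K)),
      Finset.sum_eq_zero fun v hv => h1 v (Finset.ne_of_mem_erase hv), add_zero] at hy
    exact hy
  ext v
  by_cases hv : v = w₀
  · rw [hv, h2]; rfl
  · exact h1 v hv

variable (b : Module.Basis (Fin (Units.rank K)) ℤ (unitLogLattice K))

/-- Dirichlet's unit theorem enters here. The `ℤ`-basis of `Γ` has as many members as the dimension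
of the log space, so spanning over `ℝ` already makes it an `ℝ`-basis. -/
theorem span_dropPlace_eq_top :
    ⊤ ≤ Submodule.span ℝ (Set.range fun j => dropPlace K (b j : InfinitePlace K → ℝ)) := by
  rw [← unitLattice_span_eq_top K, Submodule.span_le]
  rintro _ ⟨ε, -, rfl⟩
  have h : logEmbedding K ε = dropPlace K (logUnits K ε) := by
    obtain ⟨ε, rfl⟩ := Additive.ofMul.surjective ε
    ext v
    change logEmbedding K (Additive.ofMul ε) v = logUnits K (Additive.ofMul ε) v.1
    rw [logUnits_apply]
    exact logEmbedding_component ε v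
  have h2 := b.sum_repr ⟨logUnits K ε, ε, rfl⟩
  have h3 : logUnits K ε = ∑ j, (b.repr ⟨logUnits K ε, ε, rfl⟩ j) •
      (b j : InfinitePlace K → ℝ) := by
    have := congrArg (Subtype.val) h2
    rw [AddSubgroup.val_finsetSum] at this
    exact this.symm
  change logEmbedding K ε ∈ _
  rw [h, h3, map_sum]
  refine Submodule.sum_mem _ fun j _ => ?_
  rw [map_zsmul]
  exact zsmul_mem (Submodule.subset_span (Set.mem_range_self j)) _

/-- The basis of the log space given by a basis of the lattice of logarithms of units. -/
def logSpaceBasis : Module.Basis (Fin (Units.rank K)) ℝ (logSpace K) :=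
  basisOfTopLeSpanOfCardEqFinrank (fun j => dropPlace K (b j : InfinitePlace K → ℝ))
    (span_dropPlace_eq_top b) (by rw [Units.finrank_eq_rank, Fintype.card_fin])

/-- The coordinates with respect to a basis of the lattice of logarithms of units. -/
def unitCoord : (InfinitePlace K → ℝ) →ₗ[ℝ] (Fin (Units.rank K) → ℝ) :=
  (logSpaceBasis b).equivFun.toLinearMap ∘ₗ dropPlace K

theorem unitCoord_basis (j : Fin (Units.rank K)) :
    unitCoord b (b j : InfinitePlace K → ℝ) = Pi.single j 1 := by
  have h : dropPlace K (b j : InfinitePlace K → ℝ) = logSpaceBasis b j := by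
    simp [logSpaceBasis]
  rw [unitCoord, LinearMap.comp_apply, h]
  simp [Finsupp.single_eq_pi_single]

theorem sum_unitCoord {y : InfinitePlace K → ℝ} (hy : ∑ v, y v = 0) :
    ∑ j, unitCoord b y j • (b j : InfinitePlace K → ℝ) = y := by
  rw [← sub_eq_zero]
  apply dropPlace_injOn
  · simp only [Pi.sub_apply, Finset.sum_sub_distrib, hy, sub_zero, Finset.sum_apply, Pi.smul_apply]
    rw [Finset.sum_comm]
    refine Finset.sum_eq_zero fun j _ => ?_
    rw [← Finset.smul_sum, sum_eq_zero_of_mem_unitLogLattice (b j).2, smul_zero]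
  · rw [map_sub, map_sum, sub_eq_zero]
    have := (logSpaceBasis b).sum_equivFun (dropPlace K y)
    conv_rhs => rw [← this]
    refine Finset.sum_congr rfl fun j _ => ?_
    rw [map_smul]
    congr 1
    simp [logSpaceBasis]

theorem unitCoord_sum (t : Fin (Units.rank K) → ℝ) :
    unitCoord b (∑ j, t j • (b j : InfinitePlace K → ℝ)) = t := by
  simp only [map_sum, map_smul, unitCoord_basis]
  ext j
  simp [Finset.sum_apply, Pi.single_apply]

theorem mem_fundDomain_iff {y : InfinitePlace K → ℝ} (hy : ∑ v, y v = 0) :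
    y ∈ fundDomain b ↔ ∀ j, 0 ≤ unitCoord b y j ∧ unitCoord b y j < 1 := by
  constructor
  · rintro ⟨t, ht, rfl⟩
    rw [unitCoord_sum]
    exact ht
  · exact fun h => ⟨unitCoord b y, h, (sum_unitCoord b hy).symm⟩

theorem sum_hyperplaneProj (y : InfinitePlace K → ℝ) : ∑ v, hyperplaneProj y v = 0 := by
  have h : (Module.finrank ℚ K : ℝ) ≠ 0 := by exact_mod_cast Module.finrank_pos.ne'
  simp only [hyperplaneProj, Finset.sum_sub_distrib, ← Finset.mul_sum]
  rw [← Nat.cast_sum, sum_mult_eq, div_mul_cancel₀ _ h, sub_self]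

/-- Linear coordinates are bounded by the maximum norm. -/
theorem exists_unitCoord_le : ∃ C : ℝ, 0 ≤ C ∧ ∀ (y : InfinitePlace K → ℝ) (δ : ℝ), 0 ≤ δ →
    (∀ v, |y v| ≤ δ) → ∀ j, |unitCoord b y j| ≤ C * δ := by
  let f := (unitCoord b).toContinuousLinearMap
  refine ⟨‖f‖, norm_nonneg _, fun y δ hδ h j => ?_⟩
  have h1 : ‖f y‖ ≤ ‖f‖ * ‖y‖ := f.le_opNorm y
  have h2 : ‖y‖ ≤ δ := (pi_norm_le_iff_of_nonneg hδ).mpr h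
  exact (norm_le_pi_norm (f y) j).trans (h1.trans (by gcongr))

end UnitCoordinates

/-! ### The functions that cut out the region, and their behaviour under flows -/

section ArchFunctions

open NumberField.InfinitePlace

variable {m : ℕ} [NeZero m] {K : Type*} [Field K] [NumberField K] {w u : Fin m → ℕ+}

/-- The logarithm of the weighted norm at a place. -/
def logNorm (w : Fin m → ℕ+) (v : InfinitePlace K) (z : Fin m → mixedEmbedding.mixedSpace K) : ℝ :=
  Real.log (wnorm w (coordAt v z))

/-- The mean of the logarithms of the weighted norms. -/
def logMean (w : Fin m → ℕ+) (z : Fin m → mixedEmbedding.mixedSpace K) : ℝ :=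
  (∑ v : InfinitePlace K, v.mult * logNorm w v z) / Module.finrank ℚ K

/-- The logarithm of the archimedean height of `φ(z)`, normalized to have degree `1`. -/
def Morphism.logHeight (φ : Morphism K w u) (z : Fin m → mixedEmbedding.mixedSpace K) : ℝ :=
  (∑ v : InfinitePlace K, v.mult * Real.log (wnorm u (φ.evalHom v.embedding (coordAt v z)))) /
    (φ.e * Module.finrank ℚ K)

/-- The coordinates of `z` with respect to a basis of the unit lattice. -/
def logCoord (w : Fin m → ℕ+) (b : Module.Basis (Fin (Units.rank K)) ℤ (unitLogLattice K))
    (z : Fin m → mixedEmbedding.mixedSpace K) (j : Fin (Units.rank K)) : ℝ :=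
  unitCoord b (hyperplaneProj (eta w z)) j

theorem finrank_cast_pos : (0 : ℝ) < Module.finrank ℚ K := by exact_mod_cast Module.finrank_pos

theorem eta_eq (w : Fin m → ℕ+) (z : Fin m → mixedEmbedding.mixedSpace K) (v : InfinitePlace K) :
    eta w z v = v.mult * logNorm w v z := by
  rw [eta, placeMax_eq, Real.log_pow, logNorm]

theorem hyperplaneProj_eta (w : Fin m → ℕ+) (z : Fin m → mixedEmbedding.mixedSpace K)
    (v : InfinitePlace K) :
    hyperplaneProj (eta w z) v = v.mult * (logNorm w v z - logMean w z) := by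
  simp only [hyperplaneProj, eta_eq, logMean]
  ring

theorem mem_archDelta_iff (b : Module.Basis (Fin (Units.rank K)) ℤ (unitLogLattice K))
    (z : Fin m → mixedEmbedding.mixedSpace K) :
    z ∈ archDelta w b ↔ z ∈ archPunctured m K ∧
      ∀ j, 0 ≤ logCoord w b z j ∧ logCoord w b z j < 1 := by
  rw [archDelta, Set.mem_ofPred_eq, mem_fundDomain_iff b (sum_hyperplaneProj _)]
  rfl

theorem Morphism.wnorm_evalHom_pos (φ : Morphism K w u) {z : Fin m → mixedEmbedding.mixedSpace K}
    (hz : z ∈ archPunctured m K) (v : InfinitePlace K) :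
    0 < wnorm u (φ.evalHom v.embedding (coordAt v z)) := by
  rw [wnorm_pos_iff]
  exact φ.evalHom_ne_zero _ ((wnorm_pos_iff w _).mp ((mem_archPunctured_iff w z).mp hz v))

theorem Morphism.prod_placeMax_archEval (φ : Morphism K w u) (he : 0 < φ.e)
    {z : Fin m → mixedEmbedding.mixedSpace K} (hz : z ∈ archPunctured m K) :
    ∏ v : InfinitePlace K, placeMax u v (φ.archEval z) =
      Real.exp (φ.e * Module.finrank ℚ K * φ.logHeight z) := by
  have h : (φ.e * Module.finrank ℚ K : ℝ) ≠ 0 :=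
    (mul_pos (by exact_mod_cast he) finrank_cast_pos).ne'
  rw [Morphism.logHeight, mul_div_cancel₀ _ h, Real.exp_sum]
  refine Finset.prod_congr rfl fun v _ => ?_
  rw [placeMax_eq, coordAt_archEval, Real.exp_nat_mul, Real.exp_log (φ.wnorm_evalHom_pos hz v)]

/-- Writing the height bound as `t ^ (e N)` makes `t` the factor of a weighted dilation: the height
condition becomes `logHeight ≤ log t`, while the conditions on the unit coordinates do not involve
`t`. -/
theorem Morphism.mem_archB_iff (φ : Morphism K w u) (he : 0 < φ.e)
    (b : Module.Basis (Fin (Units.rank K)) ℤ (unitLogLattice K)) {t : ℝ} (ht : 0 < t)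
    (z : Fin m → mixedEmbedding.mixedSpace K) :
    z ∈ φ.archB b (t ^ (φ.e * Module.finrank ℚ K)) ↔ z ∈ archPunctured m K ∧
      φ.logHeight z ≤ Real.log t ∧ ∀ j, 0 ≤ logCoord w b z j ∧ logCoord w b z j < 1 := by
  have hpos : (0 : ℝ) < φ.e * Module.finrank ℚ K := mul_pos (by exact_mod_cast he) finrank_cast_pos
  rw [archB, archD, Set.mem_inter_iff, mem_archDelta_iff]
  constructor
  · rintro ⟨⟨h1, h2⟩, -, h3⟩
    refine ⟨h1, ?_, h3⟩
    rw [φ.prod_placeMax_archEval he h1, ← Real.exp_log (pow_pos ht _), Real.exp_le_exp,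
      Real.log_pow, Nat.cast_mul] at h2
    exact le_of_mul_le_mul_left h2 hpos
  · rintro ⟨h1, h2, h3⟩
    refine ⟨⟨h1, ?_⟩, h1, h3⟩
    rw [φ.prod_placeMax_archEval he h1, ← Real.exp_log (pow_pos ht _), Real.exp_le_exp,
      Real.log_pow, Nat.cast_mul]
    exact mul_le_mul_of_nonneg_left h2 hpos.le

theorem measurable_logNorm (w : Fin m → ℕ+) (v : InfinitePlace K) :
    Measurable (logNorm w v : (Fin m → mixedEmbedding.mixedSpace K) → ℝ) :=
  Real.measurable_log.comp (measurable_wnorm_coordAt w v)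

theorem Morphism.measurable_logHeight (φ : Morphism K w u) : Measurable φ.logHeight := by
  refine Measurable.div_const (Finset.measurable_sum _ fun v _ => Measurable.const_mul ?_ _) _
  exact Real.measurable_log.comp ((measurable_wnorm u).comp
    ((measurable_evalHom φ _).comp (continuous_coordAt v).measurable))

theorem measurable_logCoord (w : Fin m → ℕ+)
    (b : Module.Basis (Fin (Units.rank K)) ℤ (unitLogLattice K)) (j : Fin (Units.rank K)) :
    Measurable fun z : Fin m → mixedEmbedding.mixedSpace K => logCoord w b z j := by
  have h1 : Measurable fun z : Fin m → mixedEmbedding.mixedSpace K => hyperplaneProj (eta w z) := by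
    refine measurable_pi_lambda _ fun v => ?_
    simp only [hyperplaneProj_eta, logMean]
    refine Measurable.const_mul ((measurable_logNorm w v).sub (Measurable.div_const ?_ _)) _
    exact Finset.measurable_sum _ fun v _ => (measurable_logNorm w v).const_mul _
  exact (measurable_pi_apply j).comp
    ((unitCoord b).continuous_of_finiteDimensional.measurable.comp h1)

theorem Morphism.measurableSet_archB (φ : Morphism K w u) (he : 0 < φ.e)
    (b : Module.Basis (Fin (Units.rank K)) ℤ (unitLogLattice K)) {t : ℝ} (ht : 0 < t) :
    MeasurableSet (φ.archB b (t ^ (φ.e * Module.finrank ℚ K))) := by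
  have : φ.archB b (t ^ (φ.e * Module.finrank ℚ K)) = archPunctured m K ∩
      ({z | φ.logHeight z ≤ Real.log t} ∩
        ⋂ j, ({z | 0 ≤ logCoord w b z j} ∩ {z | logCoord w b z j < 1})) := by
    ext z
    rw [φ.mem_archB_iff he b ht]
    simp
  rw [this]
  refine measurableSet_archPunctured.inter ((measurableSet_le φ.measurable_logHeight
    measurable_const).inter (MeasurableSet.iInter fun j => ?_))
  exact (measurableSet_le measurable_const (measurable_logCoord w b j)).inter
    (measurableSet_lt (measurable_logCoord w b j) measurable_const)

theorem flow_mem_archPunctured (w : Fin m → ℕ+) {c : InfinitePlace K → ℝ} (hc : ∀ v, 0 < c v)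
    {z : Fin m → mixedEmbedding.mixedSpace K} :
    flow w c z ∈ archPunctured m K ↔ z ∈ archPunctured m K := by
  simp only [mem_archPunctured_iff w]
  refine forall_congr' fun v => ?_
  rw [wnorm_coordAt_flow _ _ _ (hc v).le, mul_pos_iff_of_pos_left (hc v)]

theorem logNorm_flow (w : Fin m → ℕ+) {c : InfinitePlace K → ℝ} (hc : ∀ v, 0 < c v)
    {z : Fin m → mixedEmbedding.mixedSpace K} (hz : z ∈ archPunctured m K) (v : InfinitePlace K) :
    logNorm w v (flow w c z) = logNorm w v z + Real.log (c v) := by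
  rw [logNorm, wnorm_coordAt_flow _ _ _ (hc v).le,
    Real.log_mul (hc v).ne' ((mem_archPunctured_iff w z).mp hz v).ne', add_comm, logNorm]

/-- The polynomials scale with exponent `e` and the local degrees add up to `N`; the normalization
by `e N` thus gives unit speed along the uniform dilation. -/
theorem Morphism.logHeight_flow (φ : Morphism K w u) (he : 0 < φ.e) {c : ℝ} (hc : 0 < c)
    {z : Fin m → mixedEmbedding.mixedSpace K} (hz : z ∈ archPunctured m K) :
    φ.logHeight (flow w (fun _ => c) z) = φ.logHeight z + Real.log c := by
  have hpos : (φ.e * Module.finrank ℚ K : ℝ) ≠ 0 :=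
    (mul_pos (by exact_mod_cast he) finrank_cast_pos).ne'
  have h : ∀ v : InfinitePlace K,
      (v.mult : ℝ) * Real.log (wnorm u (φ.evalHom v.embedding (coordAt v (flow w (fun _ => c) z)))) =
      v.mult * Real.log (wnorm u (φ.evalHom v.embedding (coordAt v z))) +
        v.mult * (φ.e * Real.log c) := by
    intro v
    rw [coordAt_flow, φ.evalHom_act, wnorm_act, norm_pow, Complex.norm_real, Real.norm_eq_abs,
      abs_of_pos hc, Real.log_mul (pow_pos hc _).ne' (φ.wnorm_evalHom_pos hz v).ne', Real.log_pow]
    ring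
  simp only [logHeight, h, Finset.sum_add_distrib]
  rw [← Finset.sum_mul, ← Nat.cast_sum, sum_mult_eq, add_div]
  congr 1
  rw [mul_left_comm, ← mul_assoc, mul_div_cancel_left₀ _ hpos]

theorem logCoord_flow_const (w : Fin m → ℕ+)
    (b : Module.Basis (Fin (Units.rank K)) ℤ (unitLogLattice K)) {c : ℝ} (hc : 0 < c)
    {z : Fin m → mixedEmbedding.mixedSpace K} (hz : z ∈ archPunctured m K) :
    logCoord w b (flow w (fun _ => c) z) = logCoord w b z := by
  have : hyperplaneProj (eta w (flow w (fun _ => c) z)) = hyperplaneProj (eta w z) := by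
    ext v
    simp only [hyperplaneProj_eta, logMean, logNorm_flow w (fun _ => hc) hz, mul_add,
      Finset.sum_add_distrib]
    rw [← Finset.sum_mul, ← Nat.cast_sum, sum_mult_eq, add_div,
      mul_div_cancel_left₀ _ finrank_cast_pos.ne']
    ring
  ext j
  rw [logCoord, this, logCoord]

/-- The flow in the direction of the basis vector `b j`, divided by the local degrees, moves the
`j`-th coordinate at unit speed. As `b j` has coordinate sum zero, the mean is unchanged and the
projection to the hyperplane plays no role. -/
theorem logCoord_flow_basis (w : Fin m → ℕ+)
    (b : Module.Basis (Fin (Units.rank K)) ℤ (unitLogLattice K)) (j : Fin (Units.rank K)) (s : ℝ)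
    {z : Fin m → mixedEmbedding.mixedSpace K} (hz : z ∈ archPunctured m K) :
    logCoord w b (flow w (fun v => Real.exp (s * ((b j : InfinitePlace K → ℝ) v / v.mult))) z) j =
      logCoord w b z j + s := by
  set c : InfinitePlace K → ℝ := fun v => Real.exp (s * ((b j : InfinitePlace K → ℝ) v / v.mult))
  have hc : ∀ v, 0 < c v := fun v => Real.exp_pos _
  have hm : ∀ v : InfinitePlace K, (v.mult : ℝ) ≠ 0 := fun v => by exact_mod_cast mult_ne_zero
  have h1 : ∀ v, (v.mult : ℝ) * Real.log (c v) = s * (b j : InfinitePlace K → ℝ) v := fun v => by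
    rw [Real.log_exp]
    field_simp [hm v]
  have h2 : logMean w (flow w c z) = logMean w z := by
    simp only [logMean, logNorm_flow w hc hz, mul_add,
      Finset.sum_add_distrib, h1]
    rw [← Finset.mul_sum, sum_eq_zero_of_mem_unitLogLattice (b j).2, mul_zero, add_zero]
  have : hyperplaneProj (eta w (flow w c z)) =
      hyperplaneProj (eta w z) + s • (b j : InfinitePlace K → ℝ) := by
    ext v
    rw [Pi.add_apply, Pi.smul_apply, smul_eq_mul, ← h1]
    simp only [hyperplaneProj_eta, h2, logNorm_flow w hc hz]
    ring
  rw [logCoord, this, map_add, map_smul, unitCoord_basis, logCoord]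
  simp

theorem Morphism.mem_archB_iff_flow (φ : Morphism K w u) (he : 0 < φ.e)
    (b : Module.Basis (Fin (Units.rank K)) ℤ (unitLogLattice K)) {t : ℝ} (ht : 0 < t)
    (z : Fin m → mixedEmbedding.mixedSpace K) :
    z ∈ φ.archB b (t ^ (φ.e * Module.finrank ℚ K)) ↔ flow w (fun _ => t⁻¹) z ∈ φ.archB b 1 := by
  have h1 := φ.mem_archB_iff he b one_pos (flow w (fun _ => t⁻¹) z)
  rw [one_pow] at h1
  rw [h1, φ.mem_archB_iff he b ht, flow_mem_archPunctured w (fun _ => inv_pos.mpr ht)]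
  refine and_congr_right fun hz => ?_
  rw [φ.logHeight_flow he (inv_pos.mpr ht) hz, logCoord_flow_const w b (inv_pos.mpr ht) hz,
    Real.log_one, Real.log_inv, ← sub_eq_add_neg, sub_nonpos]

open scoped Classical in
theorem Morphism.volume_archB (φ : Morphism K w u) (he : 0 < φ.e)
    (b : Module.Basis (Fin (Units.rank K)) ℤ (unitLogLattice K)) {t : ℝ} (ht : 0 < t) :
    volume (φ.archB b (t ^ (φ.e * Module.finrank ℚ K))) =
      ENNReal.ofReal (t ^ (Module.finrank ℚ K * totalWeight w)) * φ.archVolume b := by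
  have h : φ.archB b (t ^ (φ.e * Module.finrank ℚ K)) =
      flow w (fun _ => t⁻¹) ⁻¹' φ.archB b 1 := Set.ext fun z => φ.mem_archB_iff_flow he b ht z
  rw [h, volume_preimage_flow _ _ (fun _ => by positivity), prod_const_pow_mult, inv_pow, inv_pow,
    inv_inv, pow_mul]
  rfl

end ArchFunctions

/-! ### Weighted norms under additive and relative perturbations -/

section Perturbation

variable {m : ℕ} [NeZero m] {L : Type*} [NormedField L]

theorem wnorm_le_add (w : Fin m → ℕ+) {z z' : Fin m → L} {ρ : ℝ} (hρ : 0 ≤ ρ)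
    (h : ∀ i, ‖z i - z' i‖ ≤ ρ ^ (w i : ℕ)) : wnorm w z' ≤ wnorm w z + ρ := by
  have h0 := wnorm_nonneg w z
  rw [wnorm_le_iff _ _ (by positivity)]
  intro i
  calc ‖z' i‖ = ‖z i - (z i - z' i)‖ := by rw [sub_sub_cancel]
    _ ≤ ‖z i‖ + ‖z i - z' i‖ := norm_sub_le _ _
    _ ≤ wnorm w z ^ (w i : ℕ) + ρ ^ (w i : ℕ) := add_le_add (norm_le_wnorm_pow w z i) (h i)
    _ ≤ _ := pow_add_pow_le h0 hρ (w i).ne_zero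

theorem wnorm_le_one_add_mul (w : Fin m → ℕ+) {z z' : Fin m → L} {r δ : ℝ} (hr : 0 < r)
    (hz' : r ≤ wnorm w z') (hδ : 0 ≤ δ) (h : ∀ i, ‖z i - z' i‖ ≤ δ * r ^ (w i : ℕ)) :
    wnorm w z ≤ (1 + δ) * wnorm w z' := by
  have h0 := wnorm_nonneg w z'
  rw [wnorm_le_iff _ _ (by positivity)]
  intro i
  have h1 : r ^ (w i : ℕ) ≤ wnorm w z' ^ (w i : ℕ) := by gcongr
  calc ‖z i‖ = ‖z' i + (z i - z' i)‖ := by rw [add_sub_cancel]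
    _ ≤ ‖z' i‖ + ‖z i - z' i‖ := norm_add_le _ _
    _ ≤ wnorm w z' ^ (w i : ℕ) + δ * r ^ (w i : ℕ) := add_le_add (norm_le_wnorm_pow w z' i) (h i)
    _ ≤ (1 + δ) * wnorm w z' ^ (w i : ℕ) := by nlinarith
    _ ≤ (1 + δ) ^ (w i : ℕ) * wnorm w z' ^ (w i : ℕ) := by
        gcongr
        exact le_self_pow₀ (by linarith) (w i).ne_zero
    _ = _ := (mul_pow _ _ _).symm

theorem abs_log_sub_log_le {x y C : ℝ} (hx : 0 < x) (hy : 0 < y) (hC : 0 ≤ C)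
    (h1 : x ≤ (1 + C) * y) (h2 : y ≤ (1 + C) * x) : |Real.log x - Real.log y| ≤ C := by
  have key : ∀ {x y : ℝ}, 0 < x → 0 < y → x ≤ (1 + C) * y → Real.log x - Real.log y ≤ C := by
    intro x y hx hy h
    have h3 := Real.log_le_log hx h
    rw [Real.log_mul (by positivity) hy.ne'] at h3
    have h4 := Real.log_le_sub_one_of_pos (show 0 < 1 + C by positivity)
    linarith
  rw [abs_le]
  constructor
  · linarith [key hy hx h2]
  · exact key hx hy h1

end Perturbation

/-! ### The fundamental region and the volume near its boundary -/

section Region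

open NumberField.InfinitePlace

variable {m : ℕ} [NeZero m] {K : Type*} [Field K] [NumberField K] {w u : Fin m → ℕ+}

theorem abs_weighted_mean_le {f : InfinitePlace K → ℝ} {D : ℝ} (h : ∀ v, |f v| ≤ D) :
    |(∑ v : InfinitePlace K, v.mult * f v) / Module.finrank ℚ K| ≤ D := by
  rw [abs_div, abs_of_pos finrank_cast_pos, div_le_iff₀ finrank_cast_pos]
  calc |∑ v : InfinitePlace K, v.mult * f v| ≤ ∑ v : InfinitePlace K, (v.mult : ℝ) * D := by
        refine (Finset.abs_sum_le_sum_abs _ _).trans (Finset.sum_le_sum fun v _ => ?_)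
        rw [abs_mul, Nat.abs_cast]
        exact mul_le_mul_of_nonneg_left (h v) (Nat.cast_nonneg _)
    _ = D * Module.finrank ℚ K := by rw [← Finset.sum_mul, ← Nat.cast_sum, sum_mult_eq, mul_comm]

theorem abs_logMean_sub_le {z z' : Fin m → mixedEmbedding.mixedSpace K} {D : ℝ}
    (h : ∀ v, |logNorm w v z - logNorm w v z'| ≤ D) : |logMean w z - logMean w z'| ≤ D := by
  convert abs_weighted_mean_le h using 2
  simp only [logMean, ← sub_div, ← Finset.sum_sub_distrib, mul_sub]

theorem Morphism.abs_logHeight_sub_le (φ : Morphism K w u) (he : 0 < φ.e)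
    {z z' : Fin m → mixedEmbedding.mixedSpace K} {D : ℝ}
    (h : ∀ v : InfinitePlace K, |Real.log (wnorm u (φ.evalHom v.embedding (coordAt v z))) -
      Real.log (wnorm u (φ.evalHom v.embedding (coordAt v z')))| ≤ D) :
    |φ.logHeight z - φ.logHeight z'| ≤ D := by
  have h1 := abs_weighted_mean_le h
  have he1 : (1 : ℝ) ≤ φ.e := by exact_mod_cast he
  have h2 : φ.logHeight z - φ.logHeight z' = ((∑ v : InfinitePlace K, v.mult *
      (Real.log (wnorm u (φ.evalHom v.embedding (coordAt v z))) -
      Real.log (wnorm u (φ.evalHom v.embedding (coordAt v z'))))) / Module.finrank ℚ K) / φ.e := by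
    simp only [Morphism.logHeight, ← sub_div, ← Finset.sum_sub_distrib, mul_sub, div_div]
    rw [mul_comm (φ.e : ℝ)]
  rw [h2, abs_div, Nat.abs_cast]
  exact (div_le_self (abs_nonneg _) he1).trans h1

theorem exists_logCoord_sub_le (w : Fin m → ℕ+)
    (b : Module.Basis (Fin (Units.rank K)) ℤ (unitLogLattice K)) :
    ∃ C : ℝ, 0 ≤ C ∧ ∀ (z z' : Fin m → mixedEmbedding.mixedSpace K) (D : ℝ), 0 ≤ D →
      (∀ v, |logNorm w v z - logNorm w v z'| ≤ D) → ∀ j,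
      |logCoord w b z j - logCoord w b z' j| ≤ C * D := by
  obtain ⟨C, hC, h⟩ := exists_unitCoord_le b
  -- The factor `4` is the largest local degree `2` times two differences, that of the logarithms
  -- and that of their means.
  refine ⟨C * 4, by positivity, fun z z' D hD hzz j => ?_⟩
  have h1 : ∀ v, |(hyperplaneProj (eta w z) - hyperplaneProj (eta w z')) v| ≤ 4 * D := by
    intro v
    have h2 := abs_logMean_sub_le hzz
    have h3 : (hyperplaneProj (eta w z) - hyperplaneProj (eta w z')) v =
        v.mult * ((logNorm w v z - logNorm w v z') - (logMean w z - logMean w z')) := by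
      rw [Pi.sub_apply, hyperplaneProj_eta, hyperplaneProj_eta]
      ring
    have h4 : (v.mult : ℝ) ≤ 2 := by
      rw [InfinitePlace.mult]
      split_ifs <;> norm_num
    rw [h3, abs_mul, Nat.abs_cast]
    calc (v.mult : ℝ) * _ ≤ 2 * (D + D) := by
          gcongr
          exact (abs_sub _ _).trans (add_le_add (hzz v) h2)
      _ = 4 * D := by ring
  have h5 := h _ _ (by positivity) h1 j
  rw [map_sub] at h5
  rw [mul_assoc]
  exact h5

/-- On the fundamental region the weighted norms at all places are comparable. -/
theorem exists_logNorm_sub_logMean_le (w : Fin m → ℕ+)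
    (b : Module.Basis (Fin (Units.rank K)) ℤ (unitLogLattice K)) :
    ∃ S : ℝ, 0 ≤ S ∧ ∀ z : Fin m → mixedEmbedding.mixedSpace K,
      (∀ j, 0 ≤ logCoord w b z j ∧ logCoord w b z j < 1) →
      ∀ v, |logNorm w v z - logMean w z| ≤ S := by
  refine ⟨∑ v, ∑ j, |(b j : InfinitePlace K → ℝ) v|,
    Finset.sum_nonneg fun v _ => Finset.sum_nonneg fun j _ => abs_nonneg _, fun z hz v => ?_⟩
  have h1 := congrFun (sum_unitCoord b (sum_hyperplaneProj (eta w z))) v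
  rw [hyperplaneProj_eta, Finset.sum_apply] at h1
  have h2 : (1 : ℝ) ≤ v.mult := by exact_mod_cast mult_pos
  calc |logNorm w v z - logMean w z| ≤ v.mult * |logNorm w v z - logMean w z| :=
        le_mul_of_one_le_left (abs_nonneg _) h2
    _ = |∑ j, (unitCoord b (hyperplaneProj (eta w z)) j • (b j : InfinitePlace K → ℝ)) v| := by
        rw [h1, abs_mul, Nat.abs_cast]
    _ ≤ ∑ j, |(b j : InfinitePlace K → ℝ) v| := by
        refine (Finset.abs_sum_le_sum_abs _ _).trans (Finset.sum_le_sum fun j _ => ?_)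
        rw [Pi.smul_apply, smul_eq_mul, abs_mul]
        refine mul_le_of_le_one_left (abs_nonneg _) ?_
        change |logCoord w b z j| ≤ 1
        rw [abs_of_nonneg (hz j).1]
        exact (hz j).2.le
    _ ≤ _ := Finset.single_le_sum (f := fun v => ∑ j, |(b j : InfinitePlace K → ℝ) v|)
        (fun v _ => Finset.sum_nonneg fun j _ => abs_nonneg _) (Finset.mem_univ v)

/-- By `exists_wnorm_evalHom_bounds` the norm of `φ(z)` is comparable at each infinite place with
the `e`-th power of that of `z`; taking logarithms and averaging, the height controls the mean size
of `z`. -/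
theorem Morphism.exists_logMean_le (φ : Morphism K w u) (he : 0 < φ.e) :
    ∃ A : ℝ, 0 ≤ A ∧ ∀ z ∈ archPunctured m K, |logMean w z - φ.logHeight z| ≤ A := by
  choose A hA h using fun v : InfinitePlace K => φ.exists_wnorm_evalHom_bounds v.embedding
  have hA0 : ∀ v, 0 ≤ Real.log (A v) := fun v => Real.log_nonneg (hA v)
  refine ⟨∑ v, Real.log (A v), Finset.sum_nonneg fun v _ => hA0 v, fun z hz => ?_⟩
  have he1 : (1 : ℝ) ≤ φ.e := by exact_mod_cast he
  have key : ∀ v : InfinitePlace K, |φ.e * logNorm w v z -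
      Real.log (wnorm u (φ.evalHom v.embedding (coordAt v z)))| ≤ ∑ v, Real.log (A v) := by
    intro v
    have hg := (mem_archPunctured_iff w z).mp hz v
    have hh := φ.wnorm_evalHom_pos hz v
    obtain ⟨h1, h2⟩ := h v (coordAt v z) ((wnorm_pos_iff w _).mp hg)
    have hAv : 0 < A v := one_pos.trans_le (hA v)
    have h3 := Real.log_le_log hh h1
    have h4 := Real.log_le_log (pow_pos hg _) h2
    rw [Real.log_mul hAv.ne' (pow_pos hg _).ne', Real.log_pow] at h3
    rw [Real.log_mul hAv.ne' hh.ne', Real.log_pow] at h4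
    refine le_trans ?_ (Finset.single_le_sum (f := fun v => Real.log (A v)) (fun v _ => hA0 v)
      (Finset.mem_univ v))
    rw [abs_le, logNorm]
    constructor <;> linarith
  have h1 := abs_weighted_mean_le key
  have hN := (finrank_cast_pos (K := K)).ne'
  have h2 : logMean w z - φ.logHeight z = ((∑ v : InfinitePlace K, v.mult *
      (φ.e * logNorm w v z - Real.log (wnorm u (φ.evalHom v.embedding (coordAt v z))))) /
        Module.finrank ℚ K) / φ.e := by
    simp only [Morphism.logHeight, logMean, mul_sub, Finset.sum_sub_distrib, mul_left_comm _ (φ.e : ℝ),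
      ← Finset.mul_sum]
    field_simp
  rw [h2, abs_div, Nat.abs_cast]
  exact (div_le_self (abs_nonneg _) he1).trans h1

-- In the shell of radius `R 2^(-k)` the layer may have width of order `(ρ 2^k)^a`, since a fixed
-- displacement is relatively larger near the origin. The volume of the shell decays like
-- `2^(-kN|w|)`, and `a < N|w|` makes the series over `k` geometric.
open scoped Classical in
theorem exists_volume_dyadic_layers_le (w : Fin m → ℕ+)
    (ψ : (Fin m → mixedEmbedding.mixedSpace K) → ℝ) (hψ : Measurable ψ) (β : InfinitePlace K → ℝ)
    (hβ : 0 ≤ ∑ v, (v.mult : ℝ) * β v)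
    (hflow : ∀ z ∈ archPunctured m K, ∀ s : ℝ, ψ (flow w (fun v => Real.exp (s * β v)) z) = ψ z + s)
    {a : ℕ} (ha : a < Module.finrank ℚ K * totalWeight w) {R c : ℝ} (hR : 0 < R) (hc : 0 < c) :
    ∃ C : ℝ, 0 ≤ C ∧ ∀ ρ θ : ℝ, 0 < ρ →
      volume (⋃ k : ℕ, {z | z ∈ archPunctured m K ∧ z ∈ wbox (K := K) w (R * (1 / 2) ^ k) ∧
        |ψ z - θ| ≤ c * (ρ * 2 ^ k) ^ a}) ≤ ENNReal.ofReal (C * ρ ^ a) := by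
  obtain ⟨C, hC, h⟩ := exists_volume_layer_le w ψ hψ β hβ hflow
  set M := Module.finrank ℚ K * totalWeight w with hM
  refine ⟨C * R ^ M * c * 2, by positivity, fun ρ θ hρ => ?_⟩
  have h1 : ∀ k : ℕ, volume {z | z ∈ archPunctured m K ∧ z ∈ wbox (K := K) w (R * (1 / 2) ^ k) ∧
        |ψ z - θ| ≤ c * (ρ * 2 ^ k) ^ a} ≤
      ENNReal.ofReal (C * R ^ M * c * ρ ^ a * (1 / 2) ^ k) := by
    intro k
    refine (h (R * (1 / 2) ^ k) (c * (ρ * 2 ^ k) ^ a) θ (by positivity) (by positivity)).trans ?_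
    refine ENNReal.ofReal_le_ofReal ?_
    obtain ⟨d, hd⟩ := Nat.exists_eq_add_of_lt ha
    have h2 : (((1 / 2 : ℝ) ^ k) ^ M) * ((2 : ℝ) ^ k) ^ a ≤ (1 / 2) ^ k := by
      have h3 : ((1 / 2 : ℝ) ^ k) ^ a * ((2 : ℝ) ^ k) ^ a = 1 := by
        rw [← mul_pow, ← mul_pow]
        norm_num
      rw [hd, add_assoc, pow_add, mul_right_comm, h3, one_mul]
      exact pow_le_of_le_one (by positivity) (pow_le_one₀ (by norm_num) (by norm_num)) (by omega)
    calc C * (R * (1 / 2) ^ k) ^ M * (c * (ρ * 2 ^ k) ^ a) =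
        C * R ^ M * c * ρ ^ a * ((((1 / 2 : ℝ) ^ k) ^ M) * ((2 : ℝ) ^ k) ^ a) := by
          rw [mul_pow, mul_pow]; ring
      _ ≤ _ := by gcongr
  refine (measure_iUnion_le _).trans ((ENNReal.tsum_le_tsum h1).trans ?_)
  rw [← ENNReal.ofReal_tsum_of_nonneg (fun k => by positivity)
    (summable_geometric_two.mul_left _), tsum_mul_left, tsum_geometric_two]
  refine ENNReal.ofReal_le_ofReal (le_of_eq (by ring))

/-- The index `none` stands for the logarithmic height, with uniform dilation as its flow, and `some
j` for the `j`-th unit coordinate, with the flow along `b j`. All the functions that bound the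
region are so treated together. -/
theorem exists_dyadic_logHeight (φ : Morphism K w u) (he : 0 < φ.e)
    (b : Module.Basis (Fin (Units.rank K)) ℤ (unitLogLattice K))
    {a : ℕ} (ha : a < Module.finrank ℚ K * totalWeight w) {R c : ℝ} (hR : 0 < R) (hc : 0 < c)
    (i : Option (Fin (Units.rank K))) :
    open scoped Classical in ∃ C : ℝ, 0 ≤ C ∧ ∀ ρ θ : ℝ, 0 < ρ →
      volume (⋃ k : ℕ, {z | z ∈ archPunctured m K ∧ z ∈ wbox (K := K) w (R * (1 / 2) ^ k) ∧
        |i.elim φ.logHeight (fun j z => logCoord w b z j) z - θ| ≤ c * (ρ * 2 ^ k) ^ a}) ≤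
      ENNReal.ofReal (C * ρ ^ a) := by
  cases i with
  | none =>
    refine exists_volume_dyadic_layers_le w _ φ.measurable_logHeight (fun _ => 1) ?_ ?_ ha hR hc
    · exact Finset.sum_nonneg fun v _ => by positivity
    · intro z hz s
      rw [mul_one]
      refine (φ.logHeight_flow he (Real.exp_pos s) hz).trans ?_
      rw [Real.log_exp]
  | some j =>
    refine exists_volume_dyadic_layers_le w _ (measurable_logCoord w b j)
      (fun v => (b j : InfinitePlace K → ℝ) v / v.mult) ?_ ?_ ha hR hc
    · have h : ∀ v : InfinitePlace K, (v.mult : ℝ) * ((b j : InfinitePlace K → ℝ) v / v.mult) =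
          (b j : InfinitePlace K → ℝ) v := fun v =>
        mul_div_cancel₀ _ (by exact_mod_cast mult_ne_zero)
      simp only [h, sum_eq_zero_of_mem_unitLogLattice (b j).2, le_refl]
    · intro z hz s
      exact logCoord_flow_basis w b j s hz

/-- The logarithmic height and the logarithmic coordinates are Lipschitz. -/
theorem exists_perturbation_le (φ : Morphism K w u) (he : 0 < φ.e)
    (b : Module.Basis (Fin (Units.rank K)) ℤ (unitLogLattice K)) :
    ∃ D : ℝ, 0 < D ∧ ∀ (z z' : Fin m → mixedEmbedding.mixedSpace K) (r δ : ℝ), 0 < r →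
      (∀ v : InfinitePlace K, r ≤ wnorm w (coordAt v z)) →
      (∀ v : InfinitePlace K, r ≤ wnorm w (coordAt v z')) → 0 ≤ δ → δ ≤ 1 →
      (∀ v i, ‖coordAt v z i - coordAt v z' i‖ ≤ δ * r ^ (w i : ℕ)) →
      ∀ i : Option (Fin (Units.rank K)), |i.elim φ.logHeight (fun j z => logCoord w b z j) z -
        i.elim φ.logHeight (fun j z => logCoord w b z j) z'| ≤ D * δ := by
  choose C hC h using fun v : InfinitePlace K => φ.exists_wnorm_evalHom_le_mul v.embedding
  obtain ⟨C', hC', h'⟩ := exists_logCoord_sub_le w b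
  have hS : 0 ≤ ∑ v, C v := Finset.sum_nonneg fun v _ => hC v
  refine ⟨∑ v, C v + C' + 1, by positivity, fun z z' r δ hr hz hz' hδ hδ1 hzz i => ?_⟩
  have hzz' : ∀ v i, ‖coordAt v z' i - coordAt v z i‖ ≤ δ * r ^ (w i : ℕ) := fun v i => by
    rw [norm_sub_rev]; exact hzz v i
  have hp : z ∈ archPunctured m K := (mem_archPunctured_iff w z).mpr fun v => hr.trans_le (hz v)
  have hp' : z' ∈ archPunctured m K := (mem_archPunctured_iff w z').mpr fun v => hr.trans_le (hz' v)
  cases i with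
  | none =>
    refine (φ.abs_logHeight_sub_le he fun v => ?_).trans
      (show (∑ v, C v) * δ ≤ _ by gcongr; linarith)
    refine (abs_log_sub_log_le (φ.wnorm_evalHom_pos hp v) (φ.wnorm_evalHom_pos hp' v)
      (mul_nonneg (hC v) hδ) (h v _ _ r δ hr (hz' v) hδ hδ1 (hzz' v))
      (h v _ _ r δ hr (hz v) hδ hδ1 (hzz v))).trans ?_
    gcongr
    exact Finset.single_le_sum (fun v _ => hC v) (Finset.mem_univ v)
  | some j =>
    refine (h' z z' δ hδ (fun v => ?_) j).trans (show C' * δ ≤ _ by gcongr; linarith)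
    exact abs_log_sub_log_le ((mem_archPunctured_iff w z).mp hp v)
      ((mem_archPunctured_iff w z').mp hp' v) hδ
      (wnorm_le_one_add_mul w hr (hz' v) hδ (hzz v))
      (wnorm_le_one_add_mul w hr (hz v) hδ (hzz' v))

/-- The height bounds the mean of the logarithmic norms from above, and the unit coordinates in `[0,
1)` keep all places close to the mean. The common size `r` has no lower bound: the region reaches
the origin. -/
theorem Morphism.exists_bounds_of_mem_archB_one (φ : Morphism K w u) (he : 0 < φ.e)
    (b : Module.Basis (Fin (Units.rank K)) ℤ (unitLogLattice K)) :
    ∃ R E : ℝ, 0 < R ∧ 1 ≤ E ∧ ∀ z ∈ φ.archB b 1, ∃ r, 0 < r ∧ r ≤ R ∧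
      ∀ v : InfinitePlace K, r ≤ wnorm w (coordAt v z) ∧ wnorm w (coordAt v z) ≤ r * E := by
  obtain ⟨S, hS, hSz⟩ := exists_logNorm_sub_logMean_le w b
  obtain ⟨A, hA, hAz⟩ := φ.exists_logMean_le he
  refine ⟨Real.exp A, Real.exp (2 * S), Real.exp_pos _, Real.one_le_exp (by positivity),
    fun z hz => ?_⟩
  have hz1 := φ.mem_archB_iff he b one_pos z
  rw [one_pow, Real.log_one] at hz1
  obtain ⟨hp, h1, h2⟩ := hz1.mp hz
  refine ⟨Real.exp (logMean w z - S), Real.exp_pos _, ?_, fun v => ?_⟩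
  · rw [Real.exp_le_exp]
    linarith [(abs_le.mp (hAz z hp)).2]
  · have h3 := abs_le.mp (hSz z h2 v)
    rw [← Real.exp_log ((mem_archPunctured_iff w z).mp hp v), ← Real.exp_add, Real.exp_le_exp,
      Real.exp_le_exp]
    constructor
    · linarith [h3.1, show logNorm w v z = Real.log (wnorm w (coordAt v z)) from rfl]
    · linarith [h3.2, show logNorm w v z = Real.log (wnorm w (coordAt v z)) from rfl]

theorem Morphism.archVolume_ne_top (φ : Morphism K w u) (he : 0 < φ.e)
    (b : Module.Basis (Fin (Units.rank K)) ℤ (unitLogLattice K)) : φ.archVolume b ≠ ⊤ := by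
  classical
  obtain ⟨R, E, hR, hE, h⟩ := φ.exists_bounds_of_mem_archB_one he b
  refine ((measure_mono (t := wbox w (R * E)) fun z hz v => ?_).trans_lt
    (volume_wbox_lt_top (K := K) w (R * E))).ne
  obtain ⟨r, hr, hrR, h1⟩ := h z hz
  exact (h1 v).2.trans (by gcongr)

/-- If `z` has size `r < 2ρ`, everything nearby lies in a box of size `O(ρ)`. Otherwise the
displacement is a relative perturbation by `δ = (2ρ/r)^a ≤ 1`; between `z` and `z'` one of the
defining functions crosses its bound, so at `z` and hence at `z''` it is within `O(δ)` of that
bound. The dyadic layers contain these points. -/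
theorem Morphism.exists_boundary_cover_one (φ : Morphism K w u) (he : 0 < φ.e)
    (b : Module.Basis (Fin (Units.rank K)) ℤ (unitLogLattice K)) {a : ℕ}
    (haw : ∀ i, a ≤ w i) (ha : a < Module.finrank ℚ K * totalWeight w) (κ : ℝ) :
    open scoped Classical in ∃ C : ℝ, 0 ≤ C ∧ ∀ ρ : ℝ, 0 < ρ → ρ ≤ κ →
      ∃ U : Set (Fin m → mixedEmbedding.mixedSpace K), MeasurableSet U ∧
      volume U ≤ ENNReal.ofReal (C * ρ ^ a) ∧
      ∀ z ∈ φ.archB b 1, ∀ z' ∉ φ.archB b 1, ∀ z'',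
        (∀ v i, ‖coordAt v z i - coordAt v z' i‖ ≤ ρ ^ (w i : ℕ)) →
        (∀ v i, ‖coordAt v z i - coordAt v z'' i‖ ≤ ρ ^ (w i : ℕ)) → z'' ∈ U := by
  classical
  obtain ⟨R, E, hR, hE, hRE⟩ := φ.exists_bounds_of_mem_archB_one he b
  obtain ⟨D, hD, hpert⟩ := exists_perturbation_le φ he b
  set M := Module.finrank ℚ K * totalWeight w with hM
  set c : ℝ := 2 * D * (4 / R) ^ a with hc
  choose C hC hCv using exists_dyadic_logHeight φ he b ha (R := R * (E + 1)) (c := c)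
    (by positivity) (by positivity)
  let V : ℝ := (volume (wbox (m := m) (K := K) w 1)).toReal
  have hV : volume (wbox (m := m) (K := K) w 1) = ENNReal.ofReal V :=
    (ENNReal.ofReal_toReal (volume_wbox_lt_top w 1).ne).symm
  have hV0 : 0 ≤ V := ENNReal.toReal_nonneg
  let W : ℝ → Set (Fin m → mixedEmbedding.mixedSpace K) := fun ρ =>
    wbox w ((2 * E + 1) * ρ) ∪ ⋃ i : Option (Fin (Units.rank K)), ⋃ θ : Bool,
      ⋃ k : ℕ, {z | z ∈ archPunctured m K ∧ z ∈ wbox (K := K) w (R * (E + 1) * (1 / 2) ^ k) ∧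
        |i.elim φ.logHeight (fun j z => logCoord w b z j) z - (if θ then 1 else 0)| ≤
          c * (ρ * 2 ^ k) ^ a}
  refine ⟨(2 * E + 1) ^ M * |κ| ^ (M - a) * V + ∑ i, 2 * C i, ?_, fun ρ hρ hκ => ?_⟩
  · have : 0 ≤ ∑ i, 2 * C i := Finset.sum_nonneg fun i _ => by linarith [hC i]
    positivity
  -- The measurable hull has the same volume and spares a proof that `W ρ` is measurable. The volume
  -- of its small box is `O(ρ^M)`, which is `O(ρ^a)` because `ρ ≤ κ`.
  refine ⟨toMeasurable volume (W ρ), measurableSet_toMeasurable _ _, ?_, ?_⟩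
  · rw [measure_toMeasurable]
    refine (measure_union_le _ _).trans ?_
    have hs : ∑ i, ENNReal.ofReal (2 * C i * ρ ^ a) =
        ENNReal.ofReal ((∑ i, 2 * C i) * ρ ^ a) := by
      rw [Finset.sum_mul, ENNReal.ofReal_sum_of_nonneg fun i _ => by have := hC i; positivity]
    rw [add_mul (_ * _) (∑ i, 2 * C i), ENNReal.ofReal_add (by positivity)
      (mul_nonneg (Finset.sum_nonneg fun i _ => by linarith [hC i]) (by positivity)), ← hs]
    refine add_le_add ?_ ?_
    · rw [volume_wbox w (by positivity), hV, ← ENNReal.ofReal_mul (by positivity)]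
      refine ENNReal.ofReal_le_ofReal ?_
      have h1 : ρ ^ M = ρ ^ (M - a) * ρ ^ a := by rw [← pow_add]; congr 1; omega
      rw [← hM, mul_pow, h1]
      have h2 : ρ ^ (M - a) ≤ |κ| ^ (M - a) := by gcongr; exact hκ.trans (le_abs_self κ)
      calc (2 * E + 1) ^ M * (ρ ^ (M - a) * ρ ^ a) * V =
          (2 * E + 1) ^ M * V * ρ ^ a * ρ ^ (M - a) := by ring
        _ ≤ (2 * E + 1) ^ M * V * ρ ^ a * |κ| ^ (M - a) := by gcongr
        _ = _ := by ring
    · refine (measure_iUnion_fintype_le _ _).trans (Finset.sum_le_sum fun i _ => ?_)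
      refine (measure_iUnion_fintype_le _ _).trans ?_
      rw [Fintype.sum_bool]
      refine (add_le_add (hCv i ρ _ hρ) (hCv i ρ _ hρ)).trans (le_of_eq ?_)
      rw [← ENNReal.ofReal_add (by have := hC i; positivity) (by have := hC i; positivity)]
      congr 1
      ring
  · intro z hz z' hz' z'' h1 h2
    refine subset_toMeasurable _ _ ?_
    obtain ⟨r, hr, hrR, hrz⟩ := hRE z hz
    have hup : ∀ v : InfinitePlace K, wnorm w (coordAt v z'') ≤ r * E + ρ := fun v =>
      (wnorm_le_add w hρ.le (h2 v)).trans (add_le_add (hrz v).2 le_rfl)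
    rcases lt_or_ge (r / 2) ρ with hcase | hcase
    · left
      intro v
      refine (hup v).trans ?_
      nlinarith
    right
    have hlow : ∀ y : Fin m → mixedEmbedding.mixedSpace K,
        (∀ v i, ‖coordAt v z i - coordAt v y i‖ ≤ ρ ^ (w i : ℕ)) →
        ∀ v : InfinitePlace K, r / 2 ≤ wnorm w (coordAt v y) := by
      intro y hy v
      have h3 := wnorm_le_add w hρ.le (z := coordAt v y) (z' := coordAt v z) fun i => by
        rw [norm_sub_rev]; exact hy v i
      linarith [(hrz v).1]
    -- Here `r / 2` is a lower bound for the size of all points involved. As the ratio is at most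
    -- `1` and `a ≤ w_i`, the exponent `a` serves for all coordinates at once.
    set δ : ℝ := (ρ / (r / 2)) ^ a with hδ
    have hq0 : 0 ≤ ρ / (r / 2) := by positivity
    have hq1 : ρ / (r / 2) ≤ 1 := (div_le_one (by positivity)).mpr hcase
    have hδ0 : 0 ≤ δ := by positivity
    have hδ1 : δ ≤ 1 := pow_le_one₀ hq0 hq1
    have hclose : ∀ i, ρ ^ (w i : ℕ) ≤ δ * (r / 2) ^ (w i : ℕ) := by
      intro i
      have h3 : ρ ^ (w i : ℕ) = (ρ / (r / 2)) ^ (w i : ℕ) * (r / 2) ^ (w i : ℕ) := by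
        rw [← mul_pow, div_mul_cancel₀ _ (by positivity)]
      rw [h3]
      exact mul_le_mul_of_nonneg_right (pow_le_pow_of_le_one hq0 hq1 (haw i)) (by positivity)
    have hdiff : ∀ y : Fin m → mixedEmbedding.mixedSpace K,
        (∀ v i, ‖coordAt v z i - coordAt v y i‖ ≤ ρ ^ (w i : ℕ)) →
        ∀ i : Option (Fin (Units.rank K)), |i.elim φ.logHeight (fun j z => logCoord w b z j) z -
        i.elim φ.logHeight (fun j z => logCoord w b z j) y| ≤ D * δ := fun y hy =>
      hpert z y (r / 2) δ (by positivity) (fun v => by linarith [(hrz v).1]) (hlow y hy) hδ0 hδ1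
        fun v i => (hy v i).trans (hclose i)
    have hd1 := hdiff z' h1
    have hd2 := hdiff z'' h2
    have hBz := φ.mem_archB_iff he b one_pos z
    have hBz' := φ.mem_archB_iff he b one_pos z'
    rw [one_pow, Real.log_one] at hBz hBz'
    have hp : ∀ y : Fin m → mixedEmbedding.mixedSpace K,
        (∀ v i, ‖coordAt v z i - coordAt v y i‖ ≤ ρ ^ (w i : ℕ)) → y ∈ archPunctured m K :=
      fun y hy => (mem_archPunctured_iff w y).mpr fun v => (by positivity : 0 < r / 2).trans_le
        (hlow y hy v)
    -- The flag `θ` selects the bound that is crossed: `false` stands for the value `0`, either the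
    -- height bound `log 1` or a lower face, and `true` for the value `1` of an upper face.
    obtain ⟨i, θ, hiθ⟩ : ∃ (i : Option (Fin (Units.rank K))) (θ : Bool),
        |i.elim φ.logHeight (fun j z => logCoord w b z j) z - (if θ then 1 else 0)| ≤ D * δ := by
      obtain ⟨-, g1, g2⟩ := hBz.mp hz
      by_cases g3 : φ.logHeight z' ≤ 0
      · have g4 : ∃ j, ¬ (0 ≤ logCoord w b z' j ∧ logCoord w b z' j < 1) := by
          by_contra! g5
          exact hz' (hBz'.mpr ⟨hp z' h1, g3, g5⟩)
        obtain ⟨j, hj⟩ := g4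
        have g6 := abs_le.mp (hd1 (some j))
        simp only [Option.elim_some] at g6
        rcases lt_or_ge (logCoord w b z' j) 0 with g7 | g7
        · refine ⟨some j, false, ?_⟩
          simp only [Option.elim_some, Bool.false_eq_true, if_false, sub_zero, abs_le]
          constructor <;> linarith [(g2 j).1]
        · have g8 : 1 ≤ logCoord w b z' j := by
            by_contra! g9
            exact hj ⟨g7, g9⟩
          refine ⟨some j, true, ?_⟩
          simp only [Option.elim_some, if_true, abs_le]
          constructor <;> linarith [(g2 j).2]
      · have g6 := abs_le.mp (hd1 none)
        simp only [Option.elim_none] at g6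
        refine ⟨none, false, ?_⟩
        simp only [Option.elim_none, Bool.false_eq_true, if_false, sub_zero, abs_le]
        constructor <;> linarith
    -- The shell is chosen with `R 2^(-k-1) < r ≤ R 2^(-k)`. Then `2ρ/r ≤ (4/R) ρ 2^k`, which is the
    -- origin of the constant `c`.
    obtain ⟨k, hk1, hk2⟩ := exists_nat_pow_near_of_lt_one (x := r / R) (y := (1 / 2 : ℝ))
      (by positivity) ((div_le_one hR).mpr hrR) (by norm_num) (by norm_num)
    rw [div_le_iff₀ hR] at hk2
    rw [lt_div_iff₀ hR] at hk1
    refine Set.mem_iUnion.mpr ⟨i, Set.mem_iUnion.mpr ⟨θ, Set.mem_iUnion.mpr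
      ⟨k, hp z'' h2, fun v => (hup v).trans ?_, ?_⟩⟩⟩
    · calc r * E + ρ ≤ r * (E + 1) := by linarith
        _ ≤ (1 / 2) ^ k * R * (E + 1) := by gcongr
        _ = _ := by ring
    · have h3 : ρ / (r / 2) ≤ 4 / R * (ρ * 2 ^ k) := by
        have h4 : R ≤ r * (2 * 2 ^ k) := by
          have h5 : ((1 : ℝ) / 2) ^ (k + 1) * (2 * 2 ^ k) = 1 := by
            rw [pow_succ, mul_mul_mul_comm, mul_comm (1 / 2 : ℝ) (2 ^ k), mul_mul_mul_comm,
              ← mul_pow]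
            norm_num
          calc R = (1 / 2) ^ (k + 1) * R * (2 * 2 ^ k) := by rw [mul_right_comm, h5, one_mul]
            _ ≤ _ := by gcongr
        rw [div_le_iff₀ (by positivity), div_mul_eq_mul_div, div_mul_eq_mul_div,
          le_div_iff₀ hR]
        calc ρ * R ≤ ρ * (r * (2 * 2 ^ k)) := by gcongr
          _ = _ := by ring
      have h6 : δ ≤ (4 / R) ^ a * (ρ * 2 ^ k) ^ a := by
        rw [← mul_pow]
        exact pow_le_pow_left₀ hq0 h3 a
      have h7 : |i.elim φ.logHeight (fun j z => logCoord w b z j) z'' - (if θ then 1 else 0)| ≤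
          D * δ + D * δ := by
        refine (abs_sub_le _ (i.elim φ.logHeight (fun j z => logCoord w b z j) z) _).trans
          (add_le_add ?_ hiθ)
        rw [abs_sub_comm]
        exact hd2 i
      refine h7.trans ?_
      rw [hc]
      calc D * δ + D * δ = 2 * D * δ := by ring
        _ ≤ 2 * D * ((4 / R) ^ a * (ρ * 2 ^ k) ^ a) := by gcongr
        _ = _ := by ring

/-- The points near the boundary of the fundamental region are contained in a set of small
volume. -/
theorem Morphism.exists_boundary_cover (φ : Morphism K w u) (he : 0 < φ.e)
    (b : Module.Basis (Fin (Units.rank K)) ℤ (unitLogLattice K)) {a : ℕ}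
    (haw : ∀ i, a ≤ w i) (ha : a < Module.finrank ℚ K * totalWeight w) (κ : ℝ) :
    open scoped Classical in ∃ C : ℝ, 0 ≤ C ∧ ∀ t ρ : ℝ, 0 < t → 0 < ρ → ρ ≤ κ * t →
      ∃ U : Set (Fin m → mixedEmbedding.mixedSpace K), MeasurableSet U ∧
      volume U ≤ ENNReal.ofReal (C * ρ ^ a * t ^ (Module.finrank ℚ K * totalWeight w - a)) ∧
      ∀ z ∈ φ.archB b (t ^ (φ.e * Module.finrank ℚ K)),
        ∀ z' ∉ φ.archB b (t ^ (φ.e * Module.finrank ℚ K)), ∀ z'',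
        (∀ v i, ‖coordAt v z i - coordAt v z' i‖ ≤ ρ ^ (w i : ℕ)) →
        (∀ v i, ‖coordAt v z i - coordAt v z'' i‖ ≤ ρ ^ (w i : ℕ)) → z'' ∈ U := by
  classical
  obtain ⟨C, hC, h⟩ := φ.exists_boundary_cover_one he b haw ha κ
  set M := Module.finrank ℚ K * totalWeight w with hM
  refine ⟨C, hC, fun t ρ ht hρ hρt => ?_⟩
  obtain ⟨U, hUm, hUv, hU⟩ := h (ρ / t) (by positivity) ((div_le_iff₀ ht).mpr hρt)
  -- Weighted dilation by `1/t` brings the region to parameter `1` and divides the weighted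
  -- displacement `ρ` by `t`.
  refine ⟨flow w (fun _ => t⁻¹) ⁻¹' U, measurable_flow w _ hUm, ?_, ?_⟩
  · rw [volume_preimage_flow _ _ (fun _ => by positivity), prod_const_pow_mult, inv_pow, inv_pow,
      inv_inv, ← pow_mul, ← hM]
    refine (mul_le_mul_right hUv _).trans ?_
    rw [← ENNReal.ofReal_mul (by positivity)]
    refine ENNReal.ofReal_le_ofReal (le_of_eq ?_)
    have h1 : t ^ M = t ^ (M - a) * t ^ a := by rw [← pow_add]; congr 1; omega
    rw [h1, div_pow]
    field_simp
  · have hcl : ∀ z z' : Fin m → mixedEmbedding.mixedSpace K,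
        (∀ v i, ‖coordAt v z i - coordAt v z' i‖ ≤ ρ ^ (w i : ℕ)) →
        ∀ v i, ‖coordAt v (flow w (fun _ => t⁻¹) z) i - coordAt v (flow w (fun _ => t⁻¹) z') i‖ ≤
          (ρ / t) ^ (w i : ℕ) := by
      intro z z' hz v i
      rw [coordAt_flow, coordAt_flow, ← mul_sub, norm_mul, norm_pow, Complex.norm_real, norm_inv,
        Real.norm_of_nonneg ht.le, div_pow, div_eq_inv_mul, inv_pow]
      exact mul_le_mul_of_nonneg_left (hz v i) (by positivity)
    have hmem : ∀ z, z ∈ φ.archB b (t ^ (φ.e * Module.finrank ℚ K)) ↔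
        flow w (fun _ => t⁻¹) z ∈ φ.archB b 1 := fun z =>
      φ.mem_archB_iff_flow he b ht z
    intro z hz z' hz' z'' h1 h2
    exact hU _ ((hmem z).mp hz) _ (fun h => hz' ((hmem z').mpr h)) _ (hcl z z' h1) (hcl z z'' h2)

end Region

/-! ### Fractional ideals through their exponents -/

section Counts

open FractionalIdeal WithZero

variable {K : Type*} [Field K] [NumberField K]

theorem valuation_eq_exp_neg_count (p : HeightOneSpectrum (𝓞 K)) {x : K} (hx : x ≠ 0) :
    p.valuation K x = exp (-count K p (spanSingleton (𝓞 K)⁰ x)) := by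
  obtain ⟨n, d, hd, rfl⟩ := IsFractionRing.div_surjective (A := 𝓞 K) x
  have hd0 : d ≠ 0 := nonZeroDivisors.ne_zero hd
  have hn0 : n ≠ 0 := by rintro rfl; simp at hx
  have h1 : spanSingleton (𝓞 K)⁰ (algebraMap (𝓞 K) K n / algebraMap (𝓞 K) K d) =
      spanSingleton (𝓞 K)⁰ (algebraMap (𝓞 K) K d)⁻¹ * ((Ideal.span {n} : Ideal (𝓞 K)) : _) := by
    rw [coeIdeal_span_singleton, spanSingleton_mul_spanSingleton, div_eq_inv_mul]
  rw [count_well_defined K p (by rwa [Ne, spanSingleton_eq_zero_iff]) h1, map_div₀,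
    HeightOneSpectrum.valuation_of_algebraMap, HeightOneSpectrum.valuation_of_algebraMap,
    p.intValuation_if_neg hn0, p.intValuation_if_neg hd0, ← exp_sub]
  congr 1
  ring

theorem le_one_of_count_nonneg {I : FractionalIdeal (𝓞 K)⁰ K}
    (h : ∀ p : HeightOneSpectrum (𝓞 K), 0 ≤ count K p I) : I ≤ 1 := by
  by_cases hI : I = 0
  · rw [hI]; exact zero_le _
  rw [← finprod_heightOneSpectrum_factorization' K hI]
  refine finprod_induction (· ≤ 1) le_rfl (fun _ _ => mul_le_one') fun p => ?_
  lift count K p I to ℕ using h p with n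
  rw [zpow_natCast]
  exact pow_le_one' coeIdeal_le_one n

theorem le_iff_count_le {I J : FractionalIdeal (𝓞 K)⁰ K} (hI : I ≠ 0) (hJ : J ≠ 0) :
    I ≤ J ↔ ∀ p : HeightOneSpectrum (𝓞 K), count K p J ≤ count K p I := by
  refine ⟨fun h p => count_mono K p hI h, fun h => ?_⟩
  have h1 : I * J⁻¹ ≤ 1 := le_one_of_count_nonneg fun p => by
    rw [count_mul K p hI (inv_ne_zero hJ), count_inv]
    linarith [h p]
  have := mul_le_mul_left h1 J
  rwa [mul_assoc, inv_mul_cancel₀ hJ, mul_one, one_mul] at this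

theorem eq_iff_count_eq {I J : FractionalIdeal (𝓞 K)⁰ K} (hI : I ≠ 0) (hJ : J ≠ 0) :
    I = J ↔ ∀ p : HeightOneSpectrum (𝓞 K), count K p I = count K p J := by
  refine ⟨fun h p => by rw [h], fun h => le_antisymm ?_ ?_⟩
  · exact (le_iff_count_le hI hJ).mpr fun p => (h p).ge
  · exact (le_iff_count_le hJ hI).mpr fun p => (h p).le

theorem mem_iff_valuation_le {I : FractionalIdeal (𝓞 K)⁰ K} (hI : I ≠ 0) (x : K) :
    x ∈ I ↔ ∀ p : HeightOneSpectrum (𝓞 K), p.valuation K x ≤ exp (-count K p I) := by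
  by_cases hx : x = 0
  · simp [hx, FractionalIdeal.zero_mem]
  rw [← spanSingleton_le_iff_mem, le_iff_count_le (by rwa [Ne, spanSingleton_eq_zero_iff]) hI]
  refine forall_congr' fun p => ?_
  rw [valuation_eq_exp_neg_count p hx, exp_le_exp, neg_le_neg_iff]

theorem eventually_valuation_eq_one {x : K} (hx : x ≠ 0) :
    ∀ᶠ p : HeightOneSpectrum (𝓞 K) in cofinite, p.valuation K x = 1 := by
  filter_upwards [finite_factors (spanSingleton (𝓞 K)⁰ x)] with p hp
  rw [valuation_eq_exp_neg_count p hx, hp, neg_zero, exp_zero]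

theorem eventually_valuation_le_one (x : K) :
    ∀ᶠ p : HeightOneSpectrum (𝓞 K) in cofinite, p.valuation K x ≤ 1 := by
  by_cases hx : x = 0
  · simp [hx]
  · exact (eventually_valuation_eq_one hx).mono fun _ h => h.le

end Counts

/-! ### Local exponents and scaling ideals -/

section LocalExponent

open FractionalIdeal WithZero

variable {m : ℕ} {K : Type*} [Field K] [NumberField K]

theorem valued_le_exp_iff (p : HeightOneSpectrum (𝓞 K)) {x : p.adicCompletion K} (hx : x ≠ 0)
    (n : ℤ) : Valued.v x ≤ exp (-n) ↔ n ≤ localOrd p x := by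
  have h : (Valued.v x : WithZero (Multiplicative ℤ)) ≠ 0 := (Valuation.ne_zero_iff _).mpr hx
  rw [localOrd, ← log_le_iff_le_exp h, le_neg]

/-- The floor disappears in the equivalence `k ≤ ⌊n/w⌋ ↔ w k ≤ n`, and zero coordinates impose no
condition. Equalities of exponents are then proved by comparing all `k` below them. -/
theorem le_localExponent_iff (w : Fin m → ℕ+) (p : HeightOneSpectrum (𝓞 K))
    (x : Punctured m (p.adicCompletion K)) (k : ℤ) :
    k ≤ localExponent w p x ↔ ∀ i, Valued.v (x.1 i) ≤ exp (-((w i : ℕ) * k)) := by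
  obtain ⟨i₀, hi₀⟩ := Function.ne_iff.mp x.2
  have : Nonempty {i // x.1 i ≠ 0} := ⟨⟨i₀, hi₀⟩⟩
  rw [localExponent, le_ciInf_iff (Set.finite_range _).bddBelow]
  have hw : ∀ i, (0 : ℤ) < (w i : ℕ) := fun i => by exact_mod_cast (w i).pos
  constructor
  · intro h i
    by_cases hi : x.1 i = 0
    · simp [hi]
    · have := h ⟨i, hi⟩
      rw [Int.le_ediv_iff_mul_le (hw i)] at this
      rw [valued_le_exp_iff p hi, mul_comm]
      exact this
  · rintro h ⟨i, hi⟩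
    rw [Int.le_ediv_iff_mul_le (hw i), mul_comm]
    exact (valued_le_exp_iff p hi _).mp (h i)

theorem valued_toLocal (p : HeightOneSpectrum (𝓞 K)) (x : Fin m → K) (i : Fin m) :
    Valued.v (toLocal m p x i) = p.valuation K (x i) :=
  HeightOneSpectrum.valuedAdicCompletion_eq_valuation' p (x i)

theorem toLocal_ne_zero (p : HeightOneSpectrum (𝓞 K)) {x : Fin m → K} (hx : x ≠ 0) :
    toLocal m p x ≠ 0 := by
  obtain ⟨i, hi⟩ := Function.ne_iff.mp hx
  intro h
  have := congrFun h i
  exact hi ((map_eq_zero (algebraMap K (p.adicCompletion K))).mp this)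

/-- The image of a nonzero vector in the completion at `p`. -/
def localize (p : HeightOneSpectrum (𝓞 K)) (x : Punctured m K) :
    Punctured m (p.adicCompletion K) := ⟨toLocal m p x.1, toLocal_ne_zero p x.2⟩

theorem le_localExponent_localize_iff (w : Fin m → ℕ+) (p : HeightOneSpectrum (𝓞 K))
    (x : Punctured m K) (k : ℤ) : k ≤ localExponent w p (localize p x) ↔
      ∀ i, p.valuation K (x.1 i) ≤ exp (-((w i : ℕ) * k)) := by
  rw [le_localExponent_iff]
  exact forall_congr' fun i => by rw [← valued_toLocal]; rfl

theorem eventually_localExponent_eq_zero (w : Fin m → ℕ+) (x : Punctured m K) :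
    ∀ᶠ p : HeightOneSpectrum (𝓞 K) in cofinite, localExponent w p (localize p x) = 0 := by
  obtain ⟨i₀, hi₀⟩ := Function.ne_iff.mp x.2
  have h1 : ∀ᶠ p : HeightOneSpectrum (𝓞 K) in cofinite, ∀ i, p.valuation K (x.1 i) ≤ 1 :=
    eventually_all.mpr fun i => eventually_valuation_le_one _
  filter_upwards [h1, eventually_valuation_eq_one hi₀] with p hp hp0
  refine le_antisymm ?_ ?_
  · have h2 := (le_localExponent_localize_iff w p x _).mp le_rfl i₀
    rw [hp0, ← exp_zero, exp_le_exp, Left.nonneg_neg_iff] at h2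
    exact nonpos_of_mul_nonpos_right h2 (by exact_mod_cast (w i₀).pos)
  · rw [le_localExponent_localize_iff]
    simpa using hp

/-- Integrality of the `a ^ w_i x_i` can be tested prime by prime, and at `p` it says that `ord a`
is at least minus the local exponent. So the inverse of the scaling ideal is the inverse of the
product `E` of the local powers. -/
theorem count_scalingIdeal_aux (w : Fin m → ℕ+) (x : Punctured m K) :
    scalingIdeal w x ≠ 0 ∧
      ∀ p, count K p (scalingIdeal w x) = localExponent w p (localize p x) := by
  set E : FractionalIdeal (𝓞 K)⁰ K := ∏ᶠ p : HeightOneSpectrum (𝓞 K),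
    (p.asIdeal : FractionalIdeal (𝓞 K)⁰ K) ^ localExponent w p (localize p x)
  have hE0 : E ≠ 0 := finprod_induction (· ≠ 0) one_ne_zero (fun _ _ => mul_ne_zero) fun p =>
    zpow_ne_zero _ (coeIdeal_ne_zero.mpr p.ne_bot)
  have hE : ∀ p, count K p E = localExponent w p (localize p x) := fun p =>
    count_finprod K p _ (eventually_localExponent_eq_zero w x)
  have h : scalingInverse w x = E⁻¹ := by
    ext a
    rw [mem_iff_valuation_le (inv_ne_zero hE0)]
    change (∀ i, IsIntegral ℤ (a ^ (w i : ℕ) * x.1 i)) ↔ _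
    by_cases ha : a = 0
    · simp only [ha, map_zero, _root_.zero_le, implies_true, iff_true]
      intro i
      rw [zero_pow (w i).ne_zero, zero_mul]
      exact isIntegral_zero
    have h1 : ∀ i, IsIntegral ℤ (a ^ (w i : ℕ) * x.1 i) ↔
        ∀ p : HeightOneSpectrum (𝓞 K), p.valuation K (a ^ (w i : ℕ) * x.1 i) ≤ 1 := by
      intro i
      constructor
      · intro hi p
        exact p.valuation_le_one (⟨_, hi⟩ : 𝓞 K)
      · intro hi
        obtain ⟨y, hy⟩ := HeightOneSpectrum.mem_integers_of_valuation_le_one K _ hi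
        rw [← hy]
        exact y.2
    simp only [h1]
    rw [forall_comm]
    refine forall_congr' fun p => ?_
    rw [count_inv, hE, valuation_eq_exp_neg_count p ha, exp_le_exp, neg_neg,
      le_localExponent_localize_iff]
    refine forall_congr' fun i => ?_
    have h2 : (1 : WithZero (Multiplicative ℤ)) =
        exp ((w i : ℕ) * -count K p (spanSingleton (𝓞 K)⁰ a)) *
          exp (-((w i : ℕ) * -count K p (spanSingleton (𝓞 K)⁰ a))) := by
      rw [← exp_add, add_neg_cancel, exp_zero]
    rw [map_mul, map_pow, valuation_eq_exp_neg_count p ha, ← exp_nsmul, nsmul_eq_mul, h2,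
      mul_le_mul_iff_right₀ exp_pos]
  rw [scalingIdeal, h, inv_inv]
  exact ⟨hE0, hE⟩

theorem scalingIdeal_ne_zero (w : Fin m → ℕ+) (x : Punctured m K) : scalingIdeal w x ≠ 0 :=
  (count_scalingIdeal_aux w x).1

theorem count_scalingIdeal (w : Fin m → ℕ+) (x : Punctured m K) (p : HeightOneSpectrum (𝓞 K)) :
    count K p (scalingIdeal w x) = localExponent w p (localize p x) :=
  (count_scalingIdeal_aux w x).2 p

theorem scalingIdeal_eq_iff (w : Fin m → ℕ+) (x : Punctured m K) {I : FractionalIdeal (𝓞 K)⁰ K}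
    (hI : I ≠ 0) : scalingIdeal w x = I ↔ ∀ p, toLocal m p x.1 ∈ localPrimitive w I p := by
  rw [eq_iff_count_eq (scalingIdeal_ne_zero w x) hI]
  refine forall_congr' fun p => ?_
  rw [count_scalingIdeal]
  exact ⟨fun h => ⟨toLocal_ne_zero p x.2, h⟩, fun ⟨_, h⟩ => h⟩

theorem mem_idealLattice_iff (w : Fin m → ℕ+) {I : FractionalIdeal (𝓞 K)⁰ K} (hI : I ≠ 0)
    (x : Fin m → K) : x ∈ idealLattice w I ↔ ∀ p, toLocal m p x ∈ localIdealLattice w I p := by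
  have h1 : x ∈ idealLattice w I ↔ ∀ i, x i ∈ I ^ (w i : ℕ) := by
    simp only [idealLattice, AddSubgroup.mem_pi, Set.mem_univ, forall_const]
    rfl
  rw [h1]
  simp only [mem_iff_valuation_le (pow_ne_zero _ hI), count_pow]
  rw [forall_comm]
  refine forall_congr' fun p => forall_congr' fun i => ?_
  rw [valued_toLocal]

theorem mem_localIdealLattice_iff (w : Fin m → ℕ+) (I : FractionalIdeal (𝓞 K)⁰ K)
    (p : HeightOneSpectrum (𝓞 K)) (x : Punctured m (p.adicCompletion K)) :
    x.1 ∈ localIdealLattice w I p ↔ count K p I ≤ localExponent w p x :=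
  (le_localExponent_iff w p x _).symm

/-- Membership in an ideal lattice is thus divisibility of the scaling ideal, the form needed for
Möbius inversion. -/
theorem mem_idealLattice_iff_scalingIdeal_le (w : Fin m → ℕ+) {I : FractionalIdeal (𝓞 K)⁰ K}
    (hI : I ≠ 0) (x : Punctured m K) : x.1 ∈ idealLattice w I ↔ scalingIdeal w x ≤ I := by
  rw [mem_idealLattice_iff w hI, le_iff_count_le (scalingIdeal_ne_zero w x) hI]
  refine forall_congr' fun p => ?_
  rw [count_scalingIdeal]
  exact mem_localIdealLattice_iff w I p (localize p x)

theorem localPrimitive_subset (w : Fin m → ℕ+) (I : FractionalIdeal (𝓞 K)⁰ K)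
    (p : HeightOneSpectrum (𝓞 K)) : localPrimitive w I p ⊆ localIdealLattice w I p :=
  fun x ⟨hx, h⟩ => (mem_localIdealLattice_iff w I p ⟨x, hx⟩).mpr h.ge

theorem localExponent_act (w : Fin m → ℕ+) (p : HeightOneSpectrum (𝓞 K))
    (c : (p.adicCompletion K)ˣ) (x : Punctured m (p.adicCompletion K)) :
    localExponent w p (act w c x) = localOrd p (c : p.adicCompletion K) + localExponent w p x := by
  have h0 : (Valued.v (c : p.adicCompletion K) : WithZero (Multiplicative ℤ)) ≠ 0 :=
    (Valuation.ne_zero_iff _).mpr c.ne_zero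
  have hc : Valued.v (c : p.adicCompletion K) = exp (-localOrd p (c : p.adicCompletion K)) := by
    rw [localOrd, neg_neg, exp_log h0]
  have key : ∀ k, k ≤ localExponent w p (act w c x) ↔
      k - localOrd p (c : p.adicCompletion K) ≤ localExponent w p x := by
    intro k
    rw [le_localExponent_iff, le_localExponent_iff]
    refine forall_congr' fun i => ?_
    change Valued.v ((c : p.adicCompletion K) ^ (w i : ℕ) * x.1 i) ≤ _ ↔ _
    rw [map_mul, map_pow, hc, ← exp_nsmul, nsmul_eq_mul]
    have h1 : exp (-((w i : ℕ) * k : ℤ)) = exp ((w i : ℕ) * -localOrd p (c : p.adicCompletion K)) *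
        exp (-((w i : ℕ) * (k - localOrd p (c : p.adicCompletion K)) : ℤ)) := by
      rw [← exp_add]
      congr 1
      ring
    rw [h1, mul_le_mul_iff_right₀ (by simp)]
  refine le_antisymm ?_ ?_
  · have := (key _).mp le_rfl
    linarith
  · rw [key]
    linarith

theorem Morphism.localDiscrepancy_act {w u : Fin m → ℕ+} (φ : Morphism K w u)
    (p : HeightOneSpectrum (𝓞 K)) (c : (p.adicCompletion K)ˣ)
    (x : Punctured m (p.adicCompletion K)) :
    φ.localDiscrepancy p (act w c x) = φ.localDiscrepancy p x := by
  have h : φ.eval (act w c x) = act u (c ^ φ.e) (φ.eval x) := by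
    refine Subtype.ext (funext fun i => ?_)
    exact congrFun (φ.evalHom_act (algebraMap K (p.adicCompletion K)) (c : p.adicCompletion K) x.1) i
  have h1 : localOrd p ((c ^ φ.e : (p.adicCompletion K)ˣ) : p.adicCompletion K) =
      φ.e * localOrd p (c : p.adicCompletion K) := by
    rw [localOrd, localOrd, Units.val_pow_eq_pow_val, map_pow, log_pow, nsmul_eq_mul]
    ring
  rw [localDiscrepancy, localDiscrepancy, h, localExponent_act, localExponent_act, h1]
  ring

theorem Morphism.eval_localize {w u : Fin m → ℕ+} (φ : Morphism K w u)
    (p : HeightOneSpectrum (𝓞 K)) (x : Punctured m K) :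
    φ.eval (localize p x) = localize p (φ.eval x) := by
  refine Subtype.ext (funext fun i => ?_)
  change MvPolynomial.aeval (toLocal m p x.1) (φ.f i) =
    algebraMap K (p.adicCompletion K) (MvPolynomial.aeval x.1 (φ.f i))
  rw [MvPolynomial.aeval_def, MvPolynomial.aeval_def, MvPolynomial.eval₂_comp_left]
  rfl

/-- The discrepancy ideal of a nonzero vector. -/
def Morphism.vecDiscrepancy {w u : Fin m → ℕ+} (φ : Morphism K w u) (x : Punctured m K) :
    FractionalIdeal (𝓞 K)⁰ K := scalingIdeal u (φ.eval x) * (scalingIdeal w x ^ φ.e)⁻¹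

theorem Morphism.vecDiscrepancy_ne_zero {w u : Fin m → ℕ+} (φ : Morphism K w u)
    (x : Punctured m K) : φ.vecDiscrepancy x ≠ 0 :=
  mul_ne_zero (scalingIdeal_ne_zero _ _) (inv_ne_zero (pow_ne_zero _ (scalingIdeal_ne_zero _ _)))

theorem Morphism.mem_discrepancyIdeals_iff {w u : Fin m → ℕ+} (φ : Morphism K w u)
    (𝔡 : FractionalIdeal (𝓞 K)⁰ K) : 𝔡 ∈ φ.discrepancyIdeals ↔ ∃ x, φ.vecDiscrepancy x = 𝔡 := by
  constructor
  · rintro ⟨⟨x⟩, rfl⟩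
    exact ⟨x, rfl⟩
  · rintro ⟨x, rfl⟩
    exact ⟨Quotient.mk (orbitSetoid w K) x, rfl⟩

theorem Morphism.count_vecDiscrepancy {w u : Fin m → ℕ+} (φ : Morphism K w u)
    (x : Punctured m K) (p : HeightOneSpectrum (𝓞 K)) :
    FractionalIdeal.count K p (φ.vecDiscrepancy x) = φ.localDiscrepancy p (localize p x) := by
  rw [vecDiscrepancy, FractionalIdeal.count_mul K p (scalingIdeal_ne_zero _ _)
    (inv_ne_zero (pow_ne_zero _ (scalingIdeal_ne_zero _ _))), FractionalIdeal.count_inv,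
    FractionalIdeal.count_pow,
    count_scalingIdeal, count_scalingIdeal, localDiscrepancy, φ.eval_localize]
  ring

end LocalExponent

/-! ### Weighted norms at the finite primes -/

section LocalNorm

open FractionalIdeal WithZero NumberField.HeightOneSpectrum

variable {m : ℕ} {K : Type*} [Field K] [NumberField K] (p : HeightOneSpectrum (𝓞 K))

theorem toNNReal_exp (n : ℤ) :
    ((WithZeroMulInt.toNNReal (absNorm_ne_zero p) (exp n) : NNReal) : ℝ) =
      (Ideal.absNorm p.asIdeal : ℝ) ^ n := by
  rw [WithZeroMulInt.toNNReal_neg_apply _ exp_ne_zero, NNReal.coe_zpow]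
  rfl

theorem norm_le_zpow_iff (x : p.adicCompletion K) (n : ℤ) :
    ‖x‖ ≤ (Ideal.absNorm p.asIdeal : ℝ) ^ n ↔ Valued.v x ≤ exp n := by
  rw [FinitePlace.norm_def, ← toNNReal_exp, NNReal.coe_le_coe,
    (WithZeroMulInt.toNNReal_strictMono (one_lt_absNorm_nnreal p)).le_iff_le]

theorem norm_eq_zpow {x : p.adicCompletion K} (hx : x ≠ 0) :
    ‖x‖ = (Ideal.absNorm p.asIdeal : ℝ) ^ (-localOrd p x) := by
  rw [FinitePlace.norm_def, ← toNNReal_exp, localOrd, neg_neg,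
    exp_log ((Valuation.ne_zero_iff _).mpr hx)]

theorem one_lt_absNorm_real : (1 : ℝ) < Ideal.absNorm p.asIdeal := by
  exact_mod_cast one_lt_absNorm p

/-- The local exponent is the integral part of minus the logarithm of the weighted norm to base
`N(p)`. This makes the norm bounds for `φ` available at finite primes. -/
theorem le_localExponent_iff_wnorm_le (w : Fin m → ℕ+) (x : Punctured m (p.adicCompletion K))
    (k : ℤ) : k ≤ localExponent w p x ↔ wnorm w x.1 ≤ (Ideal.absNorm p.asIdeal : ℝ) ^ (-k) := by
  have hq : (0 : ℝ) < Ideal.absNorm p.asIdeal := one_pos.trans (one_lt_absNorm_real p)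
  rw [le_localExponent_iff, wnorm_le_iff _ _ (zpow_nonneg hq.le _)]
  refine forall_congr' fun i => ?_
  rw [← norm_le_zpow_iff, ← zpow_natCast, ← zpow_mul]
  congr! 2
  ring

/-- A summand whose exponent is strictly larger does not change the exponent: adding or removing it
preserves every bound up to one level above that of `x`. -/
theorem localExponent_add (w : Fin m → ℕ+) (x : Punctured m (p.adicCompletion K))
    {y : Fin m → p.adicCompletion K}
    (hy : ∀ i, Valued.v (y i) ≤ exp (-((w i : ℕ) * (localExponent w p x + 1)))) :
    ∃ h : x.1 + y ≠ 0, localExponent w p ⟨x.1 + y, h⟩ = localExponent w p x := by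
  have hneg : ∀ {n k : ℤ} (i : Fin m), k ≤ n → exp (-((w i : ℕ) * n)) ≤ exp (-((w i : ℕ) * k)) := by
    intro n k i h
    rw [exp_le_exp, neg_le_neg_iff]
    exact mul_le_mul_of_nonneg_left h (Nat.cast_nonneg _)
  have key : ∀ k ≤ localExponent w p x + 1, ((∀ i, Valued.v (x.1 i + y i) ≤ exp (-((w i : ℕ) * k))) ↔
      k ≤ localExponent w p x) := by
    intro k hk
    rw [le_localExponent_iff]
    refine forall_congr' fun i => ⟨fun h => ?_, fun h => ?_⟩
    · have := Valuation.map_sub_le (v := Valued.v) h ((hy i).trans (hneg i hk))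
      rwa [add_sub_cancel_right] at this
    · exact Valuation.map_add_le _ h ((hy i).trans (hneg i hk))
  have hne : x.1 + y ≠ 0 := by
    intro h
    have h1 := (key _ le_rfl).mp fun i => by
      rw [show x.1 i + y i = 0 from congrFun h i, map_zero]
      exact _root_.zero_le
    linarith
  refine ⟨hne, le_antisymm ?_ ?_⟩
  · by_contra! h
    have h1 := (le_localExponent_iff w p ⟨x.1 + y, hne⟩ _).mp (Int.add_one_le_iff.mpr h)
    linarith [(key _ le_rfl).mp h1]
  · rw [le_localExponent_iff]
    exact (key _ (by linarith)).mpr le_rfl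

end LocalNorm

/-! ### Finiteness and local constancy of the discrepancy -/

section LocalDiscrepancy

open FractionalIdeal WithZero NumberField.HeightOneSpectrum

variable {m : ℕ} [NeZero m] {K : Type*} [Field K] [NumberField K] {w u : Fin m → ℕ+}
  (φ : Morphism K w u)

/-- This is where `e = 1` or `w = (1,…,1)` is needed. Exponents are integral parts, and
multiplication by `e` commutes with the integral part of a number if `e = 1` or if the number is an
integer, as it is for trivial weights. -/
theorem localExponent_eq_of_wnorm_pow {p : HeightOneSpectrum (𝓞 K)} {e : ℕ}
    (hφ : e = 1 ∨ ∀ i, w i = 1) {x y : Punctured m (p.adicCompletion K)}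
    (h : wnorm u y.1 = wnorm w x.1 ^ e) : localExponent u p y = e * localExponent w p x := by
  have hq := one_lt_absNorm_real p
  have hq0 : (0 : ℝ) < Ideal.absNorm p.asIdeal := one_pos.trans hq
  have key : ∀ k, k ≤ localExponent u p y ↔ k ≤ e * localExponent w p x := by
    intro k
    rw [le_localExponent_iff_wnorm_le, h]
    rcases hφ with rfl | hw
    · rw [pow_one, Nat.cast_one, one_mul, le_localExponent_iff_wnorm_le]
    · obtain ⟨i, hi⟩ := exists_norm_eq_wnorm_pow w x.1
      rw [hw i, PNat.one_coe, pow_one] at hi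
      have hxi : x.1 i ≠ 0 := norm_pos_iff.mp (hi ▸ (wnorm_pos_iff w x.1).mpr x.2)
      rw [norm_eq_zpow p hxi] at hi
      have h2 : ∀ k, k ≤ localExponent w p x ↔ k ≤ localOrd p (x.1 i) := fun k => by
        rw [le_localExponent_iff_wnorm_le, ← hi, zpow_le_zpow_iff_right₀ hq, neg_le_neg_iff]
      have h1 : localExponent w p x = localOrd p (x.1 i) :=
        le_antisymm ((h2 _).mp le_rfl) ((h2 _).mpr le_rfl)
      rw [h1, ← hi, ← zpow_natCast, ← zpow_mul, zpow_le_zpow_iff_right₀ hq]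
      constructor <;> intro h <;> linarith
  exact le_antisymm ((key _).mp le_rfl) ((key _).mpr le_rfl)

theorem wnorm_lt_zpow (w : Fin m → ℕ+) (p : HeightOneSpectrum (𝓞 K))
    (x : Punctured m (p.adicCompletion K)) :
    (Ideal.absNorm p.asIdeal : ℝ) ^ (-(localExponent w p x + 1)) < wnorm w x.1 := by
  rw [← not_le, ← le_localExponent_iff_wnorm_le]
  linarith

/-- The local discrepancy is bounded at every prime. -/
theorem Morphism.exists_localDiscrepancy_bound (p : HeightOneSpectrum (𝓞 K)) :
    ∃ B : ℕ, ∀ x, |φ.localDiscrepancy p x| ≤ B := by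
  obtain ⟨A, hA, h⟩ := φ.exists_wnorm_evalHom_bounds (algebraMap K (p.adicCompletion K))
  have hq := one_lt_absNorm_real p
  have hq0 : (0 : ℝ) < Ideal.absNorm p.asIdeal := one_pos.trans hq
  obtain ⟨n, hn⟩ := pow_unbounded_of_one_lt A hq
  -- The part `n` bounds the constant `A` by `N(p)^n`; the part `e` is lost by rounding the exponent
  -- of `x` down before multiplying by `e`.
  refine ⟨n + φ.e, fun x => ?_⟩
  obtain ⟨h1, h2⟩ := h x.1 x.2
  have hA0 : 0 < A := one_pos.trans_le hA
  have e1 : φ.evalHom (algebraMap K (p.adicCompletion K)) x.1 = (φ.eval x).1 := rfl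
  rw [e1] at h1 h2
  have g1 := (le_localExponent_iff_wnorm_le p w x _).mp le_rfl
  have g2 := (le_localExponent_iff_wnorm_le p u (φ.eval x) _).mp le_rfl
  have g3 := wnorm_lt_zpow w p x
  have g4 := wnorm_lt_zpow u p (φ.eval x)
  set a := localExponent w p x
  set c := localExponent u p (φ.eval x)
  have k1 : (Ideal.absNorm p.asIdeal : ℝ) ^ (-(c + 1)) <
      (Ideal.absNorm p.asIdeal : ℝ) ^ ((n : ℤ) + φ.e * (-a)) := by
    refine (g4.trans_le h1).trans_le ?_
    rw [zpow_add₀ hq0.ne', zpow_natCast, mul_comm (φ.e : ℤ), zpow_mul, zpow_natCast]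
    exact mul_le_mul hn.le (pow_le_pow_left₀ (wnorm_nonneg _ _) g1 _)
      (pow_nonneg (wnorm_nonneg _ _) _) (by positivity)
  have k2 : (Ideal.absNorm p.asIdeal : ℝ) ^ (φ.e * (-(a + 1))) <
      (Ideal.absNorm p.asIdeal : ℝ) ^ ((n : ℤ) + -c) := by
    have k3 : (Ideal.absNorm p.asIdeal : ℝ) ^ (φ.e * (-(a + 1))) ≤ wnorm w x.1 ^ φ.e := by
      rw [mul_comm, zpow_mul, zpow_natCast]
      exact pow_le_pow_left₀ (by positivity) g3.le _
    refine k3.trans_lt (h2.trans_lt ?_)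
    rw [zpow_add₀ hq0.ne', zpow_natCast]
    exact mul_lt_mul hn g2 ((wnorm_pos_iff u _).mpr (φ.eval x).2) (by positivity)
  rw [zpow_lt_zpow_iff_right₀ hq] at k1 k2
  have : φ.localDiscrepancy p x = c - φ.e * a := rfl
  rw [this, abs_le]
  push_cast
  have he : (0 : ℤ) ≤ φ.e := Nat.cast_nonneg _
  constructor <;> linarith

/-- The local discrepancy vanishes at almost all primes. -/
theorem Morphism.eventually_localDiscrepancy_eq_zero (hφ : φ.e = 1 ∨ ∀ i, w i = 1) :
    ∀ᶠ p : HeightOneSpectrum (𝓞 K) in cofinite, ∀ x, φ.localDiscrepancy p x = 0 := by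
  choose n g hsum hg using φ.exists_homogeneous_relation
  have hc : ∀ P : MvPolynomial (Fin m) K, ∀ᶠ p : HeightOneSpectrum (𝓞 K) in cofinite,
      ∀ s, ‖algebraMap K (p.adicCompletion K) (P.coeff s)‖ ≤ 1 := by
    intro P
    have h1 : ∀ᶠ p : HeightOneSpectrum (𝓞 K) in cofinite,
        ∀ s ∈ P.support, p.valuation K (P.coeff s) ≤ 1 :=
      (eventually_all_finset _).mpr fun s _ => eventually_valuation_le_one _
    filter_upwards [h1] with p hp s
    by_cases hs : s ∈ P.support
    · rw [← zpow_zero (Ideal.absNorm p.asIdeal : ℝ), norm_le_zpow_iff, exp_zero]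
      exact (HeightOneSpectrum.valuedAdicCompletion_eq_valuation' p _).trans_le (hp s hs)
    · rw [MvPolynomial.notMem_support_iff.mp hs, map_zero, norm_zero]
      exact zero_le_one
  filter_upwards [eventually_all.mpr fun i => hc (φ.f i),
    eventually_all.mpr fun j => eventually_all.mpr fun i => hc (g j i)] with p hf hg' x
  have h1 := φ.wnorm_evalHom_of_integral (algebraMap K (p.adicCompletion K)) hsum hg hf hg' x.1 x.2
  rw [localDiscrepancy, localExponent_eq_of_wnorm_pow hφ (y := φ.eval x) h1, sub_self]

/-- A discrepancy ideal is determined by its exponents at the finitely many primes where the local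
discrepancy is not identically zero, and these exponents are bounded. -/
theorem Morphism.finite_discrepancyIdeals (hφ : φ.e = 1 ∨ ∀ i, w i = 1) :
    φ.discrepancyIdeals.Finite := by
  have hbad := φ.eventually_localDiscrepancy_eq_zero hφ
  rw [eventually_cofinite] at hbad
  choose B hB using φ.exists_localDiscrepancy_bound
  set S := {p : HeightOneSpectrum (𝓞 K) | ¬ ∀ x, φ.localDiscrepancy p x = 0} with hS
  have : Finite S := hbad
  have hfin : (Set.pi Set.univ fun p : S => Set.Icc (-(B p.1 : ℤ)) (B p.1)).Finite :=
    Set.Finite.pi fun p => Set.finite_Icc _ _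
  refine Set.Finite.of_finite_image (f := fun 𝔡 (p : S) => FractionalIdeal.count K p.1 𝔡)
    (hfin.subset ?_) ?_
  · rintro _ ⟨𝔡, h𝔡, rfl⟩ p -
    obtain ⟨x, rfl⟩ := (φ.mem_discrepancyIdeals_iff 𝔡).mp h𝔡
    simp only [φ.count_vecDiscrepancy]
    exact abs_le.mp (hB _ _)
  · intro 𝔡 h𝔡 𝔡' h𝔡' heq
    obtain ⟨x, rfl⟩ := (φ.mem_discrepancyIdeals_iff 𝔡).mp h𝔡
    obtain ⟨x', rfl⟩ := (φ.mem_discrepancyIdeals_iff 𝔡').mp h𝔡'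
    refine (eq_iff_count_eq (φ.vecDiscrepancy_ne_zero x) (φ.vecDiscrepancy_ne_zero x')).mpr
      fun p => ?_
    by_cases hp : p ∈ S
    · exact congrFun heq ⟨p, hp⟩
    · rw [hS, Set.mem_ofPred_eq, not_not] at hp
      rw [φ.count_vecDiscrepancy, φ.count_vecDiscrepancy, hp, hp]

/-- On the vectors with given local exponent, the local discrepancy is locally constant. -/
theorem Morphism.exists_localDiscrepancy_add (p : HeightOneSpectrum (𝓞 K)) (k : ℤ) :
    ∃ s : ℕ, ∀ x : Punctured m (p.adicCompletion K), localExponent w p x = k →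
      ∀ y : Fin m → p.adicCompletion K, (∀ i, Valued.v (y i) ≤ exp (-((s : ℤ) + (w i : ℕ) * k))) →
      ∃ h : x.1 + y ≠ 0, localExponent w p ⟨x.1 + y, h⟩ = k ∧
        φ.localDiscrepancy p ⟨x.1 + y, h⟩ = φ.localDiscrepancy p x := by
  have hq := one_lt_absNorm_real p
  set q : ℝ := ((Ideal.absNorm p.asIdeal : ℕ) : ℝ)
  have hq0 : 0 < q := one_pos.trans hq
  obtain ⟨B, hB⟩ := φ.exists_localDiscrepancy_bound p
  -- A bound for all coordinates of all vectors of exponent `k`, so that one Lipschitz constant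
  -- serves them all.
  let R : ℝ := ∑ i, q ^ (-((w i : ℕ) * k))
  have hR : ∀ i, q ^ (-((w i : ℕ) * k)) ≤ R := fun i =>
    Finset.single_le_sum (f := fun i => q ^ (-((w i : ℕ) * k)))
      (fun i _ => zpow_nonneg hq0.le _) (Finset.mem_univ i)
  have hR0 : 0 ≤ R := Finset.sum_nonneg fun i _ => zpow_nonneg hq0.le _
  choose C hC hlip using fun i => exists_lipschitz_eval₂ (algebraMap K (p.adicCompletion K))
    (φ.f i) R
  -- The exponent of `φ(x)` never exceeds `e k + B`. Once the Lipschitz error falls below the level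
  -- `e k + B + 1`, the exponent of `φ(x)` cannot change.
  have hev : ∀ i, ∃ s : ℕ, ∀ n ≥ s, C i * (q⁻¹ ^ n * R) ≤
      q ^ (-((u i : ℕ) * (φ.e * k + B + 1) : ℤ)) := by
    intro i
    have h1 : Tendsto (fun n : ℕ => C i * (q⁻¹ ^ n * R)) atTop (nhds (C i * (0 * R))) :=
      ((tendsto_pow_atTop_nhds_zero_of_lt_one (by positivity)
        (inv_lt_one_of_one_lt₀ hq)).mul_const R).const_mul _
    rw [zero_mul, mul_zero] at h1
    exact eventually_atTop.mp (h1.eventually_le_const (zpow_pos hq0 _))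
  choose s hs using hev
  -- The first sum makes the error in `φ` small; the second forces `s₀ ≥ w_i`, so that `y` has
  -- exponent at least `k + 1` and leaves the exponent of `x` alone.
  let s₀ : ℕ := (∑ i, s i) + ∑ i, (w i : ℕ)
  refine ⟨s₀, fun x hx y hy => ?_⟩
  have hw0 : ∀ i, (w i : ℕ) ≤ s₀ := fun i =>
    (Finset.single_le_sum (f := fun i => (w i : ℕ)) (fun _ _ => Nat.zero_le _)
      (Finset.mem_univ i)).trans (Nat.le_add_left _ _)
  have hs0 : ∀ i, s i ≤ s₀ := fun i =>
    (Finset.single_le_sum (f := s) (fun _ _ => Nat.zero_le _)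
      (Finset.mem_univ i)).trans (Nat.le_add_right _ _)
  obtain ⟨hne, h1⟩ := localExponent_add p w x (y := y) fun i => (hy i).trans <| by
    rw [exp_le_exp, neg_le_neg_iff, hx, mul_add, mul_one, add_comm]
    exact add_le_add (by exact_mod_cast hw0 i) le_rfl
  refine ⟨hne, h1.trans hx, ?_⟩
  have hyn : ∀ i, ‖y i‖ ≤ q⁻¹ ^ s₀ * R := fun i => by
    refine ((norm_le_zpow_iff p (y i) _).mpr (hy i)).trans ?_
    rw [neg_add, zpow_add₀ hq0.ne', zpow_neg, zpow_natCast, ← inv_pow]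
    exact mul_le_mul_of_nonneg_left (hR i) (by positivity)
  have hbd : ∀ z : Punctured m (p.adicCompletion K), localExponent w p z = k →
      ∀ i, ‖z.1 i‖ ≤ R := fun z hz i => by
    refine le_trans ?_ (hR i)
    rw [norm_le_zpow_iff]
    exact (le_localExponent_iff w p z k).mp hz.ge i
  have h2 : ∀ i, Valued.v ((φ.eval ⟨x.1 + y, hne⟩).1 i - (φ.eval x).1 i) ≤
      exp (-((u i : ℕ) * (φ.e * k + B + 1) : ℤ)) := by
    intro i
    rw [← norm_le_zpow_iff]
    refine le_trans ?_ (hs i s₀ (hs0 i))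
    exact (hlip i (x.1 + y) x.1 _ (hbd ⟨x.1 + y, hne⟩ (h1.trans hx)) (hbd x hx)
      (fun i => by rw [Pi.add_apply, add_sub_cancel_left]; exact hyn i) (by positivity)).2
  have h3 : localExponent u p (φ.eval x) ≤ φ.e * k + B := by
    have := (abs_le.mp (hB x)).2
    rw [localDiscrepancy, hx] at this
    linarith
  obtain ⟨hne', h4⟩ := localExponent_add p u (φ.eval x)
    (y := (φ.eval ⟨x.1 + y, hne⟩).1 - (φ.eval x).1) fun i => (h2 i).trans <| by
      rw [exp_le_exp, neg_le_neg_iff]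
      exact mul_le_mul_of_nonneg_left (by linarith) (Nat.cast_nonneg _)
  have h5 : localExponent u p (φ.eval ⟨x.1 + y, hne⟩) = localExponent u p (φ.eval x) := by
    rw [← h4]
    congr 1
    exact Subtype.ext (add_sub_cancel _ _).symm
  rw [localDiscrepancy, localDiscrepancy, h5, h1]

theorem Morphism.localDiscrepancySet_subset (𝔞 𝔡 : FractionalIdeal (𝓞 K)⁰ K)
    (p : HeightOneSpectrum (𝓞 K)) : φ.localDiscrepancySet 𝔞 𝔡 p ⊆ localPrimitive w 𝔞 p :=
  fun _ ⟨hx, h, _⟩ => ⟨hx, h⟩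

theorem localOrd_eq_zero {p : HeightOneSpectrum (𝓞 K)} {c : p.adicCompletion K}
    (hc : Valued.v c = (1 : WithZero (Multiplicative ℤ))) : localOrd p c = 0 := by
  rw [localOrd, hc, log_one, neg_zero]

-- Where the local discrepancy vanishes identically the condition is empty for each discrepancy
-- ideal, so the trivial modulus and the whole lattice serve. At the other primes `V` is the set of
-- vectors with the prescribed exponent and discrepancy, a union of cosets by
-- `exists_localDiscrepancy_add`.
open Classical in
theorem Morphism.nonempty_congruenceData (hφ : φ.e = 1 ∨ ∀ i, w i = 1)
    (𝔞 : FractionalIdeal (𝓞 K)⁰ K) : Nonempty (φ.CongruenceData 𝔞) := by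
  have hbad := φ.eventually_localDiscrepancy_eq_zero hφ
  rw [eventually_cofinite] at hbad
  choose s hs using fun p : HeightOneSpectrum (𝓞 K) =>
    φ.exists_localDiscrepancy_add p (FractionalIdeal.count K p 𝔞)
  let good : HeightOneSpectrum (𝓞 K) → Prop := fun p => ∀ x, φ.localDiscrepancy p x = 0
  refine ⟨{ s := fun p _ => if good p then 0 else s p
            finite_bad := hbad.subset fun p hp hgood => hp ?_
            V := fun 𝔡 p => if good p then localIdealLattice w 𝔞 p else φ.localDiscrepancySet 𝔞 𝔡 p
            subset := fun 𝔡 _ p => ?_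
            periodic := fun 𝔡 _ p x hx y hy => ?_
            stable := fun 𝔡 _ p x hx c hc => ?_
            inter_primitive := fun 𝔡 h𝔡 p => ?_ }⟩
  · have h : good p := hgood
    simp [localModulus, localIdealLattice, h]
  · split_ifs
    · exact subset_rfl
    · exact (φ.localDiscrepancySet_subset 𝔞 𝔡 p).trans (localPrimitive_subset w 𝔞 p)
  · by_cases hp : good p
    · simp only [hp, if_true] at hx hy ⊢
      refine add_mem hx ?_
      simpa [localModulus, localIdealLattice] using hy
    · simp only [hp, if_false] at hx hy ⊢
      obtain ⟨hx0, h1, h2⟩ := hx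
      obtain ⟨h, h3, h4⟩ := hs p ⟨x, hx0⟩ h1 y hy
      exact ⟨h, h3, h4.trans h2⟩
  · by_cases hp : good p
    · simp only [hp, if_true] at hx ⊢
      intro i
      rw [map_mul, map_pow, hc, one_pow, one_mul]
      exact hx i
    · simp only [hp, if_false] at hx ⊢
      obtain ⟨hx0, h1, h2⟩ := hx
      have hc0 : c ≠ 0 := by
        rintro rfl
        rw [map_zero] at hc
        exact zero_ne_one hc
      refine ⟨act_ne_zero w (Units.mk0 c hc0) ⟨x, hx0⟩, ?_, ?_⟩
      · refine (localExponent_act w p (Units.mk0 c hc0) ⟨x, hx0⟩).trans ?_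
        rw [Units.val_mk0, localOrd_eq_zero hc, zero_add, h1]
      · exact (φ.localDiscrepancy_act p (Units.mk0 c hc0) ⟨x, hx0⟩).trans h2
  · by_cases hp : good p
    · simp only [hp, if_true]
      obtain ⟨x, rfl⟩ := (φ.mem_discrepancyIdeals_iff 𝔡).mp h𝔡
      ext y
      constructor
      · rintro ⟨-, hy, h⟩
        exact ⟨hy, h, by rw [φ.count_vecDiscrepancy, hp, hp]⟩
      · intro hy
        have := φ.localDiscrepancySet_subset _ _ _ hy
        exact ⟨localPrimitive_subset w 𝔞 p this, this⟩
    · simp only [hp, if_false]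
      exact Set.inter_eq_left.mpr (φ.localDiscrepancySet_subset _ _ _)

end LocalDiscrepancy

/-! ### Counting cosets, and points in unions of cosets -/

section Cosets

variable {G : Type*} [AddCommGroup G]

/-- Under the bijection `G ⧸ L ≃ (G ⧸ H) × (H ⧸ L)` the image of an `H`-stable set is a full product
over its image in `G ⧸ H`. -/
theorem ncard_image_mk_eq_mul {L H : AddSubgroup G} (hLH : L ≤ H) {X : Set G}
    (hX : ∀ x ∈ X, ∀ h ∈ H, x + h ∈ X) :
    ((QuotientAddGroup.mk : G → G ⧸ L) '' X).ncard =
      ((QuotientAddGroup.mk : G → G ⧸ H) '' X).ncard * L.relIndex H := by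
  let e := AddSubgroup.quotientEquivProdOfLE hLH
  have he : ∀ x : G, (e (x : G ⧸ L)).1 = (x : G ⧸ H) := fun x => rfl
  have h1 : e '' ((QuotientAddGroup.mk : G → G ⧸ L) '' X) =
      ((QuotientAddGroup.mk : G → G ⧸ H) '' X) ×ˢ Set.univ := by
    ext ⟨a, b⟩
    simp only [Set.mem_image, exists_exists_and_eq_and, Set.mem_prod, Set.mem_univ, and_true]
    constructor
    · rintro ⟨x, hx, hxe⟩
      exact ⟨x, hx, by rw [← he, hxe]⟩
    · rintro ⟨x, hx, rfl⟩
      obtain ⟨y, hy⟩ := QuotientAddGroup.mk_surjective (e.symm ((x : G ⧸ H), b))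
      have hy' : e (y : G ⧸ L) = ((x : G ⧸ H), b) := by
        rw [show (y : G ⧸ L) = _ from hy, Equiv.apply_symm_apply]
      have h2 : (x : G ⧸ H) = (y : G ⧸ H) := by rw [← he y, hy']
      refine ⟨y, ?_, hy'⟩
      have h3 := hX x hx _ (QuotientAddGroup.eq.mp h2)
      rwa [add_neg_cancel_left] at h3
  rw [← Set.ncard_image_of_injective _ e.injective, h1, Set.ncard_prod, Set.ncard_univ]
  rfl

theorem ncard_image_mk_addSubgroup {H P : AddSubgroup G} (hHP : H ≤ P) :
    ((QuotientAddGroup.mk : G → G ⧸ H) '' P).ncard = H.relIndex P := by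
  have h1 : (QuotientAddGroup.mk : G → G ⧸ P) '' P = {0} := by
    ext q
    constructor
    · rintro ⟨x, hx, rfl⟩
      exact (QuotientAddGroup.eq_zero_iff x).mpr hx
    · rintro rfl
      exact ⟨0, P.zero_mem, rfl⟩
  rw [ncard_image_mk_eq_mul hHP fun x hx h hh => P.add_mem hx hh, h1, Set.ncard_singleton, one_mul]

theorem finite_image_mk {H P : AddSubgroup G} (hHP : H ≤ P) (h : H.relIndex P ≠ 0) {X : Set G}
    (hX : X ⊆ P) : ((QuotientAddGroup.mk : G → G ⧸ H) '' X).Finite :=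
  (Set.finite_of_ncard_ne_zero (by rwa [ncard_image_mk_addSubgroup hHP])).subset
    (Set.image_mono hX)

theorem ncard_image_mk_le {H P : AddSubgroup G} (hHP : H ≤ P) (h : H.relIndex P ≠ 0) {X : Set G}
    (hX : X ⊆ P) : ((QuotientAddGroup.mk : G → G ⧸ H) '' X).ncard ≤ H.relIndex P := by
  rw [← ncard_image_mk_addSubgroup hHP]
  exact Set.ncard_le_ncard (Set.image_mono hX) (finite_image_mk hHP h subset_rfl)

/-- If every coset of `L` has approximately `b / V` points in `B`, then a union `X` of cosets has
approximately `b / V` times the number of cosets. -/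
theorem abs_ncard_inter_sub_le {L : AddSubgroup G} {X B : Set G}
    (hX : ∀ x ∈ X, ∀ h ∈ L, x + h ∈ X)
    (hfin : ((QuotientAddGroup.mk : G → G ⧸ L) '' X).Finite) {V b u : ℝ}
    (hB : ∀ y ∈ X, {h | h ∈ L ∧ y + h ∈ B}.Finite ∧
      |({h | h ∈ L ∧ y + h ∈ B}.ncard : ℝ) * V - b| ≤ u) :
    (X ∩ B).Finite ∧ |((X ∩ B).ncard : ℝ) * V -
      ((QuotientAddGroup.mk : G → G ⧸ L) '' X).ncard * b| ≤
      ((QuotientAddGroup.mk : G → G ⧸ L) '' X).ncard * u := by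
  classical
  set Q := (QuotientAddGroup.mk : G → G ⧸ L) '' X with hQ
  have hfib : ∀ y ∈ X, X ∩ B ∩ {x | (x : G ⧸ L) = y} = (y + ·) '' {h | h ∈ L ∧ y + h ∈ B} := by
    intro y hy
    ext x
    constructor
    · rintro ⟨⟨hx, hxB⟩, hxy⟩
      refine ⟨-y + x, ⟨?_, by rwa [add_neg_cancel_left]⟩, add_neg_cancel_left _ _⟩
      exact QuotientAddGroup.eq.mp (Eq.symm hxy)
    · rintro ⟨h, ⟨hh, hB⟩, rfl⟩
      exact ⟨⟨hX y hy h hh, hB⟩, (QuotientAddGroup.eq.mpr (by simpa using hh)).symm⟩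
  have hcard : ∀ q ∈ Q, (X ∩ B ∩ {x | (x : G ⧸ L) = q}).Finite ∧
      |((X ∩ B ∩ {x | (x : G ⧸ L) = q}).ncard : ℝ) * V - b| ≤ u := by
    rintro _ ⟨y, hy, rfl⟩
    rw [hfib y hy, Set.ncard_image_of_injective _ (add_right_injective y)]
    exact ⟨(hB y hy).1.image _, (hB y hy).2⟩
  have hunion : X ∩ B = ⋃ q ∈ Q, X ∩ B ∩ {x | (x : G ⧸ L) = q} := by
    ext x
    simp only [Set.mem_iUnion, exists_prop]
    constructor
    · intro hx
      exact ⟨x, ⟨x, hx.1, rfl⟩, hx, rfl⟩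
    · rintro ⟨q, -, hx, -⟩
      exact hx
  have hXB : (X ∩ B).Finite := by
    rw [hunion]
    exact hfin.biUnion fun q hq => (hcard q hq).1
  refine ⟨hXB, ?_⟩
  have hsum : (X ∩ B).ncard = ∑ q ∈ hfin.toFinset, (X ∩ B ∩ {x | (x : G ⧸ L) = q}).ncard := by
    rw [Set.ncard_eq_toFinset_card _ hXB, Finset.card_eq_sum_card_fiberwise
      (f := (QuotientAddGroup.mk : G → G ⧸ L)) (t := hfin.toFinset)]
    · refine Finset.sum_congr rfl fun q hq => ?_
      rw [← Set.ncard_coe_finset]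
      congr 1
      ext x
      simp only [Set.mem_inter_iff, Set.mem_ofPred_eq, Finset.coe_filter, Set.Finite.mem_toFinset]
    · intro x hx
      rw [Finset.mem_coe, Set.Finite.mem_toFinset] at hx ⊢
      exact ⟨x, hx.1, rfl⟩
  rw [hsum, Nat.cast_sum, Finset.sum_mul, Set.ncard_eq_toFinset_card _ hfin, ← nsmul_eq_mul,
    ← nsmul_eq_mul, ← Finset.sum_const, ← Finset.sum_const, ← Finset.sum_sub_distrib]
  refine (Finset.abs_sum_le_sum_abs _ _).trans (Finset.sum_le_sum fun q hq => ?_)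
  exact (hcard q (hfin.mem_toFinset.mp hq)).2

end Cosets

/-! ### Products of ideals as lattices, and their indices -/

section IdealLattices

open FractionalIdeal

variable {m : ℕ} {K : Type*} [Field K] [NumberField K]

/-- The inclusion of `(𝓞 K) ^ m` in `K ^ m`. -/
def integralEmb (m : ℕ) (K : Type*) [Field K] [NumberField K] : (Fin m → 𝓞 K) →+ (Fin m → K) :=
  ((algebraMap (𝓞 K) K).toAddMonoidHom).compLeft (Fin m)

theorem integralEmb_injective : Function.Injective (integralEmb m K) := fun _ _ h =>
  funext fun i => RingOfIntegers.coe_injective (congrFun h i)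

/-- The product of ideals `J₁ × ⋯ × J_m` as a lattice in `K ^ m`. -/
def latticeOf (J : Fin m → Ideal (𝓞 K)) : AddSubgroup (Fin m → K) :=
  (AddSubgroup.pi Set.univ fun i => (J i).toAddSubgroup).map (integralEmb m K)

theorem mem_latticeOf (J : Fin m → Ideal (𝓞 K)) (x : Fin m → K) :
    x ∈ latticeOf J ↔ ∀ i, x i ∈ ((J i : Ideal (𝓞 K)) : FractionalIdeal (𝓞 K)⁰ K) := by
  simp only [mem_coeIdeal]
  constructor
  · rintro ⟨y, hy, rfl⟩ i
    exact ⟨y i, hy i (Set.mem_univ i), rfl⟩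
  · intro h
    choose y hy hyx using h
    exact ⟨y, fun i _ => hy i, funext hyx⟩

theorem integralLattice_eq : integralLattice m K = latticeOf fun _ => ⊤ := by
  ext x
  rw [mem_latticeOf]
  simp only [integralLattice, AddSubgroup.mem_pi, Set.mem_univ, forall_const, mem_coeIdeal,
    Submodule.mem_top, true_and]
  rfl

theorem idealLattice_coeIdeal (w : Fin m → ℕ+) (I : Ideal (𝓞 K)) :
    idealLattice w (I : FractionalIdeal (𝓞 K)⁰ K) = latticeOf fun i => I ^ (w i : ℕ) := by
  ext x
  rw [mem_latticeOf]
  simp only [idealLattice, AddSubgroup.mem_pi, Set.mem_univ, forall_const, coeIdeal_pow]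
  rfl

theorem latticeOf_le {J J' : Fin m → Ideal (𝓞 K)} (h : ∀ i, J i ≤ J' i) :
    latticeOf J ≤ latticeOf J' := fun x hx => by
  rw [mem_latticeOf] at hx ⊢
  exact fun i => (coeIdeal_le_coeIdeal K).mpr (h i) (hx i)

theorem latticeOf_inf (J J' : Fin m → Ideal (𝓞 K)) :
    latticeOf J ⊓ latticeOf J' = latticeOf fun i => J i ⊓ J' i := by
  ext x
  simp only [AddSubgroup.mem_inf, mem_latticeOf, coeIdeal_inf, ← forall_and]
  rfl

theorem relIndex_latticeOf (J : Fin m → Ideal (𝓞 K)) :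
    (latticeOf J).relIndex (integralLattice m K) = ∏ i, Ideal.absNorm (J i) := by
  have h1 : (AddSubgroup.pi Set.univ fun _ : Fin m => (⊤ : Ideal (𝓞 K)).toAddSubgroup) = ⊤ := by
    ext x
    simp [AddSubgroup.mem_pi]
  rw [integralLattice_eq, latticeOf, latticeOf,
    AddSubgroup.relIndex_map_map_of_injective _ _ integralEmb_injective, h1,
    AddSubgroup.relIndex_top_right, AddSubgroup.index_pi]
  rfl

theorem latticeOf_le_integralLattice (J : Fin m → Ideal (𝓞 K)) :
    latticeOf J ≤ integralLattice m K := by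
  rw [integralLattice_eq]
  exact latticeOf_le fun i => le_top

end IdealLattices

/-! ### Global moduli and densities -/

namespace Morphism.CongruenceData

open FractionalIdeal

variable {m : ℕ} {K : Type*} [Field K] [NumberField K] {w u : Fin m → ℕ+} {φ : Morphism K w u}

section General

variable {𝔞 : FractionalIdeal (𝓞 K)⁰ K} (M : φ.CongruenceData 𝔞)

theorem globalSet_subset (h𝔞 : 𝔞 ≠ 0) {𝔡 : FractionalIdeal (𝓞 K)⁰ K}
    (h𝔡 : 𝔡 ∈ φ.discrepancyIdeals) : M.globalSet 𝔡 ⊆ idealLattice w 𝔞 := fun x hx =>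
  (mem_idealLattice_iff w h𝔞 x).mpr fun p => M.subset 𝔡 h𝔡 p (hx p)

/-- A vector with scaling ideal `𝔞` is locally primitive at every prime, and on primitive vectors
`V` is by `inter_primitive` the condition on the discrepancy. Off primitive vectors `V` has no
meaning; Möbius inversion discards them. -/
theorem mem_globalSet_iff (h𝔞 : 𝔞 ≠ 0) {𝔡 : FractionalIdeal (𝓞 K)⁰ K}
    (h𝔡 : 𝔡 ∈ φ.discrepancyIdeals) (x : Punctured m K) (hx : scalingIdeal w x = 𝔞) :
    x.1 ∈ M.globalSet 𝔡 ↔ φ.vecDiscrepancy x = 𝔡 := by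
  have h𝔡0 : 𝔡 ≠ 0 := by
    obtain ⟨y, rfl⟩ := (φ.mem_discrepancyIdeals_iff 𝔡).mp h𝔡
    exact φ.vecDiscrepancy_ne_zero y
  have hprim := (scalingIdeal_eq_iff w x h𝔞).mp hx
  rw [eq_iff_count_eq (φ.vecDiscrepancy_ne_zero x) h𝔡0]
  refine forall_congr' fun p => ?_
  rw [φ.count_vecDiscrepancy]
  have h1 : toLocal m p x.1 ∈ M.V 𝔡 p ↔ toLocal m p x.1 ∈ φ.localDiscrepancySet 𝔞 𝔡 p := by
    rw [← M.inter_primitive 𝔡 h𝔡 p]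
    exact ⟨fun h => ⟨h, hprim p⟩, fun h => h.1⟩
  rw [h1]
  obtain ⟨h0, h2⟩ := hprim p
  exact ⟨fun ⟨_, _, h⟩ => h, fun h => ⟨h0, h2, h⟩⟩

theorem globalSet_add_mem {𝔡 : FractionalIdeal (𝓞 K)⁰ K} (h𝔡 : 𝔡 ∈ φ.discrepancyIdeals)
    {x y : Fin m → K} (hx : x ∈ M.globalSet 𝔡) (hy : y ∈ M.globalModulus) :
    x + y ∈ M.globalSet 𝔡 := fun p => by
  rw [map_add]
  refine M.periodic 𝔡 h𝔡 p _ (hx p) _ ?_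
  exact (AddSubgroup.mem_iInf.mp hy) p

/-- The ideals `∏ 𝔭 ^ {s_i(𝔭)}`, the product being over the bad primes. -/
def conductor (i : Fin m) : Ideal (𝓞 K) := ∏ p ∈ M.finite_bad.toFinset, p.asIdeal ^ M.s p i

theorem conductor_ne_bot (i : Fin m) : M.conductor i ≠ ⊥ :=
  Finset.prod_ne_zero_iff.mpr fun p _ => pow_ne_zero _ p.ne_bot

open Classical in
theorem count_conductor (i : Fin m) (p : HeightOneSpectrum (𝓞 K)) :
    FractionalIdeal.count K p (M.conductor i : FractionalIdeal (𝓞 K)⁰ K) =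
      if p ∈ M.badPrimes then (M.s p i : ℤ) else 0 := by
  have h1 : (M.conductor i : FractionalIdeal (𝓞 K)⁰ K) =
      ∏ p ∈ M.finite_bad.toFinset, (p.asIdeal : FractionalIdeal (𝓞 K)⁰ K) ^ M.s p i := by
    rw [conductor]
    simp only [← coeIdeal_pow]
    exact map_prod (coeIdealHom (𝓞 K)⁰ K) _ _
  rw [h1, FractionalIdeal.count_prod K p _ _ fun q _ => pow_ne_zero _ (coeIdeal_ne_zero.mpr q.ne_bot)]
  simp only [FractionalIdeal.count_pow, FractionalIdeal.count_maximal, mul_ite, mul_one, mul_zero]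
  rw [Finset.sum_ite_eq' M.finite_bad.toFinset p]
  simp only [Set.Finite.mem_toFinset]
  exact if_congr Iff.rfl rfl rfl

end General

section Integral

variable {𝔞 : Ideal (𝓞 K)} (M : φ.CongruenceData (𝔞 : FractionalIdeal (𝓞 K)⁰ K))

/-- The local moduli glue to a product of ideals: outside the bad primes they agree with `𝔞 ^ w`, so
finitely many prime powers account for the difference. -/
theorem globalModulus_eq (h𝔞 : 𝔞 ≠ ⊥) :
    M.globalModulus = latticeOf fun i => 𝔞 ^ (w i : ℕ) * M.conductor i := by
  classical
  have h0 : (𝔞 : FractionalIdeal (𝓞 K)⁰ K) ≠ 0 := coeIdeal_ne_zero.mpr h𝔞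
  ext x
  have h1 : ∀ i, ((𝔞 ^ (w i : ℕ) * M.conductor i : Ideal (𝓞 K)) : FractionalIdeal (𝓞 K)⁰ K) ≠ 0 :=
    fun i => coeIdeal_ne_zero.mpr (mul_ne_zero (pow_ne_zero _ h𝔞) (M.conductor_ne_bot i))
  rw [globalModulus, AddSubgroup.mem_iInf, mem_latticeOf]
  simp only [mem_iff_valuation_le (h1 _)]
  rw [forall_comm]
  refine forall_congr' fun p => ?_
  rw [AddSubgroup.mem_comap]
  simp only [coeIdeal_mul, coeIdeal_pow]
  simp only [count_mul K p (pow_ne_zero _ h0) (coeIdeal_ne_zero.mpr (M.conductor_ne_bot _)),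
    count_pow, count_conductor]
  by_cases hp : p ∈ M.badPrimes
  · refine forall_congr' fun i => ?_
    rw [valued_toLocal, if_pos hp, add_comm]
  · rw [show localModulus w _ p (M.s p) = localIdealLattice w _ p from not_not.mp hp]
    refine forall_congr' fun i => ?_
    rw [valued_toLocal, if_neg hp, add_zero]

/-- The ideals whose product is the lattice `𝔪_𝔠`. -/
def modulusIdeal (𝔠 : Ideal (𝓞 K)) (i : Fin m) : Ideal (𝓞 K) :=
  𝔞 ^ (w i : ℕ) * M.conductor i ⊓ (𝔞 * 𝔠) ^ (w i : ℕ)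

theorem modulusAt_eq (h𝔞 : 𝔞 ≠ ⊥) (𝔠 : Ideal (𝓞 K)) : M.modulusAt 𝔠 = latticeOf (M.modulusIdeal 𝔠) := by
  rw [modulusAt, M.globalModulus_eq h𝔞, ← coeIdeal_mul, idealLattice_coeIdeal, latticeOf_inf]
  rfl

theorem modulusIdeal_ne_bot (h𝔞 : 𝔞 ≠ ⊥) {𝔠 : Ideal (𝓞 K)} (h𝔠 : 𝔠 ≠ ⊥) (i : Fin m) :
    M.modulusIdeal 𝔠 i ≠ ⊥ := by
  refine ne_bot_of_le_ne_bot (b := 𝔞 ^ (w i : ℕ) * M.conductor i * (𝔞 * 𝔠) ^ (w i : ℕ)) ?_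
    Ideal.mul_le_inf
  exact mul_ne_zero (mul_ne_zero (pow_ne_zero _ h𝔞) (M.conductor_ne_bot i))
    (pow_ne_zero _ (mul_ne_zero h𝔞 h𝔠))

theorem modulusIndex_eq (h𝔞 : 𝔞 ≠ ⊥) (𝔠 : Ideal (𝓞 K)) :
    M.modulusIndex 𝔠 = ∏ i, Ideal.absNorm (M.modulusIdeal 𝔠 i) := by
  rw [modulusIndex, M.modulusAt_eq h𝔞, relIndex_latticeOf]

theorem modulusIndex_ne_zero (h𝔞 : 𝔞 ≠ ⊥) {𝔠 : Ideal (𝓞 K)} (h𝔠 : 𝔠 ≠ ⊥) : M.modulusIndex 𝔠 ≠ 0 := by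
  rw [M.modulusIndex_eq h𝔞]
  exact Finset.prod_ne_zero_iff.mpr fun i _ => by
    rw [Ne, Ideal.absNorm_eq_zero_iff]
    exact M.modulusIdeal_ne_bot h𝔞 h𝔠 i

/-- The density of the set `V ∩ (𝔞 𝔠) ^ w`. -/
def density (𝔡 : FractionalIdeal (𝓞 K)⁰ K) (𝔠 : Ideal (𝓞 K)) : ℝ :=
  M.cosetCount 𝔡 𝔠 / M.modulusIndex 𝔠

/-- The set `V ∩ (𝔞 𝔠) ^ w`. -/
def divisibleSet (𝔡 : FractionalIdeal (𝓞 K)⁰ K) (𝔠 : Ideal (𝓞 K)) : Set (Fin m → K) :=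
  M.globalSet 𝔡 ∩ idealLattice w ((𝔞 : FractionalIdeal (𝓞 K)⁰ K) * (𝔠 : FractionalIdeal (𝓞 K)⁰ K))

theorem divisibleSet_subset (𝔡 : FractionalIdeal (𝓞 K)⁰ K) (𝔠 : Ideal (𝓞 K)) :
    M.divisibleSet 𝔡 𝔠 ⊆ latticeOf fun i => (𝔞 * 𝔠) ^ (w i : ℕ) := by
  rw [← idealLattice_coeIdeal, coeIdeal_mul]
  exact Set.inter_subset_right

theorem divisibleSet_add_mem {𝔡 : FractionalIdeal (𝓞 K)⁰ K} (h𝔡 : 𝔡 ∈ φ.discrepancyIdeals)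
    (𝔠 : Ideal (𝓞 K)) {x y : Fin m → K} (hx : x ∈ M.divisibleSet 𝔡 𝔠) (hy : y ∈ M.modulusAt 𝔠) :
    x + y ∈ M.divisibleSet 𝔡 𝔠 :=
  ⟨M.globalSet_add_mem h𝔡 hx.1 hy.1, add_mem hx.2 hy.2⟩

theorem modulusAt_le (h𝔞 : 𝔞 ≠ ⊥) (𝔠 : Ideal (𝓞 K)) :
    M.modulusAt 𝔠 ≤ latticeOf fun i => (𝔞 * 𝔠) ^ (w i : ℕ) := by
  rw [M.modulusAt_eq h𝔞]
  exact latticeOf_le fun i => inf_le_right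

theorem relIndex_ne_zero_of_le {G : Type*} [AddGroup G] {H P Q : AddSubgroup G} (hHP : H ≤ P)
    (hPQ : P ≤ Q) (h : H.relIndex Q ≠ 0) : H.relIndex P ≠ 0 ∧ P.relIndex Q ≠ 0 := by
  rw [← AddSubgroup.relIndex_mul_relIndex H P Q hHP hPQ] at h
  exact mul_ne_zero_iff.mp h

theorem density_nonneg (𝔡 : FractionalIdeal (𝓞 K)⁰ K) (𝔠 : Ideal (𝓞 K)) : 0 ≤ M.density 𝔡 𝔠 := by
  unfold density
  positivity

/-- The cosets counted lie in `(𝔞𝔠) ^ w`, so the density is at most that of this lattice,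
`N(𝔞𝔠)^(-|w|)`. The bound makes the series over `𝔠` converge and gives the decay of the error terms.
-/
theorem density_le (h𝔞 : 𝔞 ≠ ⊥) (𝔡 : FractionalIdeal (𝓞 K)⁰ K) {𝔠 : Ideal (𝓞 K)} (h𝔠 : 𝔠 ≠ ⊥) :
    M.density 𝔡 𝔠 ≤ ((Ideal.absNorm 𝔠 : ℝ) ^ totalWeight w)⁻¹ := by
  set P : AddSubgroup (Fin m → K) := latticeOf fun i => (𝔞 * 𝔠) ^ (w i : ℕ) with hP
  have h0 := relIndex_ne_zero_of_le (M.modulusAt_le h𝔞 𝔠) (latticeOf_le_integralLattice _)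
    (M.modulusIndex_ne_zero h𝔞 h𝔠)
  have h1 : M.cosetCount 𝔡 𝔠 ≤ (M.modulusAt 𝔠).relIndex P :=
    ncard_image_mk_le (M.modulusAt_le h𝔞 𝔠) h0.1 (M.divisibleSet_subset 𝔡 𝔠)
  have h2 : M.modulusIndex 𝔠 = (M.modulusAt 𝔠).relIndex P * P.relIndex (integralLattice m K) :=
    (AddSubgroup.relIndex_mul_relIndex _ _ _ (M.modulusAt_le h𝔞 𝔠)
      (latticeOf_le_integralLattice _)).symm
  have h3 : P.relIndex (integralLattice m K) = Ideal.absNorm (𝔞 * 𝔠) ^ totalWeight w := by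
    rw [hP, relIndex_latticeOf, totalWeight, ← Finset.prod_pow_eq_pow_sum]
    simp only [map_pow]
  have h4 : Ideal.absNorm 𝔠 ^ totalWeight w ≤ Ideal.absNorm (𝔞 * 𝔠) ^ totalWeight w := by
    refine Nat.pow_le_pow_left ?_ _
    rw [map_mul]
    exact Nat.le_mul_of_pos_left _ (Nat.pos_of_ne_zero (by rwa [Ne, Ideal.absNorm_eq_zero_iff]))
  have h5 : 0 < Ideal.absNorm 𝔠 ^ totalWeight w :=
    pow_pos (Nat.pos_of_ne_zero (by rwa [Ne, Ideal.absNorm_eq_zero_iff])) _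
  have h6 : (0 : ℝ) < (M.modulusAt 𝔠).relIndex P := by
    exact_mod_cast Nat.pos_of_ne_zero h0.1
  have h7 : (0 : ℝ) < (Ideal.absNorm (𝔞 * 𝔠) : ℝ) ^ totalWeight w := by
    exact_mod_cast h5.trans_le h4
  rw [density, h2, h3, div_le_iff₀ (by push_cast; positivity)]
  push_cast
  rw [mul_left_comm]
  refine (Nat.cast_le.mpr h1).trans (le_mul_of_one_le_right h6.le ?_)
  rw [← div_eq_inv_mul, one_le_div (by exact_mod_cast h5)]
  exact_mod_cast h4

end Integral

end Morphism.CongruenceData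

/-! ### Multiplicativity of densities, and points in a region -/

namespace Morphism.CongruenceData

open FractionalIdeal NumberField.InfinitePlace

variable {m : ℕ} {K : Type*} [Field K] [NumberField K] {w u : Fin m → ℕ+} {φ : Morphism K w u}
  {𝔞 : Ideal (𝓞 K)} (M : φ.CongruenceData (𝔞 : FractionalIdeal (𝓞 K)⁰ K))

theorem isCoprime_conductor {𝔠 : Ideal (𝓞 K)} (h : ∀ p ∈ M.badPrimes, ¬ 𝔠 ≤ p.asIdeal)
    (i : Fin m) : IsCoprime (M.conductor i) 𝔠 := by
  refine IsCoprime.prod_left fun p hp => IsCoprime.pow_left ?_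
  rw [Ideal.isCoprime_iff_sup_eq]
  have := p.isMaximal.eq_of_le (J := p.asIdeal ⊔ 𝔠)
  by_contra hne
  have h1 := this hne le_sup_left
  exact h p (M.finite_bad.mem_toFinset.mp hp) (h1 ▸ le_sup_right)

/-- The Chinese remainder theorem: `𝔠₂` is prime to the conductors, so `(𝔞𝔠₁) ^ w` is the sum of the
modulus at `𝔠₁` and `(𝔞𝔠₁𝔠₂) ^ w`. -/
theorem modulusAt_sup {𝔠₁ 𝔠₂ : Ideal (𝓞 K)} (h𝔞 : 𝔞 ≠ ⊥)
    (h₂ : ∀ p ∈ M.badPrimes, ¬ 𝔠₂ ≤ p.asIdeal) {x : Fin m → K}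
    (hx : x ∈ latticeOf fun i => (𝔞 * 𝔠₁) ^ (w i : ℕ)) :
    ∃ y ∈ M.modulusAt 𝔠₁, ∃ z ∈ latticeOf fun i => (𝔞 * (𝔠₁ * 𝔠₂)) ^ (w i : ℕ), y + z = x := by
  obtain ⟨x, hx, rfl⟩ := hx
  have h1 : ∀ i, ∃ y ∈ M.modulusIdeal 𝔠₁ i, ∃ z ∈ (𝔞 * (𝔠₁ * 𝔠₂)) ^ (w i : ℕ), y + z = x i := by
    intro i
    rw [← Submodule.mem_sup]
    have h2 : (𝔞 * 𝔠₁) ^ (w i : ℕ) ≤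
        M.modulusIdeal 𝔠₁ i ⊔ (𝔞 * (𝔠₁ * 𝔠₂)) ^ (w i : ℕ) := by
      have h3 := Ideal.isCoprime_iff_sup_eq.mp (IsCoprime.pow_right (n := (w i : ℕ))
        (M.isCoprime_conductor h₂ i))
      calc (𝔞 * 𝔠₁) ^ (w i : ℕ) = (𝔞 * 𝔠₁) ^ (w i : ℕ) * (M.conductor i ⊔ 𝔠₂ ^ (w i : ℕ)) := by
            rw [h3, Ideal.mul_top]
        _ = (𝔞 * 𝔠₁) ^ (w i : ℕ) * M.conductor i ⊔ (𝔞 * (𝔠₁ * 𝔠₂)) ^ (w i : ℕ) := by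
            rw [Ideal.mul_sup, ← mul_pow, mul_assoc 𝔞]
        _ ≤ _ := by
            refine sup_le_sup_right (le_inf ?_ Ideal.mul_le_left) _
            rw [mul_pow, mul_right_comm]
            exact Ideal.mul_le_left
    exact h2 (hx i (Set.mem_univ i))
  choose y hy z hz hyz using h1
  refine ⟨integralEmb m K y, ?_, integralEmb m K z, ⟨z, fun i _ => hz i, rfl⟩, ?_⟩
  · rw [M.modulusAt_eq h𝔞]
    exact ⟨y, fun i _ => hy i, rfl⟩
  · rw [← map_add]
    exact congrArg _ (funext hyz)

theorem modulusAt_mul (𝔠₁ 𝔠₂ : Ideal (𝓞 K)) : M.modulusAt (𝔠₁ * 𝔠₂) =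
    M.modulusAt 𝔠₁ ⊓ latticeOf fun i => (𝔞 * (𝔠₁ * 𝔠₂)) ^ (w i : ℕ) := by
  rw [modulusAt, modulusAt, ← coeIdeal_mul, ← coeIdeal_mul, idealLattice_coeIdeal,
    idealLattice_coeIdeal, inf_assoc, latticeOf_inf]
  congr 2
  ext1 i
  exact (inf_eq_right.mpr (Ideal.pow_right_mono
    (Ideal.mul_mono_right (Ideal.mul_le_left (I := 𝔠₁) (J := 𝔠₂))) _)).symm

theorem divisibleSet_mul (𝔡 : FractionalIdeal (𝓞 K)⁰ K) (𝔠₁ 𝔠₂ : Ideal (𝓞 K)) :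
    M.divisibleSet 𝔡 (𝔠₁ * 𝔠₂) =
      M.divisibleSet 𝔡 𝔠₁ ∩ latticeOf fun i => (𝔞 * (𝔠₁ * 𝔠₂)) ^ (w i : ℕ) := by
  rw [divisibleSet, divisibleSet, ← coeIdeal_mul, ← coeIdeal_mul, idealLattice_coeIdeal,
    idealLattice_coeIdeal, Set.inter_assoc]
  congr 1
  refine (Set.inter_eq_right.mpr ?_).symm
  exact latticeOf_le fun i => Ideal.pow_right_mono (Ideal.mul_mono_right Ideal.mul_le_left) _

/-- By `modulusAt_sup` every coset of the modulus at `𝔠₁` in question meets `(𝔞𝔠₁𝔠₂) ^ w`, and by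
`modulusAt_mul` the intersection is a single coset of the modulus at `𝔠₁𝔠₂`. -/
theorem cosetCount_mul (h𝔞 : 𝔞 ≠ ⊥) {𝔡 : FractionalIdeal (𝓞 K)⁰ K}
    (h𝔡 : 𝔡 ∈ φ.discrepancyIdeals) (𝔠₁ : Ideal (𝓞 K)) {𝔠₂ : Ideal (𝓞 K)}
    (h₂ : ∀ p ∈ M.badPrimes, ¬ 𝔠₂ ≤ p.asIdeal) :
    M.cosetCount 𝔡 (𝔠₁ * 𝔠₂) = M.cosetCount 𝔡 𝔠₁ := by
  have hle : M.modulusAt (𝔠₁ * 𝔠₂) ≤ M.modulusAt 𝔠₁ := by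
    rw [M.modulusAt_mul]
    exact inf_le_left
  let π : (Fin m → K) ⧸ M.modulusAt (𝔠₁ * 𝔠₂) →+ (Fin m → K) ⧸ M.modulusAt 𝔠₁ :=
    QuotientAddGroup.map _ _ (AddMonoidHom.id _) hle
  have h1 : (QuotientAddGroup.mk : (Fin m → K) → (Fin m → K) ⧸ M.modulusAt 𝔠₁) ''
      M.divisibleSet 𝔡 𝔠₁ = π '' ((QuotientAddGroup.mk : (Fin m → K) → (Fin m → K) ⧸
        M.modulusAt (𝔠₁ * 𝔠₂)) '' M.divisibleSet 𝔡 (𝔠₁ * 𝔠₂)) := by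
    rw [Set.image_image]
    ext q
    constructor
    · rintro ⟨x, hx, rfl⟩
      obtain ⟨y, hy, z, hz, rfl⟩ := M.modulusAt_sup h𝔞 h₂ (M.divisibleSet_subset 𝔡 𝔠₁ hx)
      refine ⟨z, ?_, ?_⟩
      · rw [M.divisibleSet_mul]
        refine ⟨?_, hz⟩
        have := M.divisibleSet_add_mem h𝔡 𝔠₁ hx (neg_mem hy)
        rwa [add_comm y z, add_neg_cancel_right] at this
      · refine QuotientAddGroup.eq.mpr ?_
        rwa [AddMonoidHom.id_apply, add_comm y z, neg_add_cancel_left]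
    · rintro ⟨x, hx, rfl⟩
      rw [M.divisibleSet_mul] at hx
      exact ⟨x, hx.1, rfl⟩
  have h2 : Set.InjOn π ((QuotientAddGroup.mk : (Fin m → K) → (Fin m → K) ⧸
        M.modulusAt (𝔠₁ * 𝔠₂)) '' M.divisibleSet 𝔡 (𝔠₁ * 𝔠₂)) := by
    rintro _ ⟨x, hx, rfl⟩ _ ⟨y, hy, rfl⟩ hxy
    rw [M.divisibleSet_mul] at hx hy
    refine QuotientAddGroup.eq.mpr ?_
    rw [M.modulusAt_mul]
    exact ⟨QuotientAddGroup.eq.mp hxy, AddSubgroup.add_mem _ (AddSubgroup.neg_mem _ hx.2) hy.2⟩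
  change (_ '' M.divisibleSet 𝔡 (𝔠₁ * 𝔠₂)).ncard = (_ '' M.divisibleSet 𝔡 𝔠₁).ncard
  rw [h1, h2.ncard_image]

/-- The second isomorphism theorem applied to the sum and intersection of `modulusAt_sup` and
`modulusAt_mul` identifies the relative index with that of two ideal lattices. -/
theorem modulusIndex_mul (h𝔞 : 𝔞 ≠ ⊥) {𝔠₁ 𝔠₂ : Ideal (𝓞 K)} (h𝔠₁ : 𝔠₁ ≠ ⊥)
    (h₂ : ∀ p ∈ M.badPrimes, ¬ 𝔠₂ ≤ p.asIdeal) :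
    M.modulusIndex (𝔠₁ * 𝔠₂) = M.modulusIndex 𝔠₁ * Ideal.absNorm 𝔠₂ ^ totalWeight w := by
  set P₁ : AddSubgroup (Fin m → K) := latticeOf fun i => (𝔞 * 𝔠₁) ^ (w i : ℕ) with hP₁
  set P : AddSubgroup (Fin m → K) := latticeOf fun i => (𝔞 * (𝔠₁ * 𝔠₂)) ^ (w i : ℕ) with hP
  have hPP : P ≤ P₁ :=
    latticeOf_le fun i => Ideal.pow_right_mono (Ideal.mul_mono_right Ideal.mul_le_left) _
  have hle : M.modulusAt (𝔠₁ * 𝔠₂) ≤ M.modulusAt 𝔠₁ := by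
    rw [M.modulusAt_mul]
    exact inf_le_left
  have hle2 : M.modulusAt 𝔠₁ ≤ integralLattice m K :=
    (M.modulusAt_le h𝔞 𝔠₁).trans (latticeOf_le_integralLattice _)
  have hsup : M.modulusAt 𝔠₁ ⊔ P = P₁ := by
    refine le_antisymm (sup_le (M.modulusAt_le h𝔞 𝔠₁) hPP) fun x hx => ?_
    obtain ⟨y, hy, z, hz, rfl⟩ := M.modulusAt_sup h𝔞 h₂ hx
    exact AddSubgroup.add_mem_sup hy hz
  have h1 : (M.modulusAt (𝔠₁ * 𝔠₂)).relIndex (M.modulusAt 𝔠₁) = P.relIndex P₁ := by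
    rw [M.modulusAt_mul, AddSubgroup.inf_relIndex_left, ← hsup, sup_comm,
      AddSubgroup.relIndex_sup_left]
  have h3 : ∀ 𝔠 : Ideal (𝓞 K), (latticeOf fun i => (𝔞 * 𝔠) ^ (w i : ℕ)).relIndex
      (integralLattice m K) = (Ideal.absNorm 𝔞 * Ideal.absNorm 𝔠) ^ totalWeight w := by
    intro 𝔠
    rw [relIndex_latticeOf, totalWeight, ← Finset.prod_pow_eq_pow_sum]
    simp only [map_pow, map_mul]
  have h4 : P.relIndex P₁ = Ideal.absNorm 𝔠₂ ^ totalWeight w := by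
    have h5 := AddSubgroup.relIndex_mul_relIndex P P₁ _ hPP (latticeOf_le_integralLattice _)
    rw [show P.relIndex (integralLattice m K) = _ from h3 _, show P₁.relIndex (integralLattice m K) = _
      from h3 _, map_mul, ← mul_assoc (Ideal.absNorm 𝔞), mul_pow _ (Ideal.absNorm 𝔠₂), mul_comm] at h5
    refine Nat.eq_of_mul_eq_mul_left (Nat.pos_of_ne_zero (pow_ne_zero _ (mul_ne_zero ?_ ?_))) h5
    · rwa [Ne, Ideal.absNorm_eq_zero_iff]
    · rwa [Ne, Ideal.absNorm_eq_zero_iff]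
  rw [modulusIndex, modulusIndex, ← AddSubgroup.relIndex_mul_relIndex _ _ _ hle hle2, h1, h4,
    mul_comm]

/-- The density is multiplicative with respect to ideals that are prime to the bad primes. -/
theorem density_mul (h𝔞 : 𝔞 ≠ ⊥) {𝔡 : FractionalIdeal (𝓞 K)⁰ K}
    (h𝔡 : 𝔡 ∈ φ.discrepancyIdeals) {𝔠₁ 𝔠₂ : Ideal (𝓞 K)} (h𝔠₁ : 𝔠₁ ≠ ⊥)
    (h₂ : ∀ p ∈ M.badPrimes, ¬ 𝔠₂ ≤ p.asIdeal) :
    M.density 𝔡 (𝔠₁ * 𝔠₂) = M.density 𝔡 𝔠₁ * ((Ideal.absNorm 𝔠₂ : ℝ) ^ totalWeight w)⁻¹ := by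
  rw [density, density, M.cosetCount_mul h𝔞 h𝔡 𝔠₁ h₂, M.modulusIndex_mul h𝔞 h𝔠₁ h₂]
  push_cast
  rw [← div_div, div_eq_mul_inv (_ / _)]

-- The count is made with the sublattice `∏ (a_i)`, whose cells are boxes of known size at every
-- place, rather than with the modulus itself. The set is a union of more cosets of this smaller
-- lattice, and the index gained cancels against its covolume, so only the density remains.
open scoped Classical in
theorem exists_count_divisibleSet (m : ℕ) (K : Type*) [Field K] [NumberField K] :
    ∃ D : ℝ, 0 < D ∧ ∀ {w u : Fin m → ℕ+} {φ : Morphism K w u}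
    {𝔞 : Ideal (𝓞 K)} (M : φ.CongruenceData (𝔞 : FractionalIdeal (𝓞 K)⁰ K)) (_ : 𝔞 ≠ ⊥)
    {𝔡 : FractionalIdeal (𝓞 K)⁰ K} (_ : 𝔡 ∈ φ.discrepancyIdeals) {𝔠 : Ideal (𝓞 K)} (_ : 𝔠 ≠ ⊥)
    (a : Fin m → 𝓞 K) (_ : ∀ i, a i ≠ 0) (_ : ∀ i, a i ∈ M.modulusIdeal 𝔠 i)
    {B U : Set (Fin m → mixedEmbedding.mixedSpace K)} (_ : MeasurableSet B) (_ : MeasurableSet U)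
    (_ : volume B ≠ ⊤) (_ : volume U ≠ ⊤)
    (_ : ∀ z ∈ B, ∀ z' ∉ B, ∀ z'',
      (∀ v i, ‖coordAt v z i - coordAt v z' i‖ ≤ D * v (a i : K)) →
      (∀ v i, ‖coordAt v z i - coordAt v z'' i‖ ≤ D * v (a i : K)) → z'' ∈ U),
    (M.divisibleSet 𝔡 𝔠 ∩ embVec ⁻¹' B).Finite ∧
    |((M.divisibleSet 𝔡 𝔠 ∩ embVec ⁻¹' B).ncard : ℝ) * covol K ^ m -
      M.density 𝔡 𝔠 * (volume B).toReal| ≤ M.density 𝔡 𝔠 * (volume U).toReal := by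
  obtain ⟨D, hD, hcount⟩ := exists_lattice_count (m := m) (K := K)
  refine ⟨D, hD, fun {w u φ 𝔞} M h𝔞 {𝔡} h𝔡 {𝔠} h𝔠 a ha0 ha {B U} hB hU hBt hUt hBU => ?_⟩
  set L : AddSubgroup (Fin m → K) := latticeOf fun i => Ideal.span {a i} with hL
  set A : ℝ := ∏ i, |(Algebra.norm ℚ (a i : K) : ℝ)| with hA
  have hLM : L ≤ M.modulusAt 𝔠 := by
    rw [M.modulusAt_eq h𝔞]
    exact latticeOf_le fun i => (Ideal.span_singleton_le_iff_mem _).mpr (ha i)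
  have hLidx : (L.relIndex (integralLattice m K) : ℝ) = A := by
    rw [hL, relIndex_latticeOf, hA]
    push_cast
    refine Finset.prod_congr rfl fun i _ => ?_
    rw [Ideal.absNorm_span_singleton, Nat.cast_natAbs, ← Algebra.coe_norm_int]
    push_cast
    rfl
  have hA0 : 0 < A := Finset.prod_pos fun i _ => abs_pos.mpr (by
    simpa [Algebra.norm_eq_zero_iff] using ha0 i)
  have hle2 : M.modulusAt 𝔠 ≤ integralLattice m K :=
    (M.modulusAt_le h𝔞 𝔠).trans (latticeOf_le_integralLattice _)
  have hX : ∀ x ∈ M.divisibleSet 𝔡 𝔠, ∀ h ∈ M.modulusAt 𝔠, x + h ∈ M.divisibleSet 𝔡 𝔠 :=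
    fun x hx h hh => M.divisibleSet_add_mem h𝔡 𝔠 hx hh
  have hn := ncard_image_mk_eq_mul hLM hX
  -- Both the number of cosets and the index in `(𝓞 K) ^ m` grow by the index of `L` in the modulus,
  -- so their ratio is still the density.
  have hnd : ((((QuotientAddGroup.mk : (Fin m → K) → (Fin m → K) ⧸ L) ''
      M.divisibleSet 𝔡 𝔠).ncard : ℕ) : ℝ) = M.density 𝔡 𝔠 * A := by
    have h1 : (M.modulusIndex 𝔠 : ℝ) ≠ 0 := by exact_mod_cast M.modulusIndex_ne_zero h𝔞 h𝔠
    rw [hn, ← hLidx, ← AddSubgroup.relIndex_mul_relIndex _ _ _ hLM hle2, density]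
    push_cast
    rw [show (((M.modulusAt 𝔠).relIndex (integralLattice m K) : ℕ) : ℝ) = M.modulusIndex 𝔠 from rfl,
      mul_comm (L.relIndex _ : ℝ), ← mul_assoc, div_mul_cancel₀ _ h1]
    rfl
  have hL0 : L.relIndex (integralLattice m K) ≠ 0 := by
    intro h
    rw [h, Nat.cast_zero] at hLidx
    exact hA0.ne hLidx
  have hfin := finite_image_mk (hLM.trans hle2) hL0
    ((M.divisibleSet_subset 𝔡 𝔠).trans (latticeOf_le_integralLattice _))
  have hinj : Function.Injective fun (l : Fin m → 𝓞 K) (i : Fin m) => (a i : K) * (l i : K) := by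
    intro l l' h
    ext i
    exact mul_left_cancel₀ (by simpa using ha0 i : (a i : K) ≠ 0) (congrFun h i)
  have hset : ∀ y : Fin m → K, {h | h ∈ L ∧ y + h ∈ embVec ⁻¹' B} =
      (fun (l : Fin m → 𝓞 K) (i : Fin m) => (a i : K) * (l i : K)) ''
        {l : Fin m → 𝓞 K | embVec (fun i => y i + (a i : K) * (l i : K)) ∈ B} := by
    intro y
    ext h
    constructor
    · rintro ⟨⟨x, hx, rfl⟩, hB⟩
      have h1 : ∀ i, ∃ l, a i * l = x i := fun i => by
        obtain ⟨l, hl⟩ := Ideal.mem_span_singleton.mp (hx i (Set.mem_univ i))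
        exact ⟨l, hl.symm⟩
      choose l hl using h1
      have h2 : (fun i => (a i : K) * (l i : K)) = integralEmb m K x := by
        ext i
        change _ = ((x i : 𝓞 K) : K)
        rw [← hl i]
        exact (map_mul (algebraMap (𝓞 K) K) _ _).symm
      refine ⟨l, ?_, h2⟩
      change embVec (y + fun i => (a i : K) * (l i : K)) ∈ B
      rw [h2]
      exact hB
    · rintro ⟨l, hl, rfl⟩
      refine ⟨⟨fun i => a i * l i, fun i _ => Ideal.mem_span_singleton.mpr (dvd_mul_right _ _), ?_⟩,
        hl⟩
      ext i
      exact map_mul (algebraMap (𝓞 K) K) _ _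
  have hcos : ∀ y ∈ M.divisibleSet 𝔡 𝔠, {h | h ∈ L ∧ y + h ∈ embVec ⁻¹' B}.Finite ∧
      |({h | h ∈ L ∧ y + h ∈ embVec ⁻¹' B}.ncard : ℝ) * (covol K ^ m * A) - (volume B).toReal| ≤
        (volume U).toReal := by
    intro y _
    rw [hset y, Set.ncard_image_of_injective _ hinj]
    obtain ⟨h1, h2⟩ := hcount (fun i => (a i : K)) y (fun i => by simpa using ha0 i) B U hB hU hBt
      hUt hBU
    exact ⟨h1.image _, h2⟩
  obtain ⟨h1, h2⟩ := abs_ncard_inter_sub_le (fun x hx h hh => hX x hx h (hLM hh)) hfin hcos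
  refine ⟨h1, ?_⟩
  rw [hnd, ← mul_assoc, mul_right_comm _ A, mul_right_comm _ A, ← sub_mul, abs_mul,
    abs_of_pos hA0] at h2
  exact le_of_mul_le_mul_right h2 hA0

end Morphism.CongruenceData

/-! ### The Möbius function and the Dedekind zeta function -/

section Zeta

variable {K : Type*} [Field K] [NumberField K]

/-- The number of nonzero ideals of norm at most `n` grows linearly, by the asymptotic ideal count
behind the class number formula. The shift by one in the proof accounts for the zero ideal, of norm
`0`. -/
theorem sum_card_absNorm_isBigO (K : Type*) [Field K] [NumberField K] :
    (fun n : ℕ => ∑ k ∈ Finset.Icc 1 n, (Nat.card {I : Ideal (𝓞 K) // Ideal.absNorm I = k} : ℝ))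
      =O[atTop] fun n : ℕ => (n : ℝ) ^ (1 : ℝ) := by
  have h := (NumberField.Ideal.tendsto_norm_le_div_atTop₀ K).comp tendsto_natCast_atTop_atTop
  have h2 := h.isBigO_one ℝ
  have h3 : (fun n : ℕ => (Nat.card {I : (Ideal (𝓞 K))⁰ //
      Ideal.absNorm (I : Ideal (𝓞 K)) ≤ (n : ℝ)} : ℝ)) =O[atTop] fun n : ℕ => (n : ℝ) ^ (1 : ℝ) := by
    refine ((h2.mul (isBigO_refl (fun n : ℕ => (n : ℝ)) atTop)).congr' ?_ ?_)
    · filter_upwards [eventually_ne_atTop 0] with n hn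
      simp only [Function.comp_apply]
      rw [div_mul_cancel₀ _ (Nat.cast_ne_zero.mpr hn)]
    · exact Eventually.of_forall fun n => by simp
  refine h3.congr_left fun n => ?_
  simp only [Nat.cast_le]
  rw [← Nat.cast_sum]
  congr 1
  rw [← add_left_inj 1, ← Ideal.card_norm_le_eq_card_norm_le_add_one,
    show Finset.Icc 1 n = Finset.Ioc 0 n from Finset.Icc_succ_left_eq_Ioc _ _,
    show 1 = Nat.card {I : Ideal (𝓞 K) // Ideal.absNorm I = 0} by simp [Ideal.absNorm_eq_zero_iff],
    Finset.sum_Ioc_add_eq_sum_Icc (n.zero_le),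
    ← Finset.card_preimage_eq_sum_card_image_eq
      (fun k _ => Ideal.finite_setOfPred_absNorm_eq k)]
  simp [Set.coe_eq_subtype]

theorem summable_card_absNorm (K : Type*) [Field K] [NumberField K] {σ : ℝ} (hσ : 1 < σ) :
    Summable fun n : ℕ => (Nat.card {I : Ideal (𝓞 K) // Ideal.absNorm I = n} : ℝ) *
      ((n : ℝ) ^ σ)⁻¹ := by
  have h := LSeriesSummable_of_sum_norm_bigO_and_nonneg (s := (σ : ℂ))
    (sum_card_absNorm_isBigO K) (fun _ => Nat.cast_nonneg _) zero_le_one (by simpa using hσ)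
  refine h.norm.congr fun n => ?_
  rw [LSeries.norm_term_eq]
  split_ifs with hn
  · subst hn
    simp [Real.zero_rpow (by linarith : σ ≠ 0)]
  · simp [div_eq_mul_inv]

theorem tsum_eq_tsum_fiber {α β : Type*} (g : α → β) {F : α → ℝ} (hF : Summable F) :
    ∑' a, F a = ∑' b, ∑' a : {a // g a = b}, F a := by
  rw [← (Equiv.sigmaFiberEquiv g).tsum_eq]
  exact Summable.tsum_sigma ((Equiv.summable_iff (Equiv.sigmaFiberEquiv g)).mpr hF)

instance finite_absNorm_fiber (n : ℕ) : Finite (Ideal.absNorm (S := 𝓞 K) ⁻¹' {n}) :=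
  Ideal.finite_setOfPred_absNorm_eq n

theorem tsum_absNorm_fiber (g : ℕ → ℝ) (n : ℕ) :
    ∑' I : Ideal.absNorm (S := 𝓞 K) ⁻¹' {n}, g (Ideal.absNorm (I : Ideal (𝓞 K))) =
      (Nat.card {I : Ideal (𝓞 K) // Ideal.absNorm I = n} : ℝ) * g n := by
  have h : ∀ I : Ideal.absNorm (S := 𝓞 K) ⁻¹' {n}, g (Ideal.absNorm (I : Ideal (𝓞 K))) = g n :=
    fun I => congrArg g I.2
  simp_rw [h]
  rw [tsum_const, nsmul_eq_mul]
  rfl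

/-- The series `∑ N(𝔠) ^ (-σ)` converges for `σ > 1`. -/
theorem summable_absNorm_rpow (K : Type*) [Field K] [NumberField K] {σ : ℝ} (hσ : 1 < σ) :
    Summable fun I : Ideal (𝓞 K) => ((Ideal.absNorm I : ℝ) ^ σ)⁻¹ := by
  rw [← (Equiv.sigmaFiberEquiv (Ideal.absNorm (S := 𝓞 K))).summable_iff]
  rw [summable_sigma_of_nonneg (fun x => by simp only [Function.comp_apply]; positivity)]
  refine ⟨fun n => ?_, (summable_card_absNorm K hσ).congr fun n => ?_⟩
  · have : Finite {x : Ideal (𝓞 K) // Ideal.absNorm x = n} := finite_absNorm_fiber n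
    exact Summable.of_finite
  · exact (tsum_absNorm_fiber (K := K) (fun k => ((k : ℝ) ^ σ)⁻¹) n).symm

theorem summable_absNorm_pow (K : Type*) [Field K] [NumberField K] {s : ℕ} (hs : 1 < s) :
    Summable fun I : Ideal (𝓞 K) => ((Ideal.absNorm I : ℝ) ^ s)⁻¹ := by
  simpa only [Real.rpow_natCast] using
    summable_absNorm_rpow K (σ := (s : ℝ)) (by exact_mod_cast hs)

/-- The sum may run over all ideals, since the zero ideal contributes `(0 ^ s)⁻¹ = 0`. -/
theorem dedekindZeta_re (K : Type*) [Field K] [NumberField K] {s : ℕ} (hs : 1 < s) :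
    (dedekindZeta K (s : ℂ)).re = ∑' I : Ideal (𝓞 K), ((Ideal.absNorm I : ℝ) ^ s)⁻¹ := by
  have hsum := summable_absNorm_pow K hs
  have h1 : ∑' I : Ideal (𝓞 K), ((Ideal.absNorm I : ℝ) ^ s)⁻¹ =
      ∑' n : ℕ, (Nat.card {I : Ideal (𝓞 K) // Ideal.absNorm I = n} : ℝ) * ((n : ℝ) ^ s)⁻¹ := by
    rw [tsum_eq_tsum_fiber (Ideal.absNorm (S := 𝓞 K)) hsum]
    exact tsum_congr fun n => tsum_absNorm_fiber (K := K) (fun k => ((k : ℝ) ^ s)⁻¹) n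
  rw [h1, dedekindZeta, LSeries]
  have h2 : ∀ n : ℕ, LSeries.term
      (fun n => (Nat.card {I : Ideal (𝓞 K) // Ideal.absNorm I = n} : ℂ)) (s : ℂ) n =
      (((Nat.card {I : Ideal (𝓞 K) // Ideal.absNorm I = n} : ℝ) * ((n : ℝ) ^ s)⁻¹ : ℝ) : ℂ) := by
    intro n
    rw [LSeries.term]
    split_ifs with hn
    · subst hn
      simp [show s ≠ 0 by omega]
    · rw [Complex.cpow_natCast]
      push_cast
      rw [div_eq_mul_inv]
  simp_rw [h2]
  rw [← Complex.ofReal_tsum, Complex.ofReal_re]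

theorem moebius_mul_of_isCoprime {I J : Ideal (𝓞 K)} (h : IsCoprime I J) :
    UniqueFactorizationMonoid.moebius (I * J) =
      UniqueFactorizationMonoid.moebius I * UniqueFactorizationMonoid.moebius J :=
  IsRelPrime.moebius_mul (h.isRelPrime)

theorem abs_moebius_le_one (I : Ideal (𝓞 K)) :
    |(UniqueFactorizationMonoid.moebius I : ℝ)| ≤ 1 := by
  by_cases h : Squarefree I
  · rw [h.moebius_eq]
    simp
  · rw [UniqueFactorizationMonoid.moebius_of_not_squarefree h]
    simp

theorem isCoprime_of_prime_of_not_dvd {P I : Ideal (𝓞 K)} (hP : Prime P) (h : ¬ P ∣ I) :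
    IsCoprime P I := by
  have : P.IsMaximal := (Ideal.isPrime_of_prime hP).isMaximal hP.ne_zero
  rw [Ideal.isCoprime_iff_sup_eq]
  exact this.1.2 _ (lt_of_le_of_ne le_sup_left fun h' => h (Ideal.dvd_iff_le.mpr (by
    rw [h']; exact le_sup_right)))

/-- The sum of the Möbius function over the divisors of an ideal. -/
theorem sum_moebius_dvd {I : Ideal (𝓞 K)} (hI : I ≠ ⊥) (F : Finset (Ideal (𝓞 K)))
    (hF : ∀ J, J ∈ F ↔ J ∣ I) :
    ∑ J ∈ F, UniqueFactorizationMonoid.moebius J = if I = ⊤ then 1 else 0 := by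
  classical
  split_ifs with h
  · have : F = {1} := by
      ext J
      rw [hF, h, ← Ideal.one_eq_top, Finset.mem_singleton, ← isUnit_iff_dvd_one, Ideal.isUnit_iff, Ideal.one_eq_top]
    rw [this, Finset.sum_singleton, UniqueFactorizationMonoid.moebius_one]
  · obtain ⟨P, hPm, hPI⟩ := Ideal.exists_le_maximal I h
    have hP0 : P ≠ ⊥ := fun h' => hI (le_bot_iff.mp (h' ▸ hPI))
    have hP : Prime P := Ideal.prime_of_isPrime hP0 hPm.isPrime
    have hPI : P ∣ I := Ideal.dvd_iff_le.mpr hPI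
    -- Divisors prime to `P` are paired with their products by `P`, of opposite sign; the other
    -- divisors are not squarefree and contribute nothing.
    rw [← Finset.sum_filter_add_sum_filter_not F (fun J => P ∣ J)]
    have key : ∑ J ∈ F with P ∣ J, UniqueFactorizationMonoid.moebius J =
        ∑ J ∈ F with ¬ P ∣ J, UniqueFactorizationMonoid.moebius (P * J) := by
      symm
      rw [← Finset.sum_image (s := F.filter fun J => ¬ P ∣ J) (g := fun J => P * J)
        (f := UniqueFactorizationMonoid.moebius)
        (fun J _ J' _ h => mul_left_cancel₀ hP0 h)]
      refine Finset.sum_subset (fun J hJ => ?_) fun J hJ hJ' => ?_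
      · obtain ⟨J', hJ', rfl⟩ := Finset.mem_image.mp hJ
        rw [Finset.mem_filter, hF] at hJ' ⊢
        exact ⟨(isCoprime_of_prime_of_not_dvd hP hJ'.2).mul_dvd hPI hJ'.1, dvd_mul_right _ _⟩
      · rw [Finset.mem_filter, hF] at hJ
        obtain ⟨hJI, J', rfl⟩ := hJ
        refine UniqueFactorizationMonoid.moebius_of_not_squarefree fun hsq => ?_
        refine hJ' (Finset.mem_image.mpr ⟨J', ?_, rfl⟩)
        rw [Finset.mem_filter, hF]
        refine ⟨(dvd_mul_left _ _).trans hJI, fun hPJ => hP.not_isUnit (hsq P ?_)⟩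
        exact mul_dvd_mul_left _ hPJ
    rw [key, ← Finset.sum_add_distrib]
    refine Finset.sum_eq_zero fun J hJ => ?_
    rw [moebius_mul_of_isCoprime
      (isCoprime_of_prime_of_not_dvd hP (Finset.mem_filter.mp hJ).2), hP.irreducible.moebius_eq]
    ring

theorem finite_dvd {I : Ideal (𝓞 K)} (hI : I ≠ ⊥) : {J : Ideal (𝓞 K) | J ∣ I}.Finite :=
  @Finite.of_fintype _ (UniqueFactorizationMonoid.fintypeSubtypeDvd I hI)

/-- Möbius inversion for an absolutely summable completely multiplicative function. -/
theorem tsum_moebius_mul_tsum (f : Ideal (𝓞 K) →*₀ ℝ) (hf : Summable fun I => ‖f I‖) :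
    (∑' I, (UniqueFactorizationMonoid.moebius I : ℝ) * f I) * ∑' I, f I = 1 := by
  have hμ : Summable fun I => ‖(UniqueFactorizationMonoid.moebius I : ℝ) * f I‖ := by
    refine Summable.of_nonneg_of_le (fun _ => norm_nonneg _) (fun I => ?_) hf
    rw [norm_mul]
    exact mul_le_of_le_one_left (norm_nonneg _) (abs_moebius_le_one I)
  have hsum := summable_mul_of_summable_norm hμ hf
  rw [tsum_mul_tsum_of_summable_norm hμ hf]
  rw [tsum_eq_tsum_fiber (fun p : Ideal (𝓞 K) × Ideal (𝓞 K) => p.1 * p.2) hsum, tsum_eq_single 1]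
  · rw [tsum_eq_single ⟨(1, 1), one_mul _⟩]
    · change ((UniqueFactorizationMonoid.moebius (1 : Ideal (𝓞 K)) : ℤ) : ℝ) * f 1 * f 1 = 1
      rw [UniqueFactorizationMonoid.moebius_one, map_one]
      norm_num
    · rintro ⟨⟨I, J⟩, h⟩ hne
      exfalso
      refine hne (Subtype.ext (Prod.ext ?_ ?_))
      · exact (isUnit_iff_eq_one).mp (IsUnit.of_mul_eq_one _ h)
      · exact (isUnit_iff_eq_one).mp (IsUnit.of_mul_eq_one _ ((mul_comm _ _).trans h))
  · intro A hA
    -- The double sum is grouped by the product `A`. The group of `A = ⊥` vanishes since `f` does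
    -- there; for other `A ≠ 1` it is `f A` times the sum of `μ` over the divisors of `A`, which is
    -- zero.
    by_cases hA0 : A = ⊥
    · refine (tsum_congr fun p => ?_).trans tsum_zero
      obtain ⟨⟨I, J⟩, h⟩ := p
      change (UniqueFactorizationMonoid.moebius I : ℝ) * f I * f J = 0
      have h' : I * J = 0 := (show I * J = A from h).trans hA0
      rw [mul_assoc, ← map_mul, h', map_zero, mul_zero]
    · have hterm : ∀ p : {p : Ideal (𝓞 K) × Ideal (𝓞 K) // p.1 * p.2 = A},
          (UniqueFactorizationMonoid.moebius p.1.1 : ℝ) * f p.1.1 * f p.1.2 =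
            f A * (UniqueFactorizationMonoid.moebius p.1.1 : ℝ) := by
        rintro ⟨⟨I, J⟩, rfl⟩
        rw [map_mul]
        ring
      have hbij : Function.Bijective fun p : {p : Ideal (𝓞 K) × Ideal (𝓞 K) // p.1 * p.2 = A} =>
          (⟨p.1.1, (finite_dvd hA0).mem_toFinset.mpr ⟨p.1.2, p.2.symm⟩⟩ :
            {J // J ∈ (finite_dvd hA0).toFinset}) := by
        constructor
        · rintro ⟨⟨I, J⟩, h⟩ ⟨⟨I', J'⟩, h'⟩ hh
          have hI : I = I' := congrArg Subtype.val hh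
          subst hI
          have hI0 : I ≠ 0 := by
            rintro rfl
            exact hA0 (by rw [← h, zero_mul]; rfl)
          exact Subtype.ext (Prod.ext rfl (mul_left_cancel₀ hI0 (h.trans h'.symm)))
        · rintro ⟨I, hI⟩
          obtain ⟨J, hJ⟩ := (finite_dvd hA0).mem_toFinset.mp hI
          exact ⟨⟨(I, J), hJ.symm⟩, rfl⟩
      have h1 := (Equiv.ofBijective _ hbij).tsum_eq
        (fun J => f A * (UniqueFactorizationMonoid.moebius J.1 : ℝ))
      have h2 := sum_moebius_dvd hA0 (finite_dvd hA0).toFinset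
        fun J => (finite_dvd hA0).mem_toFinset
      rw [if_neg (by rwa [Ideal.one_eq_top] at hA)] at h2
      refine (tsum_congr hterm).trans (h1.trans ?_)
      rw [Finset.tsum_subtype (finite_dvd hA0).toFinset
        (fun J => f A * (UniqueFactorizationMonoid.moebius J : ℝ)), ← Finset.mul_sum,
        ← Int.cast_sum, h2, Int.cast_zero, mul_zero]

open Classical in
/-- The function `N(I) ^ (-s)` on the ideals prime to a finite set of primes, extended by zero. -/
def coprimeNormHom (S : Finset (HeightOneSpectrum (𝓞 K))) {s : ℕ} (hs : s ≠ 0) :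
    Ideal (𝓞 K) →*₀ ℝ where
  toFun I := if ∀ p ∈ S, ¬ I ≤ p.asIdeal then ((Ideal.absNorm I : ℝ) ^ s)⁻¹ else 0
  map_zero' := by simp [hs]
  map_one' := by
    rw [if_pos fun p _ h => p.isPrime.ne_top (top_le_iff.mp (by rwa [Ideal.one_eq_top] at h))]
    simp
  map_mul' I J := by
    have h : (∀ p ∈ S, ¬ I * J ≤ p.asIdeal) ↔
        (∀ p ∈ S, ¬ I ≤ p.asIdeal) ∧ ∀ p ∈ S, ¬ J ≤ p.asIdeal := by
      rw [← forall₂_and]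
      refine forall₂_congr fun p _ => ?_
      rw [p.isPrime.mul_le, not_or]
    by_cases h1 : ∀ p ∈ S, ¬ I ≤ p.asIdeal
    · by_cases h2 : ∀ p ∈ S, ¬ J ≤ p.asIdeal
      · rw [if_pos h1, if_pos h2, if_pos (h.mpr ⟨h1, h2⟩), map_mul]
        push_cast
        rw [mul_pow, mul_inv]
      · rw [if_neg h2, if_neg fun h' => h2 (h.mp h').2, mul_zero]
    · rw [if_neg h1, if_neg fun h' => h1 (h.mp h').1, zero_mul]

open Classical in
theorem coprimeNormHom_apply (S : Finset (HeightOneSpectrum (𝓞 K))) {s : ℕ} (hs : s ≠ 0)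
    (I : Ideal (𝓞 K)) : coprimeNormHom S hs I =
      if ∀ p ∈ S, ¬ I ≤ p.asIdeal then ((Ideal.absNorm I : ℝ) ^ s)⁻¹ else 0 := rfl

theorem coprimeNormHom_nonneg (S : Finset (HeightOneSpectrum (𝓞 K))) {s : ℕ} (hs : s ≠ 0)
    (I : Ideal (𝓞 K)) : 0 ≤ coprimeNormHom S hs I := by
  rw [coprimeNormHom_apply]
  split_ifs
  · positivity
  · exact le_rfl

theorem coprimeNormHom_le (S : Finset (HeightOneSpectrum (𝓞 K))) {s : ℕ} (hs : s ≠ 0)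
    (I : Ideal (𝓞 K)) : coprimeNormHom S hs I ≤ ((Ideal.absNorm I : ℝ) ^ s)⁻¹ := by
  rw [coprimeNormHom_apply]
  split_ifs
  · exact le_rfl
  · positivity

theorem summable_coprimeNormHom (S : Finset (HeightOneSpectrum (𝓞 K))) {s : ℕ} (hs : 1 < s) :
    Summable fun I => coprimeNormHom S (by omega : s ≠ 0) I :=
  Summable.of_nonneg_of_le (coprimeNormHom_nonneg S _) (coprimeNormHom_le S _)
    (summable_absNorm_pow K hs)

/-- Euler factors are removed one prime at a time: the terms divisible by `p` are those of `p J`,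
and they add up to `N(p)^(-s)` times the whole sum. -/
theorem tsum_coprimeNormHom (S : Finset (HeightOneSpectrum (𝓞 K))) {s : ℕ} (hs : 1 < s) :
    ∑' I, coprimeNormHom S (by omega : s ≠ 0) I =
      (∑' I : Ideal (𝓞 K), ((Ideal.absNorm I : ℝ) ^ s)⁻¹) *
        ∏ p ∈ S, (1 - ((Ideal.absNorm p.asIdeal : ℝ) ^ s)⁻¹) := by
  classical
  have hs0 : s ≠ 0 := by omega
  induction S using Finset.induction_on with
  | empty => simp [coprimeNormHom_apply]
  | insert p S hp ih =>
    rw [Finset.prod_insert hp, mul_comm (1 - _), ← mul_assoc, ← ih, mul_one_sub]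
    have hp0 : coprimeNormHom S hs0 p.asIdeal = ((Ideal.absNorm p.asIdeal : ℝ) ^ s)⁻¹ := by
      rw [coprimeNormHom_apply, if_pos]
      intro q hq h
      have : p = q := HeightOneSpectrum.ext (p.isMaximal.eq_of_le q.isPrime.ne_top h)
      exact hp (this ▸ hq)
    have hsum := summable_coprimeNormHom S hs
    have hinj : Function.Injective fun J : Ideal (𝓞 K) => p.asIdeal * J :=
      fun J J' h => mul_left_cancel₀ p.ne_bot h
    have h1 : ∑' J, coprimeNormHom S hs0 (p.asIdeal * J) =
        ∑' I, if I ≤ p.asIdeal then coprimeNormHom S hs0 I else 0 := by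
      rw [← hinj.tsum_eq (f := fun I => if I ≤ p.asIdeal then coprimeNormHom S hs0 I else 0)]
      · refine tsum_congr fun J => ?_
        rw [if_pos (show p.asIdeal * J ≤ p.asIdeal from Ideal.dvd_iff_le.mp (dvd_mul_right _ _))]
      · intro I hI
        have hle : I ≤ p.asIdeal := by
          by_contra h
          exact hI (if_neg h)
        obtain ⟨J, rfl⟩ := Ideal.dvd_iff_le.mpr hle
        exact ⟨J, rfl⟩
    simp only [map_mul, hp0] at h1
    rw [tsum_mul_left] at h1
    have hsum2 : Summable fun I => if I ≤ p.asIdeal then coprimeNormHom S hs0 I else 0 := by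
      refine Summable.of_nonneg_of_le (fun I => ?_) (fun I => ?_) hsum
      · split_ifs
        · exact coprimeNormHom_nonneg _ _ _
        · exact le_rfl
      · split_ifs
        · exact le_rfl
        · exact coprimeNormHom_nonneg _ _ _
    rw [mul_comm (∑' I, _), h1, ← hsum.tsum_sub hsum2]
    refine tsum_congr fun I => ?_
    rw [coprimeNormHom_apply, coprimeNormHom_apply]
    by_cases h1 : I ≤ p.asIdeal
    · rw [if_neg (fun h => h p (Finset.mem_insert_self _ _) h1), if_pos h1, sub_self]
    · rw [if_neg h1, sub_zero]
      congr 1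
      simp [h1]

/-- The nonzero ideals that are products of primes in `S`. -/
def supportedIdeals (S : Set (HeightOneSpectrum (𝓞 K))) : Set (Ideal (𝓞 K)) :=
  {I | I ≠ ⊥ ∧ ∀ p : HeightOneSpectrum (𝓞 K), I ≤ p.asIdeal → p ∈ S}

/-- The nonzero ideals that are prime to all primes in `S`. -/
def coprimeIdeals (S : Set (HeightOneSpectrum (𝓞 K))) : Set (Ideal (𝓞 K)) :=
  {I | I ≠ ⊥ ∧ ∀ p ∈ S, ¬ I ≤ p.asIdeal}

theorem isCoprime_of_forall {I J : Ideal (𝓞 K)} (hI : I ≠ ⊥)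
    (h : ∀ p : HeightOneSpectrum (𝓞 K), I ≤ p.asIdeal → ¬ J ≤ p.asIdeal) : IsCoprime I J := by
  rw [Ideal.isCoprime_iff_sup_eq]
  by_contra hne
  obtain ⟨P, hP, hle⟩ := Ideal.exists_le_maximal _ hne
  have hIP : I ≤ P := le_sup_left.trans hle
  have hP0 : P ≠ ⊥ := fun h' => hI (le_bot_iff.mp (h' ▸ hIP))
  exact h ⟨P, hP.isPrime, hP0⟩ hIP (le_sup_right.trans hle)

theorem isCoprime_of_mem {S : Set (HeightOneSpectrum (𝓞 K))} {I J : Ideal (𝓞 K)}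
    (hI : I ∈ supportedIdeals S) (hJ : J ∈ coprimeIdeals S) : IsCoprime I J :=
  isCoprime_of_forall hI.1 fun p hp => hJ.2 p (hI.2 p hp)

theorem exists_supported_mul_coprime (S : Set (HeightOneSpectrum (𝓞 K))) {I : Ideal (𝓞 K)}
    (hI : I ≠ ⊥) : ∃ I₁ ∈ supportedIdeals S, ∃ I₂ ∈ coprimeIdeals S, I₁ * I₂ = I := by
  induction I using UniqueFactorizationMonoid.induction_on_prime with
  | h₁ => exact absurd rfl hI
  | h₂ I h =>
    have h1 : ∀ p : HeightOneSpectrum (𝓞 K), ¬ (1 : Ideal (𝓞 K)) ≤ p.asIdeal := fun p h =>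
      p.isPrime.ne_top (top_le_iff.mp (by rwa [Ideal.one_eq_top] at h))
    refine ⟨1, ⟨one_ne_zero, fun p hp => absurd hp (h1 p)⟩, 1, ⟨one_ne_zero, fun p _ => h1 p⟩, ?_⟩
    rw [mul_one, isUnit_iff_eq_one.mp h]
  | h₃ I P hI0 hP ih =>
    obtain ⟨I₁, h₁, I₂, h₂, rfl⟩ := ih hI0
    by_cases hPS : (⟨P, Ideal.isPrime_of_prime hP, hP.ne_zero⟩ : HeightOneSpectrum (𝓞 K)) ∈ S
    · refine ⟨P * I₁, ⟨mul_ne_zero hP.ne_zero h₁.1, fun p hp => ?_⟩, I₂, h₂, mul_assoc _ _ _⟩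
      rcases p.isPrime.mul_le.mp hp with h | h
      · have : (⟨P, Ideal.isPrime_of_prime hP, hP.ne_zero⟩ : HeightOneSpectrum (𝓞 K)) = p :=
          HeightOneSpectrum.ext (((Ideal.isPrime_of_prime hP).isMaximal hP.ne_zero).eq_of_le
            p.isPrime.ne_top h)
        exact this ▸ hPS
      · exact h₁.2 p h
    · refine ⟨I₁, h₁, P * I₂, ⟨mul_ne_zero hP.ne_zero h₂.1, fun p hp h => ?_⟩, mul_left_comm _ _ _⟩
      rcases p.isPrime.mul_le.mp h with h | h
      · have : (⟨P, Ideal.isPrime_of_prime hP, hP.ne_zero⟩ : HeightOneSpectrum (𝓞 K)) = p :=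
          HeightOneSpectrum.ext (((Ideal.isPrime_of_prime hP).isMaximal hP.ne_zero).eq_of_le
            p.isPrime.ne_top h)
        exact hPS (this ▸ hp)
      · exact h₂.2 p hp h

theorem injective_supported_mul_coprime (S : Set (HeightOneSpectrum (𝓞 K))) :
    Function.Injective fun x : supportedIdeals S × coprimeIdeals S =>
      (x.1 : Ideal (𝓞 K)) * (x.2 : Ideal (𝓞 K)) := by
  have key : ∀ I ∈ supportedIdeals S, ∀ J ∈ coprimeIdeals S, ∀ I' ∈ supportedIdeals S,
      ∀ J' ∈ coprimeIdeals S, I * J = I' * J' → I ∣ I' ∧ J ∣ J' := by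
    intro I hI J hJ I' hI' J' hJ' h
    exact ⟨(isCoprime_of_mem hI hJ').dvd_of_dvd_mul_right (Dvd.intro _ h),
      (isCoprime_of_mem hI' hJ).symm.dvd_of_dvd_mul_left (Dvd.intro_left _ h)⟩
  rintro ⟨⟨I, hI⟩, ⟨J, hJ⟩⟩ ⟨⟨I', hI'⟩, ⟨J', hJ'⟩⟩ h
  obtain ⟨h1, h2⟩ := key I hI J hJ I' hI' J' hJ' h
  obtain ⟨h3, h4⟩ := key I' hI' J' hJ' I hI J hJ h.symm
  have h5 : I = I' := dvd_antisymm h1 h3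
  have h6 : J = J' := dvd_antisymm h2 h4
  subst h5 h6
  rfl

/-- Such ideals divide the product of the primes in `S`. Hence the sum over `𝔠₁` has finite support,
although infinitely many ideals are products of primes in `S`. -/
theorem finite_squarefree_supported {S : Set (HeightOneSpectrum (𝓞 K))} (hS : S.Finite) :
    {I | I ∈ supportedIdeals S ∧ Squarefree I}.Finite := by
  classical
  obtain ⟨Q, hQ⟩ : ∃ Q : Ideal (𝓞 K), Q = ∏ p ∈ hS.toFinset, p.asIdeal := ⟨_, rfl⟩
  have hQ0 : Q ≠ ⊥ := by
    rw [hQ]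
    exact Finset.prod_ne_zero_iff.mpr fun p _ => p.ne_bot
  have hQp : ∀ p ∈ S, Q ≤ p.asIdeal := fun p hp => by
    rw [hQ]
    exact Ideal.prod_le_inf.trans (Finset.inf_le (f := fun p : HeightOneSpectrum (𝓞 K) => p.asIdeal)
      (hS.mem_toFinset.mpr hp))
  refine (finite_dvd hQ0).subset fun I hI => ?_
  have hdvd : ∀ n (y : Ideal (𝓞 K)), I ∣ y ^ n → I ∣ y := hI.2.isRadical
  have hrad : I.radical ≤ I := by
    rintro x ⟨n, hn⟩
    have := hdvd n (Ideal.span {x}) (by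
      rw [Ideal.span_singleton_pow, Ideal.dvd_span_singleton]; exact hn)
    rwa [Ideal.dvd_span_singleton] at this
  refine Ideal.dvd_iff_le.mpr (le_trans ?_ hrad)
  rw [Ideal.radical_eq_sInf]
  refine le_sInf fun P ⟨hIP, hP⟩ => ?_
  have hP0 : P ≠ ⊥ := fun h' => hI.1.1 (le_bot_iff.mp (h' ▸ hIP))
  exact hQp _ (hI.1.2 ⟨P, hP, hP0⟩ hIP)

/-- The evaluation of `∑ μ(I) g(I)` for a function `g` that behaves like `N(I) ^ (-s)` away from a
finite set of primes. -/
theorem tsum_moebius_mul_eq {S : Set (HeightOneSpectrum (𝓞 K))} (hS : S.Finite) {s : ℕ} (hs : 1 < s)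
    (g : Ideal (𝓞 K) → ℝ) (hg : ∀ I ≠ ⊥, |g I| ≤ ((Ideal.absNorm I : ℝ) ^ s)⁻¹)
    (hmul : ∀ I ≠ ⊥, ∀ J ∈ coprimeIdeals S, g (I * J) = g I * ((Ideal.absNorm J : ℝ) ^ s)⁻¹) :
    ∑' I, (UniqueFactorizationMonoid.moebius I : ℝ) * g I =
      (∑ᶠ I ∈ supportedIdeals S, (UniqueFactorizationMonoid.moebius I : ℝ) * g I) *
        ((dedekindZeta K (s : ℂ)).re)⁻¹ *
        ∏ᶠ p ∈ S, (1 - ((Ideal.absNorm p.asIdeal : ℝ) ^ s)⁻¹)⁻¹ := by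
  classical
  have hs0 : s ≠ 0 := by omega
  have hsum := summable_absNorm_pow K hs
  have hμg : ∀ I : Ideal (𝓞 K), ‖(UniqueFactorizationMonoid.moebius I : ℝ) * g I‖ ≤
      ((Ideal.absNorm I : ℝ) ^ s)⁻¹ := by
    intro I
    by_cases hI : I = ⊥
    · rw [hI, ← Ideal.zero_eq_bot, UniqueFactorizationMonoid.moebius_zero]
      simp
    · rw [norm_mul, Real.norm_eq_abs, Real.norm_eq_abs]
      exact (mul_le_of_le_one_left (abs_nonneg _) (abs_moebius_le_one I)).trans (hg I hI)
  have hμN : ∀ I : Ideal (𝓞 K), ‖(UniqueFactorizationMonoid.moebius I : ℝ) *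
      ((Ideal.absNorm I : ℝ) ^ s)⁻¹‖ ≤ ((Ideal.absNorm I : ℝ) ^ s)⁻¹ := by
    intro I
    rw [norm_mul, Real.norm_eq_abs, Real.norm_of_nonneg (by positivity)]
    exact mul_le_of_le_one_left (by positivity) (abs_moebius_le_one I)
  -- Every nonzero ideal factors uniquely into a part supported on `S` and a part prime to `S`. Both
  -- `μ` and `g` respect this factorization, so the series is a product.
  have h1 : ∑' I, (UniqueFactorizationMonoid.moebius I : ℝ) * g I =
      (∑' I : supportedIdeals S, (UniqueFactorizationMonoid.moebius (I : Ideal (𝓞 K)) : ℝ) * g I) *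
      ∑' J : coprimeIdeals S, (UniqueFactorizationMonoid.moebius (J : Ideal (𝓞 K)) : ℝ) *
        ((Ideal.absNorm (J : Ideal (𝓞 K)) : ℝ) ^ s)⁻¹ := by
    rw [tsum_mul_tsum_of_summable_norm]
    · rw [← (injective_supported_mul_coprime S).tsum_eq]
      · refine tsum_congr fun x => ?_
        rw [hmul _ x.1.2.1 _ x.2.2, moebius_mul_of_isCoprime (isCoprime_of_mem x.1.2 x.2.2)]
        push_cast
        ring
      · intro I hI
        have hI0 : I ≠ ⊥ := by
          rintro rfl
          apply hI
          simp only
          rw [← Ideal.zero_eq_bot, UniqueFactorizationMonoid.moebius_zero]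
          simp
        obtain ⟨I₁, h₁, I₂, h₂, h⟩ := exists_supported_mul_coprime S hI0
        exact ⟨(⟨I₁, h₁⟩, ⟨I₂, h₂⟩), h⟩
    · exact (Summable.of_nonneg_of_le (fun _ => norm_nonneg _) hμg hsum).subtype _
    · exact (Summable.of_nonneg_of_le (fun _ => norm_nonneg _) hμN hsum).subtype _
  have h2 : ∑' I : supportedIdeals S, (UniqueFactorizationMonoid.moebius (I : Ideal (𝓞 K)) : ℝ) *
      g I = ∑ᶠ I ∈ supportedIdeals S, (UniqueFactorizationMonoid.moebius I : ℝ) * g I := by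
    rw [tsum_subtype (supportedIdeals S)
      (fun I => (UniqueFactorizationMonoid.moebius I : ℝ) * g I), finsum_mem_def]
    refine tsum_eq_finsum ((finite_squarefree_supported hS).subset fun I hI => ?_)
    rw [Function.mem_support, Set.indicator_apply_ne_zero] at hI
    refine ⟨hI.1, ?_⟩
    by_contra hsq
    apply hI.2
    simp [UniqueFactorizationMonoid.moebius_of_not_squarefree hsq]
  have h3 : ∑' J : coprimeIdeals S, (UniqueFactorizationMonoid.moebius (J : Ideal (𝓞 K)) : ℝ) *
        ((Ideal.absNorm (J : Ideal (𝓞 K)) : ℝ) ^ s)⁻¹ =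
      ∑' J, (UniqueFactorizationMonoid.moebius J : ℝ) * coprimeNormHom hS.toFinset hs0 J := by
    rw [tsum_subtype (coprimeIdeals S) (fun J => (UniqueFactorizationMonoid.moebius J : ℝ) *
        ((Ideal.absNorm J : ℝ) ^ s)⁻¹)]
    refine tsum_congr fun J => ?_
    by_cases hJ0 : J = ⊥
    · subst hJ0
      rw [Set.indicator_of_notMem fun h => h.1 rfl]
      rw [← Ideal.zero_eq_bot, map_zero, mul_zero]
    · rw [coprimeNormHom_apply]
      by_cases hJ : J ∈ coprimeIdeals S
      · rw [Set.indicator_of_mem hJ, if_pos fun p hp => hJ.2 p (hS.mem_toFinset.mp hp)]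
      · rw [Set.indicator_of_notMem hJ, if_neg, mul_zero]
        exact fun h => hJ ⟨hJ0, fun p hp => h p (hS.mem_toFinset.mpr hp)⟩
  have h4 := tsum_moebius_mul_tsum (coprimeNormHom hS.toFinset hs0)
    ((summable_coprimeNormHom hS.toFinset hs).congr fun I =>
      (Real.norm_of_nonneg (coprimeNormHom_nonneg _ _ I)).symm)
  rw [tsum_coprimeNormHom _ hs, ← dedekindZeta_re K hs] at h4
  rw [h1, h2, h3, eq_inv_of_mul_eq_one_left h4, mul_inv, ← mul_assoc,
    finprod_mem_eq_finite_toFinset_prod _ hS, Finset.prod_inv_distrib]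

end Zeta

/-! ### Counting the vectors of the lattices in the archimedean regions -/

section LatticeEstimate

variable {m : ℕ} {K : Type*} [Field K] [NumberField K] {w u : Fin m → ℕ+}

open scoped Classical in
/-- A nonzero ideal contains a nonzero element which is small at all infinite places. -/
theorem exists_small_mem (K : Type*) [Field K] [NumberField K] :
    ∃ C : ℝ, 0 < C ∧ ∀ I : Ideal (𝓞 K), I ≠ ⊥ → ∃ α ∈ I, α ≠ 0 ∧ ∀ v : InfinitePlace K,
      v (α : K) ≤ C * (Ideal.absNorm I : ℝ) ^ (1 / (Module.finrank ℚ K : ℝ)) := by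
  set V := (volume (ZSpan.fundamentalDomain (mixedEmbedding.latticeBasis K))) *
    (2 : ENNReal) ^ (Module.finrank ℝ (mixedEmbedding.mixedSpace K)) with hV
  have hVt : V ≠ ⊤ := ENNReal.mul_ne_top
    (ZSpan.fundamentalDomain_isBounded _).measure_lt_top.ne (ENNReal.pow_ne_top ENNReal.ofNat_ne_top)
  have hN : Module.finrank ℚ K ≠ 0 := Module.finrank_pos.ne'
  -- With `f = (V + 1) n^(1/N)` one has `f^N = (V + 1)^N n > V n`, the strict inequality required by
  -- Minkowski's theorem.
  refine ⟨V.toReal + 1, by positivity, fun I hI => ?_⟩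
  set n : ℝ := (Ideal.absNorm I : ℝ) with hn
  have hn0 : 0 < n := by
    rw [hn, Nat.cast_pos]
    exact Nat.pos_of_ne_zero (by rwa [Ne, Ideal.absNorm_eq_zero_iff])
  set f : ℝ := (V.toReal + 1) * n ^ (1 / (Module.finrank ℚ K : ℝ)) with hf
  have hf0 : 0 ≤ f := by positivity
  have hfN : f ^ Module.finrank ℚ K = (V.toReal + 1) ^ Module.finrank ℚ K * n := by
    rw [hf, mul_pow, one_div, Real.rpow_inv_natCast_pow hn0.le hN]
  let J : (FractionalIdeal (𝓞 K)⁰ K)ˣ :=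
    FractionalIdeal.mk0 K ⟨I, mem_nonZeroDivisors_of_ne_zero hI⟩
  have hJ : (J : FractionalIdeal (𝓞 K)⁰ K) = (I : FractionalIdeal (𝓞 K)⁰ K) := rfl
  have hlt : mixedEmbedding.minkowskiBound K J <
      volume (mixedEmbedding.convexBodyLT K fun _ => Real.toNNReal f) := by
    rw [mixedEmbedding.minkowskiBound,
      mixedEmbedding.volume_fundamentalDomain_fractionalIdealLatticeBasis, mul_assoc, ← hV,
      mixedEmbedding.convexBodyLT_volume, hJ, FractionalIdeal.coeIdeal_absNorm,
      Finset.prod_pow_eq_pow_sum, InfinitePlace.sum_mult_eq]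
    have h1 : ENNReal.ofReal (((Ideal.absNorm I : ℕ) : ℚ) : ℝ) * V = ENNReal.ofReal (n * V.toReal) := by
      rw [ENNReal.ofReal_mul hn0.le, ENNReal.ofReal_toReal hVt, hn]
      push_cast
      rfl
    have h2 : ((Real.toNNReal f : NNReal) : ENNReal) ^ Module.finrank ℚ K =
        ENNReal.ofReal (f ^ Module.finrank ℚ K) := by
      rw [ENNReal.ofReal_pow hf0]; rfl
    rw [h1]
    refine lt_of_lt_of_le ?_ (le_mul_of_one_le_left' (a := ENNReal.ofReal (f ^ Module.finrank ℚ K))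
      (b := (mixedEmbedding.convexBodyLTFactor K : ENNReal)) (by
        exact_mod_cast mixedEmbedding.one_le_convexBodyLTFactor K) |>.trans (le_of_eq ?_))
    · rw [ENNReal.ofReal_lt_ofReal_iff (by rw [hfN]; positivity), hfN, mul_comm]
      refine mul_lt_mul_of_pos_right ?_ hn0
      refine lt_of_lt_of_le (lt_add_one _) (le_self_pow₀ ?_ hN)
      linarith [ENNReal.toReal_nonneg (a := V)]
    · rw [← h2]
      norm_cast
  obtain ⟨x, hx, hx0, hxv⟩ := mixedEmbedding.exists_ne_zero_mem_ideal_lt K J hlt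
  rw [hJ, FractionalIdeal.mem_coeIdeal] at hx
  obtain ⟨α, hα, rfl⟩ := hx
  exact ⟨α, hα, fun h => hx0 (by rw [h, map_zero]), fun v => (hxv v).le.trans_eq (Real.coe_toNNReal f hf0)⟩

theorem norm_coordAt_embVec (v : InfinitePlace K) (x : Fin m → K) (i : Fin m) :
    ‖coordAt v (embVec x) i‖ = v (x i) := by
  rw [coordAt_embVec, InfinitePlace.norm_embedding_eq]

/-- The norm of an ideal `I` is bounded by the size of the nonzero vectors in `I ^ w`. -/
theorem absNorm_le_prod_wnorm {I : Ideal (𝓞 K)} {x : Fin m → K}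
    (hx : x ∈ latticeOf fun i => I ^ (w i : ℕ)) (hx0 : x ≠ 0) :
    (Ideal.absNorm I : ℝ) ≤ ∏ v : InfinitePlace K, wnorm w (coordAt v (embVec x)) ^ v.mult := by
  obtain ⟨i, hi⟩ := Function.ne_iff.mp hx0
  have h := (mem_latticeOf _ _).mp hx i
  rw [FractionalIdeal.mem_coeIdeal] at h
  obtain ⟨y, hy, hyx⟩ := h
  have hy0 : y ≠ 0 := by
    rintro rfl
    exact hi (by rw [← hyx, map_zero]; rfl)
  -- A nonzero coordinate `x_i` lies in `I ^ w_i`, so `N(I) ^ w_i` divides its norm, which is in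
  -- turn at most the `w_i`-th power of the product of the weighted norms.
  have h1 : Ideal.absNorm I ^ (w i : ℕ) ≤ (Algebra.norm ℤ y).natAbs := by
    rw [← map_pow, ← Ideal.absNorm_span_singleton]
    refine Nat.le_of_dvd (Nat.pos_of_ne_zero ?_) (Ideal.absNorm_dvd_absNorm_of_le
      ((Ideal.span_singleton_le_iff_mem _).mpr hy))
    rwa [Ne, Ideal.absNorm_eq_zero_iff, Ideal.span_singleton_eq_bot]
  have h2 : ((Algebra.norm ℤ y).natAbs : ℝ) = ∏ v : InfinitePlace K, v (x i) ^ v.mult := by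
    rw [InfinitePlace.prod_eq_abs_norm, ← hyx, Nat.cast_natAbs, ← Algebra.coe_norm_int]
    push_cast
    rfl
  have h3 : (Ideal.absNorm I : ℝ) ^ (w i : ℕ) ≤
      (∏ v : InfinitePlace K, wnorm w (coordAt v (embVec x)) ^ v.mult) ^ (w i : ℕ) := by
    calc (Ideal.absNorm I : ℝ) ^ (w i : ℕ) ≤ ((Algebra.norm ℤ y).natAbs : ℝ) := by exact_mod_cast h1
      _ = ∏ v : InfinitePlace K, v (x i) ^ v.mult := h2
      _ ≤ ∏ v : InfinitePlace K, (wnorm w (coordAt v (embVec x)) ^ v.mult) ^ (w i : ℕ) := by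
        refine Finset.prod_le_prod (fun v _ => by positivity) fun v _ => ?_
        rw [← pow_mul, mul_comm, pow_mul]
        refine pow_le_pow_left₀ (apply_nonneg _ _) ?_ _
        rw [← norm_coordAt_embVec]
        exact norm_le_wnorm_pow w _ i
      _ = _ := by rw [Finset.prod_pow]
  exact le_of_pow_le_pow_left₀ (w i).ne_zero
    (Finset.prod_nonneg fun v _ => pow_nonneg (wnorm_nonneg _ _) _) h3

/-- Together with `absNorm_le_prod_wnorm` this shows that no ideal `𝔠` with `N(𝔠) > A t^N`
contributes to the Möbius sum. -/
theorem Morphism.exists_prod_wnorm_le (φ : Morphism K w u) (he : 0 < φ.e) [NeZero m]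
    (b : Module.Basis (Fin (Units.rank K)) ℤ (unitLogLattice K)) :
    ∃ A : ℝ, 0 < A ∧ ∀ t : ℝ, 0 < t → ∀ z ∈ φ.archB b (t ^ (φ.e * Module.finrank ℚ K)),
      ∏ v : InfinitePlace K, wnorm w (coordAt v z) ^ v.mult ≤ A * t ^ Module.finrank ℚ K := by
  obtain ⟨R, E, hR, hE, h⟩ := φ.exists_bounds_of_mem_archB_one he b
  refine ⟨(R * E) ^ Module.finrank ℚ K, by positivity, fun t ht z hz => ?_⟩
  obtain ⟨r, hr, hrR, hrv⟩ := h _ ((φ.mem_archB_iff_flow he b ht z).mp hz)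
  rw [← mul_pow, ← prod_const_pow_mult]
  refine Finset.prod_le_prod (fun v _ => pow_nonneg (wnorm_nonneg _ _) _) fun v _ =>
    pow_le_pow_left₀ (wnorm_nonneg _ _) ?_ _
  have h1 := (hrv v).2
  rw [wnorm_coordAt_flow w (fun _ => t⁻¹) v (inv_pos.mpr ht).le, inv_mul_le_iff₀ ht] at h1
  calc wnorm w (coordAt v z) ≤ t * (r * E) := h1
    _ ≤ t * (R * E) := by gcongr
    _ = R * E * t := mul_comm _ _

/-- The vectors in the lattice attached to `𝔡` and `𝔠` that lie in the region of parameter `t`. -/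
def Morphism.regionSet {φ : Morphism K w u} {𝔞 : Ideal (𝓞 K)}
    (M : φ.CongruenceData (𝔞 : FractionalIdeal (𝓞 K)⁰ K))
    (b : Module.Basis (Fin (Units.rank K)) ℤ (unitLogLattice K)) (𝔡 : FractionalIdeal (𝓞 K)⁰ K)
    (𝔠 : Ideal (𝓞 K)) (t : ℝ) : Set (Fin m → K) :=
  M.divisibleSet 𝔡 𝔠 ∩ embVec ⁻¹' φ.archB b (t ^ (φ.e * Module.finrank ℚ K))

/-- The factor `ν` takes care of the fixed modulus and `α ^ w_i` of the variable ideal, so the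
elements have the right weighted size with one `α` for all coordinates. -/
theorem Morphism.CongruenceData.mul_pow_mem_modulusIdeal {φ : Morphism K w u} {𝔞 : Ideal (𝓞 K)}
    (M : φ.CongruenceData (𝔞 : FractionalIdeal (𝓞 K)⁰ K)) {𝔠 : Ideal (𝓞 K)} {ν α : 𝓞 K} {i : Fin m}
    (hν : ν ∈ 𝔞 ^ (w i : ℕ) * M.conductor i) (hα : α ∈ 𝔠) :
    ν * α ^ (w i : ℕ) ∈ M.modulusIdeal 𝔠 i := by
  have h1 : 𝔞 ^ (w i : ℕ) * M.conductor i ≤ 𝔞 ^ (w i : ℕ) := Ideal.dvd_iff_le.mp (dvd_mul_right _ _)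
  refine Submodule.mem_inf.mpr ⟨Ideal.mul_mem_right _ _ hν, ?_⟩
  rw [mul_pow]
  exact Ideal.mul_mem_mul (h1 hν) (Ideal.pow_mem_pow hα _)

/-- Finitely many nonzero ideals have a common nonzero element. -/
theorem exists_mem_forall {J : Fin m → Ideal (𝓞 K)} (hJ : ∀ i, J i ≠ 0) :
    ∃ ν : 𝓞 K, ν ≠ 0 ∧ ∀ i, ν ∈ J i := by
  have h0 : ∏ i, J i ≠ 0 := Finset.prod_ne_zero_iff.mpr fun i _ => hJ i
  generalize hP : ∏ i, J i = P at h0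
  obtain ⟨ν, hν, hν0⟩ := Submodule.exists_mem_ne_zero_of_ne_bot (p := P) h0
  refine ⟨ν, hν0, fun i => ?_⟩
  have h1 : P ≤ J i := by
    rw [← hP]
    exact Ideal.prod_le_inf.trans (Finset.inf_le (f := J) (Finset.mem_univ i))
  exact h1 hν

/-- The ideals defining the modulus at `𝔠` contain elements of the expected size. -/
theorem Morphism.CongruenceData.exists_small_mem_modulusIdeal {φ : Morphism K w u}
    {𝔞 : Ideal (𝓞 K)} (h𝔞 : 𝔞 ≠ ⊥) (M : φ.CongruenceData (𝔞 : FractionalIdeal (𝓞 K)⁰ K))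
    {D : ℝ} (hD : 0 < D) :
    ∃ B : ℝ, 0 < B ∧ ∀ 𝔠 : Ideal (𝓞 K), 𝔠 ≠ ⊥ → ∃ a : Fin m → 𝓞 K, (∀ i, a i ≠ 0) ∧
      (∀ i, a i ∈ M.modulusIdeal 𝔠 i) ∧ ∀ (v : InfinitePlace K) (i : Fin m),
        D * v (a i : K) ≤
          (B * (Ideal.absNorm 𝔠 : ℝ) ^ (1 / (Module.finrank ℚ K : ℝ))) ^ (w i : ℕ) := by
  obtain ⟨C₁, hC₁, hsmall⟩ := exists_small_mem K
  obtain ⟨ν, hν0, hνi⟩ := exists_mem_forall fun i => mul_ne_zero (pow_ne_zero (w i : ℕ) h𝔞)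
    (M.conductor_ne_bot i)
  set V : ℝ := ∑ v : InfinitePlace K, v (ν : K) with hV
  have hVv : ∀ v : InfinitePlace K, v (ν : K) ≤ V := fun v =>
    Finset.single_le_sum (f := fun v : InfinitePlace K => v (ν : K)) (fun v _ => apply_nonneg v _)
      (Finset.mem_univ v)
  have hV0 : 0 ≤ V := Finset.sum_nonneg fun v _ => apply_nonneg v _
  refine ⟨(1 + D * V) * C₁, by positivity, fun 𝔠 h𝔠 => ?_⟩
  set q : ℝ := (Ideal.absNorm 𝔠 : ℝ) ^ (1 / (Module.finrank ℚ K : ℝ)) with hq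
  have hq0 : 0 ≤ q := by positivity
  obtain ⟨α, hα, hα0, hαv⟩ := hsmall 𝔠 h𝔠
  refine ⟨fun i => ν * α ^ (w i : ℕ), fun i => mul_ne_zero hν0 (pow_ne_zero _ hα0),
    fun i => M.mul_pow_mem_modulusIdeal (hνi i) hα, fun v i => ?_⟩
  have h0 : ((ν * α ^ (w i : ℕ) : 𝓞 K) : K) = (ν : K) * (α : K) ^ (w i : ℕ) := by push_cast; rfl
  rw [h0, map_mul, map_pow, ← mul_assoc]
  -- The constant factor is absorbed into a `w_i`-th power, so that a single `B` bounds all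
  -- coordinates in the weighted sense.
  have h1 : D * v (ν : K) ≤ (1 + D * V) ^ (w i : ℕ) := by
    have h2 : D * v (ν : K) ≤ D * V := mul_le_mul_of_nonneg_left (hVv v) hD.le
    have h3 : 1 + D * V ≤ (1 + D * V) ^ (w i : ℕ) :=
      le_self_pow₀ (by linarith [mul_nonneg hD.le hV0]) (w i).ne_zero
    linarith
  calc D * v (ν : K) * v (α : K) ^ (w i : ℕ)
      ≤ (1 + D * V) ^ (w i : ℕ) * (C₁ * q) ^ (w i : ℕ) :=
        mul_le_mul h1 (pow_le_pow_left₀ (apply_nonneg _ _) (hαv v) _)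
          (by positivity) (by positivity)
    _ = ((1 + D * V) * C₁ * q) ^ (w i : ℕ) := by rw [← mul_pow, mul_assoc]

-- The lattice contains boxes of weighted size `ρ = B N(𝔠)^(1/N)`, so the boundary neighbourhood has
-- volume `O(ρ^a t^(N|w| - a))`, and the density contributes at most `N(𝔠)^(-|w|)`. The constants
-- `A` and `C` depend on neither `𝔡`, `t` nor `𝔠`, as the summation over `𝔠` demands.
open scoped Classical in
theorem Morphism.exists_regionSet_estimate (φ : Morphism K w u) (he : 0 < φ.e) [NeZero m]
    (b : Module.Basis (Fin (Units.rank K)) ℤ (unitLogLattice K)) {a : ℕ}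
    (haw : ∀ i, a ≤ w i) (ha : a < Module.finrank ℚ K * totalWeight w)
    {𝔞 : Ideal (𝓞 K)} (h𝔞 : 𝔞 ≠ ⊥) (M : φ.CongruenceData (𝔞 : FractionalIdeal (𝓞 K)⁰ K)) :
    ∃ A C : ℝ, 0 < A ∧ 0 ≤ C ∧ ∀ 𝔡 ∈ φ.discrepancyIdeals, ∀ t : ℝ, 0 < t →
      ∀ 𝔠 : Ideal (𝓞 K), 𝔠 ≠ ⊥ →
      (regionSet M b 𝔡 𝔠 t).Finite ∧
      (A * t ^ Module.finrank ℚ K < Ideal.absNorm 𝔠 → regionSet M b 𝔡 𝔠 t = ∅) ∧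
      ((Ideal.absNorm 𝔠 : ℝ) ≤ A * t ^ Module.finrank ℚ K →
        |((regionSet M b 𝔡 𝔠 t).ncard : ℝ) * covol K ^ m - M.density 𝔡 𝔠 *
          (t ^ (Module.finrank ℚ K * totalWeight w) * (φ.archVolume b).toReal)| ≤
        C * ((Ideal.absNorm 𝔠 : ℝ) ^ totalWeight w)⁻¹ *
          ((Ideal.absNorm 𝔠 : ℝ) ^ (1 / (Module.finrank ℚ K : ℝ))) ^ a *
          t ^ (Module.finrank ℚ K * totalWeight w - a)) := by
  obtain ⟨A, hA, hAt⟩ := φ.exists_prod_wnorm_le he b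
  obtain ⟨D, hD, hcount⟩ := CongruenceData.exists_count_divisibleSet m K
  have hN : Module.finrank ℚ K ≠ 0 := Module.finrank_pos.ne'
  obtain ⟨B, hB0, hsmall⟩ := M.exists_small_mem_modulusIdeal h𝔞 hD
  set κ : ℝ := B * A ^ (1 / (Module.finrank ℚ K : ℝ)) with hκ
  obtain ⟨C₂, hC₂, hcover⟩ := φ.exists_boundary_cover he b haw ha κ
  refine ⟨A, C₂ * B ^ a, hA, by positivity, fun 𝔡 h𝔡 t ht 𝔠 h𝔠 => ?_⟩
  have hempty : A * t ^ Module.finrank ℚ K < Ideal.absNorm 𝔠 → regionSet M b 𝔡 𝔠 t = ∅ := by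
    intro hlt
    rw [Set.eq_empty_iff_forall_notMem]
    rintro x ⟨hx, hxB⟩
    have hx0 : x ≠ 0 := by
      rintro rfl
      obtain ⟨i, hi⟩ := hxB.1.1 (Classical.arbitrary _)
      exact hi (by simp [embVec])
    have h1 := absNorm_le_prod_wnorm (M.divisibleSet_subset 𝔡 𝔠 hx) hx0
    have h2 := hAt t ht _ hxB
    have h3 : (Ideal.absNorm 𝔠 : ℝ) ≤ Ideal.absNorm (𝔞 * 𝔠) := by
      rw [map_mul]
      exact_mod_cast Nat.le_mul_of_pos_left _
        (Nat.pos_of_ne_zero (by rwa [Ne, Ideal.absNorm_eq_zero_iff]))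
    linarith
  by_cases hle : (Ideal.absNorm 𝔠 : ℝ) ≤ A * t ^ Module.finrank ℚ K
  · set n : ℝ := (Ideal.absNorm 𝔠 : ℝ) with hn
    have hn0 : 0 < n := by
      rw [hn, Nat.cast_pos]
      exact Nat.pos_of_ne_zero (by rwa [Ne, Ideal.absNorm_eq_zero_iff])
    set q : ℝ := n ^ (1 / (Module.finrank ℚ K : ℝ)) with hq
    have hq0 : 0 < q := by positivity
    obtain ⟨y, hy0, hy, hbound⟩ := hsmall 𝔠 h𝔠
    -- The boundary estimate requires `ρ ≤ κ t`; with `κ = B A^(1/N)` this follows from `N(𝔠) ≤ A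
    -- t^N`, the range in which the region can contain points.
    have hρκ : B * q ≤ κ * t := by
      rw [hκ, mul_assoc B _ t]
      refine mul_le_mul_of_nonneg_left ?_ hB0.le
      have h1 : q ≤ (A * t ^ Module.finrank ℚ K) ^ (1 / (Module.finrank ℚ K : ℝ)) :=
        Real.rpow_le_rpow hn0.le hle (by positivity)
      rwa [Real.mul_rpow hA.le (by positivity), one_div, Real.pow_rpow_inv_natCast ht.le hN,
        ← one_div] at h1
    obtain ⟨U, hUm, hUv, hU⟩ := hcover t (B * q) ht (by positivity) hρκ
    have hvol : volume (φ.archB b (t ^ (φ.e * Module.finrank ℚ K))) ≠ ⊤ := by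
      rw [φ.volume_archB he b ht]
      exact ENNReal.mul_ne_top ENNReal.ofReal_ne_top (φ.archVolume_ne_top he b)
    obtain ⟨hfin, hest⟩ := hcount M h𝔞 h𝔡 h𝔠 y hy0 hy
      (φ.measurableSet_archB he b ht) hUm hvol (ne_top_of_le_ne_top ENNReal.ofReal_ne_top hUv)
      (fun z hz z' hz' z'' h1 h2 => hU z hz z' hz' z''
        (fun v i => (h1 v i).trans (hbound v i)) (fun v i => (h2 v i).trans (hbound v i)))
    refine ⟨hfin, hempty, fun _ => ?_⟩
    rw [φ.volume_archB he b ht, ENNReal.toReal_mul, ENNReal.toReal_ofReal (by positivity)] at hest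
    refine hest.trans ?_
    have hUr : (volume U).toReal ≤ C₂ * (B * q) ^ a * t ^ (Module.finrank ℚ K * totalWeight w - a) :=
      ENNReal.toReal_le_of_le_ofReal (by positivity) hUv
    calc M.density 𝔡 𝔠 * (volume U).toReal
        ≤ (n ^ totalWeight w)⁻¹ *
          (C₂ * (B * q) ^ a * t ^ (Module.finrank ℚ K * totalWeight w - a)) :=
          mul_le_mul (M.density_le h𝔞 𝔡 h𝔠) hUr ENNReal.toReal_nonneg (by positivity)
      _ = _ := by rw [mul_pow]; ring
  · have h := hempty (not_le.mp hle)
    exact ⟨by rw [h]; exact Set.finite_empty, hempty, fun h => absurd h hle⟩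

end LatticeEstimate

/-! ### Orbits of the unit group -/

section Orbits

open NumberField.InfinitePlace NumberField.Units

variable {m : ℕ} {K : Type*} [Field K] [NumberField K] {w u : Fin m → ℕ+}

/-- The units of the ring of integers as elements of `Kˣ`. -/
def unitHom (K : Type*) [Field K] [NumberField K] : (𝓞 K)ˣ →* Kˣ :=
  Units.map (algebraMap (𝓞 K) K : 𝓞 K →* K)

theorem unitHom_injective : Function.Injective (unitHom K) :=
  Units.map_injective RingOfIntegers.coe_injective

theorem mem_range_unitHom_of_spanSingleton {c : Kˣ}
    (hc : FractionalIdeal.spanSingleton (𝓞 K)⁰ (c : K) = 1) : ∃ ε, unitHom K ε = c := by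
  have h1 : (c : K) ∈ (1 : FractionalIdeal (𝓞 K)⁰ K) := by
    rw [← hc]
    exact FractionalIdeal.mem_spanSingleton_self _ _
  have h2 : ((c⁻¹ : Kˣ) : K) ∈ (1 : FractionalIdeal (𝓞 K)⁰ K) := by
    have : FractionalIdeal.spanSingleton (𝓞 K)⁰ ((c⁻¹ : Kˣ) : K) = 1 := by
      rw [Units.val_inv_eq_inv_val, ← FractionalIdeal.spanSingleton_inv, hc, inv_one]
    rw [← this]
    exact FractionalIdeal.mem_spanSingleton_self _ _
  rw [FractionalIdeal.mem_one_iff] at h1 h2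
  obtain ⟨x, hx⟩ := h1
  obtain ⟨y, hy⟩ := h2
  have hxy : x * y = 1 := by
    apply RingOfIntegers.coe_injective
    rw [map_mul, hx, hy, map_one, Units.mul_inv]
  exact ⟨⟨x, y, hxy, by rw [mul_comm, hxy]⟩, Units.ext hx⟩

theorem spanSingleton_unitHom (ε : (𝓞 K)ˣ) :
    FractionalIdeal.spanSingleton (𝓞 K)⁰ (unitHom K ε : K) = 1 := by
  refine le_antisymm ?_ ?_
  · rw [FractionalIdeal.spanSingleton_le_iff_mem, FractionalIdeal.mem_one_iff]
    exact ⟨ε, rfl⟩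
  · rw [FractionalIdeal.one_le]
    rw [FractionalIdeal.mem_spanSingleton]
    refine ⟨((ε⁻¹ : (𝓞 K)ˣ) : 𝓞 K), ?_⟩
    rw [Algebra.smul_def]
    exact (map_mul (algebraMap (𝓞 K) K) _ _).symm.trans (by rw [Units.inv_mul, map_one])

theorem logNorm_embVec_act (c : Kˣ) (x : Punctured m K) (v : InfinitePlace K) :
    logNorm w v (embVec (act w c x).1) = Real.log (v (c : K)) + logNorm w v (embVec x.1) := by
  have h : coordAt v (embVec (act w c x).1) =
      fun i => (v.embedding (c : K)) ^ (w i : ℕ) * coordAt v (embVec x.1) i := by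
    rw [coordAt_embVec, coordAt_embVec]
    ext i
    simp [act]
  have h2 : 0 < wnorm w (coordAt v (embVec x.1)) := by
    rw [wnorm_pos_iff, coordAt_embVec]
    obtain ⟨i, hi⟩ := Function.ne_iff.mp x.2
    exact Function.ne_iff.mpr ⟨i, by simpa using hi⟩
  rw [logNorm, h, wnorm_act, InfinitePlace.norm_embedding_eq, Real.log_mul (by simp) h2.ne', logNorm]

theorem embVec_mem_archPunctured (x : Punctured m K) : embVec x.1 ∈ archPunctured m K := by
  intro v
  obtain ⟨i, hi⟩ := Function.ne_iff.mp x.2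
  refine ⟨i, ?_⟩
  simpa [embVec] using hi

section

variable [NeZero m] (b : Module.Basis (Fin (Units.rank K)) ℤ (unitLogLattice K))

theorem hyperplaneProj_of_sum_eq_zero {y : InfinitePlace K → ℝ} (hy : ∑ v, y v = 0) :
    hyperplaneProj y = y := by
  ext v
  simp [hyperplaneProj, hy]

theorem logCoord_embVec_act (ε : (𝓞 K)ˣ) (x : Punctured m K) (j : Fin (Units.rank K)) :
    logCoord w b (embVec (act w (unitHom K ε) x).1) j =
      unitCoord b (logUnits K (Additive.ofMul ε)) j + logCoord w b (embVec x.1) j := by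
  have h1 : eta w (embVec (act w (unitHom K ε) x).1) =
      logUnits K (Additive.ofMul ε) + eta w (embVec x.1) := by
    ext v
    rw [Pi.add_apply, eta_eq, eta_eq, logNorm_embVec_act, logUnits_apply, mul_add]
    rfl
  have h2 : hyperplaneProj (logUnits K (Additive.ofMul ε) + eta w (embVec x.1)) =
      logUnits K (Additive.ofMul ε) + hyperplaneProj (eta w (embVec x.1)) := by
    have h3 := hyperplaneProj_of_sum_eq_zero
      (sum_eq_zero_of_mem_unitLogLattice (K := K) ⟨Additive.ofMul ε, rfl⟩)
    conv_rhs => rw [← h3]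
    ext v
    simp only [hyperplaneProj, Pi.add_apply, Finset.sum_add_distrib]
    ring
  rw [logCoord, h1, h2, map_add, Pi.add_apply, logCoord]

theorem unitCoord_of_mem {y : InfinitePlace K → ℝ} (hy : y ∈ unitLogLattice K)
    (j : Fin (Units.rank K)) : unitCoord b y j = (b.repr ⟨y, hy⟩ j : ℝ) := by
  have h2 := congrArg Subtype.val (b.sum_repr ⟨y, hy⟩)
  rw [AddSubgroup.val_finsetSum] at h2
  have h3 : ∑ j, (b.repr ⟨y, hy⟩ j : ℝ) • (b j : InfinitePlace K → ℝ) = y := by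
    refine Eq.trans (Finset.sum_congr rfl fun j _ => ?_) h2
    rw [AddSubgroup.coe_zsmul, Int.cast_smul_eq_zsmul]
  conv_lhs => rw [← h3]
  rw [unitCoord_sum]

/-- The kernel of the logarithmic map consists of the roots of unity, and the coordinates determine
the logarithms because these have sum zero. -/
theorem mem_torsion_iff_unitCoord (ε : (𝓞 K)ˣ) :
    ε ∈ torsion K ↔ ∀ j, unitCoord b (logUnits K (Additive.ofMul ε)) j = 0 := by
  have hsum := sum_eq_zero_of_mem_unitLogLattice (K := K) (y := logUnits K (Additive.ofMul ε))
    ⟨Additive.ofMul ε, rfl⟩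
  rw [mem_torsion]
  constructor
  · intro h j
    have : logUnits K (Additive.ofMul ε) = 0 := by
      ext v
      rw [logUnits_apply, h v, Real.log_one, mul_zero]
      rfl
    rw [this, map_zero]
    rfl
  · intro h v
    have h0 := sum_unitCoord b hsum
    have h1 : logUnits K (Additive.ofMul ε) = 0 := by
      rw [← h0]
      exact Finset.sum_eq_zero fun j _ => by rw [h j, zero_smul]
    have h2 := congrFun h1 v
    rw [logUnits_apply, Pi.zero_apply, mul_eq_zero] at h2
    have hmult : (v.mult : ℝ) ≠ 0 := by exact_mod_cast v.mult_ne_zero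
    have h3 := h2.resolve_left hmult
    exact Real.eq_one_of_pos_of_log_eq_zero (InfinitePlace.pos_iff.mpr (by simp)) h3

/-- Every orbit of the unit group meets the fundamental domain. -/
theorem exists_unit_logCoord (x : Punctured m K) : ∃ ε : (𝓞 K)ˣ, ∀ j,
    0 ≤ logCoord w b (embVec (act w (unitHom K ε) x).1) j ∧
      logCoord w b (embVec (act w (unitHom K ε) x).1) j < 1 := by
  -- The unit whose logarithm subtracts the integral parts of the coordinates.
  set y : unitLogLattice K := ∑ j, (-⌊logCoord w b (embVec x.1) j⌋) • b j with hy
  obtain ⟨ε, hε⟩ := y.2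
  obtain ⟨ε, rfl⟩ := Additive.ofMul.surjective ε
  refine ⟨ε, fun j => ?_⟩
  have hrepr : b.repr y j = -⌊logCoord w b (embVec x.1) j⌋ := by
    rw [hy, b.repr_sum_self]
  rw [logCoord_embVec_act, hε, unitCoord_of_mem b y.2, Subtype.coe_eta, hrepr]
  push_cast
  constructor
  · linarith [Int.floor_le (logCoord w b (embVec x.1) j)]
  · linarith [Int.lt_floor_add_one (logCoord w b (embVec x.1) j)]

/-- A unit that maps a point of the fundamental domain into it is a root of unity. -/
theorem mem_torsion_of_logCoord {x : Punctured m K} {ε : (𝓞 K)ˣ}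
    (hx : ∀ j, 0 ≤ logCoord w b (embVec x.1) j ∧ logCoord w b (embVec x.1) j < 1)
    (hεx : ∀ j, 0 ≤ logCoord w b (embVec (act w (unitHom K ε) x).1) j ∧
      logCoord w b (embVec (act w (unitHom K ε) x).1) j < 1) : ε ∈ torsion K := by
  rw [mem_torsion_iff_unitCoord b]
  intro j
  have h1 := hx j
  have h2 := hεx j
  rw [logCoord_embVec_act] at h2
  rw [unitCoord_of_mem b ⟨Additive.ofMul ε, rfl⟩] at h2 ⊢
  generalize b.repr ⟨logUnits K (Additive.ofMul ε), ⟨Additive.ofMul ε, rfl⟩⟩ j = n at h2 ⊢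
  have h3 : (-1 : ℝ) < n := by linarith [h1.2, h2.1]
  have h4 : (n : ℝ) < 1 := by linarith [h1.1, h2.2]
  have h5 : -1 < n := by exact_mod_cast h3
  have h6 : n < 1 := by exact_mod_cast h4
  have : n = 0 := by omega
  rw [this, Int.cast_zero]

theorem archEval_embVec (φ : Morphism K w u) (x : Punctured m K) :
    φ.archEval (embVec x.1) = embVec (φ.eval x).1 := by
  ext1 i
  change MvPolynomial.eval₂ (mixedEmbedding K) (fun i => mixedEmbedding K (x.1 i)) (φ.f i) =
    mixedEmbedding K (MvPolynomial.eval₂ (algebraMap K K) x.1 (φ.f i))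
  rw [MvPolynomial.eval₂_comp_left (mixedEmbedding K)]
  rfl

theorem archHeight_eq_prod_placeMax (w : Fin m → ℕ+) (x : Punctured m K) :
    archHeight w x = ∏ v : InfinitePlace K, placeMax w v (embVec x.1) := by
  simp only [archHeight, placeMax, embVec, mixedEmbedding.normAtPlace_apply]

theorem embVec_mem_archB_iff (φ : Morphism K w u) (T : ℝ) (x : Punctured m K) :
    embVec x.1 ∈ φ.archB b T ↔ archHeight u (φ.eval x) ≤ T ∧
      ∀ j, 0 ≤ logCoord w b (embVec x.1) j ∧ logCoord w b (embVec x.1) j < 1 := by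
  rw [Morphism.archB, Morphism.archD, Set.mem_inter_iff, mem_archDelta_iff, Set.mem_ofPred_eq,
    archEval_embVec, ← archHeight_eq_prod_placeMax]
  simp only [embVec_mem_archPunctured, true_and]

end

theorem exists_class_rep (rep : ClassGroup (𝓞 K) → (Ideal (𝓞 K))⁰)
    (hrep : ∀ c, ClassGroup.mk0 (rep c) = c) {I : FractionalIdeal (𝓞 K)⁰ K} (hI : I ≠ 0) :
    ∃ (c : ClassGroup (𝓞 K)) (a : Kˣ), FractionalIdeal.spanSingleton (𝓞 K)⁰ (a : K) * I =
      ((rep c : Ideal (𝓞 K)) : FractionalIdeal (𝓞 K)⁰ K) := by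
  set c := ClassGroup.mk K (Units.mk0 I hI) with hc
  have h1 : ClassGroup.mk K (FractionalIdeal.mk0 K (rep c) * (Units.mk0 I hI)⁻¹) = 1 := by
    rw [map_mul, map_inv, ClassGroup.mk_mk0, hrep, hc, mul_inv_cancel]
  rw [ClassGroup.mk_eq_one_iff] at h1
  obtain ⟨a, ha⟩ := h1.principal
  have h2 : ((FractionalIdeal.mk0 K (rep c) * (Units.mk0 I hI)⁻¹ : (FractionalIdeal (𝓞 K)⁰ K)ˣ) :
      FractionalIdeal (𝓞 K)⁰ K) = FractionalIdeal.spanSingleton (𝓞 K)⁰ a := by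
    rw [← FractionalIdeal.coeToSubmodule_inj, ha, FractionalIdeal.coe_spanSingleton]
  have h3 : FractionalIdeal.spanSingleton (𝓞 K)⁰ a * I =
      ((rep c : Ideal (𝓞 K)) : FractionalIdeal (𝓞 K)⁰ K) := by
    rw [← h2, Units.val_mul, Units.val_inv_eq_inv_val, Units.val_mk0, mul_assoc,
      inv_mul_cancel₀ hI, mul_one]
    rfl
  have ha0 : a ≠ 0 := by
    rintro rfl
    rw [FractionalIdeal.spanSingleton_zero, zero_mul] at h3
    exact nonZeroDivisors.ne_zero (rep c).2 (FractionalIdeal.coeIdeal_eq_zero.mp h3.symm)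
  exact ⟨c, Units.mk0 a ha0, h3⟩

theorem class_rep_unique (rep : ClassGroup (𝓞 K) → (Ideal (𝓞 K))⁰)
    (hrep : ∀ c, ClassGroup.mk0 (rep c) = c) {c c' : ClassGroup (𝓞 K)} {a : Kˣ}
    (h : FractionalIdeal.spanSingleton (𝓞 K)⁰ (a : K) *
      ((rep c : Ideal (𝓞 K)) : FractionalIdeal (𝓞 K)⁰ K) =
      ((rep c' : Ideal (𝓞 K)) : FractionalIdeal (𝓞 K)⁰ K)) : c = c' := by
  rw [← hrep c, ← hrep c']
  exact (ClassGroup.mk0_eq_mk0_iff_exists_fraction_ring K).mpr ⟨a, a.ne_zero, h⟩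

/-- The weighted action of the roots of unity. -/
@[reducible]
def torsionAction (w : Fin m → ℕ+) (K : Type*) [Field K] [NumberField K] :
    MulAction (torsion K) (Punctured m K) where
  smul ζ x := act w (unitHom K ζ) x
  one_smul x := by
    change act w (unitHom K ((1 : torsion K) : (𝓞 K)ˣ)) x = x
    rw [OneMemClass.coe_one, map_one, act_one]
  mul_smul ζ ξ x := by
    change act w (unitHom K ((ζ * ξ : torsion K) : (𝓞 K)ˣ)) x =
      act w (unitHom K ζ) (act w (unitHom K ξ) x)
    rw [act_act, Subgroup.coe_mul, map_mul]

/-- The orbit-stabilizer formula for the action of the roots of unity. -/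
theorem ncard_torsion_orbit_mul (w : Fin m → ℕ+) (x : Punctured m K) :
    (Set.range fun ζ : torsion K => act w (unitHom K ζ) x).ncard * Nat.card (autGroup w x) =
      torsionOrder K := by
  let := torsionAction w K
  have h1 := MulAction.index_stabilizer (torsion K) x
  have h2 : (Set.range fun ζ : torsion K => act w (unitHom K ζ) x) = MulAction.orbit (torsion K) x :=
    rfl
  have h3 : Nat.card (autGroup w x) = Nat.card (MulAction.stabilizer (torsion K) x) := by
    symm
    refine Nat.card_congr (Equiv.ofBijective
      (fun ζ => (⟨unitHom K ζ.1, ζ.2⟩ : autGroup w x)) ⟨?_, ?_⟩)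
    · intro ζ ξ h
      exact Subtype.ext (Subtype.ext (unitHom_injective (congrArg Subtype.val h)))
    -- An element `c` of `Kˣ` fixing `x` satisfies `c ^ w_i = 1` for a nonzero coordinate. So it is
    -- a root of unity, and the stabilizer in `μ(K)` is all of `Aut x`.
    · rintro ⟨c, hc⟩
      obtain ⟨i, hi⟩ := Function.ne_iff.mp x.2
      have h4 : (c : K) ^ (w i : ℕ) = 1 := by
        have := congrFun (congrArg Subtype.val (show act w c x = x from hc)) i
        exact mul_right_cancel₀ hi (this.trans (one_mul _).symm)
      have hint : IsIntegral ℤ (c : K) :=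
        IsIntegral.of_pow (w i).pos (by rw [h4]; exact isIntegral_one)
      obtain ⟨y, hy⟩ : ∃ y : 𝓞 K, algebraMap (𝓞 K) K y = c := ⟨⟨c, hint⟩, rfl⟩
      have h5 : y ^ (w i : ℕ) = 1 := by
        apply RingOfIntegers.coe_injective
        rw [map_pow, map_one, hy]
        exact h4
      let ε : (𝓞 K)ˣ := Units.ofPowEqOne _ _ h5 (w i).ne_zero
      have hε : unitHom K ε = c := Units.ext hy
      have hεt : ε ∈ torsion K :=
        (isOfFinOrder_iff_pow_eq_one).mpr ⟨w i, (w i).pos, Units.pow_ofPowEqOne h5 (w i).ne_zero⟩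
      exact ⟨⟨⟨ε, hεt⟩, show act w (unitHom K ε) x = x by rw [hε]; exact hc⟩, Subtype.ext hε⟩
  rw [h2, h3, ← h1, mul_comm, Subgroup.card_mul_index, torsionOrder]

end Orbits

/-! ### The counting function in terms of lattice vectors -/

section Counting

open NumberField.InfinitePlace NumberField.Units

variable {m : ℕ} {K : Type*} [Field K] [NumberField K] {w u : Fin m → ℕ+}

/-- The class of a vector in the weighted projective space. -/
def Points.mk (w : Fin m → ℕ+) (x : Punctured m K) : Points w K :=
  Quotient.mk (orbitSetoid w K) x

theorem Points.mk_eq_iff {x y : Punctured m K} :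
    Points.mk w x = Points.mk w y ↔ ∃ c : Kˣ, act w c x = y := Quotient.eq (r := orbitSetoid w K)

theorem Points.mk_act (c : Kˣ) (x : Punctured m K) : Points.mk w (act w c x) = Points.mk w x :=
  (Points.mk_eq_iff.mpr ⟨c, rfl⟩).symm

variable [NeZero m] (φ : Morphism K w u) (rep : ClassGroup (𝓞 K) → (Ideal (𝓞 K))⁰)
  (b : Module.Basis (Fin (Units.rank K)) ℤ (unitLogLattice K))

/-- The vectors of bounded height in a fundamental domain for the action of `Kˣ` modulo roots of
unity. -/
def Morphism.fundVectors (T : ℝ) : Set (Punctured m K) :=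
  {x | (∃ c, scalingIdeal w x = ((rep c : Ideal (𝓞 K)) : FractionalIdeal (𝓞 K)⁰ K)) ∧
    vectorHeight u (φ.eval x) ≤ T ∧
    ∀ j, 0 ≤ logCoord w b (embVec x.1) j ∧ logCoord w b (embVec x.1) j < 1}

theorem Morphism.vectorHeight_eval_act (c : Kˣ) (x : Punctured m K) :
    vectorHeight u (φ.eval (act w c x)) = vectorHeight u (φ.eval x) := by
  rw [φ.eval_act, vectorHeight_act]

/-- A scalar in `Kˣ` brings the scaling ideal to the representative of its class. A unit then moves
the vector into the fundamental domain without changing the scaling ideal. -/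
theorem Morphism.image_mk_fundVectors (hrep : ∀ c, ClassGroup.mk0 (rep c) = c) (T : ℝ) :
    Points.mk w '' φ.fundVectors rep b T = φ.pointsOfHeightLE T := by
  ext p
  constructor
  · rintro ⟨x, hx, rfl⟩
    exact hx.2.1
  · intro hp
    obtain ⟨x, rfl⟩ := Quotient.exists_rep p
    have hT : vectorHeight u (φ.eval x) ≤ T := hp
    obtain ⟨c, a, ha⟩ := exists_class_rep rep hrep (scalingIdeal_ne_zero w x)
    obtain ⟨ε, hε⟩ := exists_unit_logCoord (w := w) b (act w a x)
    refine ⟨act w (unitHom K ε) (act w a x), ⟨⟨c, ?_⟩, ?_, hε⟩, ?_⟩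
    · rw [scalingIdeal_act, scalingIdeal_act, spanSingleton_unitHom, one_mul, ha]
    · rwa [φ.vectorHeight_eval_act, φ.vectorHeight_eval_act]
    · rw [Points.mk_act, Points.mk_act]
      rfl

/-- A scalar relating two of these vectors relates their scaling ideals, so the classes and hence
the ideals agree and the scalar is a unit; as both vectors lie in the fundamental domain, it is a
root of unity. -/
theorem Morphism.fundVectors_fiber (hrep : ∀ c, ClassGroup.mk0 (rep c) = c) {T : ℝ}
    {x : Punctured m K} (hx : x ∈ φ.fundVectors rep b T) :
    {y | y ∈ φ.fundVectors rep b T ∧ Points.mk w y = Points.mk w x} =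
      Set.range fun ζ : torsion K => act w (unitHom K ζ) x := by
  obtain ⟨⟨c, hc⟩, hT, hx⟩ := hx
  ext y
  constructor
  · rintro ⟨⟨⟨c', hc'⟩, -, hy⟩, hxy⟩
    obtain ⟨a, rfl⟩ := Points.mk_eq_iff.mp hxy.symm
    rw [scalingIdeal_act, hc] at hc'
    obtain rfl := class_rep_unique rep hrep hc'
    have h0 : ((rep c : Ideal (𝓞 K)) : FractionalIdeal (𝓞 K)⁰ K) ≠ 0 :=
      FractionalIdeal.coeIdeal_ne_zero.mpr (nonZeroDivisors.ne_zero (rep c).2)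
    obtain ⟨ε, rfl⟩ := mem_range_unitHom_of_spanSingleton (mul_right_cancel₀ h0
      (hc'.trans (one_mul _).symm))
    exact ⟨⟨ε, mem_torsion_of_logCoord b hx hy⟩, rfl⟩
  · rintro ⟨ζ, rfl⟩
    refine ⟨⟨⟨c, ?_⟩, ?_, fun j => ?_⟩, Points.mk_act _ _⟩
    · rw [scalingIdeal_act, spanSingleton_unitHom, one_mul, hc]
    · rwa [φ.vectorHeight_eval_act]
    · rw [logCoord_embVec_act, (mem_torsion_iff_unitCoord b _).mp ζ.2 j, zero_add]
      exact hx j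

/-- The fibre over a point has `#μ(K) / #Aut x` elements, so the weights `1 / #Aut x` are exactly
what makes the vectors count equally. -/
theorem Morphism.count_mul_torsionOrder (hrep : ∀ c, ClassGroup.mk0 (rep c) = c) {T : ℝ}
    (hfin : (φ.fundVectors rep b T).Finite) :
    φ.count T * torsionOrder K = (φ.fundVectors rep b T).ncard := by
  classical
  have hP : (φ.pointsOfHeightLE T).Finite := by
    rw [← φ.image_mk_fundVectors rep b hrep]
    exact hfin.image _
  rw [Morphism.count, finsum_mem_eq_finite_toFinset_sum _ hP, Set.ncard_eq_toFinset_card _ hfin,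
    Finset.card_eq_sum_card_fiberwise (f := Points.mk w) (t := hP.toFinset), Finset.sum_mul,
    Nat.cast_sum]
  · refine Finset.sum_congr rfl fun p hp => ?_
    rw [hP.mem_toFinset, ← φ.image_mk_fundVectors rep b hrep] at hp
    obtain ⟨x, hx, rfl⟩ := hp
    have h1 := ncard_torsion_orbit_mul w x
    rw [← φ.fundVectors_fiber rep b hrep hx] at h1
    have h2 : (Points.mk w x).autCard = Nat.card (autGroup w x) := rfl
    have h3 : (hfin.toFinset.filter fun y => Points.mk w y = Points.mk w x).card =
        {y | y ∈ φ.fundVectors rep b T ∧ Points.mk w y = Points.mk w x}.ncard := by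
      rw [← Set.ncard_coe_finset]
      congr 1
      ext y
      simp
    rw [h2, h3, ← h1]
    have h4 : (Nat.card (autGroup w x) : ℝ) ≠ 0 := by
      intro h
      rw [Nat.cast_eq_zero] at h
      rw [h, mul_zero] at h1
      exact torsionOrder_ne_zero K h1.symm
    push_cast
    field_simp
  · intro x hx
    rw [Finset.mem_coe, hfin.mem_toFinset] at hx
    rw [Finset.mem_coe, hP.mem_toFinset]
    exact hx.2.1

/-- The vectors with given scaling ideal and discrepancy ideal in the region of parameter `t`. -/
def Morphism.primitiveVectors (𝔞 𝔡 : FractionalIdeal (𝓞 K)⁰ K) (T : ℝ) : Set (Punctured m K) :=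
  {x | scalingIdeal w x = 𝔞 ∧ φ.vecDiscrepancy x = 𝔡 ∧ embVec x.1 ∈ φ.archB b T}

theorem absNorm_pos_of_ne_zero {I : FractionalIdeal (𝓞 K)⁰ K} (hI : I ≠ 0) :
    (0 : ℝ) < (FractionalIdeal.absNorm I : ℝ) := by
  have h1 : FractionalIdeal.absNorm I ≠ 0 := by
    rwa [Ne, FractionalIdeal.absNorm_eq_zero_iff]
  have h2 := FractionalIdeal.absNorm_nonneg I
  exact_mod_cast lt_of_le_of_ne h2 h1.symm

/-- The norm of the scaling ideal of `φ(x)` is that of the discrepancy times the `e`-th power of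
that of the scaling ideal of `x`; once both are fixed, only the archimedean height is left. -/
theorem Morphism.vectorHeight_eval_le_iff (x : Punctured m K) (T : ℝ) :
    vectorHeight u (φ.eval x) ≤ T ↔ archHeight u (φ.eval x) ≤
      T * ((FractionalIdeal.absNorm (φ.vecDiscrepancy x) : ℝ) *
        (FractionalIdeal.absNorm (scalingIdeal w x) : ℝ) ^ φ.e) := by
  have h1 : scalingIdeal u (φ.eval x) = φ.vecDiscrepancy x * scalingIdeal w x ^ φ.e := by
    rw [vecDiscrepancy, mul_assoc, inv_mul_cancel₀ (pow_ne_zero _ (scalingIdeal_ne_zero w x)),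
      mul_one]
  have h2 := absNorm_pos_of_ne_zero (scalingIdeal_ne_zero u (φ.eval x))
  rw [vectorHeight, one_div, inv_mul_le_iff₀ h2, h1, map_mul, map_pow, mul_comm T]
  push_cast
  rfl

theorem Morphism.fundVectors_eq (T : ℝ) : φ.fundVectors rep b T =
    ⋃ p : ClassGroup (𝓞 K) × φ.discrepancyIdeals,
      φ.primitiveVectors b ((rep p.1 : Ideal (𝓞 K)) : FractionalIdeal (𝓞 K)⁰ K) p.2
        (T * ((FractionalIdeal.absNorm (p.2 : FractionalIdeal (𝓞 K)⁰ K) : ℝ) *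
          (FractionalIdeal.absNorm ((rep p.1 : Ideal (𝓞 K)) : FractionalIdeal (𝓞 K)⁰ K) : ℝ) ^ φ.e)) := by
  ext x
  rw [Set.mem_iUnion]
  constructor
  · rintro ⟨⟨c, hc⟩, hT, hx⟩
    refine ⟨(c, ⟨φ.vecDiscrepancy x, (φ.mem_discrepancyIdeals_iff _).mpr ⟨x, rfl⟩⟩), hc, rfl, ?_⟩
    rw [embVec_mem_archB_iff, ← hc]
    exact ⟨(φ.vectorHeight_eval_le_iff x T).mp hT, hx⟩
  · rintro ⟨⟨c, 𝔡, h𝔡⟩, hc, h1, h2⟩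
    rw [embVec_mem_archB_iff] at h2
    refine ⟨⟨c, hc⟩, (φ.vectorHeight_eval_le_iff x T).mpr ?_, h2.2⟩
    rw [h1, hc]
    exact h2.1

theorem Morphism.ncard_fundVectors (hrep : ∀ c, ClassGroup.mk0 (rep c) = c)
    [Fintype φ.discrepancyIdeals] (T : ℝ)
    (hfin : ∀ p : ClassGroup (𝓞 K) × φ.discrepancyIdeals,
      (φ.primitiveVectors b ((rep p.1 : Ideal (𝓞 K)) : FractionalIdeal (𝓞 K)⁰ K) p.2
        (T * ((FractionalIdeal.absNorm (p.2 : FractionalIdeal (𝓞 K)⁰ K) : ℝ) *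
          (FractionalIdeal.absNorm ((rep p.1 : Ideal (𝓞 K)) :
            FractionalIdeal (𝓞 K)⁰ K) : ℝ) ^ φ.e))).Finite) :
    (φ.fundVectors rep b T).Finite ∧ (φ.fundVectors rep b T).ncard =
      ∑ p : ClassGroup (𝓞 K) × φ.discrepancyIdeals,
        (φ.primitiveVectors b ((rep p.1 : Ideal (𝓞 K)) : FractionalIdeal (𝓞 K)⁰ K) p.2
          (T * ((FractionalIdeal.absNorm (p.2 : FractionalIdeal (𝓞 K)⁰ K) : ℝ) *
            (FractionalIdeal.absNorm ((rep p.1 : Ideal (𝓞 K)) :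
              FractionalIdeal (𝓞 K)⁰ K) : ℝ) ^ φ.e))).ncard := by
  rw [φ.fundVectors_eq rep b T]
  refine ⟨Set.finite_iUnion hfin, ?_⟩
  rw [Set.ncard_iUnion_of_finite hfin, finsum_eq_sum_of_fintype]
  rintro ⟨c, 𝔡⟩ ⟨c', 𝔡'⟩ hne
  refine Set.disjoint_left.mpr ?_
  rintro x ⟨h1, h2, -⟩ ⟨h3, h4, -⟩
  refine hne (Prod.ext ?_ (Subtype.ext (h2.symm.trans h4)))
  exact class_rep_unique rep hrep (a := 1) (by
    rw [Units.val_one, FractionalIdeal.spanSingleton_one, one_mul]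
    exact h1.symm.trans h3)

end Counting

/-! ### Möbius inversion over scaling ideals -/

section MoebiusCount

open NumberField.InfinitePlace NumberField.Units

variable {m : ℕ} {K : Type*} [Field K] [NumberField K] {w u : Fin m → ℕ+} [NeZero m]
  {φ : Morphism K w u}

/-- The ideal `𝔟` is the quotient of the scaling ideal by `𝔞`. It translates lattice membership into
divisibility and primitivity into `𝔟 = ⊤`. -/
theorem exists_scalingIdeal_eq_mul {𝔞 : Ideal (𝓞 K)} (h𝔞 : 𝔞 ≠ ⊥) {x : Punctured m K}
    (hx : x.1 ∈ idealLattice w (𝔞 : FractionalIdeal (𝓞 K)⁰ K)) :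
    ∃ 𝔟 : Ideal (𝓞 K), 𝔟 ≠ ⊥ ∧ (scalingIdeal w x = 𝔞 ↔ 𝔟 = ⊤) ∧ ∀ 𝔠 : Ideal (𝓞 K), 𝔠 ≠ ⊥ →
      (x.1 ∈ idealLattice w ((𝔞 : FractionalIdeal (𝓞 K)⁰ K) * (𝔠 : FractionalIdeal (𝓞 K)⁰ K)) ↔
        𝔠 ∣ 𝔟) := by
  have h0 : (𝔞 : FractionalIdeal (𝓞 K)⁰ K) ≠ 0 := FractionalIdeal.coeIdeal_ne_zero.mpr h𝔞
  rw [mem_idealLattice_iff_scalingIdeal_le w h0] at hx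
  have h1 : (𝔞 : FractionalIdeal (𝓞 K)⁰ K)⁻¹ * scalingIdeal w x ≤ 1 := by
    rw [← inv_mul_cancel₀ h0]
    exact mul_le_mul_right hx _
  obtain ⟨𝔟, h𝔟⟩ := FractionalIdeal.le_one_iff_exists_coeIdeal.mp h1
  have h2 : scalingIdeal w x = ((𝔞 * 𝔟 : Ideal (𝓞 K)) : FractionalIdeal (𝓞 K)⁰ K) := by
    rw [FractionalIdeal.coeIdeal_mul, h𝔟, mul_inv_cancel_left₀ h0]
  have h𝔟0 : 𝔟 ≠ ⊥ := by
    rintro rfl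
    refine scalingIdeal_ne_zero w x (h2.trans ?_)
    rw [Ideal.mul_bot, FractionalIdeal.coeIdeal_bot]
  refine ⟨𝔟, h𝔟0, ?_, fun 𝔠 h𝔠 => ?_⟩
  · rw [h2, FractionalIdeal.coeIdeal_inj]
    constructor
    · intro h
      rw [← Ideal.one_eq_top]
      exact mul_left_cancel₀ h𝔞 (h.trans (mul_one _).symm)
    · rintro rfl
      rw [Ideal.mul_top]
  · rw [← FractionalIdeal.coeIdeal_mul, mem_idealLattice_iff_scalingIdeal_le w
      (FractionalIdeal.coeIdeal_ne_zero.mpr (mul_ne_zero h𝔞 h𝔠)), h2,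
      FractionalIdeal.coeIdeal_le_coeIdeal, ← Ideal.dvd_iff_le]
    exact mul_dvd_mul_iff_left h𝔞

/-- Möbius inversion for the vectors with given scaling ideal and discrepancy ideal. -/
theorem ncard_primitiveVectors {𝔞 : Ideal (𝓞 K)} (h𝔞 : 𝔞 ≠ ⊥)
    (M : φ.CongruenceData (𝔞 : FractionalIdeal (𝓞 K)⁰ K))
    (b : Module.Basis (Fin (Units.rank K)) ℤ (unitLogLattice K))
    {𝔡 : FractionalIdeal (𝓞 K)⁰ K} (h𝔡 : 𝔡 ∈ φ.discrepancyIdeals) {t : ℝ}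
    (F : Finset (Ideal (𝓞 K))) (hF0 : ⊥ ∉ F)
    (hF : ∀ 𝔠, 𝔠 ≠ ⊥ → 𝔠 ∉ F → φ.regionSet M b 𝔡 𝔠 t = ∅)
    (hfin : (φ.regionSet M b 𝔡 1 t).Finite) :
    (φ.primitiveVectors b (𝔞 : FractionalIdeal (𝓞 K)⁰ K) 𝔡
      (t ^ (φ.e * Module.finrank ℚ K))).Finite ∧
    ((φ.primitiveVectors b (𝔞 : FractionalIdeal (𝓞 K)⁰ K) 𝔡
      (t ^ (φ.e * Module.finrank ℚ K))).ncard : ℝ) =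
      ∑ 𝔠 ∈ F, (UniqueFactorizationMonoid.moebius 𝔠 : ℝ) * (φ.regionSet M b 𝔡 𝔠 t).ncard := by
  classical
  have h0 : (𝔞 : FractionalIdeal (𝓞 K)⁰ K) ≠ 0 := FractionalIdeal.coeIdeal_ne_zero.mpr h𝔞
  set X := φ.regionSet M b 𝔡 1 t with hX
  have hmem : ∀ (𝔠 : Ideal (𝓞 K)) (x : Fin m → K), x ∈ φ.regionSet M b 𝔡 𝔠 t ↔
      (x ∈ X ∧ x ∈ idealLattice w
        ((𝔞 : FractionalIdeal (𝓞 K)⁰ K) * (𝔠 : FractionalIdeal (𝓞 K)⁰ K))) := by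
    intro 𝔠 x
    have h1 : (𝔞 : FractionalIdeal (𝓞 K)⁰ K) * ((1 : Ideal (𝓞 K)) : FractionalIdeal (𝓞 K)⁰ K) =
        𝔞 := by rw [Ideal.one_eq_top, FractionalIdeal.coeIdeal_top, mul_one]
    constructor
    · rintro ⟨⟨h2, h3⟩, h4⟩
      refine ⟨⟨⟨h2, ?_⟩, h4⟩, h3⟩
      rw [h1]
      exact M.globalSet_subset h0 h𝔡 h2
    · rintro ⟨⟨⟨h2, -⟩, h4⟩, h3⟩
      exact ⟨⟨h2, h3⟩, h4⟩
  have hX0 : ∀ x ∈ X, x ≠ 0 := by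
    rintro _ ⟨-, hx⟩ rfl
    obtain ⟨i, hi⟩ := hx.1.1 (Classical.arbitrary _)
    exact hi (by simp [embVec])
  have hXl : ∀ x ∈ X, x ∈ idealLattice w (𝔞 : FractionalIdeal (𝓞 K)⁰ K) := fun x hx =>
    M.globalSet_subset h0 h𝔡 hx.1.1
  have himage : Subtype.val '' φ.primitiveVectors b (𝔞 : FractionalIdeal (𝓞 K)⁰ K) 𝔡
      (t ^ (φ.e * Module.finrank ℚ K)) =
      {x | ∃ h : x ∈ X, scalingIdeal w (⟨x, hX0 x h⟩ : Punctured m K) = 𝔞} := by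
    ext x
    constructor
    · rintro ⟨y, ⟨h1, h2, h3⟩, rfl⟩
      have h4 := (M.mem_globalSet_iff h0 h𝔡 y h1).mpr h2
      refine ⟨⟨⟨h4, ?_⟩, h3⟩, h1⟩
      rw [Ideal.one_eq_top, FractionalIdeal.coeIdeal_top, mul_one]
      exact M.globalSet_subset h0 h𝔡 h4
    · rintro ⟨h1, h2⟩
      exact ⟨⟨x, hX0 x h1⟩, ⟨h2, (M.mem_globalSet_iff h0 h𝔡 _ h2).mp h1.1.1, h1.2⟩, rfl⟩
  have hpfin : (φ.primitiveVectors b (𝔞 : FractionalIdeal (𝓞 K)⁰ K) 𝔡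
      (t ^ (φ.e * Module.finrank ℚ K))).Finite := by
    refine Set.Finite.of_finite_image ?_ Subtype.val_injective.injOn
    rw [himage]
    exact hfin.subset fun x hx => hx.1
  refine ⟨hpfin, ?_⟩
  have hncard : ∀ 𝔠 ∈ F, ((φ.regionSet M b 𝔡 𝔠 t).ncard : ℝ) = ∑ x ∈ hfin.toFinset,
      if x ∈ idealLattice w
        ((𝔞 : FractionalIdeal (𝓞 K)⁰ K) * (𝔠 : FractionalIdeal (𝓞 K)⁰ K)) then 1 else 0 := by
    intro 𝔠 _
    rw [Finset.sum_boole, ← Set.ncard_coe_finset]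
    congr 2
    ext x
    rw [hmem]
    simp
  have hterm : ∀ x ∈ hfin.toFinset, ∑ 𝔠 ∈ F, (UniqueFactorizationMonoid.moebius 𝔠 : ℝ) *
      (if x ∈ idealLattice w
        ((𝔞 : FractionalIdeal (𝓞 K)⁰ K) * (𝔠 : FractionalIdeal (𝓞 K)⁰ K)) then 1 else 0) =
      if x ∈ Subtype.val '' φ.primitiveVectors b (𝔞 : FractionalIdeal (𝓞 K)⁰ K) 𝔡
        (t ^ (φ.e * Module.finrank ℚ K)) then 1 else 0 := by
    intro x hx
    rw [hfin.mem_toFinset] at hx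
    obtain ⟨𝔟, h𝔟0, h𝔟, h𝔠⟩ := exists_scalingIdeal_eq_mul h𝔞 (x := ⟨x, hX0 x hx⟩) (hXl x hx)
    -- Every divisor `J` of `𝔟` belongs to `F`, because `x` itself is a point of the region attached
    -- to `J`; so the truncated sum is the full divisor sum.
    have h1 := sum_moebius_dvd h𝔟0 (F.filter fun 𝔠 => 𝔠 ∣ 𝔟) (fun J => by
      rw [Finset.mem_filter, and_iff_right_iff_imp]
      intro hJ
      have hJ0 : J ≠ ⊥ := fun h => h𝔟0 (by
        rw [h] at hJ
        exact zero_dvd_iff.mp hJ)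
      by_contra hJF
      have := hF J hJ0 hJF
      rw [Set.eq_empty_iff_forall_notMem] at this
      exact this x ((hmem J x).mpr ⟨hx, (h𝔠 J hJ0).mpr hJ⟩))
    have h2 : (x ∈ Subtype.val '' φ.primitiveVectors b (𝔞 : FractionalIdeal (𝓞 K)⁰ K) 𝔡
        (t ^ (φ.e * Module.finrank ℚ K))) ↔ 𝔟 = ⊤ := by
      rw [himage, ← h𝔟]
      exact ⟨fun h => h.2, fun h => ⟨hx, h⟩⟩
    simp only [h2]
    have h3 : ((if 𝔟 = ⊤ then 1 else 0 : ℤ) : ℝ) = if 𝔟 = ⊤ then 1 else 0 := by split_ifs <;> simp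
    rw [← h3, ← h1, Finset.sum_filter]
    push_cast
    refine Finset.sum_congr rfl fun 𝔠 h𝔠F => ?_
    have h4 := h𝔠 𝔠 (fun h => hF0 (h ▸ h𝔠F))
    simp only [h4]
    split_ifs <;> simp
  rw [Finset.sum_congr rfl fun 𝔠 h => by rw [hncard 𝔠 h, Finset.mul_sum], Finset.sum_comm,
    Finset.sum_congr rfl hterm, Finset.sum_boole, ← Set.ncard_coe_finset,
    ← Set.ncard_image_of_injective _ Subtype.val_injective]
  congr 2
  ext x
  simp only [Finset.coe_filter, hfin.mem_toFinset, Set.mem_ofPred_eq]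
  rw [iff_and_self, himage]
  exact fun h => h.1

end MoebiusCount

/-! ### Sums over ideals of bounded norm -/

section IdealSums

variable {K : Type*} [Field K] [NumberField K]

open Classical in
/-- The nonzero ideals of norm at most `Y`. -/
def idealBall (K : Type*) [Field K] [NumberField K] (Y : ℝ) : Finset (Ideal (𝓞 K)) :=
  (Ideal.finite_setOfPred_absNorm_le (S := 𝓞 K) ⌊Y⌋₊).toFinset.filter fun I => I ≠ ⊥

theorem mem_idealBall {Y : ℝ} (hY : 0 ≤ Y) (I : Ideal (𝓞 K)) :
    I ∈ idealBall K Y ↔ I ≠ ⊥ ∧ (Ideal.absNorm I : ℝ) ≤ Y := by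
  rw [idealBall, Finset.mem_filter, Set.Finite.mem_toFinset, and_comm, Set.mem_ofPred_eq,
    Nat.le_floor_iff hY]

open Classical in
/-- The sum of `N(I) ^ (-s)` over the ideals of norm larger than `Y`. -/
def normTail (K : Type*) [Field K] [NumberField K] (s : ℕ) (Y : ℝ) : ℝ :=
  ∑' I : Ideal (𝓞 K), if Y < Ideal.absNorm I then ((Ideal.absNorm I : ℝ) ^ s)⁻¹ else 0

theorem normTail_nonneg (s : ℕ) (Y : ℝ) : 0 ≤ normTail K s Y :=
  tsum_nonneg fun I => by split_ifs <;> positivity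

/-- The error made in the sum over the ideals of norm at most `A x` and in the remaining terms. -/
def normError (K : Type*) [Field K] [NumberField K] (s : ℕ) (σ A x : ℝ) : ℝ :=
  x ^ σ * ∑ I ∈ idealBall K (A * x), ((Ideal.absNorm I : ℝ) ^ σ)⁻¹ + x ^ s * normTail K s (A * x)

theorem summable_normTail (K : Type*) [Field K] [NumberField K] {s : ℕ} (hs : 1 < s) (Y : ℝ) :
    open scoped Classical in Summable fun I : Ideal (𝓞 K) =>
      if Y < Ideal.absNorm I then ((Ideal.absNorm I : ℝ) ^ s)⁻¹ else 0 := by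
  classical
  refine Summable.of_nonneg_of_le (fun I => ?_) (fun I => ?_) (summable_absNorm_pow K hs)
  · split_ifs <;> positivity
  · split_ifs
    · exact le_rfl
    · positivity

/-- For `σ > 1` the sum of `N(I)^(-σ)` converges. In the tail `N(I) > A x` gives `N(I)^(-s) ≤ (A
x)^(σ - s) N(I)^(-σ)`, and `x^s` reduces this to order `x^σ` as well. -/
theorem exists_normError_le {s : ℕ} (hs : 1 < s) {σ : ℝ} (hσ : 1 < σ) (hσs : σ ≤ s) {A : ℝ}
    (hA : 0 < A) : ∃ B : ℝ, 0 ≤ B ∧ ∀ x : ℝ, 0 < x → normError K s σ A x ≤ B * x ^ σ := by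
  classical
  have hsum := summable_absNorm_rpow K hσ
  set Z := ∑' I : Ideal (𝓞 K), ((Ideal.absNorm I : ℝ) ^ σ)⁻¹ with hZ
  have hZ0 : 0 ≤ Z := tsum_nonneg fun I => by positivity
  refine ⟨Z + (A ^ ((s : ℝ) - σ))⁻¹ * Z, by positivity, fun x hx => ?_⟩
  have h1 : ∑ I ∈ idealBall K (A * x), ((Ideal.absNorm I : ℝ) ^ σ)⁻¹ ≤ Z :=
    hsum.sum_le_tsum _ fun I _ => by positivity
  have h2 : normTail K s (A * x) ≤ ((A * x) ^ ((s : ℝ) - σ))⁻¹ * Z := by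
    rw [normTail, hZ, ← tsum_mul_left]
    refine (summable_normTail K hs _).tsum_le_tsum (fun I => ?_) (hsum.mul_left _)
    have hAx : 0 < A * x := by positivity
    split_ifs with h
    · have hn : (0 : ℝ) < Ideal.absNorm I := hAx.trans h
      rw [← mul_inv]
      refine inv_anti₀ (by positivity) ?_
      calc (A * x) ^ ((s : ℝ) - σ) * (Ideal.absNorm I : ℝ) ^ σ
          ≤ (Ideal.absNorm I : ℝ) ^ ((s : ℝ) - σ) * (Ideal.absNorm I : ℝ) ^ σ := by
            gcongr
        _ = (Ideal.absNorm I : ℝ) ^ s := by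
            rw [← Real.rpow_add hn, sub_add_cancel, Real.rpow_natCast]
    · positivity
  have h3 : x ^ s * ((A * x) ^ ((s : ℝ) - σ))⁻¹ = (A ^ ((s : ℝ) - σ))⁻¹ * x ^ σ := by
    rw [Real.mul_rpow hA.le hx.le, mul_inv, Real.rpow_sub hx, Real.rpow_natCast, inv_div]
    field_simp
  calc normError K s σ A x ≤ x ^ σ * Z + x ^ s * (((A * x) ^ ((s : ℝ) - σ))⁻¹ * Z) := by
        rw [normError]; gcongr
    _ = _ := by rw [← mul_assoc (x ^ s), h3]; ring

/-- In degree one a nonzero ideal is generated by its norm, because the norm lies in it and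
generates an ideal of the same norm. Sums over ideals become sums over positive integers. -/
theorem absNorm_injOn (hK : Module.finrank ℚ K = 1) {I J : Ideal (𝓞 K)} (hI : I ≠ ⊥)
    (h : Ideal.absNorm I = Ideal.absNorm J) : I = J := by
  have key : ∀ I : Ideal (𝓞 K), I ≠ ⊥ → I = Ideal.span {(Ideal.absNorm I : 𝓞 K)} := by
    intro I hI
    obtain ⟨J, hJ⟩ := Ideal.dvd_iff_le.mpr
      ((Ideal.span_singleton_le_iff_mem _).mpr (Ideal.absNorm_mem I))
    have h1 := congrArg Ideal.absNorm hJ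
    rw [map_mul, Ideal.absNorm_span_singleton, ← map_natCast (algebraMap ℤ (𝓞 K)),
      Algebra.norm_algebraMap, RingOfIntegers.rank, hK, pow_one, Int.natAbs_natCast] at h1
    have hn : Ideal.absNorm I ≠ 0 := by rwa [Ne, Ideal.absNorm_eq_zero_iff]
    have h2 : Ideal.absNorm J = 1 := Nat.eq_of_mul_eq_mul_left (Nat.pos_of_ne_zero hn)
      (h1.symm.trans (mul_one _).symm)
    rw [Ideal.absNorm_eq_one_iff] at h2
    rw [hJ, h2, Ideal.mul_top]
  have hJ : J ≠ ⊥ := by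
    rw [Ne, ← Ideal.absNorm_eq_zero_iff] at hI ⊢
    rwa [← h]
  rw [key I hI, key J hJ, h]

theorem sum_idealBall_inv_le (hK : Module.finrank ℚ K = 1) {Y : ℝ} (hY : 1 ≤ Y) :
    ∑ I ∈ idealBall K Y, ((Ideal.absNorm I : ℝ) ^ (1 : ℝ))⁻¹ ≤ 1 + Real.log Y := by
  classical
  have h1 : ∑ I ∈ idealBall K Y, ((Ideal.absNorm I : ℝ) ^ (1 : ℝ))⁻¹ =
      ∑ n ∈ (idealBall K Y).image Ideal.absNorm, ((n : ℝ))⁻¹ := by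
    rw [Finset.sum_image]
    · simp
    · intro I hI J _ h
      exact absNorm_injOn hK ((mem_idealBall (by linarith) I).mp hI).1 h
  have h2 := harmonic_floor_le_one_add_log Y hY
  rw [harmonic_eq_sum_Icc] at h2
  push_cast at h2
  rw [h1]
  refine le_trans (Finset.sum_le_sum_of_subset_of_nonneg (fun n hn => ?_)
    fun n _ _ => by positivity) h2
  obtain ⟨I, hI, rfl⟩ := Finset.mem_image.mp hn
  rw [mem_idealBall (by linarith)] at hI
  rw [Finset.mem_Icc]
  refine ⟨Nat.one_le_iff_ne_zero.mpr ?_, Nat.le_floor hI.2⟩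
  rw [Ne, Ideal.absNorm_eq_zero_iff]
  exact hI.1

theorem normTail_two_le (hK : Module.finrank ℚ K = 1) {Y : ℝ} (hY : 0 < Y) :
    normTail K 2 Y ≤ 2 / Y := by
  classical
  refine (summable_normTail K one_lt_two Y).tsum_le_of_sum_le fun G => ?_
  rw [← Finset.sum_filter]
  have h1 : ∑ I ∈ G.filter (fun I => Y < Ideal.absNorm I), ((Ideal.absNorm I : ℝ) ^ 2)⁻¹ =
      ∑ n ∈ (G.filter fun I => Y < Ideal.absNorm I).image Ideal.absNorm, ((n : ℝ) ^ 2)⁻¹ := by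
    rw [Finset.sum_image]
    intro I hI J _ h
    refine absNorm_injOn hK ?_ h
    rintro rfl
    have := (Finset.mem_filter.mp hI).2
    rw [Ideal.absNorm_bot, Nat.cast_zero] at this
    linarith
  rw [h1]
  set H := (G.filter fun I => Y < Ideal.absNorm I).image Ideal.absNorm with hH
  refine le_trans (Finset.sum_le_sum_of_subset_of_nonneg
    (t := Finset.Ioo ⌊Y⌋₊ (H.sup id + 1)) (fun n hn => ?_) fun n _ _ => by positivity)
    ((sum_Ioo_inv_sq_le _ _).trans ?_)
  · rw [Finset.mem_Ioo]
    refine ⟨?_, Nat.lt_succ_of_le (Finset.le_sup (f := id) hn)⟩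
    obtain ⟨I, hI, rfl⟩ := Finset.mem_image.mp hn
    exact (Nat.floor_lt hY.le).mpr (Finset.mem_filter.mp hI).2
  · exact div_le_div_of_nonneg_left zero_le_two hY (Nat.lt_floor_add_one Y).le

/-- The borderline `σ = 1`: the harmonic sum gives `x (1 + log (A x))`, while the tail is at most
`x² · 2/(A x)`, of order `x` only. -/
theorem normError_isBigO_log (hK : Module.finrank ℚ K = 1) {A : ℝ} (hA : 0 < A) :
    (fun x => normError K 2 1 A x) =O[atTop] fun x => x * Real.log x := by
  have hlog : (fun x : ℝ => (1 + Real.log A + 2 / A) + Real.log x) =O[atTop] Real.log :=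
    Real.isLittleO_const_log_atTop.isBigO.add (isBigO_refl _ _)
  refine IsBigO.trans ?_ ((isBigO_refl (fun x : ℝ => x) atTop).mul hlog)
  refine IsBigO.of_bound 1 ?_
  filter_upwards [eventually_ge_atTop A⁻¹, eventually_gt_atTop 0] with x hxA hx
  have hAx : 1 ≤ A * x := by
    rw [inv_le_iff_one_le_mul₀ hA] at hxA
    linarith
  have h1 := sum_idealBall_inv_le hK hAx
  have h2 := normTail_two_le hK (Y := A * x) (by positivity)
  have h3 : 0 ≤ normError K 2 1 A x := by
    rw [normError]
    have := normTail_nonneg (K := K) 2 (A * x)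
    positivity
  rw [Real.norm_of_nonneg h3, one_mul]
  refine le_trans ?_ (le_abs_self _)
  calc normError K 2 1 A x ≤ x * (1 + Real.log (A * x)) + x ^ 2 * (2 / (A * x)) := by
        rw [normError, Real.rpow_one x]; gcongr
    _ = x * (1 + Real.log A + 2 / A + Real.log x) := by
        rw [Real.log_mul hA.ne' hx.ne']
        field_simp
        ring

end IdealSums

/-! ### The asymptotic count for one scaling ideal and one discrepancy ideal -/

section Estimate

open NumberField.InfinitePlace NumberField.Units

variable {m : ℕ} {K : Type*} [Field K] [NumberField K] {w u : Fin m → ℕ+}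

namespace Morphism.CongruenceData

variable {φ : Morphism K w u} {𝔞 : Ideal (𝓞 K)}
  (M : φ.CongruenceData (𝔞 : FractionalIdeal (𝓞 K)⁰ K))

/-- The sum of the densities, weighted by the Möbius function. -/
def moebiusDensity (𝔡 : FractionalIdeal (𝓞 K)⁰ K) : ℝ :=
  ∑' 𝔠 : Ideal (𝓞 K), (UniqueFactorizationMonoid.moebius 𝔠 : ℝ) * M.density 𝔡 𝔠

theorem abs_moebius_mul_density_le (h𝔞 : 𝔞 ≠ ⊥)
    (𝔡 : FractionalIdeal (𝓞 K)⁰ K) (𝔠 : Ideal (𝓞 K)) :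
    ‖(UniqueFactorizationMonoid.moebius 𝔠 : ℝ) * M.density 𝔡 𝔠‖ ≤
      ((Ideal.absNorm 𝔠 : ℝ) ^ totalWeight w)⁻¹ := by
  by_cases h𝔠 : 𝔠 = ⊥
  · rw [h𝔠, ← Ideal.zero_eq_bot, UniqueFactorizationMonoid.moebius_zero]
    simp
  · rw [norm_mul, Real.norm_eq_abs, Real.norm_of_nonneg (M.density_nonneg 𝔡 𝔠)]
    exact (mul_le_of_le_one_left (M.density_nonneg 𝔡 𝔠) (abs_moebius_le_one 𝔠)).trans
      (M.density_le h𝔞 𝔡 h𝔠)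

theorem summable_moebius_mul_density (h𝔞 : 𝔞 ≠ ⊥) (hs : 1 < totalWeight w)
    (𝔡 : FractionalIdeal (𝓞 K)⁰ K) :
    Summable fun 𝔠 : Ideal (𝓞 K) => (UniqueFactorizationMonoid.moebius 𝔠 : ℝ) * M.density 𝔡 𝔠 :=
  Summable.of_norm_bounded (summable_absNorm_pow K hs)
    (M.abs_moebius_mul_density_le h𝔞 𝔡)

theorem dedekindZeta_re_pos (K : Type*) [Field K] [NumberField K] {s : ℕ} (hs : 1 < s) :
    0 < (dedekindZeta K (s : ℂ)).re := by
  rw [dedekindZeta_re K hs]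
  refine (summable_absNorm_pow K hs).tsum_pos (fun I => by positivity) ⊤ ?_
  simp

/-- The finite sum over `𝔠₁` with its Euler factors is `ζ_K(|w|)` times the complete Möbius sum of
the densities, by `tsum_moebius_mul_eq`. The complete sum is what the count of primitive vectors
produces. -/
theorem localConstant_eq (h𝔞 : 𝔞 ≠ ⊥) (hs : 1 < totalWeight w) :
    M.localConstant = ∑ᶠ 𝔡 ∈ φ.discrepancyIdeals,
      ((FractionalIdeal.absNorm 𝔡 : ℝ) ^ (1 / (φ.e : ℝ)) *
        (FractionalIdeal.absNorm (𝔞 : FractionalIdeal (𝓞 K)⁰ K) : ℝ)) ^ totalWeight w *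
      ((dedekindZeta K (totalWeight w : ℂ)).re * M.moebiusDensity 𝔡) := by
  refine finsum_mem_congr rfl fun 𝔡 h𝔡 => ?_
  have hζ := dedekindZeta_re_pos K hs
  have h1 := tsum_moebius_mul_eq M.finite_bad hs (M.density 𝔡)
    (fun I hI => by
      rw [abs_of_nonneg (M.density_nonneg 𝔡 I)]
      exact M.density_le h𝔞 𝔡 hI)
    (fun I hI J hJ => M.density_mul h𝔞 h𝔡 hI hJ.2)
  have h2 : (dedekindZeta K (totalWeight w : ℂ)).re * M.moebiusDensity 𝔡 =
      (∑ᶠ I ∈ supportedIdeals M.badPrimes,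
        (UniqueFactorizationMonoid.moebius I : ℝ) * M.density 𝔡 I) *
        ∏ᶠ p ∈ M.badPrimes, (1 - ((Ideal.absNorm p.asIdeal : ℝ) ^ totalWeight w)⁻¹)⁻¹ := by
    rw [moebiusDensity, h1, mul_comm (∑ᶠ I ∈ _, _), mul_assoc, mul_inv_cancel_left₀ hζ.ne']
    rfl
  rw [h2, mul_left_comm, mul_comm (∑ᶠ I ∈ _, _)]
  generalize hc : ((FractionalIdeal.absNorm 𝔡 : ℝ) ^ (1 / (φ.e : ℝ)) *
        (FractionalIdeal.absNorm (𝔞 : FractionalIdeal (𝓞 K)⁰ K) : ℝ)) ^ totalWeight w = c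
  generalize hP : ∏ᶠ p ∈ M.badPrimes,
    (1 - ((Ideal.absNorm p.asIdeal : ℝ) ^ totalWeight w)⁻¹)⁻¹ = P
  rw [← smul_eq_mul (c * P), smul_finsum]
  refine finsum_congr fun I => ?_
  rw [smul_finsum]
  refine finsum_congr fun hI => ?_
  rw [smul_eq_mul, density]
  ring

end Morphism.CongruenceData

variable [NeZero m]

theorem rpow_inv_pow_mul_inv {n : ℝ} (hn : 0 < n) (s a N : ℕ) :
    (n ^ s)⁻¹ * (n ^ (1 / (N : ℝ))) ^ a = (n ^ ((s : ℝ) - a / N))⁻¹ := by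
  rw [← Real.rpow_natCast, ← Real.rpow_natCast, ← Real.rpow_mul hn.le, ← Real.rpow_neg hn.le,
    ← Real.rpow_neg hn.le, ← Real.rpow_add hn]
  congr 1
  ring

/-- The number of vectors with given scaling ideal and discrepancy ideal. -/
theorem Morphism.exists_primitiveVectors_estimate (φ : Morphism K w u) (he : 0 < φ.e)
    (b : Module.Basis (Fin (Units.rank K)) ℤ (unitLogLattice K)) {a : ℕ}
    (haw : ∀ i, a ≤ w i) (ha : a < Module.finrank ℚ K * totalWeight w) (hs : 1 < totalWeight w)
    {𝔞 : Ideal (𝓞 K)} (h𝔞 : 𝔞 ≠ ⊥) (M : φ.CongruenceData (𝔞 : FractionalIdeal (𝓞 K)⁰ K)) :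
    ∃ A C : ℝ, 0 < A ∧ 0 ≤ C ∧ ∀ 𝔡 ∈ φ.discrepancyIdeals, ∀ t : ℝ, 0 < t →
      (φ.primitiveVectors b (𝔞 : FractionalIdeal (𝓞 K)⁰ K) 𝔡
        (t ^ (φ.e * Module.finrank ℚ K))).Finite ∧
      |((φ.primitiveVectors b (𝔞 : FractionalIdeal (𝓞 K)⁰ K) 𝔡
        (t ^ (φ.e * Module.finrank ℚ K))).ncard : ℝ) * covol K ^ m -
        (φ.archVolume b).toReal * (t ^ Module.finrank ℚ K) ^ totalWeight w *
          M.moebiusDensity 𝔡| ≤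
      C * normError K (totalWeight w) ((totalWeight w : ℝ) - a / (Module.finrank ℚ K : ℝ)) A
        (t ^ Module.finrank ℚ K) := by
  classical
  obtain ⟨A, C, hA, hC, hest⟩ := φ.exists_regionSet_estimate he b haw ha h𝔞 M
  set V := (φ.archVolume b).toReal with hV
  have hV0 : 0 ≤ V := ENNReal.toReal_nonneg
  have hN : Module.finrank ℚ K ≠ 0 := Module.finrank_pos.ne'
  refine ⟨A, C + V, hA, by positivity, fun 𝔡 h𝔡 t ht => ?_⟩
  set N := Module.finrank ℚ K with hNdef
  set s := totalWeight w with hsdef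
  set Y := A * t ^ N with hY
  have hY0 : 0 < Y := by positivity
  set F := idealBall K Y with hF
  obtain ⟨hpfin, hcount⟩ := ncard_primitiveVectors h𝔞 M b h𝔡 F
    (fun h => ((mem_idealBall hY0.le _).mp h).1 rfl)
    (fun 𝔠 h𝔠 h𝔠F => (hest 𝔡 h𝔡 t ht 𝔠 h𝔠).2.1 (by
      rw [mem_idealBall hY0.le] at h𝔠F
      exact not_le.mp fun h => h𝔠F ⟨h𝔠, h⟩))
    (hest 𝔡 h𝔡 t ht 1 one_ne_zero).1
  refine ⟨hpfin, ?_⟩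
  rw [hcount]
  have hsum := M.summable_moebius_mul_density h𝔞 hs 𝔡
  have hsplit := hsum.sum_add_tsum_compl (s := F)
  -- The part of the main series that the truncation at `N(𝔠) ≤ A t^N` omits; it is the source of
  -- `normTail` in the error.
  set R := ∑' 𝔠 : ↥((F : Set (Ideal (𝓞 K)))ᶜ),
    (UniqueFactorizationMonoid.moebius (𝔠 : Ideal (𝓞 K)) : ℝ) * M.density 𝔡 𝔠 with hR
  have hRle : |R| ≤ normTail K s Y := by
    rw [hR, tsum_subtype ((F : Set (Ideal (𝓞 K)))ᶜ)
      (fun 𝔠 => (UniqueFactorizationMonoid.moebius 𝔠 : ℝ) * M.density 𝔡 𝔠)]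
    have hle : ∀ 𝔠 : Ideal (𝓞 K), ‖((F : Set (Ideal (𝓞 K)))ᶜ).indicator
        (fun 𝔠 => (UniqueFactorizationMonoid.moebius 𝔠 : ℝ) * M.density 𝔡 𝔠) 𝔠‖ ≤
        if Y < Ideal.absNorm 𝔠 then ((Ideal.absNorm 𝔠 : ℝ) ^ s)⁻¹ else 0 := by
      intro 𝔠
      by_cases h : 𝔠 ∈ F
      · rw [Set.indicator_of_notMem (by simpa using h), norm_zero]
        split_ifs <;> positivity
      · rw [Set.indicator_of_mem (show 𝔠 ∈ ((F : Set (Ideal (𝓞 K)))ᶜ) from h)]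
        by_cases h0 : 𝔠 = ⊥
        · rw [h0, ← Ideal.zero_eq_bot, UniqueFactorizationMonoid.moebius_zero, Int.cast_zero,
            zero_mul, norm_zero]
          split_ifs <;> positivity
        · rw [if_pos (not_le.mp fun h' => h ((mem_idealBall hY0.le _).mpr ⟨h0, h'⟩))]
          exact M.abs_moebius_mul_density_le h𝔞 𝔡 𝔠
    exact tsum_of_norm_bounded (summable_normTail K hs Y).hasSum hle
  have hx : 0 < t ^ N := by positivity
  have hpow : (t ^ N) ^ s = t ^ (N * s) := by rw [pow_mul]
  -- In terms of `x = t^N` each error is a constant times `(x / N(𝔠)) ^ σ` with `σ = |w| - a/N`.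
  have hpow2 : t ^ (N * s - a) = (t ^ N) ^ ((s : ℝ) - a / (N : ℝ)) := by
    rw [← Real.rpow_natCast t N, ← Real.rpow_mul ht.le, ← Real.rpow_natCast, Nat.cast_sub ha.le]
    congr 1
    have : (N : ℝ) ≠ 0 := Nat.cast_ne_zero.mpr hN
    push_cast
    field_simp
  have hterm : ∀ 𝔠 ∈ F, |(UniqueFactorizationMonoid.moebius 𝔠 : ℝ) *
      (((φ.regionSet M b 𝔡 𝔠 t).ncard : ℝ) * covol K ^ m -
        M.density 𝔡 𝔠 * ((t ^ N) ^ s * V))| ≤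
      C * ((t ^ N) ^ ((s : ℝ) - a / (N : ℝ)) *
        ((Ideal.absNorm 𝔠 : ℝ) ^ ((s : ℝ) - a / (N : ℝ)))⁻¹) := by
    intro 𝔠 h𝔠
    obtain ⟨h0, hle⟩ := (mem_idealBall hY0.le _).mp h𝔠
    have hn : (0 : ℝ) < Ideal.absNorm 𝔠 := by
      rw [Nat.cast_pos]
      exact Nat.pos_of_ne_zero (by rwa [Ne, Ideal.absNorm_eq_zero_iff])
    have h1 := (hest 𝔡 h𝔡 t ht 𝔠 h0).2.2 hle
    rw [abs_mul, hpow]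
    refine (mul_le_of_le_one_left (abs_nonneg _) (abs_moebius_le_one 𝔠)).trans (h1.trans (le_of_eq ?_))
    rw [← rpow_inv_pow_mul_inv hn, hpow2]
    ring
  have heq : (∑ 𝔠 ∈ F, (UniqueFactorizationMonoid.moebius 𝔠 : ℝ) *
        ((φ.regionSet M b 𝔡 𝔠 t).ncard : ℝ)) * covol K ^ m -
      V * (t ^ N) ^ s * M.moebiusDensity 𝔡 =
      (∑ 𝔠 ∈ F, (UniqueFactorizationMonoid.moebius 𝔠 : ℝ) *
        (((φ.regionSet M b 𝔡 𝔠 t).ncard : ℝ) * covol K ^ m -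
          M.density 𝔡 𝔠 * ((t ^ N) ^ s * V))) - V * (t ^ N) ^ s * R := by
    rw [CongruenceData.moebiusDensity, ← hsplit, mul_add, Finset.sum_mul, Finset.mul_sum,
      ← sub_sub, ← Finset.sum_sub_distrib]
    congr 1
    refine Finset.sum_congr rfl fun 𝔠 _ => ?_
    ring
  rw [heq]
  have hS0 : 0 ≤ ∑ 𝔠 ∈ F, ((Ideal.absNorm 𝔠 : ℝ) ^ ((s : ℝ) - a / (N : ℝ)))⁻¹ :=
    Finset.sum_nonneg fun _ _ => by positivity
  calc _ ≤ |∑ 𝔠 ∈ F, (UniqueFactorizationMonoid.moebius 𝔠 : ℝ) *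
        (((φ.regionSet M b 𝔡 𝔠 t).ncard : ℝ) * covol K ^ m -
          M.density 𝔡 𝔠 * ((t ^ N) ^ s * V))| + |V * (t ^ N) ^ s * R| := abs_sub _ _
    _ ≤ C * ((t ^ N) ^ ((s : ℝ) - a / (N : ℝ)) *
          ∑ 𝔠 ∈ F, ((Ideal.absNorm 𝔠 : ℝ) ^ ((s : ℝ) - a / (N : ℝ)))⁻¹) +
        V * ((t ^ N) ^ s * normTail K s Y) := by
        refine add_le_add ?_ ?_
        · rw [Finset.mul_sum, Finset.mul_sum]
          exact (Finset.abs_sum_le_sum_abs _ _).trans (Finset.sum_le_sum hterm)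
        · rw [abs_mul, abs_of_nonneg (by positivity), mul_assoc]
          gcongr
    _ ≤ _ := by
        rw [normError]
        have h1 : 0 ≤ (t ^ N) ^ ((s : ℝ) - a / (N : ℝ)) *
          ∑ 𝔠 ∈ F, ((Ideal.absNorm 𝔠 : ℝ) ^ ((s : ℝ) - a / (N : ℝ)))⁻¹ := by positivity
        have h2 : 0 ≤ (t ^ N) ^ s * normTail K s Y := mul_nonneg (by positivity) (normTail_nonneg s Y)
        rw [← hY, ← hF]
        nlinarith [mul_nonneg hC h2, mul_nonneg hV0 h1]

end Estimate

/-! ### Choice of the exponent, and assembly of the main and error terms -/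

section Assembly

open NumberField.InfinitePlace NumberField.Units

variable {m : ℕ} {K : Type*} [Field K] [NumberField K] {w u : Fin m → ℕ+}

/-- The exponent governing the error term. -/
theorem exists_error_exponent (K : Type*) [Field K] [NumberField K] (w : Fin m → ℕ+)
    (hm : 2 ≤ m ∨ (m = 1 ∧ Module.finrank ℚ K = 1 ∧ ∀ i, w i = 2)) :
    ∃ a : ℕ, (∀ i, a ≤ w i) ∧ a < Module.finrank ℚ K * totalWeight w ∧ 1 < totalWeight w ∧
      ((IsExceptional K w ∧ Module.finrank ℚ K = 1 ∧ a = 1 ∧ totalWeight w = 2) ∨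
        (¬ IsExceptional K w ∧ (a : ℝ) = ⨅ i, ((w i : ℕ) : ℝ) ∧
          1 < (totalWeight w : ℝ) - a / (Module.finrank ℚ K : ℝ))) := by
  classical
  by_cases hex : IsExceptional K w
  · have hs : totalWeight w = 2 := by
      rcases hex.2 with ⟨hm2, hw⟩ | ⟨hm1, hw⟩
      · simp [totalWeight, hw, hm2]
      · simp [totalWeight, hw, hm1]
    -- For `w = (2)` the value `a = 1` is used instead of `min w_i = 2`, since `a < N|w| = 2` is
    -- required. In both exceptional cases then `|w| - a/N = 1`.
    refine ⟨1, fun i => (w i).pos, ?_, by omega, Or.inl ⟨hex, hex.1, rfl, hs⟩⟩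
    rw [hs, hex.1]
    norm_num
  · have hm2 : 2 ≤ m := by
      rcases hm with h | ⟨h1, h2, h3⟩
      · exact h
      · exact absurd ⟨h2, Or.inr ⟨h1, h3⟩⟩ hex
    have : NeZero m := ⟨by omega⟩
    obtain ⟨i₀, hi₀⟩ := Finite.exists_min fun i => (w i : ℕ)
    set N := Module.finrank ℚ K with hN
    have hN0 : 0 < N := Module.finrank_pos
    have hinf : ((w i₀ : ℕ) : ℝ) = ⨅ i, ((w i : ℕ) : ℝ) :=
      le_antisymm (le_ciInf fun i => by exact_mod_cast hi₀ i)
        (ciInf_le (Set.finite_range _).bddBelow i₀)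
    set S := ∑ i ∈ Finset.univ.erase i₀, (w i : ℕ) with hS
    have hsum : totalWeight w = w i₀ + S := (Finset.add_sum_erase _ _ (Finset.mem_univ i₀)).symm
    have hcard : (Finset.univ.erase i₀).card = m - 1 := by
      rw [Finset.card_erase_of_mem (Finset.mem_univ _), Finset.card_univ, Fintype.card_fin]
    have hSm : m - 1 ≤ S := by
      rw [← hcard, Finset.card_eq_sum_ones]
      exact Finset.sum_le_sum fun i _ => (w i).pos
    have hSw : ∀ i, i ≠ i₀ → (w i : ℕ) ≤ S := fun i hi =>
      Finset.single_le_sum (f := fun i => (w i : ℕ)) (fun _ _ => Nat.zero_le _)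
        (Finset.mem_erase.mpr ⟨hi, Finset.mem_univ i⟩)
    obtain ⟨j, hj⟩ : ∃ j, j ≠ i₀ := by
      have : Nontrivial (Fin m) := Fin.nontrivial_iff_two_le.mpr hm2
      exact exists_ne i₀
    have hjS := hSw j hj
    have hij := hi₀ j
    have hw0 := (w i₀).pos
    -- If `N = 1` and the weights other than a minimal one add up to `1`, there are two weights and
    -- both are `1`, which is the exceptional case.
    have key : 2 ≤ N ∨ 2 ≤ S := by
      by_contra! h
      refine hex ⟨by omega, Or.inl ⟨by omega, fun i => PNat.coe_inj.mp ?_⟩⟩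
      have := hi₀ i
      have h1 := (w i).pos
      by_cases hi : i = i₀
      · subst hi
        change (w i : ℕ) = 1
        omega
      · have := hSw i hi
        change (w i : ℕ) = 1
        omega
    have hNr : (1 : ℝ) ≤ N := by exact_mod_cast hN0
    have hw0r : (1 : ℝ) ≤ (w i₀ : ℕ) := by exact_mod_cast hw0
    have hgt : 1 < (totalWeight w : ℝ) - (w i₀ : ℕ) / (N : ℝ) := by
      rw [hsum]
      push_cast
      have hSr : ((w i₀ : ℕ) : ℝ) ≤ S := by exact_mod_cast hij.trans hjS
      -- For `N ≥ 2` the exponent is at least `w_{i₀}/2 + S ≥ 3/2`; for `S ≥ 2` it is at least `S`.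
      rcases key with h | h
      · have h2 : (2 : ℝ) ≤ N := by exact_mod_cast h
        have h3 : ((w i₀ : ℕ) : ℝ) / N ≤ (w i₀ : ℕ) / 2 :=
          div_le_div_of_nonneg_left (by positivity) two_pos h2
        linarith
      · have h2 : (2 : ℝ) ≤ S := by exact_mod_cast h
        have h3 : ((w i₀ : ℕ) : ℝ) / N ≤ (w i₀ : ℕ) := div_le_self (by positivity) hNr
        linarith
    refine ⟨w i₀, hi₀, ?_, by omega, Or.inr ⟨hex, hinf, hgt⟩⟩
    have : 1 * totalWeight w ≤ N * totalWeight w := Nat.mul_le_mul_right _ hN0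
    omega

variable [NeZero m]

theorem rpow_inv_mul_pow {T : ℝ} (hT : 0 ≤ T) {e N : ℕ} (he : 0 < e) (hN : 0 < N) :
    (T ^ (1 / ((e * N : ℕ) : ℝ))) ^ (e * N) = T ∧
      (T ^ (1 / ((e * N : ℕ) : ℝ))) ^ N = T ^ (1 / (e : ℝ)) := by
  constructor
  · rw [one_div, Real.rpow_inv_natCast_pow hT (Nat.mul_pos he hN).ne']
  · rw [← Real.rpow_natCast, ← Real.rpow_mul hT]
    congr 1
    have : (N : ℝ) ≠ 0 := Nat.cast_ne_zero.mpr hN.ne'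
    have : (e : ℝ) ≠ 0 := Nat.cast_ne_zero.mpr he.ne'
    push_cast
    field_simp

theorem tendsto_scaled_rpow {γ : ℝ} (hγ : 0 < γ) {e : ℕ} (he : 0 < e) :
    Tendsto (fun T : ℝ => (T * γ) ^ (1 / (e : ℝ))) atTop atTop :=
  (tendsto_rpow_atTop (by positivity)).comp (tendsto_id.atTop_mul_const hγ)

/-- The error term in a scaled variable. -/
theorem Morphism.normError_isBigO_errorTerm (φ : Morphism K w u) (he : 0 < φ.e) {a : ℕ}
    (hs : 1 < totalWeight w)
    (hcase : (IsExceptional K w ∧ Module.finrank ℚ K = 1 ∧ a = 1 ∧ totalWeight w = 2) ∨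
        (¬ IsExceptional K w ∧ (a : ℝ) = ⨅ i, ((w i : ℕ) : ℝ) ∧
          1 < (totalWeight w : ℝ) - a / (Module.finrank ℚ K : ℝ)))
    {A γ : ℝ} (hA : 0 < A) (hγ : 0 < γ) :
    (fun T : ℝ => normError K (totalWeight w)
      ((totalWeight w : ℝ) - a / (Module.finrank ℚ K : ℝ)) A ((T * γ) ^ (1 / (φ.e : ℝ))))
      =O[atTop] φ.errorTerm := by
  have htend := tendsto_scaled_rpow hγ he
  have he0 : (0 : ℝ) < φ.e := by exact_mod_cast he
  rcases hcase with ⟨hex, hN, rfl, hs2⟩ | ⟨hex, ha, hgt⟩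
  · have h1 := (normError_isBigO_log (K := K) hN hA).comp_tendsto htend
    have hσ : (totalWeight w : ℝ) - ((1 : ℕ) : ℝ) / (Module.finrank ℚ K : ℝ) = 1 := by
      rw [hs2, hN]; norm_num
    rw [hσ, hs2]
    refine h1.trans ?_
    have htend1 : Tendsto (fun T : ℝ => T ^ (1 / (φ.e : ℝ))) atTop atTop :=
      tendsto_rpow_atTop (by positivity)
    have hlog : (fun y : ℝ => Real.log (γ ^ (1 / (φ.e : ℝ))) + Real.log y) =O[atTop] Real.log :=
      Real.isLittleO_const_log_atTop.isBigO.add (isBigO_refl _ _)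
    have h2 : (fun y : ℝ => (y * γ ^ (1 / (φ.e : ℝ))) *
        (Real.log (γ ^ (1 / (φ.e : ℝ))) + Real.log y)) =O[atTop] fun y => y * Real.log y := by
      refine IsBigO.mul ?_ hlog
      simpa [mul_comm] using (isBigO_refl (fun y : ℝ => y) atTop).const_mul_left
        (γ ^ (1 / (φ.e : ℝ)))
    refine (h2.comp_tendsto htend1).congr' ?_ ?_
    · filter_upwards [eventually_gt_atTop 0] with T hT
      simp only [Function.comp_apply]
      rw [Real.mul_rpow hT.le hγ.le, Real.log_mul (by positivity) (by positivity), add_comm]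
    · exact Eventually.of_forall fun T => by
        simp only [Function.comp_apply, errorTerm, if_pos hex]
  · have hσs : (totalWeight w : ℝ) - a / (Module.finrank ℚ K : ℝ) ≤ totalWeight w := by
      have : (0 : ℝ) ≤ a / (Module.finrank ℚ K : ℝ) := by positivity
      linarith
    obtain ⟨B, hB, hle⟩ := exists_normError_le (K := K) hs hgt hσs hA
    generalize hσ : (totalWeight w : ℝ) - a / (Module.finrank ℚ K : ℝ) = σ at *
    have hexp : (totalWeight w : ℝ) / φ.e -
        (⨅ i, ((w i : ℕ) : ℝ)) / ((φ.e : ℝ) * (Module.finrank ℚ K : ℝ)) = 1 / (φ.e : ℝ) * σ := by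
      rw [← ha, ← hσ]
      have : (Module.finrank ℚ K : ℝ) ≠ 0 := finrank_cast_pos.ne'
      field_simp
    refine IsBigO.of_bound (B * (γ ^ (1 / (φ.e : ℝ))) ^ σ) ?_
    filter_upwards [eventually_gt_atTop 0] with T hT
    have hx : 0 < (T * γ) ^ (1 / (φ.e : ℝ)) := by positivity
    have h0 : 0 ≤ normError K (totalWeight w) σ A ((T * γ) ^ (1 / (φ.e : ℝ))) := by
      rw [normError]
      have := normTail_nonneg (K := K) (totalWeight w) (A * (T * γ) ^ (1 / (φ.e : ℝ)))
      positivity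
    rw [errorTerm, if_neg hex, hexp, Real.norm_of_nonneg h0, Real.norm_of_nonneg (by positivity)]
    refine (hle _ hx).trans (le_of_eq ?_)
    rw [Real.mul_rpow hT.le hγ.le, Real.mul_rpow (by positivity) (by positivity),
      ← Real.rpow_mul hT.le]
    ring

theorem two_pow_div_sqrt_mul_covol (K : Type*) [Field K] [NumberField K] :
    (2 ^ nrComplexPlaces K / Real.sqrt |(discr K : ℝ)|) * covol K = 1 := by
  have h : Real.sqrt |(discr K : ℝ)| ≠ 0 := by
    rw [Real.sqrt_ne_zero']
    exact abs_pos.mpr (by exact_mod_cast discr_ne_zero K)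
  rw [covol, inv_pow]
  field_simp

/-- The parameter by which the height bound is scaled for given scaling and discrepancy ideals. -/
def heightScale (φ : Morphism K w u) (rep : ClassGroup (𝓞 K) → (Ideal (𝓞 K))⁰)
    (p : ClassGroup (𝓞 K) × φ.discrepancyIdeals) : ℝ :=
  (FractionalIdeal.absNorm (p.2 : FractionalIdeal (𝓞 K)⁰ K) : ℝ) *
    (FractionalIdeal.absNorm ((rep p.1 : Ideal (𝓞 K)) : FractionalIdeal (𝓞 K)⁰ K) : ℝ) ^ φ.e

theorem coe_rep_ne_bot (rep : ClassGroup (𝓞 K) → (Ideal (𝓞 K))⁰) (c : ClassGroup (𝓞 K)) :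
    (rep c : Ideal (𝓞 K)) ≠ ⊥ := nonZeroDivisors.ne_zero (rep c).2

theorem heightScale_pos (φ : Morphism K w u) (rep : ClassGroup (𝓞 K) → (Ideal (𝓞 K))⁰)
    (p : ClassGroup (𝓞 K) × φ.discrepancyIdeals) : 0 < heightScale φ rep p := by
  obtain ⟨c, 𝔡, h𝔡⟩ := p
  obtain ⟨x, rfl⟩ := (φ.mem_discrepancyIdeals_iff 𝔡).mp h𝔡
  exact mul_pos (absNorm_pos_of_ne_zero (φ.vecDiscrepancy_ne_zero x)) (pow_pos
    (absNorm_pos_of_ne_zero (FractionalIdeal.coeIdeal_ne_zero.mpr (coe_rep_ne_bot rep c))) _)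

/-- The region for `𝔞` and `𝔡` has parameter `t^N = (T N(𝔡) N(𝔞)^e)^(1/e)`, whose `|w|`-th power
supplies the factor `(N(𝔡)^(1/e) N(𝔞))^|w|`. The zeta value cancels by `localConstant_eq`, and
`(2^r₂/√D_K)^m` is the inverse of the covolume. -/
theorem leadingCoeff_mul (φ : Morphism K w u) (rep : ClassGroup (𝓞 K) → (Ideal (𝓞 K))⁰)
    (b : Module.Basis (Fin (Units.rank K)) ℤ (unitLogLattice K)) (he : 0 < φ.e)
    (hs : 1 < totalWeight w) [Fintype φ.discrepancyIdeals]
    (M : ∀ c, φ.CongruenceData ((rep c : Ideal (𝓞 K)) : FractionalIdeal (𝓞 K)⁰ K))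
    {T : ℝ} (hT : 0 < T) :
    φ.leadingCoeff rep M b * T ^ ((totalWeight w : ℝ) / (φ.e : ℝ)) *
        (torsionOrder K * covol K ^ m) =
      ∑ p : ClassGroup (𝓞 K) × φ.discrepancyIdeals, (φ.archVolume b).toReal *
        ((T * heightScale φ rep p) ^ (1 / (φ.e : ℝ))) ^ totalWeight w *
        (M p.1).moebiusDensity p.2 := by
  have hζ := Morphism.CongruenceData.dedekindZeta_re_pos K hs
  have hω : (torsionOrder K : ℝ) ≠ 0 := Nat.cast_ne_zero.mpr (torsionOrder_ne_zero K)
  have he0 : (φ.e : ℝ) ≠ 0 := Nat.cast_ne_zero.mpr he.ne'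
  have hT' : T ^ ((totalWeight w : ℝ) / (φ.e : ℝ)) = (T ^ (1 / (φ.e : ℝ))) ^ totalWeight w := by
    rw [← Real.rpow_natCast, ← Real.rpow_mul hT.le, one_div_mul_eq_div]
  have hterm : ∀ p : ClassGroup (𝓞 K) × φ.discrepancyIdeals,
      ((T * heightScale φ rep p) ^ (1 / (φ.e : ℝ))) ^ totalWeight w =
      (T ^ (1 / (φ.e : ℝ))) ^ totalWeight w *
        ((FractionalIdeal.absNorm (p.2 : FractionalIdeal (𝓞 K)⁰ K) : ℝ) ^ (1 / (φ.e : ℝ)) *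
        (FractionalIdeal.absNorm ((rep p.1 : Ideal (𝓞 K)) : FractionalIdeal (𝓞 K)⁰ K) : ℝ)) ^
          totalWeight w := by
    intro p
    have h1 := FractionalIdeal.absNorm_nonneg (p.2 : FractionalIdeal (𝓞 K)⁰ K)
    have h2 := FractionalIdeal.absNorm_nonneg
      ((rep p.1 : Ideal (𝓞 K)) : FractionalIdeal (𝓞 K)⁰ K)
    have h1' : (0 : ℝ) ≤ (FractionalIdeal.absNorm (p.2 : FractionalIdeal (𝓞 K)⁰ K) : ℝ) := by
      exact_mod_cast h1
    have h2' : (0 : ℝ) ≤ (FractionalIdeal.absNorm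
      ((rep p.1 : Ideal (𝓞 K)) : FractionalIdeal (𝓞 K)⁰ K) : ℝ) := by exact_mod_cast h2
    rw [← mul_pow, Real.mul_rpow hT.le (heightScale_pos φ rep p).le, heightScale,
      Real.mul_rpow h1' (by positivity), one_div, Real.pow_rpow_inv_natCast h2' he.ne']
  have hconst : φ.constantC rep M = (dedekindZeta K (totalWeight w : ℂ)).re *
      ∑ p : ClassGroup (𝓞 K) × φ.discrepancyIdeals,
        ((FractionalIdeal.absNorm (p.2 : FractionalIdeal (𝓞 K)⁰ K) : ℝ) ^ (1 / (φ.e : ℝ)) *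
        (FractionalIdeal.absNorm ((rep p.1 : Ideal (𝓞 K)) : FractionalIdeal (𝓞 K)⁰ K) : ℝ)) ^
          totalWeight w * (M p.1).moebiusDensity p.2 := by
    rw [Morphism.constantC, Fintype.sum_prod_type, Finset.mul_sum]
    refine Finset.sum_congr rfl fun c _ => ?_
    rw [(M c).localConstant_eq (coe_rep_ne_bot rep c) hs, ← finsum_set_coe_eq_finsum_mem,
      finsum_eq_sum_of_fintype, Finset.mul_sum]
    refine Finset.sum_congr rfl fun 𝔡 _ => ?_
    ring
  have hcov : (2 ^ nrComplexPlaces K / Real.sqrt |(discr K : ℝ)|) ^ m * covol K ^ m = 1 := by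
    rw [← mul_pow, two_pow_div_sqrt_mul_covol, one_pow]
  simp only [hterm]
  rw [Morphism.leadingCoeff, hconst, hT']
  generalize hS : ∑ p : ClassGroup (𝓞 K) × φ.discrepancyIdeals,
        ((FractionalIdeal.absNorm (p.2 : FractionalIdeal (𝓞 K)⁰ K) : ℝ) ^ (1 / (φ.e : ℝ)) *
        (FractionalIdeal.absNorm ((rep p.1 : Ideal (𝓞 K)) : FractionalIdeal (𝓞 K)⁰ K) : ℝ)) ^
          totalWeight w * (M p.1).moebiusDensity p.2 = S
  have hrhs : ∑ p : ClassGroup (𝓞 K) × φ.discrepancyIdeals, (φ.archVolume b).toReal *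
      ((T ^ (1 / (φ.e : ℝ))) ^ totalWeight w *
        ((FractionalIdeal.absNorm (p.2 : FractionalIdeal (𝓞 K)⁰ K) : ℝ) ^ (1 / (φ.e : ℝ)) *
        (FractionalIdeal.absNorm ((rep p.1 : Ideal (𝓞 K)) : FractionalIdeal (𝓞 K)⁰ K) : ℝ)) ^
          totalWeight w) * (M p.1).moebiusDensity p.2 =
      (φ.archVolume b).toReal * (T ^ (1 / (φ.e : ℝ))) ^ totalWeight w * S := by
    rw [← hS, Finset.mul_sum]
    exact Finset.sum_congr rfl fun p _ => by ring
  rw [hrhs]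
  calc _ = (φ.archVolume b).toReal * (T ^ (1 / (φ.e : ℝ))) ^ totalWeight w * S *
        ((2 ^ nrComplexPlaces K / Real.sqrt |(discr K : ℝ)|) ^ m * covol K ^ m) *
        ((dedekindZeta K (totalWeight w : ℂ)).re * ((dedekindZeta K (totalWeight w : ℂ)).re)⁻¹) *
        (torsionOrder K * ((torsionOrder K : ℝ))⁻¹) := by ring
    _ = _ := by rw [hcov, mul_inv_cancel₀ hζ.ne', mul_inv_cancel₀ hω, mul_one, mul_one, mul_one]

/-- The counting function as a sum over scaling ideals and discrepancy ideals. -/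
theorem Morphism.finite_and_count_eq (φ : Morphism K w u)
    (rep : ClassGroup (𝓞 K) → (Ideal (𝓞 K))⁰) (hrep : ∀ c, ClassGroup.mk0 (rep c) = c)
    (b : Module.Basis (Fin (Units.rank K)) ℤ (unitLogLattice K))
    [Fintype φ.discrepancyIdeals] {T : ℝ}
    (hfin : ∀ p : ClassGroup (𝓞 K) × φ.discrepancyIdeals,
      (φ.primitiveVectors b ((rep p.1 : Ideal (𝓞 K)) : FractionalIdeal (𝓞 K)⁰ K) p.2
        (T * heightScale φ rep p)).Finite) :
    (φ.pointsOfHeightLE T).Finite ∧ φ.count T * torsionOrder K =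
      ∑ p : ClassGroup (𝓞 K) × φ.discrepancyIdeals,
        ((φ.primitiveVectors b ((rep p.1 : Ideal (𝓞 K)) : FractionalIdeal (𝓞 K)⁰ K) p.2
          (T * heightScale φ rep p)).ncard : ℝ) := by
  obtain ⟨h1, h2⟩ := φ.ncard_fundVectors rep b hrep T hfin
  refine ⟨?_, ?_⟩
  · rw [← φ.image_mk_fundVectors rep b hrep]
    exact h1.image _
  · rw [φ.count_mul_torsionOrder rep b hrep h1, h2]
    push_cast
    rfl

theorem Morphism.asymptotic_count (φ : Morphism K w u) (he : 0 < φ.e)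
    (hm : 2 ≤ m ∨ (m = 1 ∧ Module.finrank ℚ K = 1 ∧ ∀ i, w i = 2))
    (hD : φ.discrepancyIdeals.Finite)
    (rep : ClassGroup (𝓞 K) → (Ideal (𝓞 K))⁰) (hrep : ∀ c, ClassGroup.mk0 (rep c) = c)
    (b : Module.Basis (Fin (Units.rank K)) ℤ (unitLogLattice K))
    (M : ∀ c, φ.CongruenceData ((rep c : Ideal (𝓞 K)) : FractionalIdeal (𝓞 K)⁰ K)) :
    (∀ T, (φ.pointsOfHeightLE T).Finite) ∧
      (fun T : ℝ => φ.count T -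
        φ.leadingCoeff rep M b * T ^ ((totalWeight w : ℝ) / (φ.e : ℝ))) =O[atTop] φ.errorTerm := by
  classical
  have : Fintype φ.discrepancyIdeals := hD.fintype
  obtain ⟨a, haw, ha, hs, hcase⟩ := exists_error_exponent K w hm
  have hN : 0 < Module.finrank ℚ K := Module.finrank_pos
  choose A C hA hC hest using fun c =>
    φ.exists_primitiveVectors_estimate he b haw ha hs (coe_rep_ne_bot rep c) (M c)
  have hest' : ∀ (p : ClassGroup (𝓞 K) × φ.discrepancyIdeals) (T : ℝ), 0 < T →
      (φ.primitiveVectors b ((rep p.1 : Ideal (𝓞 K)) : FractionalIdeal (𝓞 K)⁰ K) p.2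
        (T * heightScale φ rep p)).Finite ∧
      |((φ.primitiveVectors b ((rep p.1 : Ideal (𝓞 K)) : FractionalIdeal (𝓞 K)⁰ K) p.2
        (T * heightScale φ rep p)).ncard : ℝ) * covol K ^ m -
        (φ.archVolume b).toReal * ((T * heightScale φ rep p) ^ (1 / (φ.e : ℝ))) ^ totalWeight w *
          (M p.1).moebiusDensity p.2| ≤
      C p.1 * normError K (totalWeight w) ((totalWeight w : ℝ) - a / (Module.finrank ℚ K : ℝ))
        (A p.1) ((T * heightScale φ rep p) ^ (1 / (φ.e : ℝ))) := by
    intro p T hT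
    have hpos : 0 < T * heightScale φ rep p := mul_pos hT (heightScale_pos φ rep p)
    obtain ⟨h1, h2⟩ := rpow_inv_mul_pow hpos.le he hN
    -- The dilation parameter is `t = (T · heightScale)^(1/(eN))`, so that `t^(eN)` is the
    -- archimedean height bound and `t^N` its `e`-th root.
    have h3 := hest p.1 p.2 p.2.2 _
      (Real.rpow_pos_of_pos hpos (1 / ((φ.e * Module.finrank ℚ K : ℕ) : ℝ)))
    rwa [h1, h2] at h3
  have hfinpos : ∀ T : ℝ, 0 < T → (φ.pointsOfHeightLE T).Finite := fun T hT =>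
    (φ.finite_and_count_eq rep hrep b fun p => (hest' p T hT).1).1
  refine ⟨fun T => ?_, ?_⟩
  -- The estimates need a positive height bound; the remaining `T` are covered by monotonicity.
  · exact (hfinpos (max T 1) (by positivity)).subset fun x hx =>
      show (φ.map x).height ≤ max T 1 from le_trans hx (le_max_left _ _)
  · have hκ : (torsionOrder K : ℝ) * covol K ^ m ≠ 0 :=
      mul_ne_zero (Nat.cast_ne_zero.mpr (torsionOrder_ne_zero K)) (pow_ne_zero _ (covol_pos (K := K)).ne')
    rw [← isBigO_const_mul_left_iff hκ]
    have hsum : (fun T : ℝ => ∑ p : ClassGroup (𝓞 K) × φ.discrepancyIdeals,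
        (((φ.primitiveVectors b ((rep p.1 : Ideal (𝓞 K)) : FractionalIdeal (𝓞 K)⁰ K) p.2
        (T * heightScale φ rep p)).ncard : ℝ) * covol K ^ m -
        (φ.archVolume b).toReal * ((T * heightScale φ rep p) ^ (1 / (φ.e : ℝ))) ^ totalWeight w *
          (M p.1).moebiusDensity p.2)) =O[atTop] φ.errorTerm := by
      refine IsBigO.fun_sum fun p _ => ?_
      refine IsBigO.trans ?_ (φ.normError_isBigO_errorTerm he hs hcase (hA p.1)
        (heightScale_pos φ rep p))
      refine IsBigO.of_bound (C p.1) ?_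
      filter_upwards [eventually_gt_atTop 0] with T hT
      exact (hest' p T hT).2.trans (mul_le_mul_of_nonneg_left (le_abs_self _) (hC p.1))
    refine hsum.congr' ?_ EventuallyEq.rfl
    filter_upwards [eventually_gt_atTop 0] with T hT
    have h1 := (φ.finite_and_count_eq rep hrep b fun p => (hest' p T hT).1).2
    have h2 := leadingCoeff_mul φ rep b he hs M hT
    rw [Finset.sum_sub_distrib, ← Finset.sum_mul, ← h1, ← h2]
    ring

end Assembly

end WeightedProj

end

theorem mainTheorem1 {K : Type*} [Field K] [NumberField K] {m : ℕ} (w u : Fin m → ℕ+)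
    (hm : 2 ≤ m ∨ (m = 1 ∧ Module.finrank ℚ K = 1 ∧ ∀ i, w i = 2))
    (φ : Morphism K w u) (he : 0 < φ.e) (hφ : φ.e = 1 ∨ ∀ i, w i = 1)
    (rep : ClassGroup (𝓞 K) → (Ideal (𝓞 K))⁰) (hrep : ∀ c, ClassGroup.mk0 (rep c) = c)
    (b : Module.Basis (Fin (Units.rank K)) ℤ (unitLogLattice K)) :
    φ.discrepancyIdeals.Finite ∧
    (∀ T : ℝ, (φ.pointsOfHeightLE T).Finite) ∧
    φ.archVolume b ≠ ⊤ ∧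
    (∀ c, Nonempty (φ.CongruenceData ((rep c : Ideal (𝓞 K)) : FractionalIdeal (𝓞 K)⁰ K))) ∧
    ∀ M : ∀ c, φ.CongruenceData ((rep c : Ideal (𝓞 K)) : FractionalIdeal (𝓞 K)⁰ K),
      (fun T : ℝ => φ.count T -
        φ.leadingCoeff rep M b * T ^ ((totalWeight w : ℝ) / (φ.e : ℝ))) =O[atTop] φ.errorTerm := by
  have : NeZero m := ⟨by omega⟩
  have hD := φ.finite_discrepancyIdeals hφ
  have hM : ∀ c, Nonempty
      (φ.CongruenceData ((rep c : Ideal (𝓞 K)) : FractionalIdeal (𝓞 K)⁰ K)) :=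
    fun c => φ.nonempty_congruenceData hφ _
  exact ⟨hD, (φ.asymptotic_count he hm hD rep hrep b fun c => (hM c).some).1,
    φ.archVolume_ne_top he b, hM, fun M => (φ.asymptotic_count he hm hD rep hrep b M).2⟩
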